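/- **Borel summability of WKB solutions.** *Conventions.* For $\theta\in\mathbb R$, $\delta>0$ let $S_\theta(\delta)=\{\hbar\in\mathbb C^*:\operatorname{Re}(e^{i\theta}/\hbar)>1/\delta\}$ be the Borel disc of diameter $\delta$ bisected by $\theta$, and $A_\theta=(\theta-\frac\pi2,\theta+\frac\pi2)$. A *sectorial domain* with opening $A=(a,b)$ is a simply connected domain $S\subset\mathbb C^*$ whose closure in the real-oriented blowup of $\mathbb C$ at $0$ meets the circle of directions exactly in $\bar A$, and which contains a Borel disc bisected by each $\theta$ with $A_\theta\subset A$. We write $f\simeq\hat f=\sum_k f_k(x)\hbar^k$ along $\bar A$, uniformly for $x\in V$, if there are a sectorial domain $S_0$ with opening $A$ (inside the given $\hbar$-domain) and $C,M>0$ with $|f(x,\hbar)-\sum_{k<n}f_k(x)\hbar^k|\le CM^n n!|\hbar|^n$ for all $n\ge0$, $x\in V$, $\hbar\in S_0$; *locally uniformly on $U$* means uniformly on a neighbourhood of each point of $U$. *Setting.* Let $X\subset\mathbb C$ be a domain, $S$ a sectorial domain with opening $A=(\vartheta_-,\vartheta_+)$, $\pi\le|A|\le2\pi$, and let $p,q$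 be holomorphic on $X\times S$ with $p\simeq\hat p=\sum p_k\hbar^k$, $q\simeq\hat q=\sum q_k\hbar^k$ along $\bar A$, locally uniformly on $X$, where $p_k,q_k\in\mathcal O(X)$. Consider $$\hbar^2\partial_x^2\psi+p\,\hbar\,\partial_x\psi+q\,\psi=0.\qquad(*)$$ Put $D_0=p_0^2-4q_0$; its zeros are the turning points. Let $\theta\in[\vartheta_-+\frac\pi2,\vartheta_+-\frac\pi2]$, let $\delta>0$ with $S_\theta(\delta)\subset S$, and let $\alpha\in\{+1,-1\}$. Let $U\subset X$ be a simply connected domain free of turning points, $x_0\in U$, fix a holomorphic branch $\sqrt{D_0}$ on $U$, and put $\lambda_\alpha=\frac12(p_0+\alpha\sqrt{D_0})$ and $\Phi(x)=\int_{x_0}^x\sqrt{D_0(t)}\,dt$. The WKB $(\theta,\alpha)$-ray emanating from $x\in U$ is the curve $\gamma$ in $X$ with $\gamma(0)=x$ and $\sqrt{D_0(\gamma(\tau))}\,\gamma'(\tau)=\alpha e^{i\theta}$, $\tau\ge0$ (the branch being continued along $\gamma$), so that the continuation of $\Phi$ along $\gamma$ is $\Phi(x)+\alpha e^{i\theta}\tau$;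 it is complete if it exists for all $\tau\ge0$. Assume: * every WKB $(\theta,\alpha)$-ray emanating from $U$ is complete; * every $x\in U$ has a neighbourhood $V\subset U$ for which there is $R>0$ such that, on the set $V_{\theta,\alpha,R}$ of those points of the $(\theta,\alpha)$-rays emanating from $V$ at which $\operatorname{Re}(\alpha e^{-i\theta}\Phi)>R$: (1) $\frac1{\sqrt{D_0}}\partial_x\log\sqrt{D_0}$ is bounded; (2) $p/\sqrt{D_0}\simeq\hat p/\sqrt{D_0}$ and $q/D_0\simeq\hat q/D_0$ along $\bar A_\theta$, uniformly on $V_{\theta,\alpha,R}$ (with $\hbar\in S_\theta(\delta)$). *Formal and exact WKB solutions.* Let $\hat s_\alpha=\sum_k s_\alpha^{(k)}\hbar^k$, $s^{(k)}_\alpha\in\mathcal O(U)$, be the unique formal solution of $\hbar\partial_x\hat s=\hat s^2-\hat p\hat s+\hat q$ with $s_\alpha^{(0)}=\lambda_\alpha$; put $\hat S_\alpha=\sum_{k\ge0}s_\alpha^{(k+1)}\hbar^k$, $\hat\Psi_\alpha=\exp\bigl(-\int_{x_0}^x\hat S_\alpha\,dt\bigr)$ (termwise integration) and $\hat\psi_\alpha=e^{-\frac1\hbar\int_{x_0}^x\lambda_\alpha}\hat\Psi_\alpha$.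 For $0<\delta'\le\delta$, an exact WKB solution on $U\times S_\theta(\delta')$ is a holomorphic solution $\psi_\alpha$ of $(*)$ there with $\psi_\alpha(x_0,\hbar)=1$ for all $\hbar$ and $\psi_\alpha\simeq\hat\psi_\alpha$, i.e. $e^{\frac1\hbar\int_{x_0}^x\lambda_\alpha}\psi_\alpha\simeq\hat\Psi_\alpha$, along $\bar A_\theta$, locally uniformly on $U$. *Borel resummation.* A series $\hat f=\sum f_k(x)\hbar^k$ with holomorphic coefficients is *locally uniformly Borel summable on $U$ in the direction $\theta$* if each point of $U$ has a neighbourhood $V$ on which $|f_k|\le CM^kk!$ for some $C,M$ and on which the formal Borel transform $\sum_k f_{k+1}(x)\xi^k/k!$ converges near $\xi=0$ and continues to a holomorphic function $\phi(x,\xi)$ on $V\times\Xi$, $\Xi=\{\xi:\operatorname{dist}(\xi,e^{i\theta}\mathbb R_+)<\eta\}$, $\eta>0$, with $|\phi(x,\xi)|\le Ae^{L|\xi|}$. Its Borel resummation is $\mathcal S_\theta[\hat f](x,\hbar)=f_0(x)+\int_{e^{i\theta}\mathbb R_+}\phi(x,\xi)e^{-\xi/\hbar}\,d\xi$. **Theorem.**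 The formal solution $\hat s_\alpha$ exists and is unique. The series $\hat S_\alpha$ and $\hat\Psi_\alpha$ are locally uniformly Borel summable on $U$ in the direction $\theta$; in particular the Borel transform of $\hat S_\alpha$ converges and continues analytically along $e^{i\theta}\mathbb R_+$, with at most exponential growth. For some $\delta'\in(0,\delta]$ there is an exact WKB solution on $U\times S_\theta(\delta')$, and for every $\delta'\in(0,\delta]$ there is at most one. Whenever $\psi_\alpha$ is the exact WKB solution on $U\times S_\theta(\delta')$, it is the locally uniform Borel resummation of $\hat\psi_\alpha$ in the direction $\theta$: for every compact $V\subset U$ there are a simply connected domain $W$ with $V\cup\{x_0\}\subset W\subset U$ and $\delta''\in(0,\delta']$ such that the Laplace integrals defining $\mathcal S_\theta[\hat S_\alpha]$ and $\mathcal S_\theta[\hat\Psi_\alpha]$ converge absolutely, and uniformly for $(x,\hbar)\in W\times S_\theta(\delta'')$, $\mathcal S_\theta[\hat S_\alpha]$ is holomorphic in $x\in W$, and for all $(x,\hbar)\in W\times S_\theta(\delta'')$ $$\psi_\alpha(x,\hbar)=e^{-\frac1\hbar\int_{x_0}^x\lambda_\alpha(t)\,dt}\,\mathcal S_\theta[\hat\Psi_\alpha](x,\hbar)=\exp\Bigl(-\frac1\hbar\int_{x_0}^x\lambda_\alpha(t)\,dt\Bigr)\exp\Bigl(-\int_{x_0}^x\mathcal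 S_\theta[\hat S_\alpha](t,\hbar)\,dt\Bigr),$$ where the last integral is taken along paths in $W$. -/

import Mathlib

open Set Filter Topology MeasureTheory

noncomputable section

namespace WKB

/-! ### Sectorial domains and Gevrey asymptotics -/

/-- The Borel disc of diameter `δ` bisected by the direction `θ`:
`{ħ | Re (e^{iθ} / ħ) > 1 / δ}` (it does not contain `0`). -/
def borelDisc (θ δ : ℝ) : Set ℂ :=
  {h | 1 / δ < (Complex.exp (θ * Complex.I) / h).re}

/-- `S` is a sectorial domain at the origin with opening arc `(a, b)`: a simply connected domain of
`ℂ \ {0}` whose closure in the real-oriented blowup at `0` meets the circle of directions exactly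
in the closed arc `[a, b]`, and which contains a Borel disc bisected by every copolar direction,
that is, by every `θ` whose halfplane arc `(θ - π/2, θ + π/2)` is contained in `(a, b)`. -/
structure IsSectorialDomain (S : Set ℂ) (a b : ℝ) : Prop where
  isOpen : IsOpen S
  isSimplyConnected : IsSimplyConnected S
  zero_notMem : (0 : ℂ) ∉ S
  arc_pos : a < b
  directions : ∀ φ : ℝ,
    (∀ η > 0, ∃ h ∈ S, ‖h‖ < η ∧ ‖h / (‖h‖ : ℂ) - Complex.exp (φ * Complex.I)‖ < η) ↔
      ∃ φ' ∈ Icc a b, Complex.exp (φ' * Complex.I) = Complex.exp (φ * Complex.I)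
  borelDisc_subset : ∀ θ : ℝ, a ≤ θ - Real.pi / 2 → θ + Real.pi / 2 ≤ b →
    ∃ δ > 0, borelDisc θ δ ⊆ S

/-- `f ≃ ∑ fh k ħ ^ k` as `ħ → 0` along the closed arc `[a, b]`, uniformly for `x ∈ V`: uniform
Gevrey bounds on some sectorial subdomain `S₀ ⊆ S` with the same opening `(a, b)`. -/
def UnifGevrey (V S : Set ℂ) (a b : ℝ) (f : ℂ → ℂ → ℂ) (fh : ℕ → ℂ → ℂ) : Prop :=
  ∃ S₀ ⊆ S, IsSectorialDomain S₀ a b ∧ ∃ C M : ℝ, 0 < C ∧ 0 < M ∧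
    ∀ n : ℕ, ∀ x ∈ V, ∀ h ∈ S₀,
      ‖f x h - ∑ k ∈ Finset.range n, fh k x * h ^ k‖ ≤ C * M ^ n * n.factorial * ‖h‖ ^ n

/-- `f ≃ ∑ fh k ħ ^ k` as `ħ → 0` along the closed arc `[a, b]`, locally uniformly for `x ∈ U`. -/
def LocUnifGevrey (U S : Set ℂ) (a b : ℝ) (f : ℂ → ℂ → ℂ) (fh : ℕ → ℂ → ℂ) : Prop :=
  ∀ x ∈ U, ∃ V ∈ 𝓝 x, V ⊆ U ∧ UnifGevrey V S a b f fh

/-! ### Integrals from the base point -/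

/-- `F` is the primitive of `f` on `U` that vanishes at `x₀`. -/
def IsPrimitive (U : Set ℂ) (x₀ : ℂ) (f F : ℂ → ℂ) : Prop :=
  F x₀ = 0 ∧ ∀ x ∈ U, HasDerivAt F (f x) x

/-- The integral `x ↦ ∫_{x₀}^x f(t) dt` of a holomorphic function `f` along paths in a simply
connected domain `U`, i.e. the unique primitive of `f` on `U` that vanishes at `x₀`. -/
def primitive (U : Set ℂ) (x₀ : ℂ) (f : ℂ → ℂ) : ℂ → ℂ :=
  Classical.epsilon (IsPrimitive U x₀ f)

/-! ### The characteristic equation and WKB rays -/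

/-- The leading-order characteristic discriminant `D₀ = p₀² - 4 q₀`. -/
def disc (ph qh : ℕ → ℂ → ℂ) (x : ℂ) : ℂ := ph 0 x ^ 2 - 4 * qh 0 x

/-- The leading-order characteristic root `λ = (p₀ + ε √D₀) / 2`, where `r` is the chosen branch
of `√D₀` and `ε = ±1`. -/
def charRoot (ph : ℕ → ℂ → ℂ) (r : ℂ → ℂ) (ε : ℂ) (x : ℂ) : ℂ := (ph 0 x + ε * r x) / 2

/-- `γ : [0, ∞) → X` is a complete WKB `(θ, ε)`-ray emanating from `x`. Here `D` is the leading
discriminant and `r` the chosen branch of its square root near `x`; `ρ` is the analytic continuation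
of this branch along `γ`. The equation `√D γ' = ε e^{iθ}` says that the Liouville coordinate of
`γ t` is that of `x` plus `ε e^{iθ} t`, so the ray is mapped onto a full ray. -/
def IsCompleteRay (X : Set ℂ) (D r : ℂ → ℂ) (θ : ℝ) (ε : ℂ) (x : ℂ) (γ : ℝ → ℂ) : Prop :=
  γ 0 = x ∧ ∃ ρ : ℝ → ℂ, ContinuousOn ρ (Ici 0) ∧ ρ 0 = r x ∧
    ∀ t : ℝ, 0 ≤ t → γ t ∈ X ∧ ρ t ^ 2 = D (γ t) ∧ ρ t ≠ 0 ∧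
      HasDerivWithinAt γ (ε * Complex.exp (θ * Complex.I) / ρ t) (Ici 0) t

/-- The part, in the halfplane `Re (ε e^{-iθ} z) > R` of the Liouville coordinate `z`, of the
union of the WKB `(θ, ε)`-rays emanating from `V`. The point `γ t` on the ray `γ` that emanates
from `x` has Liouville coordinate `Φ x + ε e^{iθ} t`. -/
def rayEnd (X : Set ℂ) (D r Φ : ℂ → ℂ) (θ : ℝ) (ε : ℂ) (V : Set ℂ) (R : ℝ) : Set ℂ :=
  {y | ∃ x ∈ V, ∃ γ : ℝ → ℂ, IsCompleteRay X D r θ ε x γ ∧ ∃ t : ℝ, 0 ≤ t ∧ γ t = y ∧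
    R < (ε * Complex.exp (-(θ * Complex.I)) *
      (Φ x + ε * Complex.exp (θ * Complex.I) * t)).re}

/-! ### Formal WKB solutions -/

/-- The power series `∑ f k x ħ ^ k` at a fixed point `x`. -/
def seriesAt (f : ℕ → ℂ → ℂ) (x : ℂ) : PowerSeries ℂ := PowerSeries.mk fun k => f k x

/-- `s = ∑ s k ħ ^ k` is a formal solution on `U`, with holomorphic coefficients and with leading
term `lam`, of the formal Riccati equation `ħ ∂ₓ s = s² - p s + q`. -/
def IsFormalCharRoot (U : Set ℂ) (ph qh : ℕ → ℂ → ℂ) (lam : ℂ → ℂ) (s : ℕ → ℂ → ℂ) : Prop :=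
  (∀ k, DifferentiableOn ℂ (s k) U) ∧ EqOn (s 0) lam U ∧
    ∀ x ∈ U, PowerSeries.X * seriesAt (fun k => deriv (s k)) x =
      seriesAt s x ^ 2 - seriesAt ph x * seriesAt s x + seriesAt qh x

/-- The exponential of a formal power series `g = g₀ + g₊` (with `g₊` without constant term),
as `e^{g₀} ∑ g₊ ^ n / n!`. -/
def formalExp (g : PowerSeries ℂ) : PowerSeries ℂ :=
  PowerSeries.C (Complex.exp (PowerSeries.constantCoeff g)) *
    (PowerSeries.exp ℂ).subst (g - PowerSeries.C (PowerSeries.constantCoeff g))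

/-- The coefficients of `S = (s - s₀) / ħ = ∑ s (k + 1) ħ ^ k`. -/
def tailCoeff (s : ℕ → ℂ → ℂ) (k : ℕ) : ℂ → ℂ := s (k + 1)

/-- The coefficients of the formal series `Ψ = exp (- ∫_{x₀}^x S dt)` (termwise integration), so
that the formal WKB solution is `e^{-(1/ħ) ∫_{x₀}^x s₀ dt} Ψ`. -/
def ampCoeff (U : Set ℂ) (x₀ : ℂ) (s : ℕ → ℂ → ℂ) (k : ℕ) (x : ℂ) : ℂ :=
  PowerSeries.coeff k
    (formalExp (seriesAt (fun j y => -primitive U x₀ (tailCoeff s j) y) x))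

/-! ### Exact WKB solutions -/

/-- `ψ` is a holomorphic solution of `ħ² ∂ₓ² ψ + p ħ ∂ₓ ψ + q ψ = 0` on `U × S`. -/
def IsHolSolution (p q : ℂ → ℂ → ℂ) (U S : Set ℂ) (ψ : ℂ → ℂ → ℂ) : Prop :=
  DifferentiableOn ℂ (fun z : ℂ × ℂ => ψ z.1 z.2) (U ×ˢ S) ∧
    ∀ x ∈ U, ∀ h ∈ S,
      h ^ 2 * iteratedDeriv 2 (fun y => ψ y h) x + p x h * h * deriv (fun y => ψ y h) x
        + q x h * ψ x h = 0

/-- `ψ` is an exact WKB solution on `U × S'`, where `S'` is the Borel disc of diameter `δ'`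
bisected by `θ`: a holomorphic solution, normalised by `ψ (x₀, ħ) = 1`, that is asymptotic to the
formal WKB solution built from the formal characteristic root `s`, in the exponential Gevrey sense
along the closed halfplane arc, locally uniformly on `U`. -/
def IsExactWKB (p q : ℂ → ℂ → ℂ) (U : Set ℂ) (x₀ : ℂ) (s : ℕ → ℂ → ℂ) (θ δ' : ℝ)
    (ψ : ℂ → ℂ → ℂ) : Prop :=
  IsHolSolution p q U (borelDisc θ δ') ψ ∧
    (∀ h ∈ borelDisc θ δ', ψ x₀ h = 1) ∧
    LocUnifGevrey U (borelDisc θ δ') (θ - Real.pi / 2) (θ + Real.pi / 2)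
      (fun x h => Complex.exp (primitive U x₀ (s 0) x / h) * ψ x h) (ampCoeff U x₀ s)

/-! ### Borel resummation -/

/-- The closed ray `e^{iθ} ℝ₊`. -/
def ray (θ : ℝ) : Set ℂ := {z | ∃ t : ℝ, 0 ≤ t ∧ z = Complex.exp (θ * Complex.I) * t}

/-- The tubular neighbourhood of thickness `η` of the ray `e^{iθ} ℝ₊`. -/
def tube (θ η : ℝ) : Set ℂ := Metric.thickening η (ray θ)

/-- `φ` is an analytic continuation to the tubular neighbourhood of thickness `η` of the formal
Borel transform `∑ a (k + 1) ξ ^ k / k!` of `∑ a k ħ ^ k`. -/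
def ContinuesBorel (θ η : ℝ) (a : ℕ → ℂ) (φ : ℂ → ℂ) : Prop :=
  DifferentiableOn ℂ φ (tube θ η) ∧
    ∀ ξ : ℂ, ‖ξ‖ < η → HasSum (fun k : ℕ => a (k + 1) / (k.factorial : ℂ) * ξ ^ k) (φ ξ)

/-- The analytic continuation, along the ray `e^{iθ} ℝ₊` and with at most exponential growth in a
tubular neighbourhood, of the formal Borel transform of `∑ a k ħ ^ k`. If it exists it is uniquely
determined on the ray. -/
def borelContinuation (θ : ℝ) (a : ℕ → ℂ) : ℂ → ℂ :=
  Classical.epsilon fun φ : ℂ → ℂ => ∃ η > 0, ContinuesBorel θ η a φ ∧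
    ∃ A L : ℝ, ∀ ξ ∈ tube θ η, ‖φ ξ‖ ≤ A * Real.exp (L * ‖ξ‖)

/-- The integrand, at `ξ = e^{iθ} t`, of the Laplace transform `∫_{e^{iθ} ℝ₊} φ(ξ) e^{-ξ/ħ} dξ`. -/
def laplaceIntegrand (θ : ℝ) (φ : ℂ → ℂ) (h : ℂ) (t : ℝ) : ℂ :=
  φ (Complex.exp (θ * Complex.I) * t) * Complex.exp (-(Complex.exp (θ * Complex.I) * t) / h)
    * Complex.exp (θ * Complex.I)

/-- The Laplace transform of `φ` in the direction `θ`. -/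
def laplace (θ : ℝ) (φ : ℂ → ℂ) (h : ℂ) : ℂ := ∫ t in Ioi (0 : ℝ), laplaceIntegrand θ φ h t

/-- The Borel resummation in the direction `θ` of `∑ a k ħ ^ k`: the constant term plus the Laplace
transform of the analytic continuation of the formal Borel transform. -/
def borelSum (θ : ℝ) (a : ℕ → ℂ) (h : ℂ) : ℂ := a 0 + laplace θ (borelContinuation θ a) h

/-- `∑ f k ħ ^ k` is locally uniformly Borel summable on `U` in the direction `θ`: locally
uniformly in `x`, it is a Gevrey series, and its formal Borel transform converges and continues
analytically to a tubular neighbourhood of `e^{iθ} ℝ₊` with at most exponential growth. -/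
def LocUnifBorelSummable (U : Set ℂ) (θ : ℝ) (f : ℕ → ℂ → ℂ) : Prop :=
  ∀ x₁ ∈ U, ∃ V : Set ℂ, IsOpen V ∧ x₁ ∈ V ∧ V ⊆ U ∧
    (∃ C M : ℝ, ∀ k : ℕ, ∀ x ∈ V, ‖f k x‖ ≤ C * M ^ k * k.factorial) ∧
    ∃ η > 0, ∃ φ : ℂ → ℂ → ℂ,
      DifferentiableOn ℂ (fun z : ℂ × ℂ => φ z.1 z.2) (V ×ˢ tube θ η) ∧
      (∀ x ∈ V, ContinuesBorel θ η (fun k => f k x) (φ x)) ∧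
      ∃ A L : ℝ, ∀ x ∈ V, ∀ ξ ∈ tube θ η, ‖φ x ξ‖ ≤ A * Real.exp (L * ‖ξ‖)

/-- The Laplace integrals in the definition of the Borel resummation of `∑ f k x ħ ^ k` converge
(absolutely), uniformly for `(x, ħ) ∈ W × S`. -/
def UnifResummable (W S : Set ℂ) (θ : ℝ) (f : ℕ → ℂ → ℂ) : Prop :=
  (∀ x ∈ W, ∀ h ∈ S,
    IntegrableOn (laplaceIntegrand θ (borelContinuation θ fun k => f k x) h) (Ioi 0)) ∧
  TendstoUniformlyOn
    (fun (T : ℝ) (z : ℂ × ℂ) =>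
      ∫ t in (0 : ℝ)..T, laplaceIntegrand θ (borelContinuation θ fun k => f k z.1) z.2 t)
    (fun z => laplace θ (borelContinuation θ fun k => f k z.1) z.2) atTop (W ×ˢ S)

end WKB

end

noncomputable section

/-! ### Normal families and the Riemann mapping theorem -/

/-! Writing ψ = exp(-(1/ħ)∫s) turns the linear equation into the Riccati equation ħ s' = s² - p s +
q. Everything therefore rests on an exact solution s = λ + ħS for which S is Gevrey-asymptotic, on a
Borel disc, to the formal series Ŝ.

Existence. The complete rays issuing from a neighbourhood of a point sweep out a half-strip in the
Liouville coordinate, holomorphically (`exists_strip_flow`). The conditions at the ends of the rays,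
together with compactness of the remaining rectangle, give uniform bounds on it
(`IsSetting.exists_strip_bounds`). After division by √D₀ and removal of the first two orders in ħ,
the Riccati equation becomes G' = G/η + n₀ + n₁G + G² with bounded n₀ and n₁, where η = e^{-iθ}ħ.
The operator ∂ - 1/η is inverted by integrating from infinity along the ray, and on a Borel disc of
diameter d this inverse has norm at most d. For small d the equation is thus a contraction
(`exists_strip_solution`, `exists_riccati_strip`).

Bounded solutions are Gevrey. The normalised remainders of the solution obey, for each ħ, a
differential recursion of the same shape as the coefficients of ŝ. Its leading factor is close to
±√D₀, hence invertible uniformly in ħ. Nagumo's induction, with bounds weighted by the distance to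
the boundary, treats formal coefficients and remainders together (`nagumo`,
`exists_gevreyOn_of_riccati`).

Resummation. Nevanlinna's theorem with a parameter (`nevanlinna`) shows that a function with Gevrey
bounds on a Borel disc is the Laplace transform of the continued Borel transform of its expansion.
This gives summability, and also uniqueness (`eqOn_of_gevreyOn`). Since the Borel sum depends on the
coefficients alone, all local Riccati solutions are restrictions of one function and patch over
compact sets (`IsSetting.exists_compact_region`).

Conclusion. Integration from x₀ and exponentiation preserve Gevrey bounds (`GevreyOn.formalExp`),
which settles the series Ψ̂. The exact solution is obtained from the Cauchy problem whose
logarithmic derivative is prescribed at x₀ only. It therefore lives on all of U over a single Borel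
disc, even though the disc of the Gevrey estimates depends on the compact set
(`IsSetting.exists_isExactWKB`). The Riemann mapping theorem supplies primitives on U, an exhaustion
by simply connected subdomains, and a coordinate in which Picard iteration runs along radii. -/

/-- Cauchy's estimate on discs of radius r/2, which still fit into the doubled ball, bounds the
derivative; the mean value inequality does the rest. -/
theorem norm_sub_le_of_bounded_ball {f : ℂ → ℂ} {c : ℂ} {r M : ℝ} (hr : 0 < r)
    (hf : DifferentiableOn ℂ f (Metric.ball c (2 * r))) (hM : ∀ z ∈ Metric.ball c (2 * r), ‖f z‖ ≤ M)
    {x y : ℂ} (hx : x ∈ Metric.ball c r) (hy : y ∈ Metric.ball c r) :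
    ‖f y - f x‖ ≤ 2 * M / r * ‖y - x‖ := by
  have hM0 : 0 ≤ M := (norm_nonneg _).trans (hM c (Metric.mem_ball_self (by positivity)))
  refine (convex_ball c r).norm_image_sub_le_of_norm_deriv_le (𝕜 := ℂ) (fun z hz => ?_)
    (fun z hz => ?_) hx hy
  · exact hf.differentiableAt (Metric.isOpen_ball.mem_nhds
      (Metric.ball_subset_ball (by linarith) hz))
  · have hsub : Metric.closedBall z (r / 2) ⊆ Metric.ball c (2 * r) := by
      intro w hw
      rw [Metric.mem_ball] at hz ⊢
      rw [Metric.mem_closedBall] at hw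
      linarith [dist_triangle w z c]
    have := Complex.norm_deriv_le_of_forall_mem_sphere_norm_le (half_pos hr)
      ((hf.mono hsub).diffContOnCl_ball subset_rfl)
      (fun w hw => hM w (hsub (Metric.sphere_subset_closedBall hw)))
    calc _ ≤ M / (r / 2) := this
      _ = 2 * M / r := by field_simp

/-- Pointwise convergence of locally uniformly bounded holomorphic functions is locally uniform. -/
theorem tendstoLocallyUniformlyOn_of_bounded {ι : Type*} {l : Filter ι} {F : ι → ℂ → ℂ}
    {f : ℂ → ℂ} {U : Set ℂ} (hU : IsOpen U) (hF : ∀ i, DifferentiableOn ℂ (F i) U)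
    (hb : ∀ z ∈ U, ∃ V ∈ 𝓝 z, ∃ M : ℝ, ∀ i, ∀ w ∈ V, ‖F i w‖ ≤ M)
    (hp : ∀ z ∈ U, Tendsto (fun i => F i z) l (𝓝 (f z))) :
    TendstoLocallyUniformlyOn F f l U := by
  rcases l.eq_or_neBot with rfl | hl
  · intro u hu x hx
    exact ⟨U, self_mem_nhdsWithin, by simp⟩
  rw [Metric.tendstoLocallyUniformlyOn_iff]
  intro ε hε z hz
  obtain ⟨V, hV, M, hM⟩ := hb z hz
  obtain ⟨r, hr, hrs⟩ := Metric.mem_nhds_iff.1 (inter_mem hV (hU.mem_nhds hz))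
  -- One Lipschitz constant serves all the functions and, by passage to the limit, also f.
  -- Convergence at the centre then controls convergence nearby.
  set K : ℝ := 2 * |M| / (r / 2)
  have hK : 0 ≤ K := by positivity
  have lip : ∀ i, ∀ x ∈ Metric.ball z (r / 2), ‖F i x - F i z‖ ≤ K * ‖x - z‖ := fun i x hx =>
    norm_sub_le_of_bounded_ball (half_pos hr)
      ((hF i).mono fun w hw => (hrs (by rwa [mul_div_cancel₀ _ two_ne_zero] at hw)).2)
      (fun w hw => (hM i w (hrs (by rwa [mul_div_cancel₀ _ two_ne_zero] at hw)).1).trans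
        (le_abs_self M)) (Metric.mem_ball_self (half_pos hr)) hx
  have hlip : ∀ x ∈ Metric.ball z (r / 2), ‖f x - f z‖ ≤ K * ‖x - z‖ := fun x hx =>
    le_of_tendsto (((hp x (hrs (Metric.ball_subset_ball (by linarith) hx)).2).sub (hp z hz)).norm)
      (Eventually.of_forall fun i => lip i x hx)
  set η : ℝ := min (r / 2) (ε / 3 / (K + 1))
  have hη : 0 < η := by positivity
  refine ⟨Metric.ball z η ∩ U, inter_mem (mem_nhdsWithin_of_mem_nhds (Metric.ball_mem_nhds z hη))
    self_mem_nhdsWithin, ?_⟩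
  filter_upwards [(hp z hz).eventually (Metric.ball_mem_nhds (f z) (by positivity : 0 < ε / 3))]
    with i hi x hx
  have hx1 : x ∈ Metric.ball z (r / 2) := Metric.ball_subset_ball (min_le_left _ _) hx.1
  have hx2 : K * ‖x - z‖ ≤ ε / 3 := by
    have : ‖x - z‖ ≤ ε / 3 / (K + 1) := by
      rw [← dist_eq_norm]
      exact (Metric.mem_ball.1 hx.1).le.trans (min_le_right _ _)
    rw [le_div_iff₀ (by positivity)] at this
    nlinarith [norm_nonneg (x - z)]
  have h1 := lip i x hx1
  have h2 := hlip x hx1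
  rw [dist_eq_norm] at hi ⊢
  have : f x - F i x = (f x - f z) - (F i x - F i z) - (F i z - f z) := by ring
  rw [this]
  linarith [norm_sub_le ((f x - f z) - (F i x - F i z)) (F i z - f z),
    norm_sub_le (f x - f z) (F i x - F i z)]

/-- The slope of σ is the slope of σ² divided by σ(w) + σ(z), and this denominator tends to 2σ(z) ≠
0. Continuity of a square root is thus all that has to be checked. -/
theorem hasDerivAt_of_sq_eq {g σ : ℂ → ℂ} {z g' : ℂ} (hg : HasDerivAt g g' z)
    (hσ : ContinuousAt σ z) (hsq : ∀ᶠ w in 𝓝 z, σ w ^ 2 = g w) (h0 : σ z ≠ 0) :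
    HasDerivAt σ (g' / (2 * σ z)) z := by
  rw [hasDerivAt_iff_tendsto_slope] at hg ⊢
  have hs : Tendsto (fun w => σ w + σ z) (𝓝[≠] z) (𝓝 (2 * σ z)) := by
    rw [two_mul]
    exact (hσ.mono_left nhdsWithin_le_nhds).add_const _
  have h2 : 2 * σ z ≠ 0 := mul_ne_zero two_ne_zero h0
  refine (hg.div hs h2).congr' ?_
  filter_upwards [mem_nhdsWithin_of_mem_nhds hsq, hs.eventually_ne h2, self_mem_nhdsWithin]
    with w hw hw2 hwz
  have hz := hsq.self_of_nhds
  have hwz' : w - z ≠ 0 := sub_ne_zero.2 hwz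
  simp only [Pi.div_apply, slope_def_field]
  rw [div_div, div_eq_div_iff (mul_ne_zero hwz' hw2) hwz', ← hw, ← hz]
  ring

/-- Hurwitz's theorem by the maximum principle. If the zero were isolated, |f| would be at least m >
0 on a small circle, so |1/F i| ≤ 2/m there and hence at the centre, contradicting F i(z) → 0. -/
theorem eventually_eq_zero_of_hurwitz {ι : Type*} {l : Filter ι} [l.NeBot] {F : ι → ℂ → ℂ}
    {f : ℂ → ℂ} {U : Set ℂ} (hU : IsOpen U) (hFf : TendstoLocallyUniformlyOn F f l U)
    (hF : ∀ i, DifferentiableOn ℂ (F i) U) (h0 : ∀ i, ∀ w ∈ U, F i w ≠ 0) {z : ℂ} (hz : z ∈ U)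
    (hfz : f z = 0) : ∀ᶠ w in 𝓝 z, f w = 0 := by
  have hf := hFf.differentiableOn (Eventually.of_forall hF) hU
  rcases (hf.analyticAt (hU.mem_nhds hz)).eventually_eq_zero_or_eventually_ne_zero with h | h
  · exact h
  exfalso
  rw [eventually_nhdsWithin_iff] at h
  obtain ⟨r, hr, hrs⟩ := Metric.nhds_basis_closedBall.mem_iff.1 (inter_mem h (hU.mem_nhds hz))
  have hne : ∀ w ∈ Metric.sphere z r, f w ≠ 0 := fun w hw =>
    (hrs (Metric.sphere_subset_closedBall hw)).1 (by
      rintro rfl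
      simp [hr.ne] at hw)
  have hsubU : Metric.closedBall z r ⊆ U := fun w hw => (hrs hw).2
  obtain ⟨w₀, hw₀, hmin⟩ := (isCompact_sphere z r).exists_isMinOn
    (NormedSpace.sphere_nonempty.2 hr.le)
    ((hf.continuousOn.mono (Metric.sphere_subset_closedBall.trans hsubU)).norm)
  set m := ‖f w₀‖
  have hm : 0 < m := norm_pos_iff.2 (hne w₀ hw₀)
  have hunif := (tendstoLocallyUniformlyOn_iff_forall_isCompact hU).1 hFf _ hsubU
    (isCompact_closedBall z r)
  rw [Metric.tendstoUniformlyOn_iff] at hunif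
  obtain ⟨i, hi⟩ := (hunif (m / 2) (half_pos hm)).exists
  have hlow : ∀ w ∈ frontier (Metric.ball z r), ‖(F i w)⁻¹‖ ≤ (m / 2)⁻¹ := by
    intro w hw
    rw [frontier_ball z hr.ne'] at hw
    rw [norm_inv]
    refine inv_anti₀ (half_pos hm) ?_
    have h1 := hi w (Metric.sphere_subset_closedBall hw)
    have h2 : m ≤ ‖f w‖ := hmin hw
    rw [dist_eq_norm] at h1
    linarith [norm_sub_norm_le (f w) (F i w)]
  have hd : DiffContOnCl ℂ (fun w => (F i w)⁻¹) (Metric.ball z r) :=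
    (((hF i).mono hsubU).inv fun w hw => h0 i w (hsubU hw)).diffContOnCl_ball subset_rfl
  have hcen := Complex.norm_le_of_forall_mem_frontier_norm_le Metric.isBounded_ball hd hlow
    (subset_closure (Metric.mem_ball_self hr))
  rw [norm_inv, inv_le_inv₀ (norm_pos_iff.2 (h0 i z hz)) (half_pos hm)] at hcen
  have h1 := hi z (Metric.mem_closedBall_self hr.le)
  rw [dist_eq_norm, hfz, zero_sub, norm_neg] at h1
  linarith

theorem deriv_eq_zero_of_eventually_const {f : ℂ → ℂ} {U : Set ℂ} (hU : IsOpen U)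
    (hc : IsPreconnected U) (hf : DifferentiableOn ℂ f U) {a x : ℂ} (ha : a ∈ U) (hx : x ∈ U)
    {c : ℂ} (h : ∀ᶠ w in 𝓝 a, f w = c) : deriv f x = 0 := by
  have := (hf.analyticOnNhd hU).eqOn_of_preconnected_of_eventuallyEq
    (analyticOnNhd_const (v := c)) hc ha h
  have h2 : f =ᶠ[𝓝 x] fun _ => c := by
    filter_upwards [hU.mem_nhds hx] with w hw using this hw
  rw [h2.deriv_eq, deriv_const]

/-- Injective holomorphic maps with nonvanishing derivative from `U` to the unit disc that
vanish at `x₀`. -/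
structure IsDiscEmbedding (U : Set ℂ) (x₀ : ℂ) (f : ℂ → ℂ) : Prop where
  diff : DifferentiableOn ℂ f U
  maps : MapsTo f U (Metric.ball 0 1)
  inj : InjOn f U
  deriv_ne : ∀ z ∈ U, deriv f z ≠ 0
  zero : f x₀ = 0

theorem exists_holomorphic_sqrt {U : Set ℂ} (hUo : IsOpen U) (hUs : IsSimplyConnected U)
    {g : ℂ → ℂ} (hg : DifferentiableOn ℂ g U) (h0 : ∀ z ∈ U, g z ≠ 0) :
    ∃ σ : ℂ → ℂ, (∀ z ∈ U, σ z ^ 2 = g z) ∧ (∀ z ∈ U, σ z ≠ 0) ∧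
      ∀ z ∈ U, HasDerivAt σ (deriv g z / (2 * σ z)) z := by
  obtain ⟨σ, hσc, hσ⟩ := Complex.exists_continuousOn_pow_eq hUs hUo hg.continuousOn
    (by rintro ⟨z, hz, h⟩; exact h0 z hz h) two_ne_zero
  have hne : ∀ z ∈ U, σ z ≠ 0 := fun z hz h => h0 z hz (by rw [← hσ z, h]; simp)
  exact ⟨σ, fun z _ => hσ z, hne, fun z hz =>
    hasDerivAt_of_sq_eq (hg.differentiableAt (hUo.mem_nhds hz)).hasDerivAt
      (hσc.continuousAt (hUo.mem_nhds hz)) (Eventually.of_forall hσ) (hne z hz)⟩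

/-- Koebe's square root trick: if U omits a, a branch of √(z - a) never takes two opposite values.
It covers a disc around its value at x₀, so it omits the opposite disc, and an inversion about the
centre of that disc makes it bounded. -/
theorem exists_isDiscEmbedding {U : Set ℂ} (hUo : IsOpen U) (hUs : IsSimplyConnected U)
    (hU : U ≠ univ) {x₀ : ℂ} (hx₀ : x₀ ∈ U) : ∃ f, IsDiscEmbedding U x₀ f := by
  obtain ⟨a, ha⟩ := (ne_univ_iff_exists_notMem _).1 hU
  obtain ⟨σ, hσ2, hσ0, hσd⟩ := exists_holomorphic_sqrt hUo hUs
    (g := fun z => z - a) (by fun_prop) (fun z hz h => ha (by rwa [← sub_eq_zero.1 h]))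
  simp only [deriv_sub_const, deriv_id''] at hσd
  have hdo : DifferentiableOn ℂ σ U := fun z hz =>
    (hσd z hz).differentiableAt.differentiableWithinAt
  have himg : σ '' U ∈ 𝓝 (σ x₀) := by
    have hs : HasStrictDerivAt σ (1 / (2 * σ x₀)) x₀ := by
      have := (hdo.analyticAt (hUo.mem_nhds hx₀)).hasStrictDerivAt
      rwa [(hσd x₀ hx₀).deriv] at this
    rw [← hs.map_nhds_eq (by simpa using hσ0 x₀ hx₀)]
    exact image_mem_map (hUo.mem_nhds hx₀)
  obtain ⟨ε, hε, hεs⟩ := Metric.mem_nhds_iff.1 himg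
  -- A violation would make -σ(z) a value σ(w); squaring gives z = w, and then σ(z) = 0.
  have hfar : ∀ z ∈ U, ε ≤ ‖σ z + σ x₀‖ := by
    intro z hz
    by_contra! hlt
    obtain ⟨w, hw, hwz⟩ := hεs (show -σ z ∈ Metric.ball (σ x₀) ε by
      rw [Metric.mem_ball, dist_eq_norm, ← norm_neg]
      simpa [add_comm] using hlt)
    have h1 := hσ2 w hw
    rw [hwz, neg_sq, hσ2 z hz] at h1
    have hzw : z = w := by linear_combination h1
    subst hzw
    exact hσ0 z hz (by linear_combination hwz / 2)
  have hne : ∀ z ∈ U, σ z + σ x₀ ≠ 0 := fun z hz h => by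
    have := hfar z hz
    rw [h, norm_zero] at this
    linarith
  -- With the factor ε/3 both terms have modulus at most 1/3, so their difference stays inside the
  -- unit disc.
  have hder : ∀ z ∈ U, HasDerivAt (fun z => (ε / 3 : ℂ) * (σ z + σ x₀)⁻¹
      - (ε / 3 : ℂ) * (σ x₀ + σ x₀)⁻¹)
      ((ε / 3 : ℂ) * (-(1 / (2 * σ z)) / (σ z + σ x₀) ^ 2)) z := fun z hz =>
    ((((hσd z hz).add_const (σ x₀)).inv (hne z hz)).const_mul _).sub_const _
  have hε0 : (ε : ℂ) ≠ 0 := by exact_mod_cast hε.ne'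
  refine ⟨_, fun z hz => (hder z hz).differentiableAt.differentiableWithinAt, fun z hz => ?_,
    fun z hz w hw h => ?_, fun z hz => ?_, sub_self _⟩
  · have key : ∀ y ∈ U, ‖(ε / 3 : ℂ) * (σ y + σ x₀)⁻¹‖ ≤ 1 / 3 := by
      intro y hy
      rw [norm_mul, norm_inv, norm_div, Complex.norm_real, Real.norm_of_nonneg hε.le,
        ← div_eq_mul_inv, div_le_iff₀ (hε.trans_le (hfar y hy))]
      have := hfar y hy
      norm_num
      linarith
    rw [mem_ball_zero_iff]
    linarith [norm_sub_le ((ε / 3 : ℂ) * (σ z + σ x₀)⁻¹) ((ε / 3 : ℂ) * (σ x₀ + σ x₀)⁻¹),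
      key z hz, key x₀ hx₀]
  · have h1 : (σ z + σ x₀)⁻¹ = (σ w + σ x₀)⁻¹ := by
      have := sub_left_inj.1 h
      exact mul_left_cancel₀ (by simpa using hε0) this
    have h2 : σ z = σ w := by simpa using h1
    have h3 := hσ2 z hz
    rw [h2, hσ2 w hw] at h3
    linear_combination -h3
  · rw [(hder z hz).deriv]
    refine mul_ne_zero (by simpa using hε0) (div_ne_zero ?_ (pow_ne_zero _ (hne z hz)))
    simpa using hσ0 z hz

/-- The disc automorphism `z ↦ (z - a) / (1 - ā z)`. -/
def discAut (a z : ℂ) : ℂ := (z - a) / (1 - (starRingEnd ℂ) a * z)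

theorem discAut_denom_ne {a z : ℂ} (ha : ‖a‖ < 1) (hz : ‖z‖ < 1) :
    1 - (starRingEnd ℂ) a * z ≠ 0 := by
  intro h
  have : ‖(starRingEnd ℂ) a * z‖ = 1 := by rw [← sub_eq_zero.1 h, norm_one]
  rw [norm_mul, RCLike.norm_conj] at this
  nlinarith [norm_nonneg a, norm_nonneg z]

theorem hasDerivAt_discAut {a z : ℂ} (ha : ‖a‖ < 1) (hz : ‖z‖ < 1) :
    HasDerivAt (discAut a) ((1 - (starRingEnd ℂ) a * a) / (1 - (starRingEnd ℂ) a * z) ^ 2) z := by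
  have h := ((hasDerivAt_id z).sub_const a).div
    (((hasDerivAt_id z).const_mul ((starRingEnd ℂ) a)).const_sub 1) (discAut_denom_ne ha hz)
  exact h.congr_deriv (by simp only [id]; congr 1; ring)

/-- This is the identity |1 - āz|² - |z - a|² = (1 - |a|²)(1 - |z|²). -/
theorem norm_discAut_lt {a z : ℂ} (ha : ‖a‖ < 1) (hz : ‖z‖ < 1) : ‖discAut a z‖ < 1 := by
  have h0 := discAut_denom_ne ha hz
  rw [discAut, norm_div, div_lt_one (norm_pos_iff.2 h0), ← sq_lt_sq₀ (norm_nonneg _) (norm_nonneg _),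
    ← Complex.normSq_eq_norm_sq, ← Complex.normSq_eq_norm_sq]
  have e1 : ‖a‖ ^ 2 < 1 := by nlinarith [norm_nonneg a]
  have e2 : ‖z‖ ^ 2 < 1 := by nlinarith [norm_nonneg z]
  rw [← Complex.normSq_eq_norm_sq] at e1 e2
  simp only [Complex.normSq_apply, Complex.sub_re, Complex.sub_im, Complex.mul_re, Complex.mul_im,
    Complex.conj_re, Complex.conj_im, Complex.one_re, Complex.one_im] at *
  nlinarith [mul_pos (sub_pos.2 e1) (sub_pos.2 e2)]

theorem discAut_injOn {a z w : ℂ} (ha : ‖a‖ < 1) (hz : ‖z‖ < 1) (hw : ‖w‖ < 1)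
    (h : discAut a z = discAut a w) : z = w := by
  rw [discAut, discAut, div_eq_div_iff (discAut_denom_ne ha hz) (discAut_denom_ne ha hw)] at h
  have h2 : (1 - (starRingEnd ℂ) a * a) * (z - w) = 0 := by linear_combination h
  rcases mul_eq_zero.1 h2 with h3 | h3
  · exact absurd h3 (discAut_denom_ne ha ha)
  · exact sub_eq_zero.1 h3

/-- Moving the omitted value a to 0 permits a holomorphic square root. Recentring that root at b,
its value at x₀, multiplies the derivative there by (1 + |b|²)/(2|b|) in modulus, which exceeds 1
because (1 - |b|)² > 0. -/
theorem IsDiscEmbedding.exists_larger {U : Set ℂ} (hUo : IsOpen U) (hUs : IsSimplyConnected U)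
    {x₀ : ℂ} (hx₀ : x₀ ∈ U) {f : ℂ → ℂ} (hf : IsDiscEmbedding U x₀ f) {a : ℂ} (ha : ‖a‖ < 1)
    (haf : a ∉ f '' U) : ∃ g, IsDiscEmbedding U x₀ g ∧ ‖deriv f x₀‖ < ‖deriv g x₀‖ := by
  have hfb : ∀ z ∈ U, ‖f z‖ < 1 := fun z hz => mem_ball_zero_iff.1 (hf.maps hz)
  have hfd : ∀ z ∈ U, HasDerivAt f (deriv f z) z := fun z hz =>
    (hf.diff.differentiableAt (hUo.mem_nhds hz)).hasDerivAt
  have hgd : ∀ z ∈ U, HasDerivAt (fun z => discAut a (f z))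
      ((1 - (starRingEnd ℂ) a * a) / (1 - (starRingEnd ℂ) a * f z) ^ 2 * deriv f z) z :=
    fun z hz => (hasDerivAt_discAut ha (hfb z hz)).comp z (hfd z hz)
  obtain ⟨σ, hσ2, hσ0, hσd⟩ := exists_holomorphic_sqrt hUo hUs (g := fun z => discAut a (f z))
    (fun z hz => (hgd z hz).differentiableAt.differentiableWithinAt) (fun z hz h => by
      rcases div_eq_zero_iff.1 h with h1 | h1
      · exact haf ⟨z, hz, sub_eq_zero.1 h1⟩
      · exact discAut_denom_ne ha (hfb z hz) h1)
  have hσb : ∀ z ∈ U, ‖σ z‖ < 1 := by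
    intro z hz
    have := norm_discAut_lt ha (hfb z hz)
    rw [← hσ2 z hz, norm_pow] at this
    nlinarith [norm_nonneg (σ z)]
  set b := σ x₀
  have hb : ‖b‖ < 1 := hσb x₀ hx₀
  have hd : ∀ z ∈ U, HasDerivAt (fun z => discAut b (σ z))
      ((1 - (starRingEnd ℂ) b * b) / (1 - (starRingEnd ℂ) b * σ z) ^ 2 *
        (((1 - (starRingEnd ℂ) a * a) / (1 - (starRingEnd ℂ) a * f z) ^ 2 * deriv f z)
          / (2 * σ z))) z := fun z hz => by
    have := (hasDerivAt_discAut hb (hσb z hz)).comp z (hσd z hz)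
    rwa [(hgd z hz).deriv] at this
  refine ⟨fun z => discAut b (σ z), ⟨fun z hz => (hd z hz).differentiableAt.differentiableWithinAt,
    fun z hz => mem_ball_zero_iff.2 (norm_discAut_lt hb (hσb z hz)), fun z hz w hw h => ?_,
    fun z hz => ?_, by simp [discAut, b]⟩, ?_⟩
  · have h1 := discAut_injOn hb (hσb z hz) (hσb w hw) h
    have h2 := hσ2 z hz
    rw [h1, hσ2 w hw] at h2
    exact hf.inj hz hw (discAut_injOn ha (hfb z hz) (hfb w hw) h2.symm)
  · rw [(hd z hz).deriv]
    exact mul_ne_zero (div_ne_zero (discAut_denom_ne hb hb)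
      (pow_ne_zero _ (discAut_denom_ne hb (hσb z hz)))) (div_ne_zero (mul_ne_zero
      (div_ne_zero (discAut_denom_ne ha ha) (pow_ne_zero _ (discAut_denom_ne ha (hfb z hz))))
      (hf.deriv_ne z hz)) (mul_ne_zero two_ne_zero (hσ0 z hz)))
  · have hb0 : b ≠ 0 := hσ0 x₀ hx₀
    have hba : b ^ 2 = -a := by
      have := hσ2 x₀ hx₀
      rw [hf.zero] at this
      simpa [discAut] using this
    have hna : ‖a‖ = ‖b‖ ^ 2 := by rw [← norm_pow, hba, norm_neg]
    have hcc : ∀ c : ℂ, ‖c‖ < 1 → ‖1 - (starRingEnd ℂ) c * c‖ = 1 - ‖c‖ ^ 2 := by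
      intro c hc
      rw [Complex.conj_mul', ← Complex.ofReal_pow, ← Complex.ofReal_one, ← Complex.ofReal_sub,
        Complex.norm_real, Real.norm_of_nonneg]
      nlinarith [norm_nonneg c]
    have hpos : 0 < ‖b‖ := norm_pos_iff.2 hb0
    have hf' : 0 < ‖deriv f x₀‖ := norm_pos_iff.2 (hf.deriv_ne x₀ hx₀)
    have h1 : 0 < 1 - ‖b‖ ^ 2 := by nlinarith
    rw [(hd x₀ hx₀).deriv, hf.zero]
    simp only [mul_zero, sub_zero, one_pow, div_one, norm_mul, norm_div, norm_pow]
    rw [hcc b hb, hcc a ha, hna]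
    simp only [RCLike.norm_ofNat]
    have h3 : (1 - ‖b‖ ^ 2) / (1 - ‖b‖ ^ 2) ^ 2 * ((1 - (‖b‖ ^ 2) ^ 2) * ‖deriv f x₀‖ / (2 * ‖b‖))
        = ‖deriv f x₀‖ * ((1 + ‖b‖ ^ 2) / (2 * ‖b‖)) := by
      field_simp
      ring
    rw [h3]
    refine lt_mul_of_one_lt_right hf' ?_
    rw [one_lt_div (by positivity)]
    nlinarith [sq_pos_of_pos (sub_pos.2 hb)]

/-- The extremal problem for |f'(x₀)| has a solution. Its limit map stays injective with
nonvanishing derivative by Hurwitz's theorem, and an omitted value would contradict extremality by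
`IsDiscEmbedding.exists_larger`. -/
theorem exists_isDiscEmbedding_surjOn {U : Set ℂ} (hUo : IsOpen U) (hUs : IsSimplyConnected U)
    (hU : U ≠ univ) {x₀ : ℂ} (hx₀ : x₀ ∈ U) :
    ∃ f, IsDiscEmbedding U x₀ f ∧ SurjOn f U (Metric.ball 0 1) := by
  have hpc : IsPreconnected U := hUs.isPathConnected.isConnected.isPreconnected
  obtain ⟨r, hr, hrU⟩ := Metric.nhds_basis_closedBall.mem_iff.1 (hUo.mem_nhds hx₀)
  obtain ⟨f₁, hf₁⟩ := exists_isDiscEmbedding hUo hUs hU hx₀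
  set A : Set ℝ := (fun f => ‖deriv f x₀‖) '' {f | IsDiscEmbedding U x₀ f}
  have hAne : A.Nonempty := ⟨_, f₁, hf₁, rfl⟩
  have hAb : BddAbove A := by
    refine ⟨1 / r, ?_⟩
    rintro _ ⟨f, hf, rfl⟩
    exact Complex.norm_deriv_le_of_forall_mem_sphere_norm_le hr
      ((hf.diff.mono hrU).diffContOnCl_ball subset_rfl)
      (fun z hz => (mem_ball_zero_iff.1 (hf.maps (hrU (Metric.sphere_subset_closedBall hz)))).le)
  obtain ⟨u, -, hu, huA⟩ := exists_seq_tendsto_sSup hAne hAb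
  choose F hF hFu using huA
  -- A limit along an ultrafilter takes the place of Montel's diagonal subsequence: bounded values
  -- converge at each point, and the uniform bound makes this convergence locally uniform.
  set l : Ultrafilter ℕ := Filter.hyperfilter ℕ
  have hlim : ∀ z, ∃ y, z ∈ U → Tendsto (fun n => F n z) (l : Filter ℕ) (𝓝 y) := by
    intro z
    by_cases hz : z ∈ U
    · obtain ⟨y, -, hy⟩ := (isCompact_closedBall (0 : ℂ) 1).ultrafilter_le_nhds
        (l.map fun n => F n z) (by
          rw [le_principal_iff]
          exact Filter.mem_map.2 (Eventually.of_forall fun n =>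
            Metric.ball_subset_closedBall ((hF n).maps hz)))
      exact ⟨y, fun _ => hy⟩
    · exact ⟨0, fun h => absurd h hz⟩
  choose f hf using hlim
  have htlu : TendstoLocallyUniformlyOn F f (l : Filter ℕ) U :=
    tendstoLocallyUniformlyOn_of_bounded hUo (fun n => (hF n).diff)
      (fun z hz => ⟨U, hUo.mem_nhds hz, 1, fun n w hw =>
        (mem_ball_zero_iff.1 ((hF n).maps hw)).le⟩) hf
  have hfd : DifferentiableOn ℂ f U :=
    htlu.differentiableOn (Eventually.of_forall fun n => (hF n).diff) hUo
  have htd := htlu.deriv (Eventually.of_forall fun n => (hF n).diff) hUo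
  have hsup : ‖deriv f x₀‖ = sSup A := by
    refine tendsto_nhds_unique (htd.tendsto_at hx₀).norm ?_
    have : Tendsto u (l : Filter ℕ) (𝓝 (sSup A)) :=
      hu.mono_left (Nat.hyperfilter_le_atTop)
    exact this.congr fun n => (hFu n).symm
  have hne0 : deriv f x₀ ≠ 0 := by
    rw [← norm_pos_iff, hsup]
    exact (norm_pos_iff.2 (hf₁.deriv_ne x₀ hx₀)).trans_le (le_csSup hAb ⟨f₁, hf₁, rfl⟩)
  have hle : ∀ z ∈ U, ‖f z‖ ≤ 1 := fun z hz => le_of_tendsto (hf z hz).norm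
    (Eventually.of_forall fun n => (mem_ball_zero_iff.1 ((hF n).maps hz)).le)
  have hemb : IsDiscEmbedding U x₀ f := by
    refine ⟨hfd, fun z hz => ?_, fun a ha b hb hab => ?_, fun z hz h => ?_, ?_⟩
    · rw [mem_ball_zero_iff]
      refine lt_of_le_of_ne (hle z hz) fun h1 => hne0 ?_
      have := Complex.eqOn_of_isPreconnected_of_isMaxOn_norm hpc hUo hfd hz
        (fun w hw => by simpa [h1] using hle w hw)
      refine deriv_eq_zero_of_eventually_const hUo hpc hfd hx₀ hx₀ (c := f z) ?_
      filter_upwards [hUo.mem_nhds hx₀] with w hw using this hw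
    · by_contra hne
      refine hne0 (deriv_eq_zero_of_eventually_const hUo hpc hfd ha hx₀ (c := f b) ?_)
      -- Away from b the functions F n - F n(b) have no zeros. A zero of their limit at a would
      -- force f to be constant.
      have ho : IsOpen (U \ {b}) := hUo.sdiff isClosed_singleton
      have h1 : TendstoLocallyUniformlyOn (fun n z => F n z - F n b) (fun z => f z - f b)
          (l : Filter ℕ) (U \ {b}) :=
        tendstoLocallyUniformlyOn_of_bounded ho
          (fun n => ((hF n).diff.mono sdiff_subset).sub_const _)
          (fun z hz => ⟨U, hUo.mem_nhds hz.1, 2, fun n w hw => by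
            have e1 := (mem_ball_zero_iff.1 ((hF n).maps hw))
            have e2 := (mem_ball_zero_iff.1 ((hF n).maps hb))
            linarith [norm_sub_le (F n w) (F n b)]⟩)
          (fun z hz => (hf z hz.1).sub (hf b hb))
      have := eventually_eq_zero_of_hurwitz ho h1
        (fun n => ((hF n).diff.mono sdiff_subset).sub_const _)
        (fun n w hw h => hw.2 ((hF n).inj hw.1 hb (sub_eq_zero.1 h))) ⟨ha, hne⟩
        (sub_eq_zero.2 hab)
      filter_upwards [this] with w hw using sub_eq_zero.1 hw
    · have h1 := eventually_eq_zero_of_hurwitz hUo htd (fun n => (hF n).diff.deriv hUo)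
        (fun n w hw => (hF n).deriv_ne w hw) hz h
      exact hne0 (((hfd.deriv hUo).analyticOnNhd hUo).eqOn_of_preconnected_of_eventuallyEq
        (analyticOnNhd_const (v := (0 : ℂ))) hpc hz h1 hx₀)
    · refine tendsto_nhds_unique (hf x₀ hx₀) ?_
      simp only [(hF _).zero]
      exact tendsto_const_nhds
  refine ⟨f, hemb, fun a ha => ?_⟩
  by_contra haf
  obtain ⟨g, hg, hlt⟩ := hemb.exists_larger hUo hUs hx₀ (mem_ball_zero_iff.1 ha) haf
  rw [hsup] at hlt
  exact absurd (le_csSup hAb ⟨g, hg, rfl⟩) (not_le.2 hlt)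

/-- A biholomorphic parametrisation `φ` of `U` by `B`, with inverse `f` and `φ 0 = x₀`. -/
structure IsChart (U : Set ℂ) (x₀ : ℂ) (B : Set ℂ) (φ f : ℂ → ℂ) : Prop where
  domain : B = Metric.ball 0 1 ∨ B = univ
  diff : DifferentiableOn ℂ φ B
  diff_inv : DifferentiableOn ℂ f U
  maps : MapsTo φ B U
  maps_inv : MapsTo f U B
  left_inv : ∀ w ∈ B, f (φ w) = w
  right_inv : ∀ x ∈ U, φ (f x) = x
  zero : φ 0 = x₀

/-- The **Riemann mapping theorem**. -/
theorem exists_isChart {U : Set ℂ} (hUo : IsOpen U) (hUs : IsSimplyConnected U) {x₀ : ℂ}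
    (hx₀ : x₀ ∈ U) : ∃ B φ f, IsChart U x₀ B φ f := by
  by_cases hU : U = univ
  · subst hU
    exact ⟨univ, fun w => w + x₀, fun x => x - x₀, Or.inr rfl, by fun_prop, by fun_prop,
      fun _ _ => trivial, fun _ _ => trivial, by simp, by simp, by simp⟩
  obtain ⟨f, hf, hsurj⟩ := exists_isDiscEmbedding_surjOn hUo hUs hU hx₀
  have hli : ∀ x ∈ U, Function.invFunOn f U (f x) = x := fun x hx => hf.inj.leftInvOn_invFunOn hx
  have hmem : ∀ w ∈ Metric.ball (0 : ℂ) 1, Function.invFunOn f U w ∈ U := fun w hw =>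
    Function.invFunOn_mem (hsurj hw)
  have hri : ∀ w ∈ Metric.ball (0 : ℂ) 1, f (Function.invFunOn f U w) = w := fun w hw =>
    Function.invFunOn_eq (hsurj hw)
  refine ⟨Metric.ball 0 1, Function.invFunOn f U, f, Or.inl rfl, fun w hw => ?_, hf.diff, hmem,
    hf.maps, hri, hli, by rw [← hf.zero]; exact hli x₀ hx₀⟩
  set x := Function.invFunOn f U w
  have hx : x ∈ U := hmem w hw
  have hxw : f x = w := hri w hw
  have hs : HasStrictDerivAt f (deriv f x) x :=
    (hf.diff.analyticAt (hUo.mem_nhds hx)).hasStrictDerivAt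
  have hcont : ContinuousAt (Function.invFunOn f U) w := by
    intro N hN
    have h1 : f '' (N ∩ U) ∈ 𝓝 w := by
      rw [← hxw, ← hs.map_nhds_eq (hf.deriv_ne x hx)]
      exact image_mem_map (inter_mem hN (hUo.mem_nhds hx))
    rw [mem_map]
    filter_upwards [h1]
    rintro _ ⟨y, hy, rfl⟩
    rw [mem_preimage, hli y hy.2]
    exact hy.1
  have := hs.hasDerivAt.of_local_left_inverse hcont (hf.deriv_ne x hx) (by
    filter_upwards [Metric.isOpen_ball.mem_nhds hw] with y hy using hri y hy)
  exact this.differentiableAt.differentiableWithinAt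

end

noncomputable section

/-! ### Primitives and exhaustion of simply connected domains -/

theorem exists_hasDerivAt_of_chart_domain {B : Set ℂ} (hB : B = Metric.ball 0 1 ∨ B = univ)
    {g : ℂ → ℂ} (hg : DifferentiableOn ℂ g B) : ∃ G : ℂ → ℂ, ∀ w ∈ B, HasDerivAt G (g w) w := by
  rcases hB with rfl | rfl
  · exact hg.isExactOn_ball
  · obtain ⟨G, hG⟩ := (differentiableOn_univ.1 hg).isExactOn_univ
    exact ⟨G, fun w _ => hG w trivial⟩

namespace IsChart

variable {U B : Set ℂ} {x₀ : ℂ} {φ f : ℂ → ℂ}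

theorem isOpen_domain (h : IsChart U x₀ B φ f) : IsOpen B := by
  rcases h.domain with rfl | rfl
  · exact Metric.isOpen_ball
  · exact isOpen_univ

theorem hasDerivAt (h : IsChart U x₀ B φ f) {w : ℂ} (hw : w ∈ B) : HasDerivAt φ (deriv φ w) w :=
  (h.diff.differentiableAt (h.isOpen_domain.mem_nhds hw)).hasDerivAt

theorem deriv_mul_deriv (h : IsChart U x₀ B φ f) (hU : IsOpen U) {x : ℂ} (hx : x ∈ U) :
    deriv φ (f x) * deriv f x = 1 := by
  have h1 := (h.hasDerivAt (h.maps_inv hx)).comp x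
    (h.diff_inv.differentiableAt (hU.mem_nhds hx)).hasDerivAt
  refine h1.unique ((hasDerivAt_id x).congr_of_eventuallyEq ?_)
  filter_upwards [hU.mem_nhds hx] with y hy using h.right_inv y hy

/-- Images of concentric discs under the chart exhaust U. They supply the simply connected domain W
around a given compact set. -/
theorem exists_radius (h : IsChart U x₀ B φ f) {K : Set ℂ} (hK : IsCompact K) (hKB : K ⊆ B) :
    ∃ r > 0, Metric.closedBall 0 r ⊆ B ∧ K ⊆ Metric.ball 0 r := by
  rcases h.domain with rfl | rfl
  · rcases K.eq_empty_or_nonempty with rfl | hne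
    · exact ⟨1 / 2, by norm_num, Metric.closedBall_subset_ball (by norm_num), empty_subset _⟩
    obtain ⟨w, hw, hmax⟩ := hK.exists_isMaxOn hne continuous_norm.continuousOn
    have hw1 : ‖w‖ < 1 := mem_ball_zero_iff.1 (hKB hw)
    refine ⟨(‖w‖ + 1) / 2, by positivity, Metric.closedBall_subset_ball (by linarith),
      fun v hv => mem_ball_zero_iff.2 ?_⟩
    have : ‖v‖ ≤ ‖w‖ := hmax hv
    linarith
  · obtain ⟨r, hr, hKr⟩ := hK.isBounded.subset_ball_lt 0 0
    exact ⟨r, hr, subset_univ _, hKr⟩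

theorem image_ball_eq (h : IsChart U x₀ B φ f) {r : ℝ} (hr : Metric.ball 0 r ⊆ B) :
    φ '' Metric.ball 0 r = U ∩ f ⁻¹' Metric.ball 0 r := by
  ext x
  constructor
  · rintro ⟨w, hw, rfl⟩
    exact ⟨h.maps (hr hw), by rwa [mem_preimage, h.left_inv w (hr hw)]⟩
  · rintro ⟨hx, hfx⟩
    exact ⟨f x, hfx, h.right_inv x hx⟩

theorem isOpen_image_ball (h : IsChart U x₀ B φ f) (hU : IsOpen U) {r : ℝ}
    (hr : Metric.ball 0 r ⊆ B) : IsOpen (φ '' Metric.ball 0 r) := by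
  rw [h.image_ball_eq hr]
  exact h.diff_inv.continuousOn.isOpen_inter_preimage hU Metric.isOpen_ball

theorem isSimplyConnected_image_ball (h : IsChart U x₀ B φ f) {r : ℝ} (hr0 : 0 < r)
    (hr : Metric.ball 0 r ⊆ B) : IsSimplyConnected (φ '' Metric.ball 0 r) := by
  have hc : IsSimplyConnected (Metric.ball (0 : ℂ) r) := by
    have : ContractibleSpace (Metric.ball (0 : ℂ) r) :=
      (convex_ball (0 : ℂ) r).contractibleSpace ⟨0, Metric.mem_ball_self hr0⟩
    exact SimplyConnectedSpace.ofContractible _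
  have hmaps : ∀ x ∈ φ '' Metric.ball 0 r, f x ∈ Metric.ball 0 r := fun x hx => by
    rw [h.image_ball_eq hr] at hx
    exact hx.2
  have hmemU : ∀ x ∈ φ '' Metric.ball 0 r, x ∈ U := fun x hx => by
    rw [h.image_ball_eq hr] at hx
    exact hx.1
  let e : Metric.ball (0 : ℂ) r ≃ₜ φ '' Metric.ball 0 r :=
    { toFun := fun w => ⟨φ w, w, w.2, rfl⟩
      invFun := fun x => ⟨f x, hmaps x x.2⟩
      left_inv := fun w => Subtype.ext (h.left_inv w (hr w.2))
      right_inv := fun x => Subtype.ext (h.right_inv x (hmemU x x.2))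
      continuous_toFun := by
        refine Continuous.subtype_mk ?_ _
        exact (h.diff.continuousOn.mono hr).comp_continuous continuous_subtype_val fun w => w.2
      continuous_invFun := by
        refine Continuous.subtype_mk ?_ _
        exact h.diff_inv.continuousOn.comp_continuous continuous_subtype_val
          fun x => hmemU x x.2 }
  exact e.toHomotopyEquiv.simplyConnectedSpace_iff.1 hc

/-- The pulled-back form g(φ) φ' is exact on the disc or plane, and composing its primitive with the
inverse chart gives a primitive on U. -/
theorem exists_primitive (h : IsChart U x₀ B φ f) (hU : IsOpen U) (x₁ : ℂ) {g : ℂ → ℂ}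
    (hg : DifferentiableOn ℂ g U) : ∃ G, WKB.IsPrimitive U x₁ g G := by
  obtain ⟨G, hG⟩ := exists_hasDerivAt_of_chart_domain h.domain
    (g := fun w => g (φ w) * deriv φ w)
    ((hg.comp h.diff h.maps).mul (h.diff.deriv h.isOpen_domain))
  refine ⟨fun x => G (f x) - G (f x₁), sub_self _, fun x hx => ?_⟩
  have h1 := ((hG (f x) (h.maps_inv hx)).comp x
    (h.diff_inv.differentiableAt (hU.mem_nhds hx)).hasDerivAt).sub_const (G (f x₁))
  refine h1.congr_deriv ?_
  rw [h.right_inv x hx, mul_assoc, h.deriv_mul_deriv hU hx, mul_one]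

end IsChart

/-- This justifies the choice in the definition of `primitive`; no integration path has to be
handled afterwards. -/
theorem isPrimitive_primitive {U : Set ℂ} (hU : IsOpen U) (hUs : IsSimplyConnected U) (x₀ : ℂ)
    {g : ℂ → ℂ} (hg : DifferentiableOn ℂ g U) :
    WKB.IsPrimitive U x₀ g (WKB.primitive U x₀ g) := by
  obtain ⟨x₁, hx₁⟩ := hUs.nonempty
  obtain ⟨B, φ, f, h⟩ := exists_isChart hU hUs hx₁
  exact Classical.epsilon_spec (h.exists_primitive hU x₀ hg)

theorem WKB.IsPrimitive.eqOn {W U : Set ℂ} (hW : IsOpen W) (hWc : IsPreconnected W) (hWU : W ⊆ U)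
    {x₀ : ℂ} (hx₀ : x₀ ∈ W) {g G₁ G₂ : ℂ → ℂ} (h₁ : WKB.IsPrimitive U x₀ g G₁)
    (h₂ : WKB.IsPrimitive W x₀ g G₂) : EqOn G₁ G₂ W := by
  refine hW.eqOn_of_deriv_eq hWc
    (fun x hx => (h₁.2 x (hWU hx)).differentiableAt.differentiableWithinAt)
    (fun x hx => (h₂.2 x hx).differentiableAt.differentiableWithinAt) (fun x hx => ?_) hx₀
    (h₁.1.trans h₂.1.symm)
  rw [(h₁.2 x (hWU hx)).deriv, (h₂.2 x hx).deriv]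

/-! ### Holomorphic functions of one and two variables -/

/-- Integrals of holomorphic functions with locally integrable bounds are holomorphic. -/
theorem differentiableOn_integral_of_bound {α : Type*} [MeasurableSpace α] {μ : Measure α}
    {F : ℂ → α → ℂ} {U : Set ℂ} (hU : IsOpen U)
    (hmeas : ∀ z ∈ U, AEStronglyMeasurable (F z) μ)
    (hd : ∀ᵐ a ∂μ, DifferentiableOn ℂ (fun z => F z a) U)
    (hb : ∀ z ∈ U, ∃ V ∈ 𝓝 z, ∃ b : α → ℝ, Integrable b μ ∧ ∀ᵐ a ∂μ, ∀ w ∈ V, ‖F w a‖ ≤ b a) :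
    DifferentiableOn ℂ (fun z => ∫ a, F z a ∂μ) U := by
  intro z hz
  obtain ⟨V, hV, b, hbi, hbV⟩ := hb z hz
  obtain ⟨r, hr, hrs⟩ := Metric.mem_nhds_iff.1 (inter_mem hV (hU.mem_nhds hz))
  have hderiv : ∀ᵐ a ∂μ, ∀ w ∈ Metric.ball z (r / 2),
      ‖deriv (fun z => F z a) w‖ ≤ b a / (r / 4) := by
    filter_upwards [hd, hbV] with a ha hba w hw
    have hsub : Metric.closedBall w (r / 4) ⊆ Metric.ball z r := by
      intro y hy
      rw [Metric.mem_ball] at hw ⊢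
      rw [Metric.mem_closedBall] at hy
      linarith [dist_triangle y w z]
    exact Complex.norm_deriv_le_of_forall_mem_sphere_norm_le (by positivity)
      ((ha.mono (hsub.trans fun y hy => (hrs hy).2)).diffContOnCl_ball subset_rfl)
      (fun y hy => hba y (hrs (hsub (Metric.sphere_subset_closedBall hy))).1)
  have hdiff : ∀ᵐ a ∂μ, ∀ w ∈ Metric.ball z (r / 2),
      HasDerivAt (fun z => F z a) (deriv (fun z => F z a) w) w := by
    filter_upwards [hd] with a ha w hw
    exact (ha.differentiableAt (hU.mem_nhds
      (hrs (Metric.ball_subset_ball (by linarith) hw)).2)).hasDerivAt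
  -- The derivative is measurable as a pointwise limit of difference quotients along the real
  -- increments u n, which keep z + u n inside U.
  have hm' : AEStronglyMeasurable (fun a => deriv (fun z => F z a) z) μ := by
    set u : ℕ → ℂ := fun n => ((r / 2 / (n + 1) : ℝ) : ℂ)
    have hu0 : ∀ n : ℕ, 0 < r / 2 / ((n : ℝ) + 1) := fun n => by positivity
    have hut : Tendsto (fun n : ℕ => r / 2 / ((n : ℝ) + 1)) atTop (𝓝 0) :=
      tendsto_const_nhds.div_atTop (tendsto_atTop_add_const_right _ _ tendsto_natCast_atTop_atTop)
    have hult : ∀ n, z + u n ∈ U := fun n => (hrs (by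
      rw [Metric.mem_ball, dist_eq_norm, add_sub_cancel_left, Complex.norm_real,
        Real.norm_of_nonneg (hu0 n).le]
      have : r / 2 / ((n : ℝ) + 1) ≤ r / 2 := div_le_self (by positivity) (by linarith [n.cast_nonneg (α := ℝ)])
      linarith)).2
    refine aestronglyMeasurable_of_tendsto_ae atTop
      (f := fun n a => (u n)⁻¹ • (F (z + u n) a - F z a))
      (fun n => ((hmeas _ (hult n)).sub (hmeas z hz)).const_smul (u n)⁻¹) ?_
    filter_upwards [hdiff] with a ha
    have h1 := hasDerivAt_iff_tendsto_slope_zero.1 (ha z (Metric.mem_ball_self (half_pos hr)))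
    refine h1.comp ?_
    rw [tendsto_nhdsWithin_iff]
    refine ⟨?_, Eventually.of_forall fun n => ?_⟩
    · have := (Complex.continuous_ofReal.tendsto 0).comp hut
      simpa only [Complex.ofReal_zero, Function.comp_def, u] using this
    · exact Complex.ofReal_ne_zero.2 (hu0 n).ne'
  have hint : Integrable (F z) μ := hbi.mono' (hmeas z hz) (by
    filter_upwards [hbV] with a ha using ha z (mem_of_mem_nhds hV))
  have hmain := hasDerivAt_integral_of_dominated_loc_of_deriv_le (𝕜 := ℂ)
    (F' := fun w a => deriv (fun z => F z a) w)
    (Metric.ball_mem_nhds z (half_pos hr))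
    (by filter_upwards [hU.mem_nhds hz] with w hw using hmeas w hw) hint hm' hderiv
    (hbi.div_const _) hdiff
  exact hmain.2.differentiableAt.differentiableWithinAt

/-- The difference f(·, y) - f(·, b) is O(|y - b|) by boundedness in the second variable, and
Cauchy's estimate carries this over to its derivative. Continuity in the first variable alone is
then enough. -/
theorem tendsto_deriv_left_of_separately {f : ℂ → ℂ → ℂ} {a b : ℂ} {r M : ℝ} (hr : 0 < r)
    (h1 : ∀ y ∈ Metric.ball b (2 * r), DifferentiableOn ℂ (fun x => f x y) (Metric.ball a (2 * r)))
    (h2 : ∀ x ∈ Metric.ball a (2 * r), DifferentiableOn ℂ (f x) (Metric.ball b (2 * r)))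
    (hM : ∀ x ∈ Metric.ball a (2 * r), ∀ y ∈ Metric.ball b (2 * r), ‖f x y‖ ≤ M) :
    ContinuousAt (fun z : ℂ × ℂ => deriv (fun x => f x z.2) z.1) (a, b) := by
  have hbb : b ∈ Metric.ball b (2 * r) := Metric.mem_ball_self (by positivity)
  have haa : a ∈ Metric.ball a (2 * r) := Metric.mem_ball_self (by positivity)
  have hsub : ∀ x ∈ Metric.ball a r, Metric.closedBall x (r / 2) ⊆ Metric.ball a (2 * r) := by
    intro x hx y hy
    rw [Metric.mem_ball] at hx ⊢
    rw [Metric.mem_closedBall] at hy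
    linarith [dist_triangle y x a]
  have hl : ∀ x ∈ Metric.ball a r, ∀ y ∈ Metric.ball b r,
      ‖deriv (fun x => f x y) x - deriv (fun x => f x b) x‖ ≤ 2 * M / r * ‖y - b‖ / (r / 2) := by
    intro x hx y hy
    have hy2 : y ∈ Metric.ball b (2 * r) := Metric.ball_subset_ball (by linarith) hy
    have hx2 : Metric.ball a (2 * r) ∈ 𝓝 x :=
      Metric.isOpen_ball.mem_nhds (Metric.ball_subset_ball (by linarith) hx)
    rw [← deriv_fun_sub ((h1 y hy2).differentiableAt hx2) ((h1 b hbb).differentiableAt hx2)]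
    refine Complex.norm_deriv_le_of_forall_mem_sphere_norm_le (half_pos hr)
      ((((h1 y hy2).sub (h1 b hbb)).mono (hsub x hx)).diffContOnCl_ball subset_rfl)
      (fun w hw => ?_)
    have hw2 := hsub x hx (Metric.sphere_subset_closedBall hw)
    exact norm_sub_le_of_bounded_ball hr (h2 w hw2) (hM w hw2) (Metric.mem_ball_self hr) hy
  have hc : ContinuousAt (deriv (fun x => f x b)) a :=
    (((h1 b hbb).deriv Metric.isOpen_ball).continuousOn).continuousAt
      (Metric.isOpen_ball.mem_nhds haa)
  have hpr : Tendsto (fun z : ℂ × ℂ => deriv (fun x => f x b) z.1) (𝓝 (a, b))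
      (𝓝 (deriv (fun x => f x b) a)) := hc.tendsto.comp continuousAt_fst.tendsto
  have hz : Tendsto (fun z : ℂ × ℂ => deriv (fun x => f x z.2) z.1 - deriv (fun x => f x b) z.1)
      (𝓝 (a, b)) (𝓝 0) := by
    refine squeeze_zero_norm' (a := fun z : ℂ × ℂ => 2 * M / r * ‖z.2 - b‖ / (r / 2)) ?_ ?_
    · have : Metric.ball a r ×ˢ Metric.ball b r ∈ 𝓝 (a, b) :=
        prod_mem_nhds (Metric.ball_mem_nhds a hr) (Metric.ball_mem_nhds b hr)
      filter_upwards [this] with z hz using hl z.1 hz.1 z.2 hz.2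
    · have : Continuous fun z : ℂ × ℂ => 2 * M / r * ‖z.2 - b‖ / (r / 2) := by fun_prop
      simpa using this.tendsto (a, b)
  have := hz.add hpr
  simpa [ContinuousAt] using this

/-- **Osgood's lemma**: locally bounded separately holomorphic functions are holomorphic. -/
theorem differentiableOn_prod_of_separately {f : ℂ → ℂ → ℂ} {U V : Set ℂ} (hU : IsOpen U)
    (hV : IsOpen V) (h1 : ∀ y ∈ V, DifferentiableOn ℂ (fun x => f x y) U)
    (h2 : ∀ x ∈ U, DifferentiableOn ℂ (f x) V)
    (hb : ∀ x ∈ U, ∀ y ∈ V, ∃ N ∈ 𝓝 x, ∃ N' ∈ 𝓝 y, ∃ M : ℝ, ∀ u ∈ N, ∀ v ∈ N', ‖f u v‖ ≤ M) :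
    DifferentiableOn ℂ (fun z : ℂ × ℂ => f z.1 z.2) (U ×ˢ V) := by
  rintro ⟨a, b⟩ ⟨ha, hb'⟩
  obtain ⟨N, hN, N', hN', M, hM⟩ := hb a ha b hb'
  obtain ⟨r₁, hr₁, hs₁⟩ := Metric.mem_nhds_iff.1 (inter_mem hN (hU.mem_nhds ha))
  obtain ⟨r₂, hr₂, hs₂⟩ := Metric.mem_nhds_iff.1 (inter_mem hN' (hV.mem_nhds hb'))
  set r := min r₁ r₂ / 2
  have hr : 0 < r := by positivity
  have e1 : Metric.ball a (2 * r) ⊆ N ∩ U := (Metric.ball_subset_ball (by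
    have := min_le_left r₁ r₂
    simp only [r]; linarith)).trans hs₁
  have e2 : Metric.ball b (2 * r) ⊆ N' ∩ V := (Metric.ball_subset_ball (by
    have := min_le_right r₁ r₂
    simp only [r]; linarith)).trans hs₂
  have c1 := tendsto_deriv_left_of_separately (f := f) hr
    (fun y hy => (h1 y (e2 hy).2).mono fun x hx => (e1 hx).2)
    (fun x hx => (h2 x (e1 hx).2).mono fun x hx => (e2 hx).2)
    (fun x hx y hy => hM x (e1 hx).1 y (e2 hy).1)
  have c2 := tendsto_deriv_left_of_separately (f := fun y x => f x y) hr
    (fun x hx => (h2 x (e1 hx).2).mono fun x hx => (e2 hx).2)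
    (fun y hy => (h1 y (e2 hy).2).mono fun x hx => (e1 hx).2)
    (fun y hy x hx => hM x (e1 hx).1 y (e2 hy).1)
  have hnhds : ∀ᶠ v : ℂ × ℂ in 𝓝 (a, b), v.1 ∈ U ∧ v.2 ∈ V :=
    (hU.prod hV).mem_nhds ⟨ha, hb'⟩
  -- Both partial derivatives exist nearby and are jointly continuous at the point, so f is
  -- differentiable there as a function of two variables.
  have := hasStrictFDerivAt_uncurry_coprod (𝕜 := ℂ) (u := (a, b)) (f := f)
    (f₁ := fun x y => ContinuousLinearMap.toSpanSingleton ℂ (deriv (fun x => f x y) x))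
    (f₂ := fun x y => ContinuousLinearMap.toSpanSingleton ℂ (deriv (f x) y))
    (by
      filter_upwards [hnhds] with v hv
      exact ((h1 v.2 hv.2).differentiableAt (hU.mem_nhds hv.1)).hasDerivAt.hasFDerivAt)
    (by
      filter_upwards [hnhds] with v hv
      exact ((h2 v.1 hv.1).differentiableAt (hV.mem_nhds hv.2)).hasDerivAt.hasFDerivAt)
    ((ContinuousLinearMap.toSpanSingletonCLE (𝕜 := ℂ) (E := ℂ)).continuous.continuousAt.comp c1)
    ((ContinuousLinearMap.toSpanSingletonCLE (𝕜 := ℂ) (E := ℂ)).continuous.continuousAt.comp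
      (ContinuousAt.comp (f := Prod.swap) (x := (a, b)) c2 continuous_swap.continuousAt))
  exact this.hasFDerivAt.differentiableAt.differentiableWithinAt

/-- Local holomorphic functions near the points of `[0, ∞)` that agree with a given function on
`[0, ∞)` glue to one function. -/
theorem exists_glue_along_ray {η : ℝ → ℝ} {h : ℝ → ℂ → ℂ} {c : ℝ → ℂ}
    (hd : ∀ t, 0 ≤ t → DifferentiableOn ℂ (h t) (Metric.ball (t : ℂ) (η t)))
    (hc : ∀ t, 0 ≤ t → ∀ s : ℝ, 0 ≤ s → |s - t| < η t → h t s = c s) :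
    ∃ H : ℂ → ℂ, ∀ t, 0 ≤ t → EqOn H (h t) (Metric.ball (t : ℂ) (η t)) := by
  classical
  have hdist : ∀ s t : ℝ, dist (s : ℂ) t = |s - t| := fun s t => by
    rw [dist_eq_norm, ← Complex.ofReal_sub, Complex.norm_real, Real.norm_eq_abs]
  have key : ∀ t t' : ℝ, 0 ≤ t → 0 ≤ t' → ∀ w : ℂ, w ∈ Metric.ball (t : ℂ) (η t) →
      w ∈ Metric.ball (t' : ℂ) (η t') → h t w = h t' w := by
    intro t t' ht ht' w hw hw'
    -- The point of [0, ∞) nearest to w. The centres lie on [0, ∞), so s₀ lies in every disc that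
    -- contains w, and the real points just to its right, where both functions equal c, accumulate
    -- at it.
    set s₀ := max w.re 0
    have hs₀ : 0 ≤ s₀ := le_max_right _ _
    have hmem : ∀ τ : ℝ, 0 ≤ τ → w ∈ Metric.ball (τ : ℂ) (η τ) →
        (s₀ : ℂ) ∈ Metric.ball (τ : ℂ) (η τ) := by
      intro τ hτ hwτ
      rw [Metric.mem_ball] at hwτ ⊢
      refine lt_of_le_of_lt ?_ hwτ
      rw [hdist, dist_eq_norm]
      refine le_trans ?_ (Complex.abs_re_le_norm _)
      simp only [Complex.sub_re, Complex.ofReal_re, s₀]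
      rcases le_total w.re 0 with h0 | h0
      · rw [max_eq_right h0, zero_sub, abs_neg, abs_of_nonneg hτ, abs_of_nonpos (by linarith)]
        linarith
      · rw [max_eq_left h0]
    have hpre : IsPreconnected (Metric.ball (t : ℂ) (η t) ∩ Metric.ball (t' : ℂ) (η t')) :=
      ((convex_ball _ _).inter (convex_ball _ _)).isPreconnected
    have ho : IsOpen (Metric.ball (t : ℂ) (η t) ∩ Metric.ball (t' : ℂ) (η t')) :=
      Metric.isOpen_ball.inter Metric.isOpen_ball
    refine (((hd t ht).mono inter_subset_left).analyticOnNhd ho).eqOn_of_preconnected_of_frequently_eq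
      (((hd t' ht').mono inter_subset_right).analyticOnNhd ho) hpre
      (z₀ := (s₀ : ℂ)) ⟨hmem t ht hw, hmem t' ht' hw'⟩ ?_ ⟨hw, hw'⟩
    have htend : Tendsto (fun s : ℝ => (s : ℂ)) (𝓝[>] s₀) (𝓝[≠] (s₀ : ℂ)) := by
      refine tendsto_nhdsWithin_iff.2 ⟨(Complex.continuous_ofReal.tendsto s₀).mono_left
        nhdsWithin_le_nhds, ?_⟩
      filter_upwards [self_mem_nhdsWithin] with s hs
      exact fun h => (ne_of_gt hs) (Complex.ofReal_injective h)
    refine htend.frequently (Eventually.frequently ?_)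
    have hin : ∀ᶠ s : ℝ in 𝓝[>] s₀, (s : ℂ) ∈
        Metric.ball (t : ℂ) (η t) ∩ Metric.ball (t' : ℂ) (η t') :=
      mem_nhdsWithin_of_mem_nhds (Complex.continuous_ofReal.continuousAt.preimage_mem_nhds
        (ho.mem_nhds ⟨hmem t ht hw, hmem t' ht' hw'⟩))
    filter_upwards [hin, self_mem_nhdsWithin] with s hs hs0
    have hs1 : 0 ≤ s := hs₀.trans (le_of_lt hs0)
    rw [hc t ht s hs1 (by rw [← hdist]; exact hs.1), hc t' ht' s hs1 (by rw [← hdist]; exact hs.2)]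
  refine ⟨fun w => if hw : ∃ t : ℝ, 0 ≤ t ∧ w ∈ Metric.ball (t : ℂ) (η t) then h hw.choose w else 0,
    fun t ht w hw => ?_⟩
  have hex : ∃ t : ℝ, 0 ≤ t ∧ w ∈ Metric.ball (t : ℂ) (η t) := ⟨t, ht, hw⟩
  simp only [dif_pos hex]
  exact key _ _ hex.choose_spec.1 ht w hex.choose_spec.2 hw

/-! ### Borel discs -/

namespace WKB

/-- Inversion sends the half-plane Re(e^{iθ}ζ) > 1/δ to a round disc tangent to the boundary at 0.
Openness and convexity follow at once. -/
theorem borelDisc_eq_ball {θ δ : ℝ} (hδ : 0 < δ) :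
    borelDisc θ δ = Metric.ball (Complex.exp (θ * Complex.I) * (δ / 2 : ℝ)) (δ / 2) := by
  ext h
  set u := Complex.exp (θ * Complex.I)
  have hu : u.re ^ 2 + u.im ^ 2 = 1 := by
    have := Complex.norm_exp_ofReal_mul_I θ
    have h2 := Complex.sq_norm u
    rw [show ‖u‖ = 1 from this, Complex.normSq_apply] at h2
    linarith
  have hb : h ∈ Metric.ball (u * (δ / 2 : ℝ)) (δ / 2) ↔
      Complex.normSq h < δ * (u.re * h.re + u.im * h.im) := by
    rw [Metric.mem_ball, dist_eq_norm, ← sq_lt_sq₀ (norm_nonneg _) (by positivity),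
      ← Complex.normSq_eq_norm_sq]
    simp only [Complex.normSq_apply, Complex.sub_re, Complex.sub_im, Complex.mul_re,
      Complex.mul_im, Complex.ofReal_re, Complex.ofReal_im]
    constructor <;> intro h1 <;> nlinarith
  rw [hb]
  change 1 / δ < (u / h).re ↔ _
  rw [Complex.div_re]
  rcases eq_or_ne h 0 with rfl | h0
  · simp [hδ.le]
  have hpos : 0 < Complex.normSq h := Complex.normSq_pos.2 h0
  rw [← add_div, div_lt_div_iff₀ hδ hpos, one_mul, mul_comm]

theorem isOpen_borelDisc {θ δ : ℝ} (hδ : 0 < δ) : IsOpen (borelDisc θ δ) := by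
  rw [borelDisc_eq_ball hδ]
  exact Metric.isOpen_ball

theorem convex_borelDisc {θ δ : ℝ} (hδ : 0 < δ) : Convex ℝ (borelDisc θ δ) := by
  rw [borelDisc_eq_ball hδ]
  exact convex_ball _ _

theorem zero_notMem_borelDisc {θ δ : ℝ} (hδ : 0 < δ) : (0 : ℂ) ∉ borelDisc θ δ := by
  simp [borelDisc, hδ.le]

theorem ne_zero_of_mem_borelDisc {θ δ : ℝ} (hδ : 0 < δ) {h : ℂ} (hh : h ∈ borelDisc θ δ) :
    h ≠ 0 := fun h0 => zero_notMem_borelDisc hδ (h0 ▸ hh)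

theorem borelDisc_mono {θ δ δ' : ℝ} (hδ : 0 < δ) (h : δ ≤ δ') : borelDisc θ δ ⊆ borelDisc θ δ' :=
  fun _ hh => lt_of_le_of_lt (one_div_le_one_div_of_le hδ h) hh

theorem norm_lt_of_mem_borelDisc {θ δ : ℝ} (hδ : 0 < δ) {h : ℂ} (hh : h ∈ borelDisc θ δ) :
    ‖h‖ < δ := by
  have h0 := ne_zero_of_mem_borelDisc hδ hh
  have h1 : 1 / δ < ‖Complex.exp (θ * Complex.I) / h‖ :=
    lt_of_lt_of_le hh (Complex.re_le_norm _)
  rw [norm_div, Complex.norm_exp_ofReal_mul_I, one_div_lt_one_div hδ (norm_pos_iff.2 h0)] at h1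
  exact h1

theorem mem_borelDisc_ofReal {θ δ t : ℝ} (ht : 0 < t) (htδ : t < δ) :
    Complex.exp (θ * Complex.I) * t ∈ borelDisc θ δ := by
  have : Complex.exp (θ * Complex.I) / (Complex.exp (θ * Complex.I) * t) = ((1 / t : ℝ) : ℂ) := by
    have h1 := Complex.exp_ne_zero (θ * Complex.I)
    have h2 : (t : ℂ) ≠ 0 := by exact_mod_cast ht.ne'
    push_cast
    field_simp
  change 1 / δ < (_ / _ : ℂ).re
  rw [this, Complex.ofReal_re]
  exact one_div_lt_one_div_of_lt ht htδ

theorem borelDisc_rotate {θ δ : ℝ} {h : ℂ} :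
    Complex.exp (θ * Complex.I) * h ∈ borelDisc θ δ ↔ h ∈ borelDisc 0 δ := by
  have h1 := Complex.exp_ne_zero (θ * Complex.I)
  simp only [borelDisc, mem_ofPred_eq]
  rw [show Complex.exp (θ * Complex.I) / (Complex.exp (θ * Complex.I) * h) = 1 / h by
    rcases eq_or_ne h 0 with rfl | h0
    · simp
    · field_simp]
  simp

end WKB

end

noncomputable section

/-! ### Nevanlinna's theorem -/

/-- Outside the open disc of centre and radius ρ one has Re(1/z) ≤ 1/(2ρ). At z = 0 the convention
t/0 = 0 keeps the bound valid. -/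
theorem norm_exp_div_le_of_le {ρ : ℝ} (hρ : 0 < ρ) {z : ℂ} (hz : ρ ≤ ‖z - ρ‖) {t : ℝ}
    (ht : 0 ≤ t) : ‖Complex.exp (t / z)‖ ≤ Real.exp (t / (2 * ρ)) := by
  rw [Complex.norm_exp, Real.exp_le_exp]
  rcases eq_or_ne z 0 with rfl | h0
  · simp only [div_zero, Complex.zero_re]
    positivity
  have h1 : ρ ^ 2 ≤ ‖z - ρ‖ ^ 2 := pow_le_pow_left₀ hρ.le hz 2
  have hpos : 0 < Complex.normSq z := Complex.normSq_pos.2 h0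
  rw [← Complex.normSq_eq_norm_sq] at h1
  rw [Complex.div_re, Complex.ofReal_re, Complex.ofReal_im, zero_mul, zero_div, add_zero,
    div_le_div_iff₀ hpos (by positivity), mul_assoc]
  refine mul_le_mul_of_nonneg_left ?_ ht
  simp only [Complex.normSq_apply, Complex.sub_re, Complex.sub_im, Complex.ofReal_re,
    Complex.ofReal_im] at h1 ⊢
  nlinarith

/-- On the circle itself Re(1/z) = 1/(2ρ) exactly, apart from the point 0. The kernel exp(t/z) is
therefore bounded although its essential singularity lies on the contour. -/
theorem norm_exp_div_le_of_mem_sphere {ρ : ℝ} (hρ : 0 < ρ) {z : ℂ}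
    (hz : z ∈ Metric.sphere (ρ : ℂ) ρ) (t : ℝ) :
    ‖Complex.exp (t / z)‖ ≤ Real.exp (|t| / (2 * ρ)) := by
  rw [Complex.norm_exp, Real.exp_le_exp]
  rcases eq_or_ne z 0 with rfl | h0
  · simp only [div_zero, Complex.zero_re]
    positivity
  have h1 : ‖z - ρ‖ ^ 2 = ρ ^ 2 := by rw [mem_sphere_iff_norm.1 hz]
  have hpos : 0 < Complex.normSq z := Complex.normSq_pos.2 h0
  rw [← Complex.normSq_eq_norm_sq] at h1
  rw [Complex.div_re, Complex.ofReal_re, Complex.ofReal_im, zero_mul, zero_div, add_zero]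
  have h2 : Complex.normSq z = 2 * ρ * z.re := by
    simp only [Complex.normSq_apply, Complex.sub_re, Complex.sub_im, Complex.ofReal_re,
      Complex.ofReal_im] at h1 ⊢
    nlinarith
  have h3 : z.re ≠ 0 := fun h => by rw [h2, h, mul_zero] at hpos; exact hpos.false
  rw [h2, mul_div_mul_right _ _ h3]
  exact div_le_div_of_nonneg_right (le_abs_self t) (by positivity)

/-- Only t/z contributes, with residue t. The rest, exp(t/z) - 1 - t/z, is O(|z|⁻²), so its integral
vanishes when the contour expands to infinity. -/
theorem circleIntegral_exp_div_of_lt {ρ R : ℝ} (hρ : 0 < ρ) (hR : ρ < R) {t : ℝ} (ht : 0 ≤ t) :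
    (∮ z in C(ρ, R), Complex.exp (t / z)) = 2 * Real.pi * Complex.I * t := by
  have hR0 : 0 < R := hρ.trans hR
  have hne : ∀ {R' : ℝ}, ρ < R' → ∀ z : ℂ, R' ≤ ‖z - ρ‖ → z ≠ 0 := by
    rintro R' hR' z hz rfl
    rw [zero_sub, norm_neg, Complex.norm_real, Real.norm_of_nonneg hρ.le] at hz
    linarith
  set g : ℂ → ℂ := fun z => Complex.exp (t / z) - 1 - t / z
  have hgd : ∀ z : ℂ, z ≠ 0 → DifferentiableAt ℂ g z := fun z hz => by
    have : DifferentiableAt ℂ (fun z : ℂ => (t : ℂ) / z) z := by fun_prop (disch := exact hz)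
    exact (this.cexp.sub_const 1).sub this
  have hg0 : (∮ z in C(ρ, R), g z) = 0 := by
    rw [← norm_le_zero_iff]
    have htend : Tendsto (fun R' : ℝ => 2 * Real.pi * (4 * t ^ 2 / R')) atTop (𝓝 0) := by
      have := (tendsto_const_nhds (x := 4 * t ^ 2)).div_atTop (tendsto_id (α := ℝ) (x := atTop))
      simpa using this.const_mul (2 * Real.pi)
    refine ge_of_tendsto htend ?_
    filter_upwards [eventually_ge_atTop R, eventually_ge_atTop (2 * ρ),
      eventually_ge_atTop (2 * t), eventually_gt_atTop 0] with R' h1 h2 h3 h4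
    rw [← Complex.circleIntegral_eq_of_differentiable_on_annulus_off_countable hR0 h1
      countable_empty (fun z hz => (hgd z (hne hR z (by
        have := hz.2
        rwa [Metric.mem_ball, not_lt, dist_eq_norm] at this))).continuousAt.continuousWithinAt)
      (fun z hz => hgd z (hne hR z (by
        have := hz.1.2
        rw [Metric.mem_closedBall, not_le, dist_eq_norm] at this
        exact this.le)))]
    have hb : ∀ z ∈ Metric.sphere (ρ : ℂ) R', ‖g z‖ ≤ (2 * t / R') ^ 2 := by
      intro z hz
      have hz1 : ‖z - ρ‖ = R' := mem_sphere_iff_norm.1 hz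
      have hz2 : R' / 2 ≤ ‖z‖ := by
        have := norm_sub_le z (ρ : ℂ)
        rw [hz1, Complex.norm_real, Real.norm_of_nonneg hρ.le] at this
        linarith
      have hz3 : ‖(t : ℂ) / z‖ ≤ 2 * t / R' := by
        rw [norm_div, Complex.norm_real, Real.norm_of_nonneg ht,
          div_le_div_iff₀ (by linarith) h4]
        nlinarith
      refine (Complex.norm_exp_sub_one_sub_id_le (hz3.trans ?_)).trans
        (pow_le_pow_left₀ (norm_nonneg _) hz3 2)
      rwa [div_le_one h4]
    refine (circleIntegral.norm_integral_le_of_norm_le_const h4.le hb).trans (le_of_eq ?_)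
    field_simp
    ring
  have hsph : ∀ z ∈ Metric.sphere (ρ : ℂ) R, z ≠ 0 := fun z hz =>
    hne hR z (mem_sphere_iff_norm.1 hz).ge
  have hci : ∀ {F : ℂ → ℂ}, (∀ z ≠ 0, DifferentiableAt ℂ F z) → CircleIntegrable F ρ R :=
    fun hF => ContinuousOn.circleIntegrable hR0.le fun z hz =>
      (hF z (hsph z hz)).continuousAt.continuousWithinAt
  have hinv : (∮ z in C(ρ, R), (t : ℂ) * (z - 0)⁻¹) = t * (2 * Real.pi * Complex.I) := by
    rw [circleIntegral.integral_const_mul, circleIntegral.integral_sub_inv_of_mem_ball]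
    rw [Metric.mem_ball, dist_comm, dist_zero_right, Complex.norm_real,
      Real.norm_of_nonneg hρ.le]
    exact hR
  have hsplit : (∮ z in C(ρ, R), Complex.exp (t / z)) =
      ∮ z in C(ρ, R), (g z + (1 + (t : ℂ) * (z - 0)⁻¹)) := by
    refine circleIntegral.integral_congr hR0.le fun z _ => ?_
    simp only [g, sub_zero, div_eq_mul_inv]
    ring
  have hone : (∮ z in C(ρ, R), (1 : ℂ)) = 0 :=
    (differentiableOn_const (c := (1 : ℂ))).diffContOnCl.circleIntegral_eq_zero hR0.le
  have hinvd : ∀ z : ℂ, z ≠ 0 → DifferentiableAt ℂ (fun z : ℂ => (t : ℂ) * (z - 0)⁻¹) z := by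
    intro z hz
    have : z - 0 ≠ 0 := by simpa using hz
    fun_prop (disch := exact this)
  have hsum : CircleIntegrable (fun z : ℂ => 1 + (t : ℂ) * (z - 0)⁻¹) ρ R :=
    (circleIntegrable_const 1 _ _).add (hci hinvd)
  rw [hsplit, circleIntegral.integral_add (hci hgd) hsum,
    circleIntegral.integral_add (circleIntegrable_const 1 _ _) (hci hinvd), hg0, hinv, hone]
  ring

/-- The contour passes through 0 only at a null set of angles, so pointwise arguments along it may
ignore the singularity. -/
theorem ae_circleMap_ne_zero {ρ : ℝ} (hρ : 0 < ρ) (μ : Measure ℝ) (hμ : μ ≪ volume) :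
    ∀ᵐ φ ∂μ, circleMap (ρ : ℂ) ρ φ ≠ 0 :=
  hμ.ae_le (((countable_singleton (0 : ℂ)).preimage_circleMap ρ hρ.ne').ae_notMem volume)

/-- Dominated convergence as the radius decreases to ρ: the kernel is bounded uniformly outside the
disc. -/
theorem circleIntegral_exp_div {ρ : ℝ} (hρ : 0 < ρ) {t : ℝ} (ht : 0 ≤ t) :
    (∮ z in C(ρ, ρ), Complex.exp (t / z)) = 2 * Real.pi * Complex.I * t := by
  have hlim : Tendsto (fun R : ℝ => ∮ z in C(ρ, R), Complex.exp (t / z)) (𝓝[>] ρ)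
      (𝓝 (∮ z in C(ρ, ρ), Complex.exp (t / z))) := by
    unfold circleIntegral
    refine intervalIntegral.tendsto_integral_filter_of_dominated_convergence
      (fun _ => (2 * ρ) * Real.exp (t / (2 * ρ))) ?_ ?_ (by simp) ?_
    · refine Eventually.of_forall fun R => ?_
      simp only [deriv_circleMap, smul_eq_mul]
      have hm : Measurable fun φ : ℝ => Complex.exp (t / circleMap (ρ : ℂ) R φ) :=
        Complex.measurable_exp.comp (measurable_const.div (measurable_circleMap _ _))
      exact (((measurable_circleMap _ _).mul_const _).mul hm).aestronglyMeasurable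
    · filter_upwards [self_mem_nhdsWithin, mem_nhdsWithin_of_mem_nhds (Iio_mem_nhds
        (by linarith : ρ < 2 * ρ))] with R hR hR2
      refine Eventually.of_forall fun φ _ => ?_
      have hR' : ρ < R := hR
      have hR0 : 0 < R := hρ.trans hR'
      rw [norm_smul, deriv_circleMap, norm_mul, Complex.norm_I, mul_one, norm_circleMap_zero,
        abs_of_pos hR0]
      refine mul_le_mul (le_of_lt hR2) (norm_exp_div_le_of_le hρ ?_ ht) (norm_nonneg _)
        (by positivity)
      rw [circleMap_sub_center, norm_circleMap_zero, abs_of_pos hR0]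
      exact hR'.le
    · filter_upwards [ae_circleMap_ne_zero hρ volume Measure.AbsolutelyContinuous.rfl] with φ hφ _
      have h1 : Continuous fun R : ℝ => circleMap (ρ : ℂ) R φ := by
        unfold circleMap
        fun_prop
      have h2 : Continuous fun R : ℝ => deriv (circleMap (ρ : ℂ) R) φ := by
        simp only [deriv_circleMap, circleMap]
        fun_prop
      have h3 : ContinuousAt (fun R : ℝ => deriv (circleMap (ρ : ℂ) R) φ •
          Complex.exp (t / circleMap (ρ : ℂ) R φ)) ρ :=
        h2.continuousAt.smul ((continuousAt_const.div h1.continuousAt hφ).cexp)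
      exact h3.tendsto.mono_left nhdsWithin_le_nhds
  refine tendsto_nhds_unique hlim (tendsto_const_nhds.congr' ?_)
  filter_upwards [self_mem_nhdsWithin] with R hR
  exact (circleIntegral_exp_div_of_lt hρ hR ht).symm

/-- `q n` is the normalised `n`-th remainder `z⁻ⁿ (f(z) - ∑_{k < n} a k z ^ k)` of a holomorphic
function on the disc of centre `ρ` and radius `ρ`, extended by `a n` to the boundary point `0`. -/
structure IsRemainderSeq (ρ C M : ℝ) (a : ℕ → ℂ) (q : ℕ → ℂ → ℂ) : Prop where
  cont : ∀ n, ContinuousOn (q n) (Metric.closedBall (ρ : ℂ) ρ)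
  diff : ∀ n, DifferentiableOn ℂ (q n) (Metric.ball (ρ : ℂ) ρ)
  eq_add : ∀ n, ∀ z ∈ Metric.closedBall (ρ : ℂ) ρ, q n z = a n + z * q (n + 1) z
  bound : ∀ n, ∀ z ∈ Metric.closedBall (ρ : ℂ) ρ, ‖q n z‖ ≤ C * M ^ n * n.factorial

/-- The `n`-th derivative of the Borel transform on the positive real axis. -/
def borelDeriv (ρ : ℝ) (a : ℕ → ℂ) (q : ℕ → ℂ → ℂ) (n : ℕ) (t : ℝ) : ℂ :=
  a (n + 1) + (2 * Real.pi * Complex.I)⁻¹ * ∮ z in C(ρ, ρ), Complex.exp (t / z) * q (n + 2) z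

theorem aestronglyMeasurable_exp_mul {ρ : ℝ} (hρ : 0 < ρ) {g : ℂ → ℂ}
    (hg : ContinuousOn g (Metric.closedBall (ρ : ℂ) ρ)) (t : ℝ) (μ : Measure ℝ) :
    AEStronglyMeasurable (fun φ => deriv (circleMap (ρ : ℂ) ρ) φ *
      (Complex.exp (t / circleMap (ρ : ℂ) ρ φ) * g (circleMap (ρ : ℂ) ρ φ))) μ := by
  have h1 : Continuous fun φ => g (circleMap (ρ : ℂ) ρ φ) :=
    hg.comp_continuous (continuous_circleMap _ _) fun φ =>
      circleMap_mem_closedBall _ hρ.le _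
  have hm : Measurable fun φ : ℝ => Complex.exp (t / circleMap (ρ : ℂ) ρ φ) :=
    Complex.measurable_exp.comp (measurable_const.div (measurable_circleMap _ _))
  simp only [deriv_circleMap]
  exact (((measurable_circleMap _ _).mul_const _).mul (hm.mul h1.measurable)).aestronglyMeasurable

theorem norm_exp_mul_le {ρ K : ℝ} (hρ : 0 < ρ) {g : ℂ → ℂ}
    (hK : ∀ z ∈ Metric.closedBall (ρ : ℂ) ρ, ‖g z‖ ≤ K) (t φ : ℝ) :
    ‖deriv (circleMap (ρ : ℂ) ρ) φ * (Complex.exp (t / circleMap (ρ : ℂ) ρ φ) *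
      g (circleMap (ρ : ℂ) ρ φ))‖ ≤ ρ * (Real.exp (|t| / (2 * ρ)) * K) := by
  rw [norm_mul, norm_mul, deriv_circleMap, norm_mul, Complex.norm_I, mul_one, norm_circleMap_zero,
    abs_of_pos hρ]
  exact mul_le_mul_of_nonneg_left (mul_le_mul
    (norm_exp_div_le_of_mem_sphere hρ (circleMap_mem_sphere _ hρ.le _) t)
    (hK _ (circleMap_mem_closedBall _ hρ.le _)) (norm_nonneg _) (Real.exp_pos _).le) hρ.le

theorem circleIntegral_eq_setIntegral (c : ℂ) (R : ℝ) (F : ℂ → ℂ) :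
    (∮ z in C(c, R), F z) = ∫ φ in Ioc 0 (2 * Real.pi), deriv (circleMap c R) φ *
      F (circleMap c R φ) := by
  rw [circleIntegral, intervalIntegral.integral_of_le Real.two_pi_pos.le]
  rfl

/-- Boundedness and measurability are used here, since the integrand need not be continuous at 0. -/
theorem circleIntegrable_exp_mul {ρ : ℝ} (hρ : 0 < ρ) {g : ℂ → ℂ}
    (hg : ContinuousOn g (Metric.closedBall (ρ : ℂ) ρ)) (t : ℝ) :
    CircleIntegrable (fun z => Complex.exp (t / z) * g z) ρ ρ := by
  obtain ⟨K, hK⟩ := (isCompact_closedBall (ρ : ℂ) ρ).exists_bound_of_continuousOn hg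
  rw [circleIntegrable_iff, intervalIntegrable_iff_integrableOn_Ioc_of_le Real.two_pi_pos.le]
  exact Measure.integrableOn_of_bounded measure_Ioc_lt_top.ne (aestronglyMeasurable_exp_mul hρ hg t _)
    (Eventually.of_forall fun φ => norm_exp_mul_le hρ hK t φ)

namespace IsRemainderSeq

variable {ρ C M : ℝ} {a : ℕ → ℂ} {q : ℕ → ℂ → ℂ}

theorem diffContOnCl (h : IsRemainderSeq ρ C M a q) (hρ : 0 < ρ) (n : ℕ) :
    DiffContOnCl ℂ (q n) (Metric.ball (ρ : ℂ) ρ) :=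
  ⟨h.diff n, by rw [closure_ball _ hρ.ne']; exact h.cont n⟩

theorem zero_mem (hρ : 0 < ρ) : (0 : ℂ) ∈ Metric.closedBall (ρ : ℂ) ρ := by
  rw [Metric.mem_closedBall, dist_zero_left, Complex.norm_real, Real.norm_of_nonneg hρ.le]

theorem norm_coeff_le (h : IsRemainderSeq ρ C M a q) (hρ : 0 < ρ) (n : ℕ) :
    ‖a n‖ ≤ C * M ^ n * n.factorial := by
  have h1 := h.bound n 0 (zero_mem hρ)
  rwa [h.eq_add n 0 (zero_mem hρ), zero_mul, add_zero] at h1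

/-- At t = 0 the contour integral is that of a function holomorphic inside and continuous up to the
circle, so Cauchy's theorem annihilates it. Hence the Taylor coefficients at 0 are those of the
formal Borel transform. -/
theorem borelDeriv_zero (h : IsRemainderSeq ρ C M a q) (hρ : 0 < ρ) (n : ℕ) :
    borelDeriv ρ a q n 0 = a (n + 1) := by
  simp only [borelDeriv, Complex.ofReal_zero, zero_div, Complex.exp_zero, one_mul]
  rw [(h.diffContOnCl hρ (n + 2)).circleIntegral_eq_zero hρ.le, mul_zero, add_zero]

/-- One more term is split off the remainder. The resulting factor z compensates the 1/z produced by
differentiating exp(t/z), so that differentiation under the integral has a bounded majorant. -/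
theorem borelDeriv_eq (h : IsRemainderSeq ρ C M a q) (hρ : 0 < ρ) (n : ℕ) {t : ℝ} (ht : 0 ≤ t) :
    borelDeriv ρ a q n t = a (n + 1) + a (n + 2) * t + (2 * Real.pi * Complex.I)⁻¹ *
      ∮ z in C(ρ, ρ), Complex.exp (t / z) * (z * q (n + 3) z) := by
  have h1 : (∮ z in C(ρ, ρ), Complex.exp (t / z) * q (n + 2) z) =
      ∮ z in C(ρ, ρ), (a (n + 2) * Complex.exp (t / z) +
        Complex.exp (t / z) * (z * q (n + 3) z)) := by
    refine circleIntegral.integral_congr hρ.le fun z hz => ?_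
    rw [h.eq_add (n + 2) z (Metric.sphere_subset_closedBall hz)]
    ring
  have h2 : CircleIntegrable (fun z => a (n + 2) * Complex.exp (t / z)) ρ ρ := by
    simpa [mul_comm] using circleIntegrable_exp_mul hρ (continuousOn_const (c := a (n + 2))) t
  have h3 : CircleIntegrable (fun z => Complex.exp (t / z) * (z * q (n + 3) z)) ρ ρ :=
    circleIntegrable_exp_mul hρ (continuousOn_id.mul (h.cont (n + 3))) t
  rw [borelDeriv, h1, circleIntegral.integral_add h2 h3,
    circleIntegral.integral_const_mul, circleIntegral_exp_div hρ ht]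
  have := Complex.two_pi_I_ne_zero
  field_simp
  ring

theorem hasDerivWithinAt_borelDeriv (h : IsRemainderSeq ρ C M a q) (hρ : 0 < ρ) (n : ℕ) {t : ℝ}
    (ht : 0 ≤ t) : HasDerivWithinAt (borelDeriv ρ a q n) (borelDeriv ρ a q (n + 1) t) (Ici 0) t := by
  have hcont : ContinuousOn (fun z => z * q (n + 3) z) (Metric.closedBall (ρ : ℂ) ρ) :=
    continuousOn_id.mul (h.cont (n + 3))
  set K := C * M ^ (n + 3) * (n + 3).factorial
  have hK : ∀ z ∈ Metric.closedBall (ρ : ℂ) ρ, ‖q (n + 3) z‖ ≤ K := h.bound (n + 3)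
  have hK0 : 0 ≤ K := (norm_nonneg _).trans (hK 0 (zero_mem hρ))
  have hder := (hasDerivAt_integral_of_dominated_loc_of_deriv_le (𝕜 := ℝ) (E := ℂ)
    (μ := volume.restrict (Ioc 0 (2 * Real.pi)))
    (F := fun (t : ℝ) φ => deriv (circleMap (ρ : ℂ) ρ) φ * (Complex.exp (t / circleMap (ρ : ℂ) ρ φ) *
      (circleMap (ρ : ℂ) ρ φ * q (n + 3) (circleMap (ρ : ℂ) ρ φ))))
    (F' := fun t φ => deriv (circleMap (ρ : ℂ) ρ) φ * (Complex.exp (t / circleMap (ρ : ℂ) ρ φ) *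
      q (n + 3) (circleMap (ρ : ℂ) ρ φ)))
    (bound := fun _ => ρ * (Real.exp ((|t| + 1) / (2 * ρ)) * K)) (x₀ := t)
    (Metric.ball_mem_nhds t one_pos)
    (Eventually.of_forall fun s => aestronglyMeasurable_exp_mul hρ hcont s _)
    ?_ (aestronglyMeasurable_exp_mul hρ (h.cont (n + 3)) t _)
    (Eventually.of_forall fun φ s hs => ?_) (integrable_const _) ?_).2
  · have h1 : HasDerivAt (fun s : ℝ => a (n + 1) + a (n + 2) * s + (2 * Real.pi * Complex.I)⁻¹ *
        ∮ z in C(ρ, ρ), Complex.exp (s / z) * (z * q (n + 3) z))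
        (a (n + 2) * 1 + (2 * Real.pi * Complex.I)⁻¹ *
        ∮ z in C(ρ, ρ), Complex.exp (t / z) * q (n + 3) z) t := by
      refine HasDerivAt.add ((HasDerivAt.const_mul _ ?_).const_add _) (HasDerivAt.const_mul _ ?_)
      · exact (hasDerivAt_id t).ofReal_comp
      · simp only [circleIntegral_eq_setIntegral]
        exact hder
    refine (h1.hasDerivWithinAt.congr (fun s hs => h.borelDeriv_eq hρ n hs)
      (h.borelDeriv_eq hρ n ht)).congr_deriv ?_
    rw [mul_one, borelDeriv]
  · have := (circleIntegrable_iff ρ).1 (circleIntegrable_exp_mul hρ hcont t)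
    rw [intervalIntegrable_iff_integrableOn_Ioc_of_le Real.two_pi_pos.le] at this
    exact this
  · refine (norm_exp_mul_le hρ hK s φ).trans ?_
    have hs1 : |s| ≤ |t| + 1 := by
      rw [Metric.mem_ball, Real.dist_eq] at hs
      linarith [abs_sub_abs_le_abs_sub s t]
    gcongr
  · filter_upwards [ae_circleMap_ne_zero hρ _ Measure.absolutelyContinuous_restrict] with φ hφ s _
    have h1 : HasDerivAt (fun s : ℝ => Complex.exp ((s : ℂ) / circleMap (ρ : ℂ) ρ φ))
        (Complex.exp (s / circleMap (ρ : ℂ) ρ φ) * (1 / circleMap (ρ : ℂ) ρ φ)) s :=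
      (((hasDerivAt_id s).ofReal_comp).div_const _).cexp
    refine ((h1.mul_const (circleMap (ρ : ℂ) ρ φ * q (n + 3) (circleMap (ρ : ℂ) ρ φ))).const_mul
      (deriv (circleMap (ρ : ℂ) ρ) φ)).congr_deriv ?_
    field_simp

/-- The shift from n! to (n + 1)! and (n + 2)! costs polynomial factors, absorbed by replacing M
with 4M. The contour contributes the exponential rate 1/(2ρ). -/
theorem norm_borelDeriv_le (h : IsRemainderSeq ρ C M a q) (hρ : 0 < ρ) (hC : 0 ≤ C) (hM : 0 ≤ M)
    (n : ℕ) {t : ℝ} (ht : 0 ≤ t) : ‖borelDeriv ρ a q n t‖ ≤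
      (C * M + 2 * ρ * (C * M ^ 2)) * Real.exp (t / (2 * ρ)) * (4 * M) ^ n * n.factorial := by
  have h1 : ‖(2 * Real.pi * Complex.I)⁻¹ * ∮ z in C(ρ, ρ), Complex.exp (t / z) * q (n + 2) z‖ ≤
      ρ * (Real.exp (t / (2 * ρ)) * (C * M ^ (n + 2) * (n + 2).factorial)) := by
    refine circleIntegral.norm_two_pi_i_inv_smul_integral_le_of_norm_le_const hρ.le fun z hz => ?_
    rw [norm_mul]
    have := norm_exp_div_le_of_mem_sphere hρ hz t
    rw [abs_of_nonneg ht] at this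
    exact mul_le_mul this (h.bound _ z (Metric.sphere_subset_closedBall hz)) (norm_nonneg _)
      (Real.exp_pos _).le
  have h2 := h.norm_coeff_le hρ (n + 1)
  have h3 : ((n : ℝ) + 1) ≤ 4 ^ n := by
    have := one_add_mul_le_pow (show (-2 : ℝ) ≤ 3 by norm_num) n
    norm_num at this
    nlinarith [(Nat.cast_nonneg n : (0 : ℝ) ≤ n)]
  have h4 : ((n : ℝ) + 2) * (n + 1) ≤ 2 * 4 ^ n := by
    have h5 := one_add_mul_le_pow (show (-2 : ℝ) ≤ 1 by norm_num) n
    norm_num at h5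
    have h6 : ((4 : ℝ)) ^ n = 2 ^ n * 2 ^ n := by rw [← mul_pow]; norm_num
    rw [h6]
    nlinarith [(Nat.cast_nonneg n : (0 : ℝ) ≤ n)]
  have he : 1 ≤ Real.exp (t / (2 * ρ)) := Real.one_le_exp (by positivity)
  have e1 : ((n + 1).factorial : ℝ) = (n + 1) * n.factorial := by
    rw [Nat.factorial_succ]; push_cast; ring
  have e2 : ((n + 2).factorial : ℝ) = ((n + 2) * (n + 1)) * n.factorial := by
    rw [Nat.factorial_succ, Nat.factorial_succ]; push_cast; ring
  calc ‖borelDeriv ρ a q n t‖ ≤ C * M ^ (n + 1) * (n + 1).factorial +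
      ρ * (Real.exp (t / (2 * ρ)) * (C * M ^ (n + 2) * (n + 2).factorial)) :=
        (norm_add_le _ _).trans (add_le_add h2 h1)
    _ = (C * M) * M ^ n * n.factorial * (n + 1) * 1 + ρ * (C * M ^ 2) * Real.exp (t / (2 * ρ)) *
        M ^ n * n.factorial * ((n + 2) * (n + 1)) := by rw [e1, e2]; ring
    _ ≤ (C * M) * M ^ n * n.factorial * 4 ^ n * Real.exp (t / (2 * ρ)) +
        ρ * (C * M ^ 2) * Real.exp (t / (2 * ρ)) * M ^ n * n.factorial * (2 * 4 ^ n) := by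
        gcongr
    _ = _ := by rw [mul_pow]; ring

/-- The Laplace transform of the Borel transform. -/
theorem integral_borelDeriv (h : IsRemainderSeq ρ C M a q) (hρ : 0 < ρ) {w : ℂ}
    (hw : w ∈ Metric.ball (ρ : ℂ) ρ) (hre : 1 / (2 * ρ) < (1 / w).re) :
    ∫ t in Ioi (0 : ℝ), borelDeriv ρ a q 0 t * Complex.exp (-t / w) = q 0 w - a 0 := by
  have hw0 : w ≠ 0 := by
    rintro rfl
    rw [div_zero, Complex.zero_re] at hre
    exact absurd hre (not_lt.2 (by positivity))
  set K := C * M ^ 2 * (2 : ℕ).factorial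
  have hK : ∀ z ∈ Metric.closedBall (ρ : ℂ) ρ, ‖q 2 z‖ ≤ K := h.bound 2
  have hK0 : 0 ≤ K := (norm_nonneg _).trans (hK 0 (zero_mem hρ))
  -- The decay exp(-t Re(1/w)) beats the growth exp(t/(2ρ)) of the kernel by the margin β, which
  -- makes the double integral absolutely convergent.
  set β := (1 / w).re - 1 / (2 * ρ)
  have hβ : 0 < β := sub_pos.2 hre
  set μ : Measure ℝ := volume.restrict (Ioc 0 (2 * Real.pi))
  set ν : Measure ℝ := volume.restrict (Ioi 0)
  have hexpw : ∀ t : ℝ, ‖Complex.exp (-t / w)‖ = Real.exp (-t * (1 / w).re) := by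
    intro t
    rw [Complex.norm_exp]
    congr 1
    rw [show (-(t : ℂ) / w) = ((-t : ℝ) : ℂ) * (1 / w) by push_cast; ring, Complex.re_ofReal_mul]
  set F : ℝ → ℝ → ℂ := fun t φ => deriv (circleMap (ρ : ℂ) ρ) φ *
    (Complex.exp (t / circleMap (ρ : ℂ) ρ φ) * q 2 (circleMap (ρ : ℂ) ρ φ)) * Complex.exp (-t / w)
  have hFi : Integrable (Function.uncurry F) (ν.prod μ) := by
    have hb : Integrable (fun p : ℝ × ℝ => Real.exp (-β * p.1) * (ρ * K)) (ν.prod μ) :=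
      (Integrable.mul_prod (f := fun t : ℝ => Real.exp (-β * t)) (g := fun _ : ℝ => ρ * K)
        (integrableOn_exp_mul_Ioi (by linarith) 0) (integrable_const _))
    refine hb.mono' ?_ ?_
    · have m1 : Measurable fun p : ℝ × ℝ => circleMap (ρ : ℂ) ρ p.2 :=
        (measurable_circleMap _ _).comp measurable_snd
      have m0 : Measurable fun p : ℝ × ℝ => (p.1 : ℂ) := Complex.measurable_ofReal.comp measurable_fst
      have m2 : Measurable fun p : ℝ × ℝ => Complex.exp (p.1 / circleMap (ρ : ℂ) ρ p.2) :=
        Complex.measurable_exp.comp (m0.div m1)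
      have m3 : Measurable fun p : ℝ × ℝ => q 2 (circleMap (ρ : ℂ) ρ p.2) :=
        ((h.cont 2).comp_continuous (continuous_circleMap _ _) fun φ =>
          circleMap_mem_closedBall _ hρ.le _).measurable.comp measurable_snd
      have m4 : Measurable fun p : ℝ × ℝ => deriv (circleMap (ρ : ℂ) ρ) p.2 := by
        simp only [deriv_circleMap]
        exact ((measurable_circleMap _ _).comp measurable_snd).mul_const _
      have m5 : Measurable fun p : ℝ × ℝ => Complex.exp (-(p.1 : ℂ) / w) :=
        Complex.measurable_exp.comp (m0.neg.div_const w)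
      exact ((m4.mul (m2.mul m3)).mul m5).aestronglyMeasurable
    · have hae : ∀ᵐ p ∂(ν.prod μ), 0 < p.1 := by
        have h1 : ∀ᵐ t ∂ν, 0 < t := ae_restrict_mem measurableSet_Ioi
        exact Measure.quasiMeasurePreserving_fst.ae h1
      filter_upwards [hae] with p hp
      simp only [Function.uncurry, F]
      rw [norm_mul, hexpw]
      have h1 := norm_exp_mul_le hρ hK p.1 p.2
      rw [abs_of_pos hp] at h1
      calc _ ≤ ρ * (Real.exp (p.1 / (2 * ρ)) * K) * Real.exp (-p.1 * (1 / w).re) := by gcongr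
        _ = (Real.exp (p.1 / (2 * ρ)) * Real.exp (-p.1 * (1 / w).re)) * (ρ * K) := by ring
        _ = _ := by
          rw [← Real.exp_add]
          congr 2
          simp only [β]
          ring
  have hneg : ((-1 / w : ℂ)).re < 0 := by
    rw [show (-1 / w : ℂ) = -(1 / w) by ring, Complex.neg_re]
    have : 0 < 1 / (2 * ρ) := by positivity
    linarith
  have hint1 : (∫ t in Ioi (0 : ℝ), Complex.exp (-t / w)) = w := by
    have := integral_exp_mul_complex_Ioi hneg 0
    simp only [Complex.ofReal_zero, mul_zero, Complex.exp_zero] at this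
    rw [show (fun t : ℝ => Complex.exp (-(t : ℂ) / w)) = fun t : ℝ => Complex.exp (-1 / w * t) by
      ext t; congr 1; ring, this]
    field_simp
  have hi1 : IntegrableOn (fun t : ℝ => Complex.exp (-t / w)) (Ioi 0) := by
    have := integrableOn_exp_mul_complex_Ioi hneg 0
    rwa [show (fun t : ℝ => Complex.exp (-1 / w * t)) = fun t : ℝ => Complex.exp (-(t : ℂ) / w) by
      ext t; congr 1; ring] at this
  have hinner : ∀ t : ℝ, (∫ φ, F t φ ∂μ) =
      (∮ z in C(ρ, ρ), Complex.exp (t / z) * q 2 z) * Complex.exp (-t / w) := by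
    intro t
    rw [circleIntegral_eq_setIntegral, ← integral_mul_const]
  have hswap : (∫ t in Ioi (0 : ℝ), (∮ z in C(ρ, ρ), Complex.exp (t / z) * q 2 z) *
      Complex.exp (-t / w)) = ∫ φ, ∫ t, F t φ ∂ν ∂μ := by
    rw [← integral_integral_swap hFi]
    exact integral_congr_ae (Eventually.of_forall fun t => (hinner t).symm)
  -- After Fubini the inner integral is 1/(1/w - 1/z) = zw/(z - w), a Cauchy kernel. Cauchy's
  -- formula then evaluates the remainder at w.
  have hq2 : (∫ φ, ∫ t, F t φ ∂ν ∂μ) =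
      ∮ z in C(ρ, ρ), w * ((z - w)⁻¹ * (z * q 2 z)) := by
    rw [circleIntegral_eq_setIntegral]
    refine integral_congr_ae ?_
    filter_upwards [ae_circleMap_ne_zero hρ _ Measure.absolutelyContinuous_restrict] with φ hφ
    set z := circleMap (ρ : ℂ) ρ φ
    have hzs : z ∈ Metric.sphere (ρ : ℂ) ρ := circleMap_mem_sphere _ hρ.le _
    have hzw : z - w ≠ 0 := by
      intro h0
      rw [sub_eq_zero] at h0
      rw [← h0, Metric.mem_ball, Metric.mem_sphere.1 hzs] at hw
      exact hw.false
    have hre2 : (1 / z - 1 / w).re < 0 := by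
      have h1 : ‖z - ρ‖ ^ 2 = ρ ^ 2 := by rw [mem_sphere_iff_norm.1 hzs]
      have hpos : 0 < Complex.normSq z := Complex.normSq_pos.2 hφ
      rw [← Complex.normSq_eq_norm_sq] at h1
      have h2 : Complex.normSq z = 2 * ρ * z.re := by
        simp only [Complex.normSq_apply, Complex.sub_re, Complex.sub_im, Complex.ofReal_re,
          Complex.ofReal_im] at h1 ⊢
        nlinarith
      have h3 : z.re ≠ 0 := fun h => by rw [h2, h, mul_zero] at hpos; exact hpos.false
      have h4 : (1 / z).re = 1 / (2 * ρ) := by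
        rw [one_div, Complex.inv_re, h2]
        field_simp
      rw [Complex.sub_re, h4]
      linarith
    have h5 : (fun t : ℝ => F t φ) = fun t : ℝ => (deriv (circleMap (ρ : ℂ) ρ) φ * q 2 z) *
        Complex.exp ((1 / z - 1 / w) * t) := by
      ext t
      simp only [F]
      rw [show (1 / z - 1 / w) * (t : ℂ) = t / z + -t / w by ring, Complex.exp_add]
      ring
    rw [h5, integral_const_mul, integral_exp_mul_complex_Ioi hre2 0]
    have h6 : (1 / z - 1 / w) ≠ 0 := fun h0 => by rw [h0] at hre2; simp at hre2
    have h7 : (w - z) ≠ 0 := by rw [← neg_sub]; exact neg_ne_zero.2 hzw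
    have h8 : (1 / z - 1 / w) = (w - z) / (z * w) := by field_simp
    rw [h8]
    simp only [Complex.ofReal_zero, mul_zero, Complex.exp_zero]
    rw [neg_div, one_div_div, ← neg_sub w z]
    field_simp
  have hd : DiffContOnCl ℂ (fun z => z * q 2 z) (Metric.ball (ρ : ℂ) ρ) :=
    ⟨differentiableOn_id.mul (h.diff 2), by
      rw [closure_ball _ hρ.ne']
      exact continuousOn_id.mul (h.cont 2)⟩
  have hcauchy := hd.circleIntegral_sub_inv_smul hw
  simp only [smul_eq_mul] at hcauchy
  have hint2 : Integrable (fun t : ℝ => (∮ z in C(ρ, ρ), Complex.exp (t / z) * q 2 z) *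
      Complex.exp (-t / w)) ν := by
    refine hFi.integral_prod_left.congr (Eventually.of_forall fun t => ?_)
    exact hinner t
  have hwc := Metric.ball_subset_closedBall hw
  calc ∫ t in Ioi (0 : ℝ), borelDeriv ρ a q 0 t * Complex.exp (-t / w)
      = ∫ t in Ioi (0 : ℝ), (a 1 * Complex.exp (-t / w) + (2 * Real.pi * Complex.I)⁻¹ *
        ((∮ z in C(ρ, ρ), Complex.exp (t / z) * q 2 z) * Complex.exp (-t / w))) := by
        simp only [borelDeriv, zero_add]
        congr 1
        ext t
        ring
    _ = a 1 * w + (2 * Real.pi * Complex.I)⁻¹ * (w * (2 * Real.pi * Complex.I * (w * q 2 w))) := by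
        rw [integral_add (hi1.const_mul _) (hint2.const_mul _), integral_const_mul,
          integral_const_mul, hint1, hswap, hq2, circleIntegral.integral_const_mul, hcauchy]
    _ = q 0 w - a 0 := by
        rw [h.eq_add 0 w hwc, h.eq_add 1 w hwc]
        have := Complex.two_pi_I_ne_zero
        field_simp
        ring

end IsRemainderSeq

end

/-! ### ### Continuation of the Borel transform to a tube -/

noncomputable section

/-- Taylor expansion of a smooth function on `[0, ∞)` with factorially bounded derivatives. -/
theorem hasSum_taylor_of_bound {c : ℕ → ℝ → ℂ}
    (hder : ∀ n t, 0 ≤ t → HasDerivWithinAt (c n) (c (n + 1) t) (Ici 0) t) {K M T : ℝ}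
    (hK : 0 ≤ K) (hM : 0 ≤ M)
    (hb : ∀ n t, 0 ≤ t → t ≤ T → ‖c n t‖ ≤ K * M ^ n * n.factorial) {s t : ℝ} (hs : 0 ≤ s)
    (hsT : s ≤ T) (ht : 0 ≤ t) (htT : t ≤ T) (hst : M * |s - t| < 1) :
    HasSum (fun k => c k t / k.factorial * ((s : ℂ) - t) ^ k) (c 0 s) := by
  set x := M * |s - t|
  have hx0 : 0 ≤ x := by positivity
  have hnorm : ‖(s : ℂ) - t‖ = |s - t| := by
    rw [← Complex.ofReal_sub, Complex.norm_real, Real.norm_eq_abs]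
  -- The Taylor polynomial at τ evaluated at s, as a function of τ. Its derivative telescopes to a
  -- single term and it equals c 0 s at τ = s, so integrating back to t yields the remainder
  -- estimate.
  set G : ℕ → ℝ → ℂ := fun n τ => ∑ k ∈ Finset.range n, c k τ / k.factorial * ((s : ℂ) - τ) ^ k
  have hG : ∀ n τ, 0 ≤ τ → HasDerivWithinAt (G (n + 1))
      (c (n + 1) τ / n.factorial * ((s : ℂ) - τ) ^ n) (Ici 0) τ := by
    intro n τ hτ
    have hlin : ∀ m : ℕ, HasDerivWithinAt (fun τ : ℝ => ((s : ℂ) - τ) ^ m)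
        (m * ((s : ℂ) - τ) ^ (m - 1) * -1) (Ici 0) τ := fun m =>
      ((((hasDerivAt_id τ).ofReal_comp).const_sub (s : ℂ)).pow m).hasDerivWithinAt
    induction n with
    | zero =>
      simp only [G, zero_add, Finset.range_one, Finset.sum_singleton, pow_zero, mul_one,
        Nat.factorial_zero, Nat.cast_one, div_one]
      exact hder 0 τ hτ
    | succ n ih =>
      have h1 := ih.add (((hder (n + 1) τ hτ).div_const ((n + 1).factorial : ℂ)).mul (hlin (n + 1)))
      have h2 : G (n + 1 + 1) = fun τ => G (n + 1) τ +
          c (n + 1) τ / (n + 1).factorial * ((s : ℂ) - τ) ^ (n + 1) := by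
        ext τ
        simp only [G]
        rw [Finset.sum_range_succ]
      rw [h2]
      refine h1.congr_deriv ?_
      have h3 : ((n + 1).factorial : ℂ) = (n + 1) * n.factorial := by
        rw [Nat.factorial_succ]; push_cast; ring
      have h4 : (n.factorial : ℂ) ≠ 0 := by exact_mod_cast n.factorial_ne_zero
      have h5 : (n : ℂ) + 1 ≠ 0 := by exact_mod_cast n.succ_ne_zero
      rw [h3]
      push_cast
      field_simp
      ring
  have hGs : ∀ n, G (n + 1) s = c 0 s := by
    intro n
    change ∑ k ∈ Finset.range (n + 1), c k s / k.factorial * ((s : ℂ) - s) ^ k = c 0 s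
    rw [Finset.sum_range_succ']
    simp
  have hsub : uIcc s t ⊆ Ici 0 := fun τ hτ => (le_min hs ht).trans hτ.1
  have hest : ∀ n, ‖G (n + 1) t - c 0 s‖ ≤ K * ((n + 1 : ℕ) * x ^ (n + 1)) := by
    intro n
    rw [← hGs n]
    have hbd : ∀ τ ∈ uIcc s t, ‖c (n + 1) τ / n.factorial * ((s : ℂ) - τ) ^ n‖ ≤
        K * M ^ (n + 1) * (n + 1) * |s - t| ^ n := by
      intro τ hτ
      have hτ0 : 0 ≤ τ := hsub hτ
      have hτT : τ ≤ T := hτ.2.trans (max_le hsT htT)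
      have h1 := hb (n + 1) τ hτ0 hτT
      have h2 : ‖(s : ℂ) - τ‖ ≤ |s - t| := by
        rw [← Complex.ofReal_sub, Complex.norm_real, Real.norm_eq_abs, abs_sub_comm s τ,
          abs_sub_comm s t]
        exact abs_sub_left_of_mem_uIcc hτ
      have hf : (0 : ℝ) < n.factorial := by exact_mod_cast n.factorial_pos
      rw [norm_mul, norm_div, norm_pow, Complex.norm_natCast]
      refine mul_le_mul ?_ (pow_le_pow_left₀ (norm_nonneg _) h2 n) (by positivity) (by positivity)
      rw [div_le_iff₀ hf]
      refine h1.trans (le_of_eq ?_)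
      rw [Nat.factorial_succ]
      push_cast
      ring
    have := (convex_uIcc s t).norm_image_sub_le_of_norm_hasDerivWithin_le
      (fun τ hτ => (hG n τ (hsub hτ)).mono hsub) hbd left_mem_uIcc right_mem_uIcc
    refine this.trans (le_of_eq ?_)
    rw [Real.norm_eq_abs, abs_sub_comm t s]
    simp only [x]
    push_cast
    ring
  have hsum : Summable fun k => c k t / k.factorial * ((s : ℂ) - t) ^ k := by
    refine Summable.of_norm_bounded ((summable_geometric_of_lt_one hx0 hst).mul_left K) fun k => ?_
    have hf : (0 : ℝ) < k.factorial := by exact_mod_cast k.factorial_pos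
    rw [norm_mul, norm_div, norm_pow, Complex.norm_natCast, hnorm, mul_pow, ← mul_assoc]
    refine mul_le_mul_of_nonneg_right ?_ (by positivity)
    rw [div_le_iff₀ hf]
    exact hb k t ht htT
  refine (hsum.hasSum_iff_tendsto_nat).2 ?_
  rw [← tendsto_add_atTop_iff_nat 1, tendsto_iff_norm_sub_tendsto_zero]
  refine squeeze_zero (fun n => norm_nonneg _) hest ?_
  have := (tendsto_self_mul_const_pow_of_lt_one hx0 hst).comp (tendsto_add_atTop_nat 1)
  simpa using this.const_mul K

namespace WKB

theorem mem_tube {θ η : ℝ} {ξ : ℂ} :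
    ξ ∈ tube θ η ↔ ∃ t : ℝ, 0 ≤ t ∧ ‖ξ - Complex.exp (θ * Complex.I) * t‖ < η := by
  rw [tube, Metric.mem_thickening_iff]
  constructor
  · rintro ⟨_, ⟨t, ht, rfl⟩, h⟩
    exact ⟨t, ht, by rwa [← dist_eq_norm]⟩
  · rintro ⟨t, ht, h⟩
    exact ⟨_, ⟨t, ht, rfl⟩, by rwa [dist_eq_norm]⟩

theorem isOpen_tube (θ η : ℝ) : IsOpen (tube θ η) := Metric.isOpen_thickening

theorem ofReal_mem_tube {θ η : ℝ} (hη : 0 < η) {t : ℝ} (ht : 0 ≤ t) :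
    Complex.exp (θ * Complex.I) * t ∈ tube θ η :=
  mem_tube.2 ⟨t, ht, by simpa using hη⟩

theorem convex_tube (θ η : ℝ) : Convex ℝ (tube θ η) := by
  refine Convex.thickening ?_ η
  rintro _ ⟨t, ht, rfl⟩ _ ⟨s, hs, rfl⟩ α β hα hβ _
  refine ⟨α * t + β * s, by positivity, ?_⟩
  simp only [Complex.real_smul]
  push_cast
  ring

theorem tube_mono {θ η η' : ℝ} (h : η ≤ η') : tube θ η ⊆ tube θ η' := Metric.thickening_mono h _

/-- The Gevrey bounds of `f` with respect to the asymptotic series `∑ a k h ^ k` on `D`. -/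
def GevreyOn (D : Set ℂ) (C M : ℝ) (f : ℂ → ℂ) (a : ℕ → ℂ) : Prop :=
  ∀ n : ℕ, ∀ h ∈ D, ‖f h - ∑ k ∈ Finset.range n, a k * h ^ k‖ ≤
    C * M ^ n * n.factorial * ‖h‖ ^ n

theorem GevreyOn.mono {D D' : Set ℂ} {C M : ℝ} {f : ℂ → ℂ} {a : ℕ → ℂ} (h : GevreyOn D C M f a)
    (hD : D' ⊆ D) : GevreyOn D' C M f a := fun n z hz => h n z (hD hz)

/-- The term a n zⁿ is the difference of two consecutive remainders. Dividing by |z|ⁿ and letting z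
tend to 0 along the ray of direction θ leaves the constant of order n. -/
theorem GevreyOn.norm_coeff_le {θ δ C M : ℝ} (hδ : 0 < δ) {f : ℂ → ℂ} {a : ℕ → ℂ}
    (h : GevreyOn (borelDisc θ δ) C M f a) (n : ℕ) : ‖a n‖ ≤ C * M ^ n * n.factorial := by
  have h1 : Tendsto (fun t : ℝ => C * M ^ n * n.factorial + C * M ^ (n + 1) * (n + 1).factorial * t)
      (𝓝[>] 0) (𝓝 (C * M ^ n * n.factorial + C * M ^ (n + 1) * (n + 1).factorial * 0)) :=
    (Continuous.tendsto (by fun_prop) 0).mono_left nhdsWithin_le_nhds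
  rw [mul_zero, add_zero] at h1
  refine ge_of_tendsto h1 ?_
  filter_upwards [self_mem_nhdsWithin, mem_nhdsWithin_of_mem_nhds (Iio_mem_nhds hδ)] with t ht htδ
  have ht0 : 0 < t := ht
  have hmem := mem_borelDisc_ofReal (θ := θ) ht0 htδ
  set z := Complex.exp (θ * Complex.I) * t
  have hz : ‖z‖ = t := by
    rw [norm_mul, Complex.norm_exp_ofReal_mul_I, one_mul, Complex.norm_real,
      Real.norm_of_nonneg ht0.le]
  have e1 := h n z hmem
  have e2 := h (n + 1) z hmem
  rw [Finset.sum_range_succ] at e2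
  have e3 : ‖a n * z ^ n‖ ≤ C * M ^ n * n.factorial * ‖z‖ ^ n +
      C * M ^ (n + 1) * (n + 1).factorial * ‖z‖ ^ (n + 1) := by
    have : a n * z ^ n = (f z - ∑ k ∈ Finset.range n, a k * z ^ k) -
        (f z - (∑ k ∈ Finset.range n, a k * z ^ k + a n * z ^ n)) := by ring
    rw [this]
    exact (norm_sub_le _ _).trans (add_le_add e1 e2)
  rw [norm_mul, norm_pow, hz] at e3
  have hp : 0 < t ^ n := by positivity
  refine le_of_mul_le_mul_right (e3.trans (le_of_eq ?_)) hp
  ring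

/-- The normalised remainders of `f` at `0`. -/
def remainder (f : ℂ → ℂ) (a : ℕ → ℂ) (n : ℕ) (z : ℂ) : ℂ :=
  if z = 0 then a n else (f z - ∑ k ∈ Finset.range n, a k * z ^ k) / z ^ n

/-- The disc of half the size touches the boundary of the Borel disc only at 0. The contour can thus
run along its circle, 0 being the only exceptional point. -/
theorem closedBall_subset_borelDisc {δ : ℝ} (hδ : 0 < δ) {z : ℂ}
    (hz : z ∈ Metric.closedBall ((δ / 4 : ℝ) : ℂ) (δ / 4)) (h0 : z ≠ 0) : z ∈ borelDisc 0 δ := by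
  rw [borelDisc_eq_ball hδ]
  simp only [Complex.ofReal_zero, zero_mul, Complex.exp_zero, one_mul]
  rw [Metric.mem_closedBall, dist_eq_norm, ← sq_le_sq₀ (norm_nonneg _) (by positivity),
    ← Complex.normSq_eq_norm_sq] at hz
  rw [Metric.mem_ball, dist_eq_norm, ← sq_lt_sq₀ (norm_nonneg _) (by positivity),
    ← Complex.normSq_eq_norm_sq]
  have hpos : 0 < Complex.normSq z := Complex.normSq_pos.2 h0
  simp only [Complex.normSq_apply, Complex.sub_re, Complex.sub_im, Complex.ofReal_re,
    Complex.ofReal_im] at hz hpos ⊢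
  nlinarith

theorem remainder_eq_add (f : ℂ → ℂ) (a : ℕ → ℂ) (n : ℕ) (z : ℂ) :
    remainder f a n z = a n + z * remainder f a (n + 1) z := by
  rcases eq_or_ne z 0 with rfl | h0
  · simp [remainder]
  · simp only [remainder, if_neg h0, Finset.sum_range_succ]
    field_simp
    ring

theorem norm_remainder_le {δ C M : ℝ} (hδ : 0 < δ) {f : ℂ → ℂ} {a : ℕ → ℂ}
    (h : GevreyOn (borelDisc 0 δ) C M f a) (n : ℕ) {z : ℂ}
    (hz : z ∈ Metric.closedBall ((δ / 4 : ℝ) : ℂ) (δ / 4)) :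
    ‖remainder f a n z‖ ≤ C * M ^ n * n.factorial := by
  rcases eq_or_ne z 0 with rfl | h0
  · simpa [remainder] using h.norm_coeff_le hδ n
  · have hp : 0 < ‖z‖ ^ n := pow_pos (norm_pos_iff.2 h0) n
    simp only [remainder, if_neg h0]
    rw [norm_div, norm_pow, div_le_iff₀ hp]
    exact h n z (closedBall_subset_borelDisc hδ hz h0)

/-- Continuity at 0 comes from `remainder_eq_add`: the next remainder is bounded, so multiplied by z
it tends to 0. -/
theorem isRemainderSeq_remainder {δ C M : ℝ} (hδ : 0 < δ) {f : ℂ → ℂ} {a : ℕ → ℂ}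
    (hf : DifferentiableOn ℂ f (borelDisc 0 δ)) (h : GevreyOn (borelDisc 0 δ) C M f a) :
    IsRemainderSeq (δ / 4) C M a (remainder f a) := by
  have hδ4 : 0 < δ / 4 := by positivity
  have hdiff : ∀ n, ∀ z ∈ borelDisc 0 δ, DifferentiableAt ℂ (remainder f a n) z := by
    intro n z hz
    have h0 := ne_zero_of_mem_borelDisc hδ hz
    have h1 : DifferentiableAt ℂ (fun z => (f z - ∑ k ∈ Finset.range n, a k * z ^ k) / z ^ n) z := by
      have hfz := hf.differentiableAt ((isOpen_borelDisc hδ).mem_nhds hz)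
      have h2 : z ^ n ≠ 0 := pow_ne_zero n h0
      fun_prop (disch := exact h2)
    refine h1.congr_of_eventuallyEq ?_
    filter_upwards [isOpen_ne.mem_nhds h0] with w hw
    simp [remainder, if_neg hw]
  refine ⟨fun n z hz => ?_, fun n z hz => ?_, fun n z _ => remainder_eq_add f a n z,
    fun n z hz => norm_remainder_le hδ h n hz⟩
  · rcases eq_or_ne z 0 with rfl | h0
    · rw [ContinuousWithinAt]
      have e1 : remainder f a n 0 = a n := by simp [remainder]
      rw [e1]
      have e2 : Tendsto (fun z => a n + z * remainder f a (n + 1) z)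
          (𝓝[Metric.closedBall ((δ / 4 : ℝ) : ℂ) (δ / 4)] 0) (𝓝 (a n + 0)) := by
        refine tendsto_const_nhds.add ?_
        have e3 : Tendsto (fun z : ℂ => ‖z‖ * (C * M ^ (n + 1) * (n + 1).factorial))
            (𝓝[Metric.closedBall ((δ / 4 : ℝ) : ℂ) (δ / 4)] 0) (𝓝 0) := by
          have : Continuous fun z : ℂ => ‖z‖ * (C * M ^ (n + 1) * (n + 1).factorial) := by fun_prop
          simpa using (this.tendsto 0).mono_left nhdsWithin_le_nhds
        refine squeeze_zero_norm' ?_ e3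
        filter_upwards [self_mem_nhdsWithin] with w hw
        rw [norm_mul]
        exact mul_le_mul_of_nonneg_left (norm_remainder_le hδ h (n + 1) hw) (norm_nonneg _)
      rw [add_zero] at e2
      exact e2.congr fun z => (remainder_eq_add f a n z).symm
    · exact (hdiff n z (closedBall_subset_borelDisc hδ hz h0)).continuousAt.continuousWithinAt
  · have h0 : z ≠ 0 := by
      rintro rfl
      rw [Metric.mem_ball, dist_zero_left, Complex.norm_real, Real.norm_of_nonneg hδ4.le] at hz
      exact hz.false
    exact (hdiff n z (closedBall_subset_borelDisc hδ (Metric.ball_subset_closedBall hz)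
      h0)).differentiableWithinAt

theorem differentiableOn_borelDeriv {V : Set ℂ} (hV : IsOpen V) {ρ C M : ℝ} (hρ : 0 < ρ)
    {a : ℕ → ℂ → ℂ} {q : ℂ → ℕ → ℂ → ℂ} (ha : ∀ k, DifferentiableOn ℂ (a k) V)
    (hq : ∀ n, ∀ z ∈ Metric.sphere (ρ : ℂ) ρ, DifferentiableOn ℂ (fun x => q x n z) V)
    (h : ∀ x ∈ V, IsRemainderSeq ρ C M (fun k => a k x) (q x)) (n : ℕ) (t : ℝ) :
    DifferentiableOn ℂ (fun x => borelDeriv ρ (fun k => a k x) (q x) n t) V := by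
  simp only [borelDeriv, circleIntegral_eq_setIntegral]
  refine (ha (n + 1)).add (DifferentiableOn.const_mul (differentiableOn_integral_of_bound hV
    (fun x hx => aestronglyMeasurable_exp_mul hρ ((h x hx).cont _) t _)
    (Eventually.of_forall fun φ => ?_) fun x hx => ⟨V, hV.mem_nhds hx, _, integrable_const
    (ρ * (Real.exp (|t| / (2 * ρ)) * (C * M ^ (n + 2) * (n + 2).factorial))),
    Eventually.of_forall fun φ y hy => norm_exp_mul_le hρ ((h y hy).bound (n + 2)) t φ⟩) _)
  exact ((hq (n + 2) _ (circleMap_mem_sphere _ hρ.le _)).const_mul _).const_mul _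

/-- **Nevanlinna's theorem** with a holomorphic parameter. -/
theorem nevanlinna {V : Set ℂ} (hV : IsOpen V) {θ δ C M : ℝ} (hδ : 0 < δ) (hC : 0 < C)
    (hM : 0 < M) {f : ℂ → ℂ → ℂ} {a : ℕ → ℂ → ℂ}
    (hf : ∀ x ∈ V, DifferentiableOn ℂ (f x) (borelDisc θ δ))
    (hfx : ∀ h ∈ borelDisc θ δ, DifferentiableOn ℂ (fun x => f x h) V)
    (ha : ∀ k, DifferentiableOn ℂ (a k) V)
    (hG : ∀ x ∈ V, GevreyOn (borelDisc θ δ) C M (f x) fun k => a k x) :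
    ∃ η > 0, ∃ φ : ℂ → ℂ → ℂ, DifferentiableOn ℂ (fun z : ℂ × ℂ => φ z.1 z.2) (V ×ˢ tube θ η) ∧
      (∀ x ∈ V, ContinuesBorel θ η (fun k => a k x) (φ x)) ∧ ∃ A L : ℝ, 0 < A ∧ 0 < L ∧
      (∀ x ∈ V, ∀ ξ ∈ tube θ η, ‖φ x ξ‖ ≤ A * Real.exp (L * ‖ξ‖)) ∧
      ∀ x ∈ V, ∀ h ∈ borelDisc θ (1 / L), f x h = a 0 x + laplace θ (φ x) h := by
  set u := Complex.exp (θ * Complex.I)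
  have hu : u ≠ 0 := Complex.exp_ne_zero _
  have hun : ‖u‖ = 1 := Complex.norm_exp_ofReal_mul_I θ
  set ρ := δ / 4
  have hρ : 0 < ρ := by positivity
  -- Rotating ħ by e^{iθ} reduces everything to direction 0, at the cost of these powers of u in the
  -- coefficients.
  set b : ℂ → ℕ → ℂ := fun x k => a k x * u ^ k
  set q : ℂ → ℕ → ℂ → ℂ := fun x => remainder (fun z => f x (u * z)) (b x)
  have hrot : ∀ z ∈ borelDisc 0 δ, u * z ∈ borelDisc θ δ := fun z hz => borelDisc_rotate.2 hz
  have hR : ∀ x ∈ V, IsRemainderSeq ρ C M (b x) (q x) := by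
    intro x hx
    refine isRemainderSeq_remainder hδ ((hf x hx).comp (by fun_prop) hrot) fun n z hz => ?_
    have := hG x hx n (u * z) (hrot z hz)
    rw [norm_mul, hun, one_mul] at this
    simpa only [b, mul_pow, mul_assoc] using this
  have hq : ∀ n, ∀ z ∈ Metric.sphere (ρ : ℂ) ρ, DifferentiableOn ℂ (fun x => q x n z) V := by
    intro n z hz
    rcases eq_or_ne z 0 with rfl | h0
    · simp only [q, remainder, if_true, b]
      exact (ha n).mul_const _
    · simp only [q, remainder, if_neg h0, b]
      have h1 := hfx _ (hrot z (closedBall_subset_borelDisc hδ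
        (Metric.sphere_subset_closedBall hz) h0))
      exact (h1.sub (DifferentiableOn.fun_sum fun k _ =>
        ((ha k).mul_const _).mul_const _)).div_const _
  set c : ℂ → ℕ → ℝ → ℂ := fun x => borelDeriv ρ (b x) (q x)
  have hcd : ∀ n t, DifferentiableOn ℂ (fun x => c x n t) V := fun n t =>
    differentiableOn_borelDeriv hV hρ (a := fun k x => b x k)
      (fun k => (ha k).mul_const _) hq hR n t
  set K := C * M + 2 * ρ * (C * M ^ 2)
  have hK : 0 < K := by positivity
  set L := 1 / (2 * ρ)
  have hL : 0 < L := by positivity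
  have hcb : ∀ x ∈ V, ∀ n t, 0 ≤ t →
      ‖c x n t‖ ≤ K * Real.exp (L * t) * (4 * M) ^ n * n.factorial := by
    intro x hx n t ht
    have := (hR x hx).norm_borelDeriv_le hρ hC.le hM.le n ht
    rwa [show L * t = t / (2 * ρ) by simp only [L]; ring]
  -- Half the radius of convergence 1/(4M) granted by the derivative bounds; all the Taylor series
  -- below then have ratio 1/2.
  set η := 1 / (8 * M)
  have hη : 0 < η := by positivity
  set P : ℂ → ℝ → ℂ → ℂ := fun x t w => ∑' k, c x k t / k.factorial * (w - t) ^ k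
  have hterm : ∀ x ∈ V, ∀ t : ℝ, 0 ≤ t → ∀ w ∈ Metric.ball (t : ℂ) η, ∀ k : ℕ,
      ‖c x k t / k.factorial * (w - t) ^ k‖ ≤ K * Real.exp (L * t) * (1 / 2) ^ k := by
    intro x hx t ht w hw k
    have hf : (0 : ℝ) < k.factorial := by exact_mod_cast k.factorial_pos
    rw [mem_ball_iff_norm] at hw
    have h1 : ‖c x k t / k.factorial‖ ≤ K * Real.exp (L * t) * (4 * M) ^ k := by
      rw [norm_div, Complex.norm_natCast, div_le_iff₀ hf]
      exact hcb x hx k t ht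
    have h2 : (1 / 2 : ℝ) ^ k = (4 * M) ^ k * η ^ k := by
      rw [← mul_pow]
      congr 1
      simp only [η]
      field_simp
      norm_num
    rw [norm_mul, norm_pow, h2, ← mul_assoc]
    exact mul_le_mul h1 (pow_le_pow_left₀ (norm_nonneg _) hw.le k) (by positivity) (by positivity)
  have hgeo : ∀ t : ℝ, Summable fun k : ℕ => K * Real.exp (L * t) * (1 / 2 : ℝ) ^ k := fun t =>
    (summable_geometric_of_lt_one (by norm_num) (by norm_num)).mul_left _
  have hPd : ∀ x ∈ V, ∀ t : ℝ, 0 ≤ t → DifferentiableOn ℂ (P x t) (Metric.ball (t : ℂ) η) :=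
    fun x hx t ht => Complex.differentiableOn_tsum_of_summable_norm (hgeo t)
      (fun k => by fun_prop) Metric.isOpen_ball fun k w hw => hterm x hx t ht w hw k
  have hPx : ∀ t : ℝ, 0 ≤ t → ∀ w ∈ Metric.ball (t : ℂ) η, DifferentiableOn ℂ (fun x => P x t w) V :=
    fun t ht w hw => Complex.differentiableOn_tsum_of_summable_norm (hgeo t)
      (fun k => ((hcd k t).div_const _).mul_const _) hV fun k x hx => hterm x hx t ht w hw k
  have hPb : ∀ x ∈ V, ∀ t : ℝ, 0 ≤ t → ∀ w ∈ Metric.ball (t : ℂ) η,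
      ‖P x t w‖ ≤ 2 * (K * Real.exp (L * t)) := by
    intro x hx t ht w hw
    refine (tsum_of_norm_bounded (hgeo t).hasSum fun k => hterm x hx t ht w hw k).trans
      (le_of_eq ?_)
    rw [tsum_mul_left, tsum_geometric_of_lt_one (by norm_num) (by norm_num)]
    norm_num
    ring
  -- The local power series all reproduce the same function on the real axis, which is what allows
  -- them to be glued.
  have hPc : ∀ x ∈ V, ∀ t : ℝ, 0 ≤ t → ∀ s : ℝ, 0 ≤ s → |s - t| < η → P x t s = c x 0 s := by
    intro x hx t ht s hs hst
    refine (hasSum_taylor_of_bound (T := max s t) (K := K * Real.exp (L * max s t))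
      (fun n t ht => (hR x hx).hasDerivWithinAt_borelDeriv hρ n ht) (by positivity)
      (by positivity : 0 ≤ 4 * M) (fun n τ hτ hτT => (hcb x hx n τ hτ).trans (by gcongr)) hs
      (le_max_left _ _) ht (le_max_right _ _) ?_).tsum_eq
    calc 4 * M * |s - t| < 4 * M * η := by gcongr
      _ = 1 / 2 := by simp only [η]; field_simp; norm_num
      _ < 1 := by norm_num
  have hglue : ∀ x, ∃ H : ℂ → ℂ, x ∈ V → ∀ t : ℝ, 0 ≤ t → EqOn H (P x t) (Metric.ball (t : ℂ) η) := by
    intro x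
    by_cases hx : x ∈ V
    · obtain ⟨H, hH⟩ := exists_glue_along_ray (η := fun _ => η) (h := P x) (c := c x 0)
        (hPd x hx) (hPc x hx)
      exact ⟨H, fun _ => hH⟩
    · exact ⟨0, fun h => absurd h hx⟩
  choose H hH using hglue
  have htube : ∀ ξ ∈ tube θ η, ∃ t : ℝ, 0 ≤ t ∧ u⁻¹ * ξ ∈ Metric.ball (t : ℂ) η := by
    intro ξ hξ
    obtain ⟨t, ht, hξt⟩ := mem_tube.1 hξ
    refine ⟨t, ht, ?_⟩
    rw [mem_ball_iff_norm]
    have : u⁻¹ * ξ - t = u⁻¹ * (ξ - u * t) := by field_simp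
    rw [this, norm_mul, norm_inv, hun, inv_one, one_mul]
    exact hξt
  have hHat : ∀ x ∈ V, ∀ t : ℝ, 0 ≤ t → ∀ w ∈ Metric.ball (t : ℂ) η, DifferentiableAt ℂ (H x) w := by
    intro x hx t ht w hw
    refine ((hPd x hx t ht).differentiableAt (Metric.isOpen_ball.mem_nhds hw)).congr_of_eventuallyEq ?_
    filter_upwards [Metric.isOpen_ball.mem_nhds hw] with v hv using hH x hx t ht hv
  -- The factor u⁻¹ offsets the shift by one between b and the Borel coefficients, and equally the
  -- e^{iθ} coming from dξ.
  set φ : ℂ → ℂ → ℂ := fun x ξ => u⁻¹ * H x (u⁻¹ * ξ)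
  have hbd : ∀ x ∈ V, ∀ ξ ∈ tube θ η,
      ‖φ x ξ‖ ≤ 2 * K * Real.exp (L * η) * Real.exp (L * ‖ξ‖) := by
    intro x hx ξ hξ
    obtain ⟨t, ht, hw⟩ := htube ξ hξ
    have h1 := hPb x hx t ht _ hw
    rw [← hH x hx t ht hw] at h1
    simp only [φ]
    rw [norm_mul, norm_inv, hun, inv_one, one_mul]
    have h2 : t ≤ η + ‖ξ‖ := by
      rw [mem_ball_iff_norm'] at hw
      have h3 := norm_sub_norm_le (t : ℂ) (u⁻¹ * ξ)
      rw [Complex.norm_real, Real.norm_of_nonneg ht, norm_mul, norm_inv, hun, inv_one, one_mul] at h3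
      linarith
    calc _ ≤ 2 * (K * Real.exp (L * t)) := h1
      _ ≤ 2 * (K * Real.exp (L * (η + ‖ξ‖))) := by gcongr
      _ = _ := by rw [mul_add, Real.exp_add]; ring
  have hφξ : ∀ x ∈ V, DifferentiableOn ℂ (φ x) (tube θ η) := by
    intro x hx ξ hξ
    obtain ⟨t, ht, hw⟩ := htube ξ hξ
    have h1 : DifferentiableAt ℂ (fun ξ : ℂ => u⁻¹ * ξ) ξ := by fun_prop
    exact (DifferentiableAt.const_mul ((hHat x hx t ht _ hw).comp ξ h1) _).differentiableWithinAt
  have hφu : ∀ x ∈ V, ∀ t : ℝ, 0 ≤ t → φ x (u * t) = u⁻¹ * c x 0 t := by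
    intro x hx t ht
    simp only [φ]
    rw [inv_mul_cancel_left₀ hu, hH x hx t ht (Metric.mem_ball_self hη),
      hPc x hx t ht t ht (by simpa using hη)]
  refine ⟨η, hη, φ, ?_, fun x hx => ⟨hφξ x hx, fun ξ hξ => ?_⟩, 2 * K * Real.exp (L * η), L,
    by positivity, hL, hbd, fun x hx h hh => ?_⟩
  · refine differentiableOn_prod_of_separately hV (isOpen_tube θ η) (fun ξ hξ => ?_) hφξ
      fun x hx ξ hξ => ⟨V, hV.mem_nhds hx, tube θ η ∩ Metric.ball 0 (‖ξ‖ + 1),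
        ((isOpen_tube θ η).inter Metric.isOpen_ball).mem_nhds ⟨hξ, by simp⟩,
        2 * K * Real.exp (L * η) * Real.exp (L * (‖ξ‖ + 1)), fun y hy ζ hζ =>
          (hbd y hy ζ hζ.1).trans ?_⟩
    · obtain ⟨t, ht, hw⟩ := htube ξ hξ
      refine ((hPx t ht _ hw).const_mul u⁻¹).congr fun x hx => ?_
      simp only [φ]
      rw [hH x hx t ht hw]
    · have := (mem_ball_zero_iff.1 hζ.2).le
      gcongr
  · have hw : u⁻¹ * ξ ∈ Metric.ball ((0 : ℝ) : ℂ) η := by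
      rw [mem_ball_iff_norm, Complex.ofReal_zero, sub_zero, norm_mul, norm_inv, hun, inv_one,
        one_mul]
      exact hξ
    have h1 : HasSum (fun k => c x k 0 / k.factorial * (u⁻¹ * ξ - (0 : ℝ)) ^ k) (H x (u⁻¹ * ξ)) := by
      rw [hH x hx 0 le_rfl hw]
      exact (Summable.of_norm_bounded (hgeo 0) fun k => hterm x hx 0 le_rfl _ hw k).hasSum
    refine (h1.mul_left u⁻¹).congr_fun fun k => ?_
    simp only [c, (hR x hx).borelDeriv_zero hρ, b, Complex.ofReal_zero, sub_zero, mul_pow]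
    have hk : u⁻¹ * u ^ (k + 1) * u⁻¹ ^ k = 1 := by
      rw [inv_pow, pow_succ]
      field_simp
    linear_combination (-(a (k + 1) x / k.factorial * ξ ^ k)) * hk
  · have hL2 : 1 / L = 2 * ρ := by simp [L]
    rw [hL2] at hh
    have hρδ : 2 * ρ ≤ δ := by simp only [ρ]; linarith
    set w := u⁻¹ * h
    have hw : h = u * w := by simp only [w]; field_simp
    rw [hw, borelDisc_rotate] at hh
    have hwb : w ∈ Metric.ball (ρ : ℂ) ρ := by
      rw [borelDisc_eq_ball (by positivity)] at hh
      simpa using hh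
    have hre : 1 / (2 * ρ) < (1 / w).re := by
      have : 1 / (2 * ρ) < (Complex.exp ((0 : ℝ) * Complex.I) / w).re := hh
      simpa using this
    have hw0 : w ≠ 0 := ne_zero_of_mem_borelDisc (by positivity) hh
    have hlap : laplace θ (φ x) h =
        ∫ t in Ioi (0 : ℝ), borelDeriv ρ (b x) (q x) 0 t * Complex.exp (-t / w) := by
      rw [laplace]
      refine setIntegral_congr_fun measurableSet_Ioi fun t ht => ?_
      simp only [laplaceIntegrand]
      rw [hφu x hx t (le_of_lt ht), hw]
      have : -(u * (t : ℂ)) / (u * w) = -t / w := by field_simp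
      rw [this]
      field_simp
      ring
    rw [hlap, (hR x hx).integral_borelDeriv hρ hwb hre]
    simp only [q, remainder, if_neg hw0, b]
    simp [hw]

end WKB

end

noncomputable section

namespace WKB

/-! ### Borel sums of Gevrey functions -/

/-- Two continuations agree near 0 with the same power series, hence on the thinner of the two
convex tubes. The choice made in `borelContinuation` does not matter on the ray. -/
theorem borelContinuation_eq {θ η A L : ℝ} {a : ℕ → ℂ} {φ : ℂ → ℂ} (hη : 0 < η)
    (hφ : ContinuesBorel θ η a φ) (hb : ∀ ξ ∈ tube θ η, ‖φ ξ‖ ≤ A * Real.exp (L * ‖ξ‖))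
    {t : ℝ} (ht : 0 ≤ t) :
    borelContinuation θ a (Complex.exp (θ * Complex.I) * t) =
      φ (Complex.exp (θ * Complex.I) * t) := by
  have hex : ∃ φ : ℂ → ℂ, ∃ η > 0, ContinuesBorel θ η a φ ∧
      ∃ A L : ℝ, ∀ ξ ∈ tube θ η, ‖φ ξ‖ ≤ A * Real.exp (L * ‖ξ‖) := ⟨φ, η, hη, hφ, A, L, hb⟩
  obtain ⟨η', hη', hφ', -⟩ := Classical.epsilon_spec hex
  set χ := Classical.epsilon fun φ : ℂ → ℂ => ∃ η > 0, ContinuesBorel θ η a φ ∧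
      ∃ A L : ℝ, ∀ ξ ∈ tube θ η, ‖φ ξ‖ ≤ A * Real.exp (L * ‖ξ‖)
  change χ _ = _
  have hm : 0 < min η η' := lt_min hη hη'
  have h1 := (hφ'.1.mono (tube_mono (min_le_right η η'))).analyticOnNhd (isOpen_tube _ _)
  have h2 := (hφ.1.mono (tube_mono (min_le_left η η'))).analyticOnNhd (isOpen_tube _ _)
  have h0 : (0 : ℂ) ∈ tube θ (min η η') := by simpa using ofReal_mem_tube (θ := θ) hm le_rfl
  refine h1.eqOn_of_preconnected_of_eventuallyEq h2 (convex_tube _ _).isPreconnected h0 ?_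
    (ofReal_mem_tube hm ht)
  filter_upwards [Metric.ball_mem_nhds (0 : ℂ) hm] with ξ hξ
  rw [mem_ball_zero_iff, lt_min_iff] at hξ
  exact (hφ'.2 ξ hξ.2).unique (hφ.2 ξ hξ.1)

/-- Nevanlinna's theorem restated for the canonical `borelSum`, which depends on the coefficients
only. The growth constants are uniform over V. -/
theorem exists_borelSum_eq {V : Set ℂ} (hV : IsOpen V) {θ δ C M : ℝ} (hδ : 0 < δ) (hC : 0 < C)
    (hM : 0 < M) {f : ℂ → ℂ → ℂ} {a : ℕ → ℂ → ℂ}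
    (hf : ∀ x ∈ V, DifferentiableOn ℂ (f x) (borelDisc θ δ))
    (hfx : ∀ h ∈ borelDisc θ δ, DifferentiableOn ℂ (fun x => f x h) V)
    (ha : ∀ k, DifferentiableOn ℂ (a k) V)
    (hG : ∀ x ∈ V, GevreyOn (borelDisc θ δ) C M (f x) fun k => a k x) :
    ∃ A L : ℝ, 0 < A ∧ 0 < L ∧ ∀ x ∈ V,
      (∀ h ∈ borelDisc θ (1 / L), f x h = borelSum θ (fun k => a k x) h) ∧
      ContinuousOn (fun t : ℝ => borelContinuation θ (fun k => a k x)
        (Complex.exp (θ * Complex.I) * t)) (Ici 0) ∧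
      ∀ t : ℝ, 0 ≤ t → ‖borelContinuation θ (fun k => a k x) (Complex.exp (θ * Complex.I) * t)‖ ≤
        A * Real.exp (L * t) := by
  obtain ⟨η, hη, φ, -, hφ, A, L, hA, hL, hb, hs⟩ := nevanlinna hV hδ hC hM hf hfx ha hG
  refine ⟨A, L, hA, hL, fun x hx => ?_⟩
  have key : ∀ t : ℝ, 0 ≤ t → borelContinuation θ (fun k => a k x)
      (Complex.exp (θ * Complex.I) * t) = φ x (Complex.exp (θ * Complex.I) * t) :=
    fun t ht => borelContinuation_eq hη (hφ x hx) (hb x hx) ht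
  refine ⟨fun h hh => ?_, ?_, fun t ht => ?_⟩
  · rw [hs x hx h hh, borelSum, laplace, laplace]
    congr 1
    refine setIntegral_congr_fun measurableSet_Ioi fun t ht => ?_
    simp only [laplaceIntegrand, key t (le_of_lt ht)]
  · refine ContinuousOn.congr ?_ fun t ht => key t ht
    exact (hφ x hx).1.continuousOn.comp (by fun_prop) fun t ht => ofReal_mem_tube hη ht
  · rw [key t ht]
    refine (hb x hx _ (ofReal_mem_tube hη ht)).trans (le_of_eq ?_)
    rw [norm_mul, Complex.norm_exp_ofReal_mul_I, one_mul, Complex.norm_real,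
      Real.norm_of_nonneg ht]

/-- Watson-type uniqueness: both functions equal the Borel sum of the same series on a smaller disc,
and the identity theorem extends this to the whole disc. -/
theorem eqOn_of_gevreyOn {θ δ δ₁ δ₂ C₁ M₁ C₂ M₂ : ℝ} (hδ₁ : 0 < δ₁) (hδ₂ : 0 < δ₂)
    (h₁ : δ₁ ≤ δ) (h₂ : δ₂ ≤ δ) (hC₁ : 0 < C₁) (hM₁ : 0 < M₁) (hC₂ : 0 < C₂) (hM₂ : 0 < M₂)
    {f g : ℂ → ℂ} {a : ℕ → ℂ} (hf : DifferentiableOn ℂ f (borelDisc θ δ))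
    (hg : DifferentiableOn ℂ g (borelDisc θ δ)) (hfa : GevreyOn (borelDisc θ δ₁) C₁ M₁ f a)
    (hga : GevreyOn (borelDisc θ δ₂) C₂ M₂ g a) : EqOn f g (borelDisc θ δ) := by
  have hδ : 0 < δ := hδ₁.trans_le h₁
  obtain ⟨_, L₁, -, hL₁, e₁⟩ := exists_borelSum_eq (V := univ) isOpen_univ hδ₁ hC₁ hM₁
    (f := fun _ => f) (a := fun k _ => a k)
    (fun _ _ => hf.mono (borelDisc_mono hδ₁ h₁)) (fun _ _ => differentiableOn_const _)
    (fun _ => differentiableOn_const _) (fun _ _ => hfa)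
  obtain ⟨_, L₂, -, hL₂, e₂⟩ := exists_borelSum_eq (V := univ) isOpen_univ hδ₂ hC₂ hM₂
    (f := fun _ => g) (a := fun k _ => a k)
    (fun _ _ => hg.mono (borelDisc_mono hδ₂ h₂)) (fun _ _ => differentiableOn_const _)
    (fun _ => differentiableOn_const _) (fun _ _ => hga)
  set d := min δ (min (1 / L₁) (1 / L₂))
  have hd : 0 < d := lt_min hδ (lt_min (by positivity) (by positivity))
  have hd1 : d ≤ 1 / L₁ := (min_le_right _ _).trans (min_le_left _ _)
  have hd2 : d ≤ 1 / L₂ := (min_le_right _ _).trans (min_le_right _ _)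
  have hmem : Complex.exp (θ * Complex.I) * ((d / 2 : ℝ) : ℂ) ∈ borelDisc θ d :=
    mem_borelDisc_ofReal (by positivity) (by linarith)
  refine (hf.analyticOnNhd (isOpen_borelDisc hδ)).eqOn_of_preconnected_of_eventuallyEq
    (hg.analyticOnNhd (isOpen_borelDisc hδ)) (convex_borelDisc hδ).isPreconnected
    (borelDisc_mono hd (min_le_left _ _) hmem) ?_
  filter_upwards [(isOpen_borelDisc hd).mem_nhds hmem] with h hh
  have h₃ : f h = borelSum θ (fun k => a k) h := (e₁ 0 (mem_univ _)).1 h (borelDisc_mono hd hd1 hh)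
  have h₄ : g h = borelSum θ (fun k => a k) h := (e₂ 0 (mem_univ _)).1 h (borelDisc_mono hd hd2 hh)
  rw [h₃, h₄]

/-- Asking for the rate L + 1 instead of L leaves a spare e^{-t}. The majorant is then independent
of ħ, and this gives uniform convergence up to ħ = 0. -/
theorem norm_laplaceIntegrand_le {θ A L d : ℝ} (hA : 0 < A)
    (hdL : L + 1 ≤ 1 / d) {φ : ℂ → ℂ}
    (hb : ∀ t : ℝ, 0 ≤ t → ‖φ (Complex.exp (θ * Complex.I) * t)‖ ≤ A * Real.exp (L * t))
    {h : ℂ} (hh : h ∈ borelDisc θ d) {t : ℝ} (ht : 0 ≤ t) :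
    ‖laplaceIntegrand θ φ h t‖ ≤ A * Real.exp (-t) := by
  have hre : L + 1 < (Complex.exp (θ * Complex.I) / h).re := hdL.trans_lt hh
  rw [laplaceIntegrand, norm_mul, norm_mul, Complex.norm_exp_ofReal_mul_I, mul_one,
    Complex.norm_exp]
  have e1 : (-(Complex.exp (θ * Complex.I) * t) / h).re =
      -((Complex.exp (θ * Complex.I) / h).re * t) := by
    rw [show -(Complex.exp (θ * Complex.I) * t) / h = (Complex.exp (θ * Complex.I) / h) * ((-t : ℝ) : ℂ) by
      push_cast; ring, Complex.re_mul_ofReal]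
    ring
  rw [e1]
  calc _ ≤ A * Real.exp (L * t) * Real.exp (-((L + 1) * t)) := by
        refine mul_le_mul (hb t ht) (Real.exp_le_exp.2 ?_) (Real.exp_nonneg _) (by positivity)
        exact neg_le_neg (mul_le_mul_of_nonneg_right hre.le ht)
    _ = A * Real.exp (-t) := by
        rw [mul_assoc, ← Real.exp_add]
        congr 2
        ring

theorem integrableOn_laplaceIntegrand {θ A L d : ℝ} (hA : 0 < A)
    (hdL : L + 1 ≤ 1 / d) {φ : ℂ → ℂ}
    (hc : ContinuousOn (fun t : ℝ => φ (Complex.exp (θ * Complex.I) * t)) (Ici 0))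
    (hb : ∀ t : ℝ, 0 ≤ t → ‖φ (Complex.exp (θ * Complex.I) * t)‖ ≤ A * Real.exp (L * t))
    {h : ℂ} (hh : h ∈ borelDisc θ d) : IntegrableOn (laplaceIntegrand θ φ h) (Ioi 0) := by
  refine Integrable.mono' ((integrableOn_exp_neg_Ioi 0).const_mul A) ?_ ?_
  · refine ContinuousOn.aestronglyMeasurable ?_ measurableSet_Ioi
    unfold laplaceIntegrand
    exact ((hc.mono Ioi_subset_Ici_self).mul (Continuous.continuousOn (by fun_prop))).mul
      continuousOn_const
  · filter_upwards [ae_restrict_mem measurableSet_Ioi] with t ht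
    exact norm_laplaceIntegrand_le hA hdL hb hh (le_of_lt ht)

theorem unifResummable {W : Set ℂ} {θ A L d : ℝ} (hA : 0 < A)
    (hdL : L + 1 ≤ 1 / d) {a : ℕ → ℂ → ℂ}
    (hc : ∀ x ∈ W, ContinuousOn (fun t : ℝ => borelContinuation θ (fun k => a k x)
        (Complex.exp (θ * Complex.I) * t)) (Ici 0))
    (hb : ∀ x ∈ W, ∀ t : ℝ, 0 ≤ t →
      ‖borelContinuation θ (fun k => a k x) (Complex.exp (θ * Complex.I) * t)‖ ≤
        A * Real.exp (L * t)) : UnifResummable W (borelDisc θ d) θ a := by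
  have hint : ∀ x ∈ W, ∀ h ∈ borelDisc θ d, IntegrableOn (laplaceIntegrand θ
      (borelContinuation θ fun k => a k x) h) (Ioi 0) := fun x hx h hh =>
    integrableOn_laplaceIntegrand hA hdL (hc x hx) (hb x hx) hh
  refine ⟨hint, ?_⟩
  rw [Metric.tendstoUniformlyOn_iff]
  intro e he
  have hlim : Tendsto (fun T : ℝ => A * Real.exp (-T)) atTop (𝓝 0) := by
    simpa using (Real.tendsto_exp_neg_atTop_nhds_zero).const_mul A
  filter_upwards [hlim.eventually_lt_const he, eventually_ge_atTop 0] with T hT hT0 z hz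
  have hi := hint z.1 hz.1 z.2 hz.2
  have hsplit := intervalIntegral.integral_interval_add_Ioi (a := (0 : ℝ)) (b := T)
    hi (hi.mono_set (Ioi_subset_Ioi hT0))
  refine lt_of_le_of_lt ?_ hT
  rw [dist_eq_norm, laplace, ← hsplit, add_sub_cancel_left]
  refine (norm_integral_le_of_norm_le ((integrableOn_exp_neg_Ioi T).const_mul A) ?_).trans ?_
  · filter_upwards [ae_restrict_mem measurableSet_Ioi] with t ht
    exact norm_laplaceIntegrand_le hA hdL (hb z.1 hz.1) hz.2 (hT0.trans (le_of_lt ht))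
  · rw [integral_const_mul, integral_exp_neg_Ioi]

/-! ### Borel discs are sectorial domains -/

theorem re_pos_of_mem_borelDisc {θ δ : ℝ} (hδ : 0 < δ) {h : ℂ} (hh : h ∈ borelDisc θ δ) :
    0 < (h / (‖h‖ : ℂ) * Complex.exp (-(θ * Complex.I))).re := by
  have h0 := ne_zero_of_mem_borelDisc hδ hh
  have hn : 0 < ‖h‖ := norm_pos_iff.2 h0
  have h1 : 0 < (Complex.exp (θ * Complex.I) / h).re := lt_trans (by positivity) hh
  have h2 : h / (‖h‖ : ℂ) * Complex.exp (-(θ * Complex.I)) =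
      (starRingEnd ℂ) (Complex.exp (θ * Complex.I) / h) * (‖h‖ : ℝ) := by
    rw [map_div₀, ← Complex.exp_conj]
    have h3 : (starRingEnd ℂ) h ≠ 0 := by simpa using h0
    have h4 : (‖h‖ : ℂ) ≠ 0 := by exact_mod_cast hn.ne'
    have h5 : h * (starRingEnd ℂ) h = (‖h‖ : ℂ) ^ 2 := Complex.mul_conj' h
    simp only [map_mul, Complex.conj_ofReal, Complex.conj_I, mul_neg]
    field_simp
    linear_combination h5
  rw [h2, Complex.re_mul_ofReal, Complex.conj_re]
  positivity

/-- The circle is tangent to the boundary directions θ ± π/2, so these occur as limits although no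
chord has them; hence the closed arc. For an opening of length π the only copolar direction is θ
itself. -/
theorem isSectorialDomain_borelDisc (θ : ℝ) {δ : ℝ} (hδ : 0 < δ) :
    IsSectorialDomain (borelDisc θ δ) (θ - Real.pi / 2) (θ + Real.pi / 2) where
  isOpen := isOpen_borelDisc hδ
  isSimplyConnected := by
    have hne : (borelDisc θ δ).Nonempty :=
      ⟨_, mem_borelDisc_ofReal (t := δ / 2) (by positivity) (by linarith)⟩
    have := (convex_borelDisc (θ := θ) hδ).contractibleSpace hne
    exact SimplyConnectedSpace.ofContractible _
  zero_notMem := zero_notMem_borelDisc hδ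
  arc_pos := by linarith [Real.pi_pos]
  directions := by
    intro φ
    set u := Complex.exp (θ * Complex.I) with hu
    set e := Complex.exp ((φ - θ : ℝ) * Complex.I) with he
    have hue : u * e = Complex.exp (φ * Complex.I) := by
      rw [hu, he, ← Complex.exp_add]
      congr 1
      push_cast
      ring
    have huu : Complex.exp (-(θ * Complex.I)) * u = 1 := by
      rw [hu, ← Complex.exp_add, neg_add_cancel, Complex.exp_zero]
    have hun : ‖u‖ = 1 := Complex.norm_exp_ofReal_mul_I θ
    have hen : ‖e‖ = 1 := Complex.norm_exp_ofReal_mul_I _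
    have key : (∃ φ' ∈ Icc (θ - Real.pi / 2) (θ + Real.pi / 2),
        Complex.exp (φ' * Complex.I) = Complex.exp (φ * Complex.I)) ↔ 0 ≤ e.re := by
      constructor
      · rintro ⟨φ', ⟨h1, h2⟩, h3⟩
        have : e = Complex.exp ((φ' - θ : ℝ) * Complex.I) := by
          rw [← mul_right_inj' (Complex.exp_ne_zero (θ * Complex.I)), ← hu, hue, ← h3, hu,
            ← Complex.exp_add]
          congr 1
          push_cast
          ring
        rw [this, Complex.exp_ofReal_mul_I_re]
        exact Real.cos_nonneg_of_neg_pi_div_two_le_of_le (by linarith) (by linarith)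
      · intro h
        have h1 := abs_le.1 (Complex.abs_arg_le_pi_div_two_iff.2 h)
        refine ⟨θ + e.arg, ⟨by linarith, by linarith⟩, ?_⟩
        rw [← hue]
        have h2 : (‖e‖ : ℂ) * Complex.exp (e.arg * Complex.I) = e := Complex.norm_mul_exp_arg_mul_I e
        rw [hen, Complex.ofReal_one, one_mul] at h2
        rw [Complex.ofReal_add, add_mul, Complex.exp_add, h2]
    rw [key]
    constructor
    · intro H
      refine le_of_forall_pos_lt_add fun η hη => ?_
      obtain ⟨h, hh, -, h2⟩ := H η hη
      have h3 := re_pos_of_mem_borelDisc hδ hh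
      have h4 : ‖h / (‖h‖ : ℂ) * Complex.exp (-(θ * Complex.I)) - e‖ < η := by
        have : h / (‖h‖ : ℂ) * Complex.exp (-(θ * Complex.I)) - e =
            Complex.exp (-(θ * Complex.I)) * (h / (‖h‖ : ℂ) - Complex.exp (φ * Complex.I)) := by
          rw [← hue]
          linear_combination e * huu
        rw [this, norm_mul, ← neg_mul, ← Complex.ofReal_neg, Complex.norm_exp_ofReal_mul_I, one_mul]
        exact h2
      have h5 := (Complex.abs_re_le_norm _).trans_lt h4
      rw [Complex.sub_re] at h5
      linarith [(abs_lt.1 h5).2]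
    · intro H η hη
      -- Adding σ pushes the direction e strictly into the right half-plane while moving it, after
      -- normalisation, by at most 2σ < η. The factor t below then scales the point into the Borel
      -- disc.
      set σ : ℝ := min (η / 3) (1 / 2)
      have hσ : 0 < σ := lt_min (by positivity) (by norm_num)
      have hσ1 : σ ≤ η / 3 := min_le_left _ _
      set z : ℂ := e + σ
      have hzre : σ ≤ z.re := by simp [z, H]
      have hz0 : z ≠ 0 := fun h => by rw [h, Complex.zero_re] at hzre; linarith
      have hzn : 0 < ‖z‖ := norm_pos_iff.2 hz0
      have hzn2 : |‖z‖ - 1| ≤ σ := by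
        have := abs_norm_sub_norm_le z e
        rw [hen] at this
        simpa [z, abs_of_pos hσ] using this
      set t : ℝ := min (η / (2 * ‖z‖)) (δ * σ / (2 * ‖z‖ ^ 2))
      have ht : 0 < t := lt_min (by positivity) (by positivity)
      have htn : ‖(t : ℂ)‖ = t := by rw [Complex.norm_real, Real.norm_of_nonneg ht.le]
      have hn : ‖u * (t * z)‖ = t * ‖z‖ := by rw [norm_mul, norm_mul, hun, one_mul, htn]
      refine ⟨u * (t * z), ?_, ?_, ?_⟩
      · change 1 / δ < (u / (u * (t * z))).re
        have hu0 : u ≠ 0 := Complex.exp_ne_zero _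
        have : u / (u * (t * z)) = ((1 / t : ℝ) : ℂ) * z⁻¹ := by
          push_cast
          have : (t : ℂ) ≠ 0 := by exact_mod_cast ht.ne'
          field_simp
        rw [this, Complex.re_ofReal_mul, Complex.inv_re, Complex.normSq_eq_norm_sq]
        have h1 : t ≤ δ * σ / (2 * ‖z‖ ^ 2) := min_le_right _ _
        rw [le_div_iff₀ (by positivity)] at h1
        rw [div_mul_div_comm, one_mul, div_lt_div_iff₀ hδ (by positivity), one_mul]
        nlinarith [mul_pos hδ hσ]
      · rw [hn]
        have h1 : t ≤ η / (2 * ‖z‖) := min_le_left _ _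
        rw [le_div_iff₀ (by positivity)] at h1
        nlinarith
      · rw [hn, ← hue]
        have h1 : u * (t * z) / ((t * ‖z‖ : ℝ) : ℂ) - u * e = u * (z / (‖z‖ : ℂ) - e) := by
          have h1 : (t : ℂ) ≠ 0 := by exact_mod_cast ht.ne'
          have h2 : (‖z‖ : ℂ) ≠ 0 := by exact_mod_cast hzn.ne'
          push_cast
          field_simp
        rw [h1, norm_mul, hun, one_mul]
        have h2 : z / (‖z‖ : ℂ) - e = z / (‖z‖ : ℂ) * ((1 - ‖z‖ : ℝ) : ℂ) + σ := by
          have h2 : (‖z‖ : ℂ) ≠ 0 := by exact_mod_cast hzn.ne'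
          have h3 : z / (‖z‖ : ℂ) * ‖z‖ = z := div_mul_cancel₀ _ h2
          push_cast
          simp only [mul_sub, mul_one, h3]
          simp only [z]
          ring
        rw [h2]
        refine (norm_add_le _ _).trans_lt ?_
        rw [norm_mul, norm_div, Complex.norm_real, Complex.norm_real, Complex.norm_real, norm_norm,
          div_self hzn.ne', one_mul, Real.norm_eq_abs, abs_sub_comm, Real.norm_of_nonneg hσ.le]
        linarith
  borelDisc_subset := by
    intro θ' h1 h2
    have : θ' = θ := by linarith
    subst this
    exact ⟨δ, hδ, subset_rfl⟩

/-- Every sectorial domain contains a Borel disc in each copolar direction; from here on only Borel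
discs are needed. -/
theorem UnifGevrey.exists_gevreyOn {V S : Set ℂ} {a b θ : ℝ} {f : ℂ → ℂ → ℂ} {fh : ℕ → ℂ → ℂ}
    (h : UnifGevrey V S a b f fh) (ha : a ≤ θ - Real.pi / 2) (hb : θ + Real.pi / 2 ≤ b) :
    ∃ d > 0, borelDisc θ d ⊆ S ∧ ∃ C M : ℝ, 0 < C ∧ 0 < M ∧
      ∀ x ∈ V, GevreyOn (borelDisc θ d) C M (f x) fun k => fh k x := by
  obtain ⟨S₀, hS₀, hsec, C, M, hC, hM, H⟩ := h
  obtain ⟨d, hd, hdS⟩ := hsec.borelDisc_subset θ ha hb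
  exact ⟨d, hd, hdS.trans hS₀, C, M, hC, hM, fun x hx n h hh => H n x hx h (hdS hh)⟩

theorem unifGevrey_of_gevreyOn {V S : Set ℂ} {θ d C M : ℝ} (hd : 0 < d) (hdS : borelDisc θ d ⊆ S)
    (hC : 0 < C) (hM : 0 < M) {f : ℂ → ℂ → ℂ} {fh : ℕ → ℂ → ℂ}
    (h : ∀ x ∈ V, GevreyOn (borelDisc θ d) C M (f x) fun k => fh k x) :
    UnifGevrey V S (θ - Real.pi / 2) (θ + Real.pi / 2) f fh :=
  ⟨_, hdS, isSectorialDomain_borelDisc θ hd, C, M, hC, hM, fun n x hx z hz => h x hx n z hz⟩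

end WKB

end

noncomputable section

namespace WKB

/-! ### Algebra of Gevrey expansions -/

/-- The two end terms are n! each. Each of the n - 1 interior terms is at most (n - 1)!, so together
they add less than one further n!. -/
theorem sum_factorial_mul_factorial_le (n : ℕ) :
    ∑ i ∈ Finset.range (n + 1), i.factorial * (n - i).factorial ≤ 3 * n.factorial := by
  rcases n with _ | m
  · simp
  · rw [Finset.sum_range_succ, Finset.sum_range_succ']
    have h : ∀ i ∈ Finset.range m, (i + 1).factorial * (m + 1 - (i + 1)).factorial ≤ m.factorial := by
      intro i hi
      rw [Finset.mem_range] at hi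
      obtain ⟨k, rfl⟩ := Nat.exists_eq_add_of_lt hi
      have h1 : i + k + 1 + 1 - (i + 1) = k + 1 := by omega
      rw [h1]
      have h2 := Nat.factorial_mul_factorial_dvd_factorial_add i (k + 1)
      have h3 : (i + 1) ∣ (i + 1).factorial := Nat.dvd_factorial (by omega) le_rfl
      have h4 : i + 1 ≤ (i + k + 1).choose i := by
        rcases Nat.eq_zero_or_pos i with rfl | hi0
        · simp
        · calc i + 1 = (i + 1).choose i := by simp
            _ ≤ (i + k + 1).choose i := Nat.choose_le_choose i (by omega)
      have h5 := Nat.choose_mul_factorial_mul_factorial (show i ≤ i + k + 1 by omega)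
      rw [show i + k + 1 - i = k + 1 by omega] at h5
      calc (i + 1).factorial * (k + 1).factorial
          = (i + 1) * i.factorial * (k + 1).factorial := by rw [Nat.factorial_succ]
        _ ≤ (i + k + 1).choose i * i.factorial * (k + 1).factorial := by gcongr
        _ = _ := h5
    have h1 := Finset.sum_le_card_nsmul _ _ _ h
    simp only [Finset.card_range, smul_eq_mul] at h1
    have h2 : (m + 1).factorial = (m + 1) * m.factorial := Nat.factorial_succ m
    simp only [Nat.factorial_zero, Nat.sub_self, mul_one, one_mul, Nat.sub_zero]
    have h3 : m * m.factorial ≤ (m + 1).factorial := by rw [h2]; gcongr; omega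
    omega

/-- The exact remainder of a Cauchy product: the truncation of G is paired with the term of order i
of F, and the remainder of F is multiplied by the full value z. -/
theorem mul_sub_sum_coeff_mul (F G : PowerSeries ℂ) (y z h : ℂ) (n : ℕ) :
    y * z - ∑ k ∈ Finset.range n, PowerSeries.coeff k (F * G) * h ^ k =
      ∑ i ∈ Finset.range n, PowerSeries.coeff i F * h ^ i *
        (z - ∑ j ∈ Finset.range (n - i), PowerSeries.coeff j G * h ^ j) +
      (y - ∑ i ∈ Finset.range n, PowerSeries.coeff i F * h ^ i) * z := by
  have hsum : ∑ k ∈ Finset.range n, PowerSeries.coeff k (F * G) * h ^ k =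
      ∑ i ∈ Finset.range n, PowerSeries.coeff i F * h ^ i *
        ∑ j ∈ Finset.range (n - i), PowerSeries.coeff j G * h ^ j := by
    simp only [PowerSeries.coeff_mul, Finset.sum_mul, Finset.mul_sum]
    rw [Finset.sum_sigma', Finset.sum_sigma']
    refine Finset.sum_bij' (fun x _ => ⟨x.2.1, x.2.2⟩) (fun x _ => ⟨x.1 + x.2, (x.1, x.2)⟩)
      ?_ ?_ ?_ ?_ ?_
    · rintro ⟨k, i, j⟩ hx
      simp only [Finset.mem_sigma, Finset.mem_range, Finset.HasAntidiagonal.mem_antidiagonal] at hx ⊢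
      omega
    · rintro ⟨i, j⟩ hx
      simp only [Finset.mem_sigma, Finset.mem_range] at hx
      refine Finset.mem_sigma.2 ⟨Finset.mem_range.2 ?_,
        Finset.HasAntidiagonal.mem_antidiagonal.2 rfl⟩
      change i + j < n
      omega
    · rintro ⟨k, i, j⟩ hx
      simp only [Finset.mem_sigma, Finset.mem_range, Finset.HasAntidiagonal.mem_antidiagonal] at hx ⊢
      obtain ⟨-, rfl⟩ := hx
      rfl
    · rintro ⟨i, j⟩ hx
      rfl
    · rintro ⟨k, i, j⟩ hx
      simp only [Finset.mem_sigma, Finset.mem_range, Finset.HasAntidiagonal.mem_antidiagonal] at hx ⊢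
      rw [← hx.2]
      ring
  rw [hsum]
  simp only [mul_sub, Finset.sum_sub_distrib, sub_mul, Finset.sum_mul]
  ring

theorem GevreyOn.mul {θ δ C C' M : ℝ} (hδ : 0 < δ) (hC : 0 ≤ C) (hC' : 0 ≤ C') (hM : 0 ≤ M)
    {f g : ℂ → ℂ} {F G : PowerSeries ℂ}
    (hf : GevreyOn (borelDisc θ δ) C M f fun k => PowerSeries.coeff k F)
    (hg : GevreyOn (borelDisc θ δ) C' M g fun k => PowerSeries.coeff k G) :
    GevreyOn (borelDisc θ δ) (3 * C * C') M (fun h => f h * g h)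
      fun k => PowerSeries.coeff k (F * G) := by
  intro n h hh
  have hg0 : ‖g h‖ ≤ C' := by simpa using hg 0 h hh
  rw [mul_sub_sum_coeff_mul]
  refine (norm_add_le _ _).trans ?_
  have h1 : ‖∑ i ∈ Finset.range n, PowerSeries.coeff i F * h ^ i *
        (g h - ∑ j ∈ Finset.range (n - i), PowerSeries.coeff j G * h ^ j)‖ ≤
      ∑ i ∈ Finset.range n, C * C' * M ^ n * ‖h‖ ^ n * (i.factorial * (n - i).factorial : ℕ) := by
    refine norm_sum_le_of_le _ fun i hi => ?_
    have hin : i ≤ n := (Finset.mem_range.1 hi).le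
    rw [norm_mul, norm_mul, norm_pow]
    calc _ ≤ C * M ^ i * i.factorial * ‖h‖ ^ i *
          (C' * M ^ (n - i) * (n - i).factorial * ‖h‖ ^ (n - i)) := by
          refine mul_le_mul ?_ (hg _ h hh) (norm_nonneg _) (by positivity)
          exact mul_le_mul_of_nonneg_right (hf.norm_coeff_le hδ i) (by positivity)
      _ = C * C' * (M ^ i * M ^ (n - i)) * (‖h‖ ^ i * ‖h‖ ^ (n - i)) *
          (i.factorial * (n - i).factorial : ℕ) := by push_cast; ring
      _ = _ := by rw [← pow_add, ← pow_add, Nat.add_sub_cancel' hin]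
  have h2 : ‖(f h - ∑ i ∈ Finset.range n, PowerSeries.coeff i F * h ^ i) * g h‖ ≤
      C * C' * M ^ n * ‖h‖ ^ n * (n.factorial * (n - n).factorial : ℕ) := by
    rw [norm_mul, Nat.sub_self, Nat.factorial_zero, mul_one]
    calc _ ≤ C * M ^ n * n.factorial * ‖h‖ ^ n * C' :=
          mul_le_mul (hf n h hh) hg0 (norm_nonneg _) (by positivity)
      _ = _ := by ring
  refine (add_le_add h1 h2).trans ?_
  rw [← Finset.sum_range_succ (fun i => C * C' * M ^ n * ‖h‖ ^ n *
    ((i.factorial * (n - i).factorial : ℕ) : ℝ)), ← Finset.mul_sum, ← Nat.cast_sum]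
  calc _ ≤ C * C' * M ^ n * ‖h‖ ^ n * ((3 * n.factorial : ℕ) : ℝ) := by
        refine mul_le_mul_of_nonneg_left ?_ (by positivity)
        exact_mod_cast sum_factorial_mul_factorial_le n
    _ = _ := by push_cast; ring

theorem GevreyOn.pow {θ δ C M : ℝ} (hδ : 0 < δ) (hC : 0 ≤ C) (hM : 0 ≤ M)
    {f : ℂ → ℂ} {F : PowerSeries ℂ}
    (hf : GevreyOn (borelDisc θ δ) C M f fun k => PowerSeries.coeff k F) (m : ℕ) :
    GevreyOn (borelDisc θ δ) ((3 * C) ^ m) M (fun h => f h ^ m)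
      fun k => PowerSeries.coeff k (F ^ m) := by
  induction m with
  | zero =>
    intro n h hh
    rcases n with _ | n
    · simp
    · simp only [pow_zero, PowerSeries.coeff_one, one_mul]
      rw [Finset.sum_range_succ']
      simp only [Nat.add_eq_zero_iff, one_ne_zero, and_false, if_false, zero_mul,
        Finset.sum_const_zero, if_true, pow_zero, one_mul, zero_add, sub_self, norm_zero]
      positivity
  | succ m ih =>
    have := ih.mul hδ (by positivity) hC hM hf
    simp only [pow_succ]
    convert this using 1
    ring

/-- Summing the bounds for the powers over the exponential series. The constant is C for the factor
e^c plus 3 · 2C for the part without constant term, which is bounded by 2C. -/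
theorem GevreyOn.formalExp {θ δ C M : ℝ} (hδ : 0 < δ) (hC : 0 ≤ C) (hM : 0 ≤ M)
    {u : ℂ → ℂ} {g : PowerSeries ℂ}
    (hu : GevreyOn (borelDisc θ δ) C M u fun k => PowerSeries.coeff k g) :
    GevreyOn (borelDisc θ δ) (Real.exp (7 * C)) M (fun h => Complex.exp (u h))
      fun k => PowerSeries.coeff k (formalExp g) := by
  set c := PowerSeries.constantCoeff g with hc
  set F := g - PowerSeries.C c with hF
  have hcn : ‖c‖ ≤ C := by simpa using hu.norm_coeff_le hδ 0
  have hF0 : PowerSeries.constantCoeff F = 0 := by simp [hF, hc]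
  have hs : PowerSeries.HasSubst F := PowerSeries.HasSubst.of_constantCoeff_zero' hF0
  have hv : GevreyOn (borelDisc θ δ) (2 * C) M (fun h => u h - c)
      fun k => PowerSeries.coeff k F := by
    intro n h hh
    rcases n with _ | n
    · have h0 : ‖u h‖ ≤ C := by simpa using hu 0 h hh
      simpa using (norm_sub_le _ _).trans (by linarith : ‖u h‖ + ‖c‖ ≤ 2 * C)
    · have e : u h - c - ∑ k ∈ Finset.range (n + 1), PowerSeries.coeff k F * h ^ k =
          u h - ∑ k ∈ Finset.range (n + 1), PowerSeries.coeff k g * h ^ k := by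
        rw [Finset.sum_range_succ', Finset.sum_range_succ']
        simp [hF, hc]
        ring
      rw [e]
      refine (hu (n + 1) h hh).trans ?_
      gcongr
      linarith
  -- As F has no constant term, only finitely many powers reach a given order; the formal
  -- substitution becomes an honest sum that can be interchanged with the truncation.
  have hcoef : ∀ k, HasSum (fun m : ℕ => (1 / (m.factorial : ℂ)) * PowerSeries.coeff k (F ^ m))
      (PowerSeries.coeff k ((PowerSeries.exp ℂ).subst F)) := by
    intro k
    rw [PowerSeries.coeff_subst' hs]
    have hfin := PowerSeries.coeff_subst_finite' hs (PowerSeries.exp ℂ) k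
    have h1 := (summable_of_hasFiniteSupport (L := SummationFilter.unconditional ℕ) hfin).hasSum
    rw [tsum_eq_finsum (L := SummationFilter.unconditional ℕ) hfin] at h1
    simpa [PowerSeries.coeff_exp] using h1
  intro n h hh
  have hexp : HasSum (fun m : ℕ => (1 / (m.factorial : ℂ)) * (u h - c) ^ m)
      (Complex.exp (u h - c)) := by
    have := NormedSpace.expSeries_div_hasSum_exp (u h - c)
    rw [← Complex.exp_eq_exp_ℂ] at this
    simpa [div_eq_inv_mul] using this
  have hR : HasSum (fun m : ℕ => (1 / (m.factorial : ℂ)) *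
      ((u h - c) ^ m - ∑ k ∈ Finset.range n, PowerSeries.coeff k (F ^ m) * h ^ k))
      (Complex.exp (u h - c) - ∑ k ∈ Finset.range n,
        PowerSeries.coeff k ((PowerSeries.exp ℂ).subst F) * h ^ k) := by
    have h1 := hasSum_sum (s := Finset.range n) fun k _ => (hcoef k).mul_right (h ^ k)
    refine (hexp.sub h1).congr_fun ?_
    intro m
    rw [mul_sub, Finset.mul_sum]
    congr 1
    exact Finset.sum_congr rfl fun k _ => by ring
  have hB : HasSum (fun m : ℕ => (6 * C) ^ m / m.factorial * (M ^ n * n.factorial * ‖h‖ ^ n))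
      (Real.exp (6 * C) * (M ^ n * n.factorial * ‖h‖ ^ n)) := by
    have := NormedSpace.expSeries_div_hasSum_exp (6 * C)
    rw [← Real.exp_eq_exp_ℝ] at this
    exact this.mul_right _
  have hle : ‖Complex.exp (u h - c) - ∑ k ∈ Finset.range n,
        PowerSeries.coeff k ((PowerSeries.exp ℂ).subst F) * h ^ k‖ ≤
      Real.exp (6 * C) * (M ^ n * n.factorial * ‖h‖ ^ n) := by
    rw [← hR.tsum_eq, ← hB.tsum_eq]
    refine tsum_of_norm_bounded hB.summable.hasSum fun m => ?_
    have := hv.pow hδ (by positivity) hM m n h hh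
    rw [norm_mul, norm_div, norm_one, Complex.norm_natCast]
    calc _ ≤ 1 / (m.factorial : ℝ) * ((3 * (2 * C)) ^ m * M ^ n * n.factorial * ‖h‖ ^ n) := by
          gcongr
      _ = _ := by ring
  have e : Complex.exp (u h) - ∑ k ∈ Finset.range n,
        PowerSeries.coeff k (WKB.formalExp g) * h ^ k =
      Complex.exp c * (Complex.exp (u h - c) - ∑ k ∈ Finset.range n,
        PowerSeries.coeff k ((PowerSeries.exp ℂ).subst F) * h ^ k) := by
    rw [mul_sub, ← Complex.exp_add, add_sub_cancel, Finset.mul_sum]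
    congr 1
    refine Finset.sum_congr rfl fun k _ => ?_
    rw [WKB.formalExp, PowerSeries.coeff_C_mul]
    ring
  rw [e, norm_mul]
  calc _ ≤ Real.exp C * (Real.exp (6 * C) * (M ^ n * n.factorial * ‖h‖ ^ n)) := by
        refine mul_le_mul ?_ hle (norm_nonneg _) (Real.exp_nonneg _)
        rw [Complex.norm_exp]
        exact Real.exp_le_exp.2 ((Complex.re_le_norm _).trans hcn)
    _ = _ := by
        rw [show 7 * C = C + 6 * C by ring, Real.exp_add]
        ring

end WKB

end

noncomputable section

namespace WKB

/-! ### The formal Riccati equation -/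

/-- Comparing coefficients isolates the highest unknown with the factor 2s₀ - p₀. For s₀ = λ this is
±√D₀, so the recursion can be solved away from turning points. -/
theorem formalRiccati_iff {ph qh s : ℕ → ℂ → ℂ} {x : ℂ} :
    (PowerSeries.X * seriesAt (fun k => deriv (s k)) x =
      seriesAt s x ^ 2 - seriesAt ph x * seriesAt s x + seriesAt qh x) ↔
    s 0 x ^ 2 - ph 0 x * s 0 x + qh 0 x = 0 ∧ ∀ m, deriv (s m) x =
      (s 0 x - ph 0 x + s 0 x) * s (m + 1) x +
        ∑ i ∈ Finset.range m, (s (i + 1) x - ph (i + 1) x) * s (m - i) x -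
        ph (m + 1) x * s 0 x + qh (m + 1) x := by
  rw [PowerSeries.ext_iff]
  have h0 : (PowerSeries.coeff 0 (PowerSeries.X * seriesAt (fun k => deriv (s k)) x) =
      PowerSeries.coeff 0 (seriesAt s x ^ 2 - seriesAt ph x * seriesAt s x + seriesAt qh x)) ↔
      s 0 x ^ 2 - ph 0 x * s 0 x + qh 0 x = 0 := by
    rw [PowerSeries.coeff_zero_X_mul, eq_comm]
    simp [seriesAt]
  have h1 : ∀ m, (PowerSeries.coeff (m + 1) (PowerSeries.X * seriesAt (fun k => deriv (s k)) x) =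
      PowerSeries.coeff (m + 1)
        (seriesAt s x ^ 2 - seriesAt ph x * seriesAt s x + seriesAt qh x)) ↔
      deriv (s m) x = (s 0 x - ph 0 x + s 0 x) * s (m + 1) x +
        ∑ i ∈ Finset.range m, (s (i + 1) x - ph (i + 1) x) * s (m - i) x -
        ph (m + 1) x * s 0 x + qh (m + 1) x := by
    intro m
    have e : ∀ f g : ℕ → ℂ, ∑ i ∈ Finset.range (m + 2), f i * g (m + 1 - i) =
        ∑ i ∈ Finset.range m, f (i + 1) * g (m - i) + f 0 * g (m + 1) + f (m + 1) * g 0 := by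
      intro f g
      rw [Finset.sum_range_succ, Finset.sum_range_succ']
      simp
    rw [PowerSeries.coeff_succ_X_mul, pow_two]
    simp only [map_add, map_sub, PowerSeries.coeff_mul]
    simp only [seriesAt, PowerSeries.coeff_mk]
    rw [Finset.Nat.sum_antidiagonal_eq_sum_range_succ (fun i j => s i x * s j x),
      Finset.Nat.sum_antidiagonal_eq_sum_range_succ (fun i j => ph i x * s j x),
      e (fun i => s i x) (fun i => s i x), e (fun i => ph i x) (fun i => s i x)]
    simp only [sub_mul, Finset.sum_sub_distrib]
    constructor <;> intro h <;> rw [h] <;> ring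
  constructor
  · exact fun H => ⟨h0.1 (H 0), fun m => (h1 m).1 (H (m + 1))⟩
  · rintro ⟨H0, H1⟩ (_ | m)
    · exact h0.2 H0
    · exact (h1 m).2 (H1 m)

/-- The formal solution of the Riccati equation with leading term `lam`. -/
def formalRoot (ph qh : ℕ → ℂ → ℂ) (lam : ℂ → ℂ) : ℕ → ℂ → ℂ
  | 0 => lam
  | m + 1 => fun x => (deriv (formalRoot ph qh lam m) x -
      ∑ i : Fin m, (formalRoot ph qh lam (i + 1) x - ph (i + 1) x) *
        formalRoot ph qh lam (m - i) x + ph (m + 1) x * lam x - qh (m + 1) x) /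
      (lam x - ph 0 x + lam x)
termination_by m => m
decreasing_by all_goals omega

theorem formalRoot_zero (ph qh : ℕ → ℂ → ℂ) (lam : ℂ → ℂ) : formalRoot ph qh lam 0 = lam := by
  rw [formalRoot]

theorem formalRoot_succ (ph qh : ℕ → ℂ → ℂ) (lam : ℂ → ℂ) (m : ℕ) (x : ℂ) :
    formalRoot ph qh lam (m + 1) x = (deriv (formalRoot ph qh lam m) x -
      ∑ i ∈ Finset.range m, (formalRoot ph qh lam (i + 1) x - ph (i + 1) x) *
        formalRoot ph qh lam (m - i) x + ph (m + 1) x * lam x - qh (m + 1) x) /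
      (lam x - ph 0 x + lam x) := by
  rw [formalRoot, Finset.sum_range fun i => (formalRoot ph qh lam (i + 1) x - ph (i + 1) x) *
        formalRoot ph qh lam (m - i) x]

theorem isFormalCharRoot_formalRoot {U : Set ℂ} (hU : IsOpen U) {ph qh : ℕ → ℂ → ℂ} {lam : ℂ → ℂ}
    (hph : ∀ k, DifferentiableOn ℂ (ph k) U) (hqh : ∀ k, DifferentiableOn ℂ (qh k) U)
    (hlam : DifferentiableOn ℂ lam U) (h0 : ∀ x ∈ U, lam x ^ 2 - ph 0 x * lam x + qh 0 x = 0)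
    (hne : ∀ x ∈ U, lam x - ph 0 x + lam x ≠ 0) :
    IsFormalCharRoot U ph qh lam (formalRoot ph qh lam) := by
  refine ⟨fun k => ?_, fun x _ => by rw [formalRoot_zero], fun x hx => ?_⟩
  · induction k using Nat.strong_induction_on with
    | _ k ih =>
      rcases k with _ | m
      · rwa [formalRoot_zero]
      · have e : formalRoot ph qh lam (m + 1) = fun x => (deriv (formalRoot ph qh lam m) x -
          ∑ i ∈ Finset.range m, (formalRoot ph qh lam (i + 1) x - ph (i + 1) x) *
            formalRoot ph qh lam (m - i) x + ph (m + 1) x * lam x - qh (m + 1) x) /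
          (lam x - ph 0 x + lam x) := funext fun x => formalRoot_succ ph qh lam m x
        rw [e]
        refine DifferentiableOn.div ?_ ((hlam.sub (hph 0)).add hlam) hne
        refine ((((ih m (by omega)).deriv hU).sub ?_).add ((hph _).mul hlam)).sub (hqh _)
        refine DifferentiableOn.fun_sum fun i hi => ?_
        rw [Finset.mem_range] at hi
        exact ((ih _ (by omega)).sub (hph _)).mul (ih _ (by omega))
  · refine formalRiccati_iff.2 ⟨?_, fun m => ?_⟩
    · rw [formalRoot_zero]
      exact h0 x hx
    · rw [formalRoot_succ, formalRoot_zero, mul_div_cancel₀ _ (hne x hx)]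
      ring

theorem IsFormalCharRoot.eqOn {U : Set ℂ} (hU : IsOpen U) {ph qh : ℕ → ℂ → ℂ} {lam : ℂ → ℂ}
    (hne : ∀ x ∈ U, lam x - ph 0 x + lam x ≠ 0) {s s' : ℕ → ℂ → ℂ}
    (hs : IsFormalCharRoot U ph qh lam s) (hs' : IsFormalCharRoot U ph qh lam s') (k : ℕ) :
    EqOn (s' k) (s k) U := by
  induction k using Nat.strong_induction_on with
  | _ k ih =>
    rcases k with _ | m
    · exact hs'.2.1.trans hs.2.1.symm
    · intro x hx
      have h1 := (formalRiccati_iff.1 (hs.2.2 x hx)).2 m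
      have h2 := (formalRiccati_iff.1 (hs'.2.2 x hx)).2 m
      have h3 : deriv (s' m) x = deriv (s m) x :=
        ((ih m (by omega)).eventuallyEq_of_mem (hU.mem_nhds hx)).deriv_eq
      have h4 : ∑ i ∈ Finset.range m, (s' (i + 1) x - ph (i + 1) x) * s' (m - i) x =
          ∑ i ∈ Finset.range m, (s (i + 1) x - ph (i + 1) x) * s (m - i) x := by
        refine Finset.sum_congr rfl fun i hi => ?_
        rw [Finset.mem_range] at hi
        rw [ih (i + 1) (by omega) hx, ih (m - i) (by omega) hx]
      rw [h3, h4, hs'.2.1 hx, h1, hs.2.1 hx] at h2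
      refine mul_left_cancel₀ (hne x hx) ?_
      linear_combination -h2

/-! ### Nagumo's lemma -/

/-- The power is at most e. It measures the growth of the distance weight over the Cauchy circle in
Nagumo's induction. -/
theorem div_pow_le_three {m : ℕ} : ((m + 2 : ℝ) / (m + 1)) ^ m ≤ 3 := by
  have h1 : (m + 2 : ℝ) / (m + 1) = 1 + 1 / (m + 1) := by field_simp; ring
  have h2 : (m + 2 : ℝ) / (m + 1) ≤ Real.exp (1 / (m + 1)) := by
    rw [h1, add_comm]
    exact Real.add_one_le_exp _
  calc _ ≤ Real.exp (1 / (m + 1)) ^ m := pow_le_pow_left₀ (by positivity) h2 m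
    _ = Real.exp (m * (1 / (m + 1))) := by rw [← Real.exp_nat_mul]
    _ ≤ Real.exp 1 := by
        refine Real.exp_le_exp.2 ?_
        rw [mul_one_div, div_le_one (by positivity)]
        linarith
    _ ≤ 3 := by linarith [Real.exp_one_lt_d9]

/-- A family of sequences of holomorphic functions that satisfies the differential inequality of
the formal Riccati equation is a family of Gevrey sequences. -/
theorem nagumo {ι : Type*} (i₀ : ι) {w : ι → ℕ → ℂ → ℂ} {x₁ : ℂ} {ρ c K A N : ℝ} (hρ : 0 < ρ)
    (hρ1 : ρ ≤ 1) (hc : 0 < c) (hK : 0 < K) (hA : 0 < A) (hN : 0 < N) (a b : ℕ → ℂ → ℝ)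
    (hw : ∀ i n, DifferentiableOn ℂ (w i n) (Metric.ball x₁ ρ))
    (h0 : ∀ i, ∀ x ∈ Metric.ball x₁ ρ, ‖w i 0 x‖ ≤ K)
    (ha : ∀ n, ∀ x ∈ Metric.ball x₁ ρ, a n x ≤ A * N ^ n * n.factorial)
    (hb : ∀ n, ∀ x ∈ Metric.ball x₁ ρ, b n x ≤ A * N ^ n * n.factorial)
    (h : ∀ i m, ∀ x ∈ Metric.ball x₁ ρ, c * ‖w i (m + 1) x‖ ≤
      ∑ k ∈ Finset.range m, (‖w i₀ (k + 1) x‖ + a (k + 1) x) * ‖w i (m - k) x‖ + b (m + 1) x +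
        ‖deriv (w i m) x‖) :
    ∃ C M : ℝ, 0 < C ∧ 0 < M ∧ ∀ i n, ∀ x ∈ Metric.ball x₁ (ρ / 2), ‖w i (n + 1) x‖ ≤
      C * M ^ (n + 1) * (n + 1).factorial := by
  -- Makes 6C² = cC/4, so the quadratic terms use up a quarter of the available cC.
  set C : ℝ := c / 24 with hCdef
  have hC : 0 < C := by positivity
  -- The first group absorbs the data a and b, 24/c absorbs the derivative at a general step, and
  -- the last term absorbs it at the first step, where only the bound K is known.
  set M : ℝ := N * (1 + A / C + 4 * A / (c * C)) + 24 / c + 8 * K / (c * C) with hMdef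
  have hM : 0 < M := by positivity
  have hM1 : 24 ≤ c * M := by
    have : c * (24 / c) = 24 := by field_simp
    have h2 : 0 ≤ c * (N * (1 + A / C + 4 * A / (c * C)) + 8 * K / (c * C)) := by positivity
    rw [hMdef]
    linarith
  have hM2 : 2 * K ≤ c * C / 4 * M := by
    have : c * C / 4 * (8 * K / (c * C)) = 2 * K := by field_simp; ring
    have h2 : 0 ≤ c * C / 4 * (N * (1 + A / C + 4 * A / (c * C)) + 24 / c) := by positivity
    rw [hMdef]
    linarith
  have hNM : N ≤ M := by
    have h2 : 0 ≤ N * (A / C + 4 * A / (c * C)) + 24 / c + 8 * K / (c * C) := by positivity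
    rw [hMdef]
    linarith
  have hAM : ∀ n : ℕ, A * N ^ (n + 1) ≤ C * M ^ (n + 1) := by
    intro n
    have h1 : A * N ≤ C * M := by
      have : C * (N * (A / C)) = A * N := by field_simp
      have h2 : 0 ≤ C * (N * (1 + 4 * A / (c * C)) + 24 / c + 8 * K / (c * C)) := by positivity
      rw [hMdef]
      linarith
    calc A * N ^ (n + 1) = N ^ n * (A * N) := by ring
      _ ≤ M ^ n * (C * M) := by gcongr
      _ = _ := by ring
  have hBM : ∀ n : ℕ, A * N ^ (n + 1) ≤ c * C / 4 * M ^ (n + 1) := by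
    intro n
    have h1 : A * N ≤ c * C / 4 * M := by
      have : c * C / 4 * (N * (4 * A / (c * C))) = A * N := by field_simp
      have h2 : 0 ≤ c * C / 4 * (N * (1 + A / C) + 24 / c + 8 * K / (c * C)) := by positivity
      rw [hMdef]
      linarith
    calc A * N ^ (n + 1) = N ^ n * (A * N) := by ring
      _ ≤ M ^ n * (c * C / 4 * M) := by gcongr
      _ = _ := by ring
  -- The weight by powers of the distance to the boundary is Nagumo's device: a derivative loses one
  -- power of the distance and one factor of the order, exactly what the next bound allows. Hence no
  -- shrinking domains are needed.
  have main : ∀ n, ∀ i, ∀ x ∈ Metric.ball x₁ ρ, ‖w i (n + 1) x‖ ≤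
      C * M ^ (n + 1) * (n + 1).factorial / (ρ - ‖x - x₁‖) ^ (n + 1) := by
    intro m
    induction m using Nat.strong_induction_on with
    | _ m ih =>
      intro i x hx
      have hxρ : ‖x - x₁‖ < ρ := by rwa [← dist_eq_norm]
      set d := ρ - ‖x - x₁‖ with hd
      have hd0 : 0 < d := sub_pos.2 hxρ
      have hd1 : d ≤ 1 := by have := norm_nonneg (x - x₁); linarith
      have hfac : (0 : ℝ) < (m + 1).factorial := by exact_mod_cast Nat.factorial_pos _
      have hdn : ∀ n : ℕ, 1 ≤ 1 / d ^ n := fun n => by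
        rw [le_div_iff₀ (by positivity), one_mul]
        exact pow_le_one₀ hd0.le hd1
      set T := M ^ (m + 1) * (m + 1).factorial / d ^ (m + 1) with hT
      have hT0 : 0 < T := by positivity
      -- the quadratic terms
      have e1 : ∑ k ∈ Finset.range m, (‖w i₀ (k + 1) x‖ + a (k + 1) x) * ‖w i (m - k) x‖ ≤
          6 * C ^ 2 * T := by
        have e2 : ∀ k ∈ Finset.range m, (‖w i₀ (k + 1) x‖ + a (k + 1) x) * ‖w i (m - k) x‖ ≤
            2 * C ^ 2 * M ^ (m + 1) / d ^ (m + 1) *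
              ((k + 1).factorial * (m + 1 - (k + 1)).factorial : ℕ) := by
          intro k hk
          rw [Finset.mem_range] at hk
          have e3 : ‖w i₀ (k + 1) x‖ + a (k + 1) x ≤
              2 * (C * M ^ (k + 1) * (k + 1).factorial / d ^ (k + 1)) := by
            have e4 := ih k hk i₀ x hx
            have e5 : a (k + 1) x ≤ C * M ^ (k + 1) * (k + 1).factorial / d ^ (k + 1) := by
              refine (ha (k + 1) x hx).trans ?_
              rw [div_eq_mul_one_div]
              calc _ ≤ C * M ^ (k + 1) * (k + 1).factorial * 1 := by
                    rw [mul_one]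
                    exact mul_le_mul_of_nonneg_right (hAM k) (by positivity)
                _ ≤ _ := mul_le_mul_of_nonneg_left (hdn _) (by positivity)
            linarith
          obtain ⟨l, rfl⟩ := Nat.exists_eq_add_of_lt hk
          have e6 := ih l (by omega) i x hx
          rw [show k + l + 1 - k = l + 1 by omega,
            show k + l + 1 + 1 - (k + 1) = l + 1 by omega]
          calc _ ≤ 2 * (C * M ^ (k + 1) * (k + 1).factorial / d ^ (k + 1)) *
                (C * M ^ (l + 1) * (l + 1).factorial / d ^ (l + 1)) :=
                mul_le_mul e3 e6 (norm_nonneg _) (by positivity)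
            _ = _ := by
                push_cast
                rw [show k + l + 1 + 1 = (k + 1) + (l + 1) by ring, pow_add M, pow_add d]
                field_simp
                ring
        refine (Finset.sum_le_sum e2).trans ?_
        rw [← Finset.mul_sum, ← Nat.cast_sum]
        have e7 : ∑ k ∈ Finset.range m, (k + 1).factorial * (m + 1 - (k + 1)).factorial ≤
            3 * (m + 1).factorial := by
          refine le_trans ?_ (sum_factorial_mul_factorial_le (m + 1))
          rw [Finset.sum_range_succ, Finset.sum_range_succ']
          omega
        calc _ ≤ 2 * C ^ 2 * M ^ (m + 1) / d ^ (m + 1) * ((3 * (m + 1).factorial : ℕ) : ℝ) := by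
              refine mul_le_mul_of_nonneg_left ?_ (by positivity)
              exact_mod_cast e7
          _ = _ := by push_cast; rw [hT]; ring
      -- the source terms
      have e2 : b (m + 1) x ≤ c * C / 4 * T := by
        refine (hb (m + 1) x hx).trans ?_
        calc _ ≤ c * C / 4 * M ^ (m + 1) * (m + 1).factorial * 1 := by
              rw [mul_one]
              exact mul_le_mul_of_nonneg_right (hBM m) (by positivity)
          _ ≤ c * C / 4 * M ^ (m + 1) * (m + 1).factorial * (1 / d ^ (m + 1)) :=
              mul_le_mul_of_nonneg_left (hdn _) (by positivity)
          _ = _ := by rw [hT]; ring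
      -- the derivative
      have e3 : ‖deriv (w i m) x‖ ≤ c * C / 4 * T := by
        -- The radius adapted to the order m: Cauchy's estimate costs (m + 2)/d, while the weight on
        -- the circle changes only by a bounded factor.
        set R := d / (m + 2 : ℝ) with hR
        have hR0 : 0 < R := by positivity
        have hRd : R < d := by
          rw [hR, div_lt_iff₀ (by positivity)]
          nlinarith [(Nat.cast_nonneg m : (0 : ℝ) ≤ m)]
        have hsub : Metric.closedBall x R ⊆ Metric.ball x₁ ρ := by
          refine Metric.closedBall_subset_ball' ?_
          rw [dist_eq_norm]
          linarith
        have hdc : DiffContOnCl ℂ (w i m) (Metric.ball x R) :=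
          ((hw i m).mono hsub).diffContOnCl_ball subset_rfl
        have hdz : ∀ z ∈ Metric.sphere x R, d * ((m + 1) / (m + 2)) ≤ ρ - ‖z - x₁‖ := by
          intro z hz
          have h1 : ‖z - x₁‖ ≤ R + ‖x - x₁‖ := by
            rw [← mem_sphere_iff_norm.1 hz]
            calc ‖z - x₁‖ = ‖(z - x) + (x - x₁)‖ := by ring_nf
              _ ≤ _ := norm_add_le _ _
          have h2 : d * ((m + 1) / (m + 2)) = d - R := by
            rw [hR]
            field_simp
            ring
          linarith
        rcases m with _ | m
        · have h1 := Complex.norm_deriv_le_of_forall_mem_sphere_norm_le hR0 hdc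
            (C := K) fun z hz => h0 i z (hsub (Metric.sphere_subset_closedBall hz))
          refine h1.trans ?_
          rw [hR, hT]
          calc K / (d / ((0 : ℕ) + 2 : ℝ)) = 2 * K / d := by push_cast; field_simp; ring
            _ ≤ c * C / 4 * M / d := by gcongr
            _ = _ := by simp; ring
        · have h1 := Complex.norm_deriv_le_of_forall_mem_sphere_norm_le hR0 hdc
            (C := C * M ^ (m + 1) * (m + 1).factorial /
              (d * (((m + 1 : ℕ) + 1) / ((m + 1 : ℕ) + 2))) ^ (m + 1)) fun z hz => by
            refine (ih m (by omega) i z (hsub (Metric.sphere_subset_closedBall hz))).trans ?_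
            have := hdz z hz
            gcongr
          refine h1.trans ?_
          have h2 := div_pow_le_three (m := m + 1)
          rw [hR, hT, mul_pow, div_pow]
          rw [div_pow] at h2
          have h3 : ((m + 1 + 1).factorial : ℝ) = ((m + 1 : ℕ) + 1 : ℝ) * (m + 1).factorial := by
            rw [Nat.factorial_succ]
            push_cast
            ring
          have h4 : ((m + 1 : ℕ) + 2 : ℝ) ≤ 2 * ((m + 1 : ℕ) + 1 : ℝ) := by
            have : (0 : ℝ) ≤ (m + 1 : ℕ) := Nat.cast_nonneg _
            linarith
          set y1 : ℝ := ((m + 1 : ℕ) + 1 : ℝ) with hy1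
          set y2 : ℝ := ((m + 1 : ℕ) + 2 : ℝ) with hy2
          have hy1p : 0 < y1 := by positivity
          have hy2p : 0 < y2 := by positivity
          calc C * M ^ (m + 1) * (m + 1).factorial / (d ^ (m + 1) * (y1 ^ (m + 1) / y2 ^ (m + 1))) /
                (d / y2) = C * M ^ (m + 1) * ((m + 1).factorial * y2) / d ^ (m + 1 + 1) *
                  (y2 ^ (m + 1) / y1 ^ (m + 1)) := by
                rw [pow_succ d (m + 1)]
                field_simp
            _ ≤ C * M ^ (m + 1) * ((m + 1).factorial * (2 * y1)) / d ^ (m + 1 + 1) * 3 := by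
                gcongr
            _ = 6 * (C * M ^ (m + 1) * (m + 1 + 1).factorial / d ^ (m + 1 + 1)) := by
                rw [h3]
                ring
            _ ≤ c * M / 4 * (C * M ^ (m + 1) * (m + 1 + 1).factorial / d ^ (m + 1 + 1)) := by
                refine mul_le_mul_of_nonneg_right ?_ (by positivity)
                linarith
            _ = _ := by
                rw [pow_succ M (m + 1)]
                ring
      have e4 := h i m x hx
      have e5 : 6 * C ^ 2 * T = c * C / 4 * T := by
        rw [hCdef]
        ring
      have e6 : c * ‖w i (m + 1) x‖ ≤ c * (C * T) := by
        have : 0 ≤ c * C * T := by positivity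
        calc _ ≤ c * C / 4 * T + c * C / 4 * T + c * C / 4 * T := by
              refine e4.trans (add_le_add (add_le_add (e1.trans e5.le) e2) e3)
          _ ≤ _ := by linarith
      refine (le_of_mul_le_mul_left e6 hc).trans (le_of_eq ?_)
      rw [hT]
      ring
  refine ⟨C, 2 * M / ρ, hC, by positivity, fun i n x hx => ?_⟩
  have hx2 : ‖x - x₁‖ < ρ / 2 := by rwa [← dist_eq_norm]
  refine (main n i x (Metric.ball_subset_ball (by linarith) hx)).trans ?_
  have h1 : ρ / 2 ≤ ρ - ‖x - x₁‖ := by linarith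
  calc _ ≤ C * M ^ (n + 1) * (n + 1).factorial / (ρ / 2) ^ (n + 1) := by gcongr
    _ = _ := by
        rw [div_pow, div_pow, mul_pow]
        field_simp

end WKB

end

noncomputable section

namespace WKB

/-! ### Bounded solutions of the Riccati equation are Gevrey -/

/-- Subtracting the truncated formal equation from the exact one. The quotients by powers of ħ obey
the recursion of the formal coefficients, with 2s₀ replaced by s₀ + y in the leading factor. -/
theorem riccati_remainder {ph qh s : ℕ → ℂ → ℂ} {x : ℂ}
    (hs : PowerSeries.X * seriesAt (fun k => deriv (s k)) x =
      seriesAt s x ^ 2 - seriesAt ph x * seriesAt s x + seriesAt qh x)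
    {y y' z w h : ℂ} (hh : h ≠ 0) (hy : h * y' = y ^ 2 - z * y + w) (m : ℕ) :
    (y' - ∑ k ∈ Finset.range m, deriv (s k) x * h ^ k) / h ^ m =
      (s 0 x - ph 0 x + y) *
        ((y - ∑ k ∈ Finset.range (m + 1), s k x * h ^ k) / h ^ (m + 1)) +
      ∑ i ∈ Finset.range m, (s (i + 1) x - ph (i + 1) x) *
        ((y - ∑ k ∈ Finset.range (m - i), s k x * h ^ k) / h ^ (m - i)) -
      (z - ∑ k ∈ Finset.range (m + 1), ph k x * h ^ k) / h ^ (m + 1) * y +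
      (w - ∑ k ∈ Finset.range (m + 1), qh k x * h ^ k) / h ^ (m + 1) := by
  have e1 := mul_sub_sum_coeff_mul (seriesAt s x) (seriesAt s x) y y h (m + 1)
  have e2 := mul_sub_sum_coeff_mul (seriesAt ph x) (seriesAt s x) z y h (m + 1)
  have e3 : h * ∑ k ∈ Finset.range m, deriv (s k) x * h ^ k =
      ∑ k ∈ Finset.range (m + 1), PowerSeries.coeff k
        (PowerSeries.X * seriesAt (fun k => deriv (s k)) x) * h ^ k := by
    rw [Finset.sum_range_succ', PowerSeries.coeff_zero_X_mul, zero_mul, add_zero, Finset.mul_sum]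
    refine Finset.sum_congr rfl fun k _ => ?_
    rw [PowerSeries.coeff_succ_X_mul, seriesAt, PowerSeries.coeff_mk]
    ring
  rw [hs, pow_two] at e3
  simp only [map_add, map_sub, add_mul, sub_mul, Finset.sum_add_distrib,
    Finset.sum_sub_distrib] at e3
  simp only [seriesAt, PowerSeries.coeff_mk] at e1 e2 e3
  have e4 : ∀ f : ℕ → ℂ, ∑ i ∈ Finset.range (m + 1), f i * h ^ i *
      (y - ∑ k ∈ Finset.range (m + 1 - i), s k x * h ^ k) =
      h ^ (m + 1) * ∑ i ∈ Finset.range m, f (i + 1) *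
        ((y - ∑ k ∈ Finset.range (m - i), s k x * h ^ k) / h ^ (m - i)) +
      f 0 * (y - ∑ k ∈ Finset.range (m + 1), s k x * h ^ k) := by
    intro f
    rw [Finset.sum_range_succ', Finset.mul_sum, pow_zero, mul_one, Nat.sub_zero]
    congr 1
    refine Finset.sum_congr rfl fun i hi => ?_
    rw [Finset.mem_range] at hi
    obtain ⟨l, rfl⟩ := Nat.exists_eq_add_of_lt hi
    rw [show i + l + 1 + 1 - (i + 1) = l + 1 by omega, show i + l + 1 - i = l + 1 by omega,
      show i + l + 1 + 1 = (i + 1) + (l + 1) by ring, pow_add h (i + 1)]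
    field_simp
  have e5 := e4 fun i => s i x
  have e6 := e4 fun i => ph i x
  have hp : h ^ m ≠ 0 := pow_ne_zero _ hh
  simp only [sub_mul, Finset.sum_sub_distrib]
  set A1 := ∑ i ∈ Finset.range m, s (i + 1) x *
    ((y - ∑ k ∈ Finset.range (m - i), s k x * h ^ k) / h ^ (m - i))
  set A2 := ∑ i ∈ Finset.range m, ph (i + 1) x *
    ((y - ∑ k ∈ Finset.range (m - i), s k x * h ^ k) / h ^ (m - i))
  rw [← sub_eq_zero]
  refine mul_left_cancel₀ (pow_ne_zero (m + 1) hh) ?_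
  rw [mul_zero]
  field_simp
  linear_combination h ^ m * (hy - e3 + e1 - e2 + e5 - e6)

/-- Nagumo's estimate, applied to the family of all normalised remainders with ħ as index, turns
mere boundedness of S into Gevrey bounds uniform in ħ. -/
theorem exists_gevreyOn_of_riccati {θ δ ρ c K A N : ℝ} {x₁ : ℂ} (hδ : 0 < δ) (hρ : 0 < ρ)
    (hρ1 : ρ ≤ 1) (hc : 0 < c) (hK : 0 < K) (hA : 0 < A) (hN : 0 < N)
    {p q S : ℂ → ℂ → ℂ} {ph qh s : ℕ → ℂ → ℂ} {lam : ℂ → ℂ}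
    (hs : IsFormalCharRoot (Metric.ball x₁ ρ) ph qh lam s)
    (hS : ∀ h ∈ borelDisc θ δ, DifferentiableOn ℂ (fun x => S x h) (Metric.ball x₁ ρ))
    (hlK : ∀ x ∈ Metric.ball x₁ ρ, ‖lam x‖ ≤ K)
    (hSK : ∀ x ∈ Metric.ball x₁ ρ, ∀ h ∈ borelDisc θ δ, ‖S x h‖ ≤ K)
    (hpG : ∀ x ∈ Metric.ball x₁ ρ, GevreyOn (borelDisc θ δ) A N (p x) fun k => ph k x)
    (hqG : ∀ x ∈ Metric.ball x₁ ρ, GevreyOn (borelDisc θ δ) A N (q x) fun k => qh k x)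
    (hne : ∀ x ∈ Metric.ball x₁ ρ, 2 * c ≤ ‖lam x - ph 0 x + lam x‖)
    (hric : ∀ x ∈ Metric.ball x₁ ρ, ∀ h ∈ borelDisc θ δ,
      h * deriv (fun y => lam y + h * S y h) x =
        (lam x + h * S x h) ^ 2 - p x h * (lam x + h * S x h) + q x h) :
    ∃ d > 0, d ≤ δ ∧ ∃ C M : ℝ, 0 < C ∧ 0 < M ∧ ∀ x ∈ Metric.ball x₁ (ρ / 2),
      GevreyOn (borelDisc θ d) C M (S x) fun k => tailCoeff s k x := by
  -- Keeps |ħS| ≤ c, so the perturbed leading factor still has modulus at least c.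
  set d := min δ (c / K) with hd
  have hd0 : 0 < d := lt_min hδ (by positivity)
  have hdδ : d ≤ δ := min_le_left _ _
  have hsub : borelDisc θ d ⊆ borelDisc θ δ := borelDisc_mono hd0 hdδ
  have hO : IsOpen (Metric.ball x₁ ρ) := Metric.isOpen_ball
  have hlam : DifferentiableOn ℂ lam (Metric.ball x₁ ρ) := (hs.1 0).congr fun x hx => (hs.2.1 hx).symm
  -- The index ħ = 0 stands for the formal coefficients. They occur in the quadratic terms of every
  -- remainder recursion, so both must be estimated in one induction.
  set ι := {h : ℂ // h = 0 ∨ h ∈ borelDisc θ d} with hι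
  set w : ι → ℕ → ℂ → ℂ := fun i n x =>
    remainder (fun h => lam x + h * S x h) (fun k => s k x) n i with hw
  have hw0 : ∀ n x, w ⟨0, Or.inl rfl⟩ n x = s n x := fun n x => by simp [hw, remainder]
  have hwS : ∀ (h : ℂ) (hh : h ∈ borelDisc θ d) n x, w ⟨h, Or.inr hh⟩ n x =
      (lam x + h * S x h - ∑ k ∈ Finset.range n, s k x * h ^ k) / h ^ n := fun h hh n x => by
    simp only [hw, remainder, if_neg (ne_zero_of_mem_borelDisc hd0 hh)]
  have hhn : ∀ h ∈ borelDisc θ d, ‖h‖ ≤ d := fun h hh => (norm_lt_of_mem_borelDisc hd0 hh).le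
  have hyK : ∀ x ∈ Metric.ball x₁ ρ, ∀ h ∈ borelDisc θ d, ‖lam x + h * S x h‖ ≤ K + δ * K := by
    intro x hx h hh
    refine (norm_add_le _ _).trans (add_le_add (hlK x hx) ?_)
    rw [norm_mul]
    exact mul_le_mul ((hhn h hh).trans hdδ) (hSK x hx h (hsub hh)) (norm_nonneg _) hδ.le
  have hcoef : ∀ n, ∀ x ∈ Metric.ball x₁ ρ, ‖ph n x‖ ≤ A * N ^ n * n.factorial ∧
      ‖qh n x‖ ≤ A * N ^ n * n.factorial := fun n x hx =>
    ⟨(hpG x hx).norm_coeff_le hδ n, (hqG x hx).norm_coeff_le hδ n⟩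
  have hfin : ∀ (m : ℕ) (x : ℂ) (v y P Q v' : ℂ) (W : ℕ → ℂ), x ∈ Metric.ball x₁ ρ →
      ‖y‖ ≤ K + δ * K → c ≤ ‖s 0 x - ph 0 x + y‖ →
      ‖P‖ ≤ A * N ^ (m + 1) * (m + 1).factorial → ‖Q‖ ≤ A * N ^ (m + 1) * (m + 1).factorial →
      v' = (s 0 x - ph 0 x + y) * v + ∑ i ∈ Finset.range m, (s (i + 1) x - ph (i + 1) x) * W (m - i)
        - P * y + Q →
      c * ‖v‖ ≤ ∑ k ∈ Finset.range m, (‖s (k + 1) x‖ + A * N ^ (k + 1) * (k + 1).factorial) *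
        ‖W (m - k)‖ + A * (1 + K + δ * K) * N ^ (m + 1) * (m + 1).factorial + ‖v'‖ := by
    intro m x v y P Q v' W hx hy hcy hP hQ hv'
    have e1 : (s 0 x - ph 0 x + y) * v = v' + P * y - Q -
        ∑ i ∈ Finset.range m, (s (i + 1) x - ph (i + 1) x) * W (m - i) := by
      rw [hv']; ring
    have e2 : ‖∑ i ∈ Finset.range m, (s (i + 1) x - ph (i + 1) x) * W (m - i)‖ ≤
        ∑ k ∈ Finset.range m, (‖s (k + 1) x‖ + A * N ^ (k + 1) * (k + 1).factorial) *
        ‖W (m - k)‖ := by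
      refine norm_sum_le_of_le _ fun i _ => ?_
      rw [norm_mul]
      refine mul_le_mul_of_nonneg_right ((norm_sub_le _ _).trans ?_) (norm_nonneg _)
      exact add_le_add le_rfl (hcoef (i + 1) x hx).1
    have e3 : ‖P * y‖ ≤ A * N ^ (m + 1) * (m + 1).factorial * (K + δ * K) := by
      rw [norm_mul]
      exact mul_le_mul hP hy (norm_nonneg _) (by positivity)
    calc c * ‖v‖ ≤ ‖s 0 x - ph 0 x + y‖ * ‖v‖ := mul_le_mul_of_nonneg_right hcy (norm_nonneg _)
      _ = ‖v' + P * y - Q - ∑ i ∈ Finset.range m, (s (i + 1) x - ph (i + 1) x) * W (m - i)‖ := by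
          rw [← norm_mul, e1]
      _ ≤ ‖v'‖ + ‖P * y‖ + ‖Q‖ +
          ‖∑ i ∈ Finset.range m, (s (i + 1) x - ph (i + 1) x) * W (m - i)‖ := by
          refine (norm_sub_le _ _).trans (add_le_add ((norm_sub_le _ _).trans
            (add_le_add (norm_add_le _ _) le_rfl)) le_rfl)
      _ ≤ _ := by
          have : A * (1 + K + δ * K) * N ^ (m + 1) * (m + 1).factorial =
            A * N ^ (m + 1) * (m + 1).factorial * (K + δ * K) +
              A * N ^ (m + 1) * (m + 1).factorial := by ring
          linarith
  obtain ⟨C, M, hC, hM, H⟩ := nagumo (ι := ι) ⟨0, Or.inl rfl⟩ (w := w) (c := c) (K := K + δ * K)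
    (A := A * (1 + K + δ * K)) (N := N) hρ hρ1 hc (by positivity) (by positivity) hN
    (fun n _ => A * N ^ n * n.factorial)
    (fun n _ => A * (1 + K + δ * K) * N ^ n * n.factorial)
    (by
      rintro ⟨h, rfl | hh⟩ n
      · exact (hs.1 n).congr fun x _ => hw0 n x
      · refine DifferentiableOn.congr ?_ fun x _ => hwS h hh n x
        refine DifferentiableOn.div_const ?_ _
        refine (hlam.add ((hS h (hsub hh)).const_mul h)).sub ?_
        exact DifferentiableOn.fun_sum fun k _ => (hs.1 k).mul_const _)
    (by
      rintro ⟨h, rfl | hh⟩ x hx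
      · rw [hw0, hs.2.1 hx]
        exact (hlK x hx).trans (by linarith [mul_pos hδ hK])
      · rw [hwS h hh]
        simpa using hyK x hx h hh)
    (by
      intro n x _
      have : 0 ≤ A * (K + δ * K) * N ^ n * n.factorial := by positivity
      linarith)
    (fun n x _ => le_rfl)
    (by
      rintro ⟨h, rfl | hh⟩ m x hx
      · have e := (formalRiccati_iff.1 (hs.2.2 x hx)).2 m
        simp only [hw0]
        have e0 : w ⟨0, Or.inl rfl⟩ m = s m := funext (hw0 m)
        rw [e0]
        refine hfin m x (s (m + 1) x) (s 0 x) (ph (m + 1) x) (qh (m + 1) x) _ (fun k => s k x)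
          hx ?_ ?_ (hcoef _ x hx).1 (hcoef _ x hx).2 e
        · rw [hs.2.1 hx]
          exact (hlK x hx).trans (by linarith [mul_pos hδ hK])
        · have := hne x hx
          rw [hs.2.1 hx]
          linarith
      · have hh0 := ne_zero_of_mem_borelDisc hd0 hh
        have hhδ := hsub hh
        have hpow : 0 < ‖h‖ ^ (m + 1) := by positivity
        have e := riccati_remainder (hs.2.2 x hx) hh0 (hric x hx h hhδ) m
        have hder : deriv (w ⟨h, Or.inr hh⟩ m) x = (deriv (fun y => lam y + h * S y h) x -
            ∑ k ∈ Finset.range m, deriv (s k) x * h ^ k) / h ^ m := by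
          have e0 : w ⟨h, Or.inr hh⟩ m = fun x =>
            (lam x + h * S x h - ∑ k ∈ Finset.range m, s k x * h ^ k) / h ^ m := funext (hwS h hh m)
          rw [e0]
          have d1 : DifferentiableAt ℂ (fun y => lam y + h * S y h) x :=
            ((hlam.add ((hS h hhδ).const_mul h)).differentiableAt (hO.mem_nhds hx))
          have d2 : ∀ k, DifferentiableAt ℂ (s k) x := fun k =>
            (hs.1 k).differentiableAt (hO.mem_nhds hx)
          exact ((d1.hasDerivAt.sub (HasDerivAt.fun_sum fun k _ =>
            (d2 k).hasDerivAt.mul_const (h ^ k))).div_const _).deriv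
        simp only [hw0]
        rw [hder]
        simp only [hwS h hh]
        refine hfin m x _ _ _ _ _
          (fun n => (lam x + h * S x h - ∑ k ∈ Finset.range n, s k x * h ^ k) / h ^ n)
          hx (hyK x hx h hh) ?_ ?_ ?_ e
        · have h1 := hne x hx
          rw [hs.2.1 hx]
          have h2 : ‖h * S x h‖ ≤ c := by
            rw [norm_mul]
            calc _ ≤ c / K * K := mul_le_mul ((hhn h hh).trans (min_le_right _ _))
                  (hSK x hx h hhδ) (norm_nonneg _) (by positivity)
              _ = c := by field_simp
          have h3 : ‖lam x - ph 0 x + lam x‖ ≤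
              ‖lam x - ph 0 x + (lam x + h * S x h)‖ + ‖h * S x h‖ := by
            have : lam x - ph 0 x + lam x = lam x - ph 0 x + (lam x + h * S x h) - h * S x h := by
              ring
            rw [this]
            exact norm_sub_le _ _
          linarith
        · rw [norm_div, norm_pow, div_le_iff₀ hpow]
          exact hpG x hx (m + 1) h hhδ
        · rw [norm_div, norm_pow, div_le_iff₀ hpow]
          exact hqG x hx (m + 1) h hhδ)
  refine ⟨d, hd0, hdδ, C * M, 2 * M, by positivity, by positivity, fun x hx n h hh => ?_⟩
  have hx' : x ∈ Metric.ball x₁ ρ := Metric.ball_subset_ball (by linarith) hx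
  have hh0 := ne_zero_of_mem_borelDisc hd0 hh
  have e := H ⟨h, Or.inr hh⟩ n x hx
  rw [hwS h hh] at e
  have e1 : lam x + h * S x h - ∑ k ∈ Finset.range (n + 1), s k x * h ^ k =
      h * (S x h - ∑ k ∈ Finset.range n, tailCoeff s k x * h ^ k) := by
    rw [Finset.sum_range_succ', hs.2.1 hx', mul_sub, Finset.mul_sum]
    have : ∑ k ∈ Finset.range n, s (k + 1) x * h ^ (k + 1) =
        ∑ k ∈ Finset.range n, h * (tailCoeff s k x * h ^ k) :=
      Finset.sum_congr rfl fun k _ => by rw [tailCoeff]; ring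
    rw [this]
    ring
  rw [e1, pow_succ' h, mul_div_mul_left _ _ hh0, norm_div, norm_pow,
    div_le_iff₀ (by positivity)] at e
  refine e.trans (mul_le_mul_of_nonneg_right ?_ (by positivity))
  -- Order n for S is order n + 1 for λ + ħS; doubling M pays for the factor n + 1 in the factorial.
  have h2 : ((n + 1 : ℕ) : ℝ) ≤ 2 ^ n := by exact_mod_cast Nat.lt_two_pow_self (n := n)
  rw [Nat.factorial_succ]
  calc C * M ^ (n + 1) * (((n + 1) * n.factorial : ℕ) : ℝ)
      = C * M ^ (n + 1) * n.factorial * ((n + 1 : ℕ) : ℝ) := by push_cast; ring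
    _ ≤ C * M ^ (n + 1) * n.factorial * 2 ^ n := by gcongr
    _ = _ := by rw [mul_pow]; ring

end WKB

end

noncomputable section

namespace WKB

/-! ### The Riccati equation on a half-strip -/

/-- The operator that inverts `∂ - 1 / η` on bounded functions on a half-strip. -/
def expResolvent (n : ℂ → ℂ) (η z : ℂ) : ℂ :=
  -∫ t in Ioi (0 : ℝ), Complex.exp (-t / η) * n (z + t)

theorem norm_exp_neg_div_le {d : ℝ} {η : ℂ} (hη : η ∈ borelDisc 0 d) {t : ℝ} (ht : 0 ≤ t) :
    ‖Complex.exp (-t / η)‖ ≤ Real.exp (-(1 / d) * t) := by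
  have h1 : 1 / d < (1 / η).re := by simpa [borelDisc] using hη
  have h2 : (-t / η : ℂ) = (1 / η) * ((-t : ℝ) : ℂ) := by push_cast; ring
  rw [Complex.norm_exp, h2, Complex.re_mul_ofReal]
  refine Real.exp_le_exp.2 ?_
  nlinarith

section Resolvent

variable {Y : Set ℂ} {d K : ℝ}

theorem integrableOn_exp_neg_mul (hd : 0 < d) (K : ℝ) :
    IntegrableOn (fun t : ℝ => Real.exp (-(1 / d) * t) * K) (Ioi 0) :=
  (integrableOn_exp_mul_Ioi (by simpa using hd) 0).mul_const K

theorem continuousOn_exp_mul {n : ℂ → ℂ} (hn : ContinuousOn n Y) (η z : ℂ) :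
    ContinuousOn (fun t : ℝ => Complex.exp (-t / η) * n (z + t)) {t : ℝ | z + t ∈ Y} :=
  (Continuous.continuousOn (by fun_prop)).mul (hn.comp (by fun_prop) fun _ ht => ht)

theorem integrableOn_exp_mul (hY : ∀ z ∈ Y, ∀ t : ℝ, 0 ≤ t → z + t ∈ Y) (hd : 0 < d)
    {n : ℂ → ℂ} (hn : ContinuousOn n Y) (hK : ∀ z ∈ Y, ‖n z‖ ≤ K) {η z : ℂ}
    (hη : η ∈ borelDisc 0 d) (hz : z ∈ Y) :
    IntegrableOn (fun t : ℝ => Complex.exp (-t / η) * n (z + t)) (Ioi 0) := by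
  refine Integrable.mono' (integrableOn_exp_neg_mul hd K) ?_ ?_
  · exact ((continuousOn_exp_mul hn η z).mono fun t ht => hY z hz t (le_of_lt ht)
      ).aestronglyMeasurable measurableSet_Ioi
  · filter_upwards [ae_restrict_mem measurableSet_Ioi] with t ht
    rw [norm_mul]
    exact mul_le_mul (norm_exp_neg_div_le hη (le_of_lt ht)) (hK _ (hY z hz t (le_of_lt ht)))
      (norm_nonneg _) (Real.exp_nonneg _)

/-- The kernel decays like e^{-t/d}, whose integral is d. This small factor is the source of the
contraction. -/
theorem norm_expResolvent_le (hY : ∀ z ∈ Y, ∀ t : ℝ, 0 ≤ t → z + t ∈ Y) (hd : 0 < d)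
    {n : ℂ → ℂ} (hK : ∀ z ∈ Y, ‖n z‖ ≤ K) {η z : ℂ}
    (hη : η ∈ borelDisc 0 d) (hz : z ∈ Y) : ‖expResolvent n η z‖ ≤ d * K := by
  rw [expResolvent, norm_neg]
  refine (norm_integral_le_of_norm_le (integrableOn_exp_neg_mul hd K) ?_).trans ?_
  · filter_upwards [ae_restrict_mem measurableSet_Ioi] with t ht
    rw [norm_mul]
    exact mul_le_mul (norm_exp_neg_div_le hη (le_of_lt ht)) (hK _ (hY z hz t (le_of_lt ht)))
      (norm_nonneg _) (Real.exp_nonneg _)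
  · rw [integral_mul_const, integral_exp_mul_Ioi (by simpa using hd)]
    refine le_of_eq ?_
    simp

theorem expResolvent_sub (hY : ∀ z ∈ Y, ∀ t : ℝ, 0 ≤ t → z + t ∈ Y) (hd : 0 < d)
    {n n' : ℂ → ℂ} (hn : ContinuousOn n Y) (hK : ∀ z ∈ Y, ‖n z‖ ≤ K) (hn' : ContinuousOn n' Y)
    (hK' : ∀ z ∈ Y, ‖n' z‖ ≤ K) {η z : ℂ} (hη : η ∈ borelDisc 0 d) (hz : z ∈ Y) :
    expResolvent n η z - expResolvent n' η z = expResolvent (fun z => n z - n' z) η z := by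
  rw [expResolvent, expResolvent, expResolvent, neg_sub_neg, ← neg_sub, ← integral_sub
    (integrableOn_exp_mul hY hd hn hK hη hz) (integrableOn_exp_mul hY hd hn' hK' hη hz)]
  simp only [mul_sub]

theorem differentiableOn_expResolvent (hO : IsOpen Y)
    (hY : ∀ z ∈ Y, ∀ t : ℝ, 0 ≤ t → z + t ∈ Y) (hd : 0 < d)
    {n : ℂ → ℂ} (hn : DifferentiableOn ℂ n Y) (hK : ∀ z ∈ Y, ‖n z‖ ≤ K) {η : ℂ}
    (hη : η ∈ borelDisc 0 d) : DifferentiableOn ℂ (expResolvent n η) Y := by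
  refine DifferentiableOn.neg (differentiableOn_integral_of_bound hO (fun z hz =>
    (integrableOn_exp_mul hY hd hn.continuousOn hK hη hz).aestronglyMeasurable) ?_ fun z hz =>
    ⟨Y, hO.mem_nhds hz, _, integrableOn_exp_neg_mul hd K, ?_⟩)
  · filter_upwards [ae_restrict_mem measurableSet_Ioi] with t ht
    refine DifferentiableOn.const_mul ?_ _
    exact hn.comp (by fun_prop) fun z hz => hY z hz t (le_of_lt ht)
  · filter_upwards [ae_restrict_mem measurableSet_Ioi] with t ht w hw
    rw [norm_mul]
    exact mul_le_mul (norm_exp_neg_div_le hη (le_of_lt ht)) (hK _ (hY w hw t (le_of_lt ht)))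
      (norm_nonneg _) (Real.exp_nonneg _)

theorem differentiableOn_expResolvent_param
    (hY : ∀ z ∈ Y, ∀ t : ℝ, 0 ≤ t → z + t ∈ Y) (hd : 0 < d) {n : ℂ → ℂ → ℂ}
    (hn : ∀ η ∈ borelDisc 0 d, DifferentiableOn ℂ (fun z => n z η) Y)
    (hn' : ∀ z ∈ Y, DifferentiableOn ℂ (n z) (borelDisc 0 d))
    (hK : ∀ z ∈ Y, ∀ η ∈ borelDisc 0 d, ‖n z η‖ ≤ K) {z : ℂ} (hz : z ∈ Y) :
    DifferentiableOn ℂ (fun η => expResolvent (fun z => n z η) η z) (borelDisc 0 d) := by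
  refine DifferentiableOn.neg (differentiableOn_integral_of_bound (isOpen_borelDisc hd)
    (fun η hη => (integrableOn_exp_mul hY hd (hn η hη).continuousOn (fun z hz => hK z hz η hη)
      hη hz).aestronglyMeasurable) ?_ fun η hη =>
    ⟨borelDisc 0 d, (isOpen_borelDisc hd).mem_nhds hη, _, integrableOn_exp_neg_mul hd K, ?_⟩)
  · filter_upwards [ae_restrict_mem measurableSet_Ioi] with t ht
    refine DifferentiableOn.mul ?_ (hn' _ (hY z hz t (le_of_lt ht)))
    refine DifferentiableOn.cexp (DifferentiableOn.div (differentiableOn_const _)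
      differentiableOn_id fun η hη => ne_zero_of_mem_borelDisc hd hη)
  · filter_upwards [ae_restrict_mem measurableSet_Ioi] with t ht w hw
    rw [norm_mul]
    exact mul_le_mul (norm_exp_neg_div_le hw (le_of_lt ht)) (hK _ (hY z hz t (le_of_lt ht)) w hw)
      (norm_nonneg _) (Real.exp_nonneg _)

/-- Holomorphy being known, the derivative may be computed along the real direction. There a
translation of the variable turns the integral into e^{τ/η} times a tail, and the fundamental
theorem of calculus applies. -/
theorem hasDerivAt_expResolvent (hO : IsOpen Y)
    (hY : ∀ z ∈ Y, ∀ t : ℝ, 0 ≤ t → z + t ∈ Y) (hd : 0 < d)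
    {n : ℂ → ℂ} (hn : DifferentiableOn ℂ n Y) (hK : ∀ z ∈ Y, ‖n z‖ ≤ K) {η z : ℂ}
    (hη : η ∈ borelDisc 0 d) (hz : z ∈ Y) :
    HasDerivAt (expResolvent n η) (expResolvent n η z / η + n z) z := by
  have h1 := ((differentiableOn_expResolvent hO hY hd hn hK hη).differentiableAt
    (hO.mem_nhds hz)).hasDerivAt
  refine h1.congr_deriv ?_
  -- the derivative along the real direction
  have h2 : HasDerivWithinAt (fun τ : ℝ => expResolvent n η (z + τ)) (deriv (expResolvent n η) z)
      (Ici 0) 0 := by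
    have h3 : HasDerivAt (fun w : ℂ => expResolvent n η (z + w)) (deriv (expResolvent n η) z)
        ((0 : ℝ) : ℂ) := by
      have : HasDerivAt (expResolvent n η) (deriv (expResolvent n η) z) (z + ((0 : ℝ) : ℂ)) := by
        simpa using h1
      exact this.comp_const_add z _
    exact h3.comp_ofReal.hasDerivWithinAt
  set f : ℝ → ℂ := fun t => Complex.exp (-t / η) * n (z + t) with hf
  have hfi := integrableOn_exp_mul hY hd hn.continuousOn hK hη hz
  have h4 : ∀ τ ∈ Ici (0 : ℝ), expResolvent n η (z + τ) =
      -(Complex.exp (τ / η) * ((∫ t in Ioi (0 : ℝ), f t) - ∫ t in (0 : ℝ)..τ, f t)) := by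
    intro τ hτ
    rw [← intervalIntegral.integral_interval_add_Ioi hfi (hfi.mono_set (Ioi_subset_Ioi hτ)),
      add_sub_cancel_left, expResolvent, ← integral_const_mul]
    have h5 := (measurePreserving_add_right volume τ).setIntegral_preimage_emb
      (measurableEmbedding_addRight τ) (fun t : ℝ => Complex.exp (τ / η) * f t) (Ioi τ)
    rw [Set.preimage_add_const_Ioi, sub_self] at h5
    rw [← h5]
    congr 1
    refine integral_congr_ae (Eventually.of_forall fun t => ?_)
    simp only [hf]
    rw [← mul_assoc, ← Complex.exp_add]
    push_cast
    congr 2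
    · ring
    · ring
  have hopen : IsOpen {t : ℝ | z + t ∈ Y} := hO.preimage (by fun_prop)
  have h0mem : (0 : ℝ) ∈ {t : ℝ | z + t ∈ Y} := by simpa using hz
  have hfc : ContinuousOn f {t : ℝ | z + t ∈ Y} := continuousOn_exp_mul hn.continuousOn η z
  have h5 : HasDerivAt (fun τ : ℝ => ∫ t in (0 : ℝ)..τ, f t) (f 0) 0 :=
    intervalIntegral.integral_hasDerivAt_right IntervalIntegrable.refl
      (hfc.stronglyMeasurableAtFilter hopen 0 h0mem) (hfc.continuousAt (hopen.mem_nhds h0mem))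
  have h6 : HasDerivAt (fun τ : ℝ => Complex.exp (τ / η)) (1 / η) 0 := by
    have : HasDerivAt (fun w : ℂ => Complex.exp (w / η)) (1 / η) ((0 : ℝ) : ℂ) := by
      have := ((hasDerivAt_id ((0 : ℝ) : ℂ)).div_const η).cexp
      simpa using this
    exact this.comp_ofReal
  have h7 := (h6.mul (h5.const_sub (∫ t in Ioi (0 : ℝ), f t))).neg.hasDerivWithinAt (s := Ici 0)
  have h8 := (uniqueDiffWithinAt_Ici (0 : ℝ)).eq_deriv _ h2 (h7.congr h4 (h4 0 self_mem_Ici))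
  rw [h8, expResolvent]
  simp [hf]
  ring

end Resolvent

/-- Picard iteration for the fixed point equation G = resolvent(n₀ + n₁G + G²) in the unit ball. The
iterates are uniformly bounded, so their limit remains holomorphic in each variable. -/
theorem exists_strip_solution {Y : Set ℂ} (hO : IsOpen Y)
    (hY : ∀ z ∈ Y, ∀ t : ℝ, 0 ≤ t → z + t ∈ Y) {δ K : ℝ} (hδ : 0 < δ) (hK : 0 < K)
    {n₀ n₁ : ℂ → ℂ → ℂ}
    (h₀ : ∀ η ∈ borelDisc 0 δ, DifferentiableOn ℂ (fun z => n₀ z η) Y)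
    (h₀' : ∀ z ∈ Y, DifferentiableOn ℂ (n₀ z) (borelDisc 0 δ))
    (h₁ : ∀ η ∈ borelDisc 0 δ, DifferentiableOn ℂ (fun z => n₁ z η) Y)
    (h₁' : ∀ z ∈ Y, DifferentiableOn ℂ (n₁ z) (borelDisc 0 δ))
    (hK₀ : ∀ z ∈ Y, ∀ η ∈ borelDisc 0 δ, ‖n₀ z η‖ ≤ K)
    (hK₁ : ∀ z ∈ Y, ∀ η ∈ borelDisc 0 δ, ‖n₁ z η‖ ≤ K) :
    ∃ d > 0, d ≤ δ ∧ ∃ G : ℂ → ℂ → ℂ,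
      (∀ η ∈ borelDisc 0 d, DifferentiableOn ℂ (fun z => G z η) Y) ∧
      (∀ z ∈ Y, DifferentiableOn ℂ (G z) (borelDisc 0 d)) ∧
      (∀ z ∈ Y, ∀ η ∈ borelDisc 0 d, ‖G z η‖ ≤ 1) ∧
      ∀ z ∈ Y, ∀ η ∈ borelDisc 0 d, HasDerivAt (fun z => G z η)
        (G z η / η + (n₀ z η + n₁ z η * G z η + G z η ^ 2)) z := by
  -- On the unit ball the nonlinearity is bounded by 2(K + 2) and has Lipschitz constant K + 2. With
  -- this d the ball is preserved and distances are halved.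
  set d : ℝ := min δ (1 / (2 * (K + 2))) with hddef
  have hd : 0 < d := lt_min hδ (by positivity)
  have hdδ : d ≤ δ := min_le_left _ _
  have hsub : borelDisc 0 d ⊆ borelDisc 0 δ := borelDisc_mono hd hdδ
  have hdK : d * (K + 2) ≤ 1 / 2 := by
    have h1 : d ≤ 1 / (2 * (K + 2)) := min_le_right _ _
    rw [le_div_iff₀ (by positivity)] at h1
    linarith
  set N : (ℂ → ℂ → ℂ) → ℂ → ℂ → ℂ := fun g z η => n₀ z η + n₁ z η * g z η + g z η ^ 2 with hN
  set T : (ℂ → ℂ → ℂ) → ℂ → ℂ → ℂ := fun g z η => expResolvent (fun z => N g z η) η z with hT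
  -- admissible functions
  let Adm : (ℂ → ℂ → ℂ) → Prop := fun g =>
    (∀ η ∈ borelDisc 0 d, DifferentiableOn ℂ (fun z => g z η) Y) ∧
      (∀ z ∈ Y, DifferentiableOn ℂ (g z) (borelDisc 0 d)) ∧
      (∀ z ∈ Y, ∀ η ∈ borelDisc 0 d, ‖g z η‖ ≤ 1)
  have hND : ∀ g, Adm g → ∀ η ∈ borelDisc 0 d, DifferentiableOn ℂ (fun z => N g z η) Y :=
    fun g hg η hη => ((h₀ η (hsub hη)).add ((h₁ η (hsub hη)).mul (hg.1 η hη))).add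
      ((hg.1 η hη).pow 2)
  have hND' : ∀ g, Adm g → ∀ z ∈ Y, DifferentiableOn ℂ (N g z) (borelDisc 0 d) :=
    fun g hg z hz => (((h₀' z hz).mono hsub).add (((h₁' z hz).mono hsub).mul (hg.2.1 z hz))).add
      ((hg.2.1 z hz).pow 2)
  have hNK : ∀ g, Adm g → ∀ z ∈ Y, ∀ η ∈ borelDisc 0 d, ‖N g z η‖ ≤ 2 * (K + 2) := by
    intro g hg z hz η hη
    have e1 := hK₀ z hz η (hsub hη)
    have e2 := hg.2.2 z hz η hη
    have e3 : ‖n₁ z η * g z η‖ ≤ K * 1 := by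
      rw [norm_mul]
      exact mul_le_mul (hK₁ z hz η (hsub hη)) e2 (norm_nonneg _) hK.le
    have e4 : ‖g z η ^ 2‖ ≤ 1 := by
      rw [norm_pow]
      exact pow_le_one₀ (norm_nonneg _) e2
    refine (norm_add₃_le).trans ?_
    linarith
  have hTA : ∀ g, Adm g → Adm (T g) := by
    intro g hg
    refine ⟨fun η hη => ?_, fun z hz => ?_, fun z hz η hη => ?_⟩
    · exact differentiableOn_expResolvent hO hY hd (hND g hg η hη)
        (fun z hz => hNK g hg z hz η hη) hη
    · exact differentiableOn_expResolvent_param hY hd (hND g hg) (hND' g hg) (hNK g hg) hz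
    · refine (norm_expResolvent_le hY hd (fun z hz => hNK g hg z hz η hη) hη hz).trans ?_
      linarith
  have hTL : ∀ g g', Adm g → Adm g' → ∀ η ∈ borelDisc 0 d, ∀ B : ℝ,
      (∀ z ∈ Y, ‖g z η - g' z η‖ ≤ B) → ∀ z ∈ Y, ‖T g z η - T g' z η‖ ≤ 1 / 2 * B := by
    intro g g' hg hg' η hη B hB z hz
    have hB0 : 0 ≤ B := (norm_nonneg _).trans (hB z hz)
    simp only [hT]
    rw [expResolvent_sub hY hd (hND g hg η hη).continuousOn (fun z hz => hNK g hg z hz η hη)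
      (hND g' hg' η hη).continuousOn (fun z hz => hNK g' hg' z hz η hη) hη hz]
    refine (norm_expResolvent_le hY hd (K := (K + 2) * B) (fun z hz => ?_) hη hz).trans ?_
    · have e : N g z η - N g' z η = (n₁ z η + (g z η + g' z η)) * (g z η - g' z η) := by
        simp only [hN]; ring
      rw [e, norm_mul]
      refine mul_le_mul ?_ (hB z hz) (norm_nonneg _) (by positivity)
      refine (norm_add_le _ _).trans (add_le_add (hK₁ z hz η (hsub hη)) ?_)
      refine (norm_add_le _ _).trans ?_
      linarith [hg.2.2 z hz η hη, hg'.2.2 z hz η hη]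
    · rw [← mul_assoc]
      exact mul_le_mul_of_nonneg_right hdK hB0
  set u : ℕ → ℂ → ℂ → ℂ := fun k => T^[k] (fun _ _ => 0) with hu
  have husucc : ∀ k, u (k + 1) = T (u k) := fun k => Function.iterate_succ_apply' T k _
  have huA : ∀ k, Adm (u k) := by
    intro k
    induction k with
    | zero =>
      exact ⟨fun _ _ => differentiableOn_const _, fun _ _ => differentiableOn_const _,
        fun _ _ _ _ => by simp [hu]⟩
    | succ k ih => rw [husucc]; exact hTA _ ih
  have hdist : ∀ η ∈ borelDisc 0 d, ∀ k, ∀ z ∈ Y, ‖u (k + 1) z η - u k z η‖ ≤ 1 * (1 / 2) ^ k := by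
    intro η hη k
    induction k with
    | zero =>
      intro z hz
      have := (huA 1).2.2 z hz η hη
      simpa [hu] using this
    | succ k ih =>
      intro z hz
      have := hTL _ _ (huA (k + 1)) (huA k) η hη _ ih z hz
      rw [husucc (k + 1), husucc k]
      rw [husucc k] at this
      refine this.trans (le_of_eq ?_)
      rw [pow_succ]
      ring
  have hdist' : ∀ η ∈ borelDisc 0 d, ∀ z ∈ Y, ∀ k, dist (u k z η) (u (k + 1) z η) ≤
      1 * (1 / 2) ^ k := fun η hη z hz k => by
    rw [dist_comm, dist_eq_norm]
    exact hdist η hη k z hz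
  have hlim : ∀ z η, ∃ g, z ∈ Y → η ∈ borelDisc 0 d → Tendsto (fun k => u k z η) atTop (𝓝 g) := by
    intro z η
    by_cases hz : z ∈ Y
    · by_cases hη : η ∈ borelDisc 0 d
      · obtain ⟨g, hg⟩ := cauchySeq_tendsto_of_complete
          (cauchySeq_of_le_geometric (1 / 2) 1 (by norm_num) (hdist' η hη z hz))
        exact ⟨g, fun _ _ => hg⟩
      · exact ⟨0, fun _ h => absurd h hη⟩
    · exact ⟨0, fun h => absurd h hz⟩
  choose G hG using hlim
  have hGA : Adm G := by
    refine ⟨fun η hη => ?_, fun z hz => ?_, fun z hz η hη => ?_⟩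
    · exact (tendstoLocallyUniformlyOn_of_bounded hO (fun k => (huA k).1 η hη)
        (fun z hz => ⟨Y, hO.mem_nhds hz, 1, fun k w hw => (huA k).2.2 w hw η hη⟩)
        (fun z hz => hG z η hz hη)).differentiableOn
          (Eventually.of_forall fun k => (huA k).1 η hη) hO
    · exact (tendstoLocallyUniformlyOn_of_bounded (isOpen_borelDisc hd) (fun k => (huA k).2.1 z hz)
        (fun η hη => ⟨borelDisc 0 d, (isOpen_borelDisc hd).mem_nhds hη, 1,
          fun k w hw => (huA k).2.2 z hz w hw⟩)
        (fun η hη => hG z η hz hη)).differentiableOn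
          (Eventually.of_forall fun k => (huA k).2.1 z hz) (isOpen_borelDisc hd)
    · exact le_of_tendsto (hG z η hz hη).norm (Eventually.of_forall fun k => (huA k).2.2 z hz η hη)
  have hfix : ∀ z ∈ Y, ∀ η ∈ borelDisc 0 d, G z η = T G z η := by
    intro z hz η hη
    have h1 : ∀ k, ‖u (k + 1) z η - T G z η‖ ≤ 1 / 2 * (1 * (1 / 2) ^ k / (1 - 1 / 2)) := by
      intro k
      rw [husucc]
      refine hTL _ _ (huA k) hGA η hη _ (fun w hw => ?_) z hz
      rw [← dist_eq_norm]
      exact dist_le_of_le_geometric_of_tendsto (1 / 2) 1 (by norm_num) (hdist' η hη w hw)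
        (hG w η hw hη) k
    have h2 : Tendsto (fun k => u (k + 1) z η) atTop (𝓝 (T G z η)) := by
      rw [tendsto_iff_norm_sub_tendsto_zero]
      refine squeeze_zero (fun _ => norm_nonneg _) h1 ?_
      have := (tendsto_pow_atTop_nhds_zero_of_lt_one (r := (1 / 2 : ℝ)) (by norm_num)
        (by norm_num))
      have h3 := ((this.const_mul (1 : ℝ)).div_const (1 - 1 / 2)).const_mul (1 / 2 : ℝ)
      simpa using h3
    exact tendsto_nhds_unique ((hG z η hz hη).comp (tendsto_add_atTop_nat 1)) h2
  refine ⟨d, hd, hdδ, G, hGA.1, hGA.2.1, hGA.2.2, fun z hz η hη => ?_⟩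
  have h1 := hasDerivAt_expResolvent hO hY hd (hND G hGA η hη) (fun z hz => hNK G hGA z hz η hη)
    hη hz
  have h2 : (fun z => G z η) =ᶠ[𝓝 z] expResolvent (fun z => N G z η) η := by
    filter_upwards [hO.mem_nhds hz] with w hw using hfix w hw η hη
  refine (h1.congr_of_eventuallyEq h2).congr_deriv ?_
  have h3 : expResolvent (fun z => N G z η) η z = G z η := (hfix z hz η hη).symm
  rw [h3]

end WKB

end

noncomputable section

namespace WKB

/-! ### Flowing out along WKB rays -/

/-- Two square roots with a common nonzero limit cannot eventually differ by a sign; this matches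
branches of √D along rays. -/
theorem eventually_eq_of_sq_eq {α : Type*} {l : Filter α} {f g : α → ℂ} {a : ℂ} (ha : a ≠ 0)
    (hf : Tendsto f l (𝓝 a)) (hg : Tendsto g l (𝓝 a)) (h : ∀ᶠ x in l, f x ^ 2 = g x ^ 2) :
    ∀ᶠ x in l, f x = g x := by
  have h2 : (a + a) ≠ 0 := by rw [← two_mul]; exact mul_ne_zero two_ne_zero ha
  filter_upwards [h, (hf.add hg).eventually_ne h2] with x h1 h3
  have : (f x - g x) * (f x + g x) = 0 := by linear_combination h1
  exact sub_eq_zero.1 ((mul_eq_zero.1 this).resolve_right h3)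

/-- `γ` is a solution of `√D γ' = c` on `s`, and `ρ` is the branch of `√D` along it. -/
def IsRayOn (X : Set ℂ) (D : ℂ → ℂ) (c : ℂ) (s : Set ℝ) (γ ρ : ℝ → ℂ) : Prop :=
  ContinuousOn ρ s ∧ ∀ t ∈ s, γ t ∈ X ∧ ρ t ≠ 0 ∧ ρ t ^ 2 = D (γ t) ∧
    HasDerivWithinAt γ (c / ρ t) s t

theorem IsRayOn.mono {X : Set ℂ} {D : ℂ → ℂ} {c : ℂ} {s s' : Set ℝ} {γ ρ : ℝ → ℂ}
    (h : IsRayOn X D c s γ ρ) (hs : s' ⊆ s) : IsRayOn X D c s' γ ρ :=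
  ⟨h.1.mono hs, fun t ht => ⟨(h.2 t (hs ht)).1, (h.2 t (hs ht)).2.1, (h.2 t (hs ht)).2.2.1,
    (h.2 t (hs ht)).2.2.2.mono hs⟩⟩

/-- `g` is a holomorphic solution of `√D g' = c` on `N`, and `σ` is the branch of `√D` along it. -/
def IsFlowOn (X : Set ℂ) (D : ℂ → ℂ) (c : ℂ) (N : Set ℂ) (g σ : ℂ → ℂ) : Prop :=
  ∀ z ∈ N, g z ∈ X ∧ σ z ≠ 0 ∧ σ z ^ 2 = D (g z) ∧ HasDerivAt g (c / σ z) z ∧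
    DifferentiableAt ℂ σ z

theorem IsFlowOn.mono {X : Set ℂ} {D : ℂ → ℂ} {c : ℂ} {N N' : Set ℂ} {g σ : ℂ → ℂ}
    (h : IsFlowOn X D c N g σ) (hN : N' ⊆ N) : IsFlowOn X D c N' g σ := fun z hz => h z (hN hz)

theorem IsFlowOn.isRayOn {X : Set ℂ} {D : ℂ → ℂ} {c : ℂ} {N : Set ℂ} {g σ : ℂ → ℂ}
    (h : IsFlowOn X D c N g σ) {s : Set ℝ} (b : ℂ) (hs : ∀ t ∈ s, b + t ∈ N) :
    IsRayOn X D c s (fun t => g (b + t)) fun t => σ (b + t) := by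
  refine ⟨fun t ht => ?_, fun t ht => ?_⟩
  · have h1 := (h _ (hs t ht)).2.2.2.2.continuousAt
    exact (ContinuousAt.comp (f := fun t : ℝ => b + (t : ℂ)) h1 (by fun_prop)).continuousWithinAt
  · obtain ⟨h1, h2, h3, h4, -⟩ := h _ (hs t ht)
    refine ⟨h1, h2, h3, ?_⟩
    exact (h4.comp_const_add b _).comp_ofReal.hasDerivWithinAt

/-- A primitive P of a local branch of √D is a local Liouville coordinate, and its inverse evaluated
at cz is the flow. Any ray satisfies P(γ(t)) = c(t - t₀) because the difference has zero derivative,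
hence coincides with the flow. -/
theorem exists_local_flow {X : Set ℂ} (hX : IsOpen X) {D : ℂ → ℂ} (hD : DifferentiableOn ℂ D X)
    {c : ℂ} {y₀ ρ₀ : ℂ} (hy : y₀ ∈ X) (hρ0 : ρ₀ ≠ 0) (hρ : ρ₀ ^ 2 = D y₀) :
    ∃ η > 0, ∃ h σ : ℂ → ℂ, h 0 = y₀ ∧ σ 0 = ρ₀ ∧ IsFlowOn X D c (Metric.ball 0 η) h σ ∧
      ∀ (s : Set ℝ) (γ ρ : ℝ → ℂ) (t₀ : ℝ), Convex ℝ s → IsRayOn X D c s γ ρ → t₀ ∈ s →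
        γ t₀ = y₀ → ρ t₀ = ρ₀ →
        ∀ᶠ t : ℝ in 𝓝[s] t₀, γ t = h ((t - t₀ : ℝ) : ℂ) ∧ ρ t = σ ((t - t₀ : ℝ) : ℂ) := by
  have hD0 : D y₀ ≠ 0 := by rw [← hρ]; exact pow_ne_zero 2 hρ0
  have hDc : ContinuousAt D y₀ := (hD.differentiableAt (hX.mem_nhds hy)).continuousAt
  obtain ⟨e, he, hball⟩ := Metric.mem_nhds_iff.1 (inter_mem (hX.mem_nhds hy)
    (hDc.eventually_ne hD0))
  have hyb : y₀ ∈ Metric.ball y₀ e := Metric.mem_ball_self he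
  -- the branch of the square root
  obtain ⟨R, hR2, hR0, hRd, hRy⟩ : ∃ R : ℂ → ℂ, (∀ z ∈ Metric.ball y₀ e, R z ^ 2 = D z) ∧
      (∀ z ∈ Metric.ball y₀ e, R z ≠ 0) ∧ DifferentiableOn ℂ R (Metric.ball y₀ e) ∧
      R y₀ = ρ₀ := by
    have hsc : IsSimplyConnected (Metric.ball y₀ e) := by
      have := (convex_ball y₀ e).contractibleSpace ⟨y₀, hyb⟩
      exact SimplyConnectedSpace.ofContractible _
    obtain ⟨R, h1, h2, h3⟩ := exists_holomorphic_sqrt Metric.isOpen_ball hsc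
      (hD.mono fun z hz => (hball hz).1) fun z hz => (hball hz).2
    have h4 : DifferentiableOn ℂ R (Metric.ball y₀ e) := fun z hz =>
      (h3 z hz).differentiableAt.differentiableWithinAt
    have h5 : R y₀ = ρ₀ ∨ R y₀ = -ρ₀ := by
      rw [← sq_eq_sq_iff_eq_or_eq_neg, h1 y₀ hyb, hρ]
    rcases h5 with h5 | h5
    · exact ⟨R, h1, h2, h4, h5⟩
    · refine ⟨fun z => -R z, fun z hz => by rw [neg_sq, h1 z hz], fun z hz => neg_ne_zero.2 (h2 z hz),
        h4.neg, by simp [h5]⟩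
  -- its primitive and the inverse of the primitive
  obtain ⟨P, hPy, hP⟩ := hRd.isExactOn_ball.with_val_at y₀ 0
  have hPd : DifferentiableOn ℂ P (Metric.ball y₀ e) := fun z hz =>
    (hP z hz).differentiableAt.differentiableWithinAt
  have hPa : AnalyticAt ℂ P y₀ := hPd.analyticAt (Metric.ball_mem_nhds _ he)
  have hP' : deriv P y₀ ≠ 0 := by rw [(hP y₀ hyb).deriv, hRy]; exact hρ0
  obtain ⟨Q, hQa, hQl, hQr⟩ : ∃ Q : ℂ → ℂ, AnalyticAt ℂ Q 0 ∧ (∀ᶠ z in 𝓝 y₀, Q (P z) = z) ∧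
      ∀ᶠ w in 𝓝 (0 : ℂ), P (Q w) = w := by
    refine ⟨hPa.hasStrictDerivAt.localInverse _ _ _ hP', ?_, ?_, ?_⟩
    · rw [← hPy]; exact hPa.analyticAt_localInverse hP'
    · exact hPa.hasStrictDerivAt.eventually_left_inverse hP'
    · rw [← hPy]; exact hPa.hasStrictDerivAt.eventually_right_inverse hP'
  have hQ0 : Q 0 = y₀ := by rw [← hPy]; exact hQl.self_of_nhds
  have hQc : ∀ᶠ w in 𝓝 (0 : ℂ), Q w ∈ Metric.ball y₀ e := by
    refine hQa.continuousAt.eventually_mem ?_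
    rw [hQ0]; exact Metric.ball_mem_nhds _ he
  have hall : ∀ᶠ w in 𝓝 (0 : ℂ), Q w ∈ Metric.ball y₀ e ∧ AnalyticAt ℂ Q w ∧
      ∀ᶠ w' in 𝓝 w, P (Q w') = w' :=
    hQc.and (hQa.eventually_analyticAt.and hQr.eventually_nhds)
  have hscale : Tendsto (fun z : ℂ => c * z) (𝓝 0) (𝓝 0) :=
    Continuous.tendsto' (by fun_prop) _ _ (by simp)
  obtain ⟨η, hη, hηs⟩ := Metric.mem_nhds_iff.1 (hscale.eventually hall)
  refine ⟨η, hη, fun z => Q (c * z), fun z => R (Q (c * z)), by simp [hQ0], by simp [hQ0, hRy],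
    ?_, ?_⟩
  · intro z hz
    obtain ⟨h1, h2, h3⟩ := hηs hz
    have hd : HasDerivAt Q (1 / R (Q (c * z))) (c * z) := by
      have h4 := (hP _ h1).comp (c * z) h2.differentiableAt.hasDerivAt
      have h5 : HasDerivAt (P ∘ Q) 1 (c * z) :=
        (hasDerivAt_id (c * z)).congr_of_eventuallyEq h3
      have h6 := h4.unique h5
      refine h2.differentiableAt.hasDerivAt.congr_deriv ?_
      rw [eq_div_iff (hR0 _ h1), mul_comm]
      exact h6
    have hd2 : HasDerivAt (fun z => Q (c * z)) (c / R (Q (c * z))) z := by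
      have := hd.comp z ((hasDerivAt_id z).const_mul c)
      refine this.congr_deriv ?_
      simp only [mul_one]
      ring
    refine ⟨(hball h1).1, hR0 _ h1, hR2 _ h1, hd2, ?_⟩
    exact (hRd.differentiableAt (Metric.isOpen_ball.mem_nhds h1)).comp z hd2.differentiableAt
  · intro s γ ρ t₀ hs hγ ht₀ hγ0 hρ0'
    have hγc : ContinuousWithinAt γ s t₀ := (hγ.2 t₀ ht₀).2.2.2.continuousWithinAt
    have hγt : Tendsto γ (𝓝[s] t₀) (𝓝 y₀) := by rw [← hγ0]; exact hγc
    have hρt : Tendsto ρ (𝓝[s] t₀) (𝓝 ρ₀) := by rw [← hρ0']; exact hγ.1 t₀ ht₀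
    have e1 : ∀ᶠ t in 𝓝[s] t₀, γ t ∈ Metric.ball y₀ e := hγt.eventually (Metric.ball_mem_nhds _ he)
    have hRt : Tendsto (fun t => R (γ t)) (𝓝[s] t₀) (𝓝 ρ₀) := by
      rw [← hRy]
      exact ((hRd.differentiableAt (Metric.ball_mem_nhds _ he)).continuousAt.tendsto).comp hγt
    have e2 : ∀ᶠ t in 𝓝[s] t₀, R (γ t) = ρ t := by
      refine eventually_eq_of_sq_eq hρ0 hRt hρt ?_
      filter_upwards [e1, self_mem_nhdsWithin] with t h1 h2
      rw [hR2 _ h1, (hγ.2 t h2).2.2.1]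
    have e3 : ∀ᶠ t in 𝓝[s] t₀, Q (P (γ t)) = γ t := hγt.eventually hQl
    obtain ⟨κ, hκ, hκs⟩ := Metric.mem_nhdsWithin_iff.1 (e1.and e2)
    have hconv : Convex ℝ (Metric.ball t₀ κ ∩ s) := (convex_ball t₀ κ).inter hs
    have hder : ∀ t ∈ Metric.ball t₀ κ ∩ s, HasDerivWithinAt (fun t : ℝ => P (γ t) - c * (t : ℂ)) 0
        (Metric.ball t₀ κ ∩ s) t := by
      intro t ht
      obtain ⟨h1, h2⟩ := hκs ht
      have h3 := (hγ.2 t ht.2).2.2.2.mono (inter_subset_right : Metric.ball t₀ κ ∩ s ⊆ s)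
      have h4 := (hP _ h1).comp_hasDerivWithinAt t h3
      have h5 : HasDerivAt (fun t : ℝ => c * (t : ℂ)) (c * 1) t :=
        ((hasDerivAt_id ((t : ℝ) : ℂ)).const_mul c).comp_ofReal
      refine (h4.sub h5.hasDerivWithinAt).congr_deriv ?_
      have h6 : R (γ t) ≠ 0 := hR0 _ h1
      rw [← h2]
      field_simp
      ring
    have hmem : t₀ ∈ Metric.ball t₀ κ ∩ s := ⟨Metric.mem_ball_self hκ, ht₀⟩
    have hκn : Metric.ball t₀ κ ∩ s ∈ 𝓝[s] t₀ := Metric.mem_nhdsWithin_iff.2 ⟨κ, hκ, subset_rfl⟩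
    filter_upwards [e3, hκn] with t h3 ht
    have h4 := hconv.norm_image_sub_le_of_norm_hasDerivWithin_le hder
      (fun t _ => (norm_zero (E := ℂ)).le) hmem ht
    rw [zero_mul, norm_le_zero_iff, hγ0, hPy] at h4
    have h5 : P (γ t) = c * ((t - t₀ : ℝ) : ℂ) := by
      push_cast
      linear_combination h4
    rw [← h5, h3]
    exact ⟨rfl, (hκs ht).2.symm⟩

/-- The set of coincidence is closed by continuity and can be continued to the right by the
uniqueness clause of `exists_local_flow`. The branch has to be followed together with the point. -/
theorem IsRayOn.eqOn {X : Set ℂ} (hX : IsOpen X) {D : ℂ → ℂ} (hD : DifferentiableOn ℂ D X)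
    {c : ℂ} {a b : ℝ} {γ₁ ρ₁ γ₂ ρ₂ : ℝ → ℂ} (h₁ : IsRayOn X D c (Icc a b) γ₁ ρ₁)
    (h₂ : IsRayOn X D c (Icc a b) γ₂ ρ₂) (hγ : γ₁ a = γ₂ a) (hρ : ρ₁ a = ρ₂ a) :
    ∀ t ∈ Icc a b, γ₁ t = γ₂ t ∧ ρ₁ t = ρ₂ t := by
  have hc₁ : ContinuousOn γ₁ (Icc a b) := fun t ht => (h₁.2 t ht).2.2.2.continuousWithinAt
  have hc₂ : ContinuousOn γ₂ (Icc a b) := fun t ht => (h₂.2 t ht).2.2.2.continuousWithinAt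
  have hcl : IsClosed ({t | γ₁ t = γ₂ t ∧ ρ₁ t = ρ₂ t} ∩ Icc a b) := by
    have h3 : IsClosed {t | t ∈ Icc a b ∧ (γ₁ t - γ₂ t, ρ₁ t - ρ₂ t) ∈ ({(0, 0)} : Set (ℂ × ℂ))} :=
      ((hc₁.sub hc₂).prodMk (h₁.1.sub h₂.1)).preimage_isClosed_of_isClosed isClosed_Icc
        isClosed_singleton
    convert h3 using 1
    ext t
    simp only [mem_inter_iff, mem_ofPred_eq, mem_singleton_iff, Prod.mk.injEq, sub_eq_zero]
    tauto
  have hsub : Icc a b ⊆ {t | γ₁ t = γ₂ t ∧ ρ₁ t = ρ₂ t} := by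
    refine hcl.Icc_subset_of_forall_mem_nhdsWithin ⟨hγ, hρ⟩ ?_
    rintro t ⟨⟨h3, h4⟩, ht⟩
    have htI : t ∈ Icc a b := Ico_subset_Icc_self ht
    obtain ⟨hX1, h5, h6, -⟩ := h₁.2 t htI
    obtain ⟨η, hη, h, σ, -, -, -, H⟩ := exists_local_flow hX hD hX1 h5 h6
    have k1 := H _ γ₁ ρ₁ t (convex_Icc a b) h₁ htI rfl rfl
    have k2 := H _ γ₂ ρ₂ t (convex_Icc a b) h₂ htI h3.symm h4.symm
    have k3 : ∀ᶠ s in 𝓝[Icc a b] t, γ₁ s = γ₂ s ∧ ρ₁ s = ρ₂ s := by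
      filter_upwards [k1, k2] with s h7 h8
      exact ⟨h7.1.trans h8.1.symm, h7.2.trans h8.2.symm⟩
    rw [← nhdsWithin_Ioc_eq_nhdsGT ht.2]
    exact nhdsWithin_mono t (fun s (hs : s ∈ Ioc t b) => (⟨ht.1.trans hs.1.le, hs.2⟩ : s ∈ Icc a b)) k3
  exact fun t ht => hsub ht

/-- The half-strip `{z | -ρ < Re z, |Im z| < ρ}`. -/
def halfStrip (ρ : ℝ) : Set ℂ := {z | -ρ < z.re ∧ |z.im| < ρ}

theorem isOpen_halfStrip (ρ : ℝ) : IsOpen (halfStrip ρ) :=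
  (isOpen_lt continuous_const Complex.continuous_re).inter
    (isOpen_lt (continuous_abs.comp Complex.continuous_im) continuous_const)

/-- Local flows at the points of a ray agree with it on the real axis and therefore glue. The branch
is recovered as c/H'. At time 0 the given flow itself is used, so the result extends it on the whole
initial disc. -/
theorem exists_flow_along_ray {X : Set ℂ} (hX : IsOpen X) {D : ℂ → ℂ}
    (hD : DifferentiableOn ℂ D X) {c : ℂ} (hc : c ≠ 0) {η₀ : ℝ} (hη₀ : 0 < η₀) {g₀ σ₀ : ℂ → ℂ}
    (h₀ : IsFlowOn X D c (Metric.ball 0 η₀) g₀ σ₀) {γ ρ : ℝ → ℂ}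
    (hγ : IsRayOn X D c (Ici 0) γ ρ) (hγ0 : γ 0 = g₀ 0) (hρ0 : ρ 0 = σ₀ 0) :
    ∃ (N : Set ℂ) (H τ : ℂ → ℂ), IsOpen N ∧ (∀ t : ℝ, 0 ≤ t → (t : ℂ) ∈ N) ∧
      IsFlowOn X D c N H τ ∧ Metric.ball 0 η₀ ⊆ N ∧
      ∀ z ∈ Metric.ball (0 : ℂ) η₀, H z = g₀ z ∧ τ z = σ₀ z := by
  have key : ∀ t : ℝ, ∃ (η : ℝ) (h σ : ℂ → ℂ), 0 ≤ t → 0 < η ∧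
      IsFlowOn X D c (Metric.ball (t : ℂ) η) h σ ∧
      (∀ s : ℝ, 0 ≤ s → |s - t| < η → h s = γ s) ∧ (t = 0 → η = η₀ ∧ h = g₀ ∧ σ = σ₀) := by
    intro t
    by_cases ht : 0 ≤ t
    swap
    · exact ⟨0, 0, 0, fun h => absurd h ht⟩
    rcases ht.eq_or_lt with rfl | ht0
    · refine ⟨η₀, g₀, σ₀, fun _ => ⟨hη₀, by simpa using h₀, fun s hs hsη => ?_, fun _ =>
        ⟨rfl, rfl, rfl⟩⟩⟩
      rw [sub_zero, abs_of_nonneg hs] at hsη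
      have h1 := h₀.isRayOn (s := Icc 0 s) 0 fun t ht => by
        rw [zero_add, mem_ball_zero_iff, Complex.norm_real, Real.norm_of_nonneg ht.1]
        exact ht.2.trans_lt hsη
      have h2 := (h1.eqOn hX hD (hγ.mono Icc_subset_Ici_self) (by simp [hγ0]) (by simp [hρ0])
        s ⟨hs, le_rfl⟩).1
      simpa using h2
    · obtain ⟨h1, h2, h3, -⟩ := hγ.2 t ht
      obtain ⟨η, hη, h, σ, -, -, hflow, H⟩ := exists_local_flow hX hD h1 h2 h3
      obtain ⟨κ, hκ, hκs⟩ := Metric.mem_nhdsWithin_iff.1 (H _ γ ρ t (convex_Ici 0) hγ ht rfl rfl)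
      refine ⟨min η κ, fun z => h (z - t), fun z => σ (z - t), fun _ =>
        ⟨lt_min hη hκ, fun z hz => ?_, fun s hs hsη => ?_, fun h => absurd h ht0.ne'⟩⟩
      · have hz' : z - t ∈ Metric.ball (0 : ℂ) η := by
          rw [mem_ball_zero_iff]
          exact (mem_ball_iff_norm.1 hz).trans_le (min_le_left _ _)
        obtain ⟨f1, f2, f3, f4, f5⟩ := hflow _ hz'
        refine ⟨f1, f2, f3, f4.comp_sub_const z _, ?_⟩
        exact f5.comp z (by fun_prop)
      · have := (hκs ⟨by rw [Metric.mem_ball, Real.dist_eq]; exact hsη.trans_le (min_le_right _ _),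
          hs⟩).1
        simpa using this.symm
  choose η h σ hk using key
  obtain ⟨H, hH⟩ := exists_glue_along_ray (η := η) (h := h) (c := γ)
    (fun t ht z hz => ((hk t ht).2.1 z hz).2.2.2.1.differentiableAt.differentiableWithinAt)
    (fun t ht => (hk t ht).2.2.1)
  have hHe : ∀ t : ℝ, 0 ≤ t → ∀ z ∈ Metric.ball (t : ℂ) (η t), H =ᶠ[𝓝 z] h t := fun t ht z hz =>
    (hH t ht).eventuallyEq_of_mem (Metric.isOpen_ball.mem_nhds hz)
  have hτ : ∀ t : ℝ, 0 ≤ t → ∀ z ∈ Metric.ball (t : ℂ) (η t), c / deriv H z = σ t z := by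
    intro t ht z hz
    rw [(hHe t ht z hz).deriv_eq, ((hk t ht).2.1 z hz).2.2.2.1.deriv]
    have := ((hk t ht).2.1 z hz).2.1
    field_simp
  refine ⟨⋃ t ∈ Ici (0 : ℝ), Metric.ball (t : ℂ) (η t), H, fun z => c / deriv H z,
    isOpen_biUnion fun _ _ => Metric.isOpen_ball, fun t ht => ?_, fun z hz => ?_, ?_, fun z hz => ?_⟩
  · exact mem_biUnion (mem_Ici.2 ht) (Metric.mem_ball_self (hk t ht).1)
  · obtain ⟨t, ht, hz⟩ := mem_iUnion₂.1 hz
    obtain ⟨f1, f2, f3, f4, f5⟩ := (hk t ht).2.1 z hz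
    beta_reduce
    rw [hτ t ht z hz, hH t ht hz]
    refine ⟨f1, f2, f3, f4.congr_of_eventuallyEq (hHe t ht z hz), ?_⟩
    refine f5.congr_of_eventuallyEq ?_
    filter_upwards [Metric.isOpen_ball.mem_nhds hz] with w hw using hτ t ht w hw
  · obtain ⟨e1, -, -⟩ := (hk 0 le_rfl).2.2.2 rfl
    refine subset_trans ?_ (subset_biUnion_of_mem (u := fun t : ℝ => Metric.ball (t : ℂ) (η t))
      (mem_Ici.2 (le_refl (0 : ℝ))))
    simp [e1]
  · obtain ⟨e1, e2, e3⟩ := (hk 0 le_rfl).2.2.2 rfl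
    have hz' : z ∈ Metric.ball ((0 : ℝ) : ℂ) (η 0) := by rw [e1]; simpa using hz
    exact ⟨by rw [hH 0 le_rfl hz', e2], by beta_reduce; rw [hτ 0 le_rfl z hz', e3]⟩

/-- Each point of the half-strip is reached from the left edge by a complete ray. Near such a point
the map so defined coincides with the holomorphic flow along one ray, by uniqueness of rays, hence
is holomorphic. -/
theorem exists_strip_flow {X : Set ℂ} (hX : IsOpen X) {D : ℂ → ℂ} (hD : DifferentiableOn ℂ D X)
    {c : ℂ} (hc : c ≠ 0) {ρ : ℝ} (hρ : 0 < ρ) {g₀ σ₀ : ℂ → ℂ}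
    (h₀ : IsFlowOn X D c (Metric.ball 0 (2 * ρ)) g₀ σ₀) {γ P : ℂ → ℝ → ℂ}
    (hγ : ∀ z ∈ Metric.ball (0 : ℂ) (2 * ρ), IsRayOn X D c (Ici 0) (γ z) (P z) ∧
      γ z 0 = g₀ z ∧ P z 0 = σ₀ z) :
    ∃ g σ : ℂ → ℂ, IsFlowOn X D c (halfStrip ρ) g σ ∧
      (∀ z ∈ halfStrip ρ, g z = γ (-ρ + z.im * Complex.I) (z.re + ρ)) ∧
      ∀ z ∈ Metric.ball (0 : ℂ) ρ, g z = g₀ z ∧ σ z = σ₀ z := by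
  have hstart : ∀ y : ℝ, |y| < ρ → (-ρ + y * Complex.I : ℂ) ∈ Metric.ball (0 : ℂ) (2 * ρ) := by
    intro y hy
    rw [mem_ball_zero_iff]
    refine (norm_add_le _ _).trans_lt ?_
    rw [norm_neg, norm_mul, Complex.norm_I, Complex.norm_real, Complex.norm_real,
      Real.norm_of_nonneg hρ.le, Real.norm_eq_abs]
    linarith
  -- The ray starts at the point of the left edge with the same imaginary part and runs for the time
  -- Re z + ρ.
  refine ⟨fun z => γ (-ρ + z.im * Complex.I) (z.re + ρ),
    fun z => P (-ρ + z.im * Complex.I) (z.re + ρ), ?_, fun z _ => rfl, ?_⟩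
  · intro w hw
    set a : ℂ := -ρ + w.im * Complex.I with ha
    have hab := hstart w.im hw.2
    obtain ⟨hr1, hr2, hr3⟩ := hγ a hab
    obtain ⟨η₀, hη₀, hη₀s⟩ := Metric.isOpen_ball.mem_nhds hab |> Metric.mem_nhds_iff.1
    have hflow0 : IsFlowOn X D c (Metric.ball 0 η₀) (fun z => g₀ (a + z)) fun z => σ₀ (a + z) := by
      intro z hz
      have hz' : a + z ∈ Metric.ball a η₀ := by simpa using hz
      obtain ⟨f1, f2, f3, f4, f5⟩ := h₀ _ (hη₀s hz')
      exact ⟨f1, f2, f3, f4.comp_const_add a z, f5.comp z (by fun_prop)⟩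
    obtain ⟨N, H, τ, hN, hNt, hHf, hN0, hH0⟩ := exists_flow_along_ray hX hD hc hη₀ hflow0 hr1
      (by simp [hr2]) (by simp [hr3])
    set T : ℝ := w.re + ρ + 1 with hT
    have hwre : 0 < w.re + ρ := by have := hw.1; linarith
    have hcomp : IsCompact ((fun t : ℝ => (t : ℂ)) '' Icc 0 T) :=
      isCompact_Icc.image (by fun_prop)
    -- The flow neighbourhood N may narrow at infinity, but it has a uniform width κ over the finite
    -- times needed near w.
    obtain ⟨κ, hκ, hκN⟩ := hcomp.exists_thickening_subset_open hN
      (by rintro _ ⟨t, ht, rfl⟩; exact hNt t ht.1)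
    -- identification of the flow with the rays
    have hid : ∀ z : ℂ, |z.im - w.im| < κ → |z.im - w.im| < η₀ → |z.im| < ρ → 0 ≤ z.re + ρ →
        z.re + ρ ≤ T → γ (-ρ + z.im * Complex.I) (z.re + ρ) = H (z - a) ∧
          P (-ρ + z.im * Complex.I) (z.re + ρ) = τ (z - a) := by
      intro z hz1 hz2 hz3 hz4 hz5
      set y : ℂ := ((z.im - w.im : ℝ) : ℂ) * Complex.I with hy
      have hyn : ‖y‖ = |z.im - w.im| := by
        rw [hy, norm_mul, Complex.norm_I, mul_one, Complex.norm_real, Real.norm_eq_abs]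
      have hrayH := hHf.isRayOn (s := Icc 0 T) y fun t ht => hκN (by
        rw [Metric.mem_thickening_iff]
        refine ⟨_, ⟨t, ht, rfl⟩, ?_⟩
        rw [dist_eq_norm, add_sub_cancel_right, hyn]
        exact hz1)
      obtain ⟨k1, k2, k3⟩ := hγ _ (hstart z.im hz3)
      have hy0 : y ∈ Metric.ball (0 : ℂ) η₀ := by rw [mem_ball_zero_iff, hyn]; exact hz2
      have hay : a + y = -ρ + z.im * Complex.I := by
        rw [ha, hy]; push_cast; ring
      have := (k1.mono (Icc_subset_Ici_self : Icc 0 T ⊆ Ici 0)).eqOn hX hD hrayH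
        (by simp only [Complex.ofReal_zero, add_zero]; rw [k2, (hH0 y hy0).1, hay])
        (by simp only [Complex.ofReal_zero, add_zero]; rw [k3, (hH0 y hy0).2, hay])
        (z.re + ρ) ⟨hz4, hz5⟩
      have hza : y + ((z.re + ρ : ℝ) : ℂ) = z - a := by
        rw [ha, hy]
        apply Complex.ext <;> simp
      rwa [hza] at this
    have hwN : w - a ∈ N := by
      have : w - a = ((w.re + ρ : ℝ) : ℂ) := by
        rw [ha]
        apply Complex.ext <;> simp
      rw [this]
      exact hNt _ hwre.le
    obtain ⟨f1, f2, f3, f4, f5⟩ := hHf _ hwN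
    have hwid := hid w (by simpa using hκ) (by simpa using hη₀) hw.2 hwre.le (by linarith)
    have hev : ∀ᶠ z in 𝓝 w, γ (-ρ + z.im * Complex.I) (z.re + ρ) = H (z - a) ∧
          P (-ρ + z.im * Complex.I) (z.re + ρ) = τ (z - a) := by
      have c1 : Tendsto (fun z : ℂ => |z.im - w.im|) (𝓝 w) (𝓝 0) := by
        have : Continuous fun z : ℂ => |z.im - w.im| := by fun_prop
        exact this.tendsto' _ _ (by simp)
      have c2 : Tendsto (fun z : ℂ => |z.im|) (𝓝 w) (𝓝 |w.im|) :=
        Continuous.tendsto (by fun_prop) w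
      have c3 : Tendsto (fun z : ℂ => z.re + ρ) (𝓝 w) (𝓝 (w.re + ρ)) :=
        Continuous.tendsto (by fun_prop) w
      filter_upwards [c1.eventually_lt_const hκ, c1.eventually_lt_const hη₀,
        c2.eventually_lt_const hw.2, c3.eventually_const_lt hwre,
        c3.eventually_lt_const (show w.re + ρ < T by linarith)] with z h1 h2 h3 h4 h5
      exact hid z h1 h2 h3 h4.le h5.le
    refine ⟨?_, ?_, ?_, ?_, ?_⟩
    · simp only; rw [hwid.1]; exact f1
    · simp only; rw [hwid.2]; exact f2
    · simp only; rw [hwid.1, hwid.2]; exact f3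
    · simp only
      rw [hwid.2]
      exact (f4.comp_sub_const w a).congr_of_eventuallyEq (hev.mono fun z hz => hz.1)
    · refine DifferentiableAt.congr_of_eventuallyEq ?_ (hev.mono fun z hz => hz.2)
      exact f5.comp w (by fun_prop)
  · intro z hz
    rw [mem_ball_zero_iff] at hz
    have hzi : |z.im| < ρ := (Complex.abs_im_le_norm z).trans_lt hz
    have hzr := (abs_lt.1 ((Complex.abs_re_le_norm z).trans_lt hz))
    obtain ⟨k1, k2, k3⟩ := hγ _ (hstart z.im hzi)
    have hz2 : z ∈ Metric.ball (0 : ℂ) (2 * ρ) := by rw [mem_ball_zero_iff]; linarith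
    have hray := h₀.isRayOn (s := Icc 0 (z.re + ρ)) (-ρ + z.im * Complex.I) fun t ht => by
      have hseg := (convex_ball (0 : ℂ) (2 * ρ)).add_smul_sub_mem (hstart z.im hzi) hz2
        (t := t / (z.re + ρ)) ⟨by have := ht.1; have : 0 < z.re + ρ := by linarith
                                  positivity, by
          rw [div_le_one (by linarith)]; exact ht.2⟩
      convert hseg using 1
      have h1 : ((z.re + ρ : ℝ) : ℂ) ≠ 0 := by exact_mod_cast (by linarith : z.re + ρ ≠ 0)
      have h2 : z - (-ρ + z.im * Complex.I) = ((z.re + ρ : ℝ) : ℂ) := by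
        apply Complex.ext <;> simp
      rw [h2, Complex.real_smul]
      push_cast at h1 ⊢
      rw [div_mul_cancel₀ _ h1]
    have := (k1.mono (Icc_subset_Ici_self : Icc 0 (z.re + ρ) ⊆ Ici 0)).eqOn hX hD hray
      (by simp [k2]) (by simp [k3]) (z.re + ρ) ⟨by linarith, le_rfl⟩
    have h2 : (-ρ + z.im * Complex.I : ℂ) + ((z.re + ρ : ℝ) : ℂ) = z := by
      apply Complex.ext <;> simp
    rwa [h2] at this

end WKB

end

noncomputable section

namespace WKB

/-! ### Bounded solutions of the Riccati equation on a half-strip -/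

theorem halfStrip_mono {ρ ρ' : ℝ} (h : ρ ≤ ρ') : halfStrip ρ ⊆ halfStrip ρ' :=
  fun _ hz => ⟨by linarith [hz.1], hz.2.trans_le h⟩

theorem add_mem_halfStrip {ρ : ℝ} {z : ℂ} (hz : z ∈ halfStrip ρ) (t : ℝ) (ht : 0 ≤ t) :
    z + t ∈ halfStrip ρ := by
  refine ⟨?_, ?_⟩
  · have := hz.1
    simp only [Complex.add_re, Complex.ofReal_re]
    linarith
  · simpa using hz.2

theorem norm_deriv_le_of_halfStrip {ρ K : ℝ} (hρ : 0 < ρ) {f : ℂ → ℂ}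
    (hf : DifferentiableOn ℂ f (halfStrip ρ)) (hK : ∀ z ∈ halfStrip ρ, ‖f z‖ ≤ K) {z : ℂ}
    (hz : z ∈ halfStrip (ρ / 2)) : ‖deriv f z‖ ≤ K / (ρ / 4) := by
  have hsub : Metric.closedBall z (ρ / 4) ⊆ halfStrip ρ := by
    intro w hw
    rw [mem_closedBall_iff_norm] at hw
    have h1 := abs_le.1 ((Complex.abs_re_le_norm _).trans hw)
    have h2 := abs_le.1 ((Complex.abs_im_le_norm _).trans hw)
    simp only [Complex.sub_re, Complex.sub_im] at h1 h2
    have h3 := abs_lt.1 hz.2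
    exact ⟨by linarith [hz.1], abs_lt.2 ⟨by linarith, by linarith⟩⟩
  exact Complex.norm_deriv_le_of_forall_mem_sphere_norm_le (by positivity)
    ((hf.mono hsub).diffContOnCl_ball subset_rfl)
    fun w hw => hK w (hsub (Metric.sphere_subset_closedBall hw))

/-- The pointwise algebra behind the change of unknown: once the characteristic equation for L and
the choice of a are used, the equation for G is the Riccati equation. -/
theorem riccati_of_strip {ε u η σ σ' p₀ q₀ p₁ q₁ P Q L L' a a' G : ℂ} (hε : ε = 1 ∨ ε = -1)
    (hu : u ≠ 0) (hη : η ≠ 0) (hσ : σ ≠ 0) (hL : L ^ 2 - p₀ * L + q₀ = 0) (hL2 : 2 * L = p₀ + ε * σ)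
    (ha : a = u * (q₁ / σ ^ 2 - p₁ / σ * (L / σ)) - ε * (L' / σ)) :
    u * η * (L' + u * η * ((σ' * (G - a) + σ * (G / η + (a' +
        u ^ 2 * ((Q - q₀ - q₁ * (u * η)) / ((u * η) ^ 2 * σ ^ 2) -
          (P - p₀ - p₁ * (u * η)) / ((u * η) ^ 2 * σ) * (L / σ)) + a ^ 2 -
        (-(ε * u) * ((P - p₀) / (u * η * σ)) - σ' / σ) * a +
        (-(ε * u) * ((P - p₀) / (u * η * σ)) - σ' / σ - 2 * a) * G + G ^ 2) - a')) / (ε * u))) *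
        (σ / (ε * u)) =
      (L + u * η * (σ * (G - a) / (ε * u))) ^ 2 - P * (L + u * η * (σ * (G - a) / (ε * u))) + Q := by
  rw [ha]
  rcases hε with rfl | rfl
  · field_simp
    linear_combination (-σ ^ 2) * hL + (-η * L' * σ ^ 2 + η * σ * u * q₁ - η * σ * u * p₁ * L -
      η * σ ^ 3 * G) * hL2
  · field_simp
    linear_combination (-σ ^ 2) * hL + (-η * L' * σ ^ 2 - η * σ * u * q₁ + η * σ * u * p₁ * L +
      η * σ ^ 3 * G) * hL2

/-- In the unknown G = F + a, with η = ħe^{-iθ}, all coefficients are quotients by powers of σ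
bounded by hypothesis. The only singular term is G/η, so `exists_strip_solution` applies. -/
theorem exists_riccati_strip {ρ d B C M θ : ℝ} {ε : ℂ} (hρ : 0 < ρ) (hd : 0 < d) (hB : 0 < B)
    (hC : 0 < C) (hM : 0 < M) (hε : ε = 1 ∨ ε = -1) {ph qh : ℕ → ℂ → ℂ} {p q : ℂ → ℂ → ℂ}
    {σ : ℂ → ℂ} (hph : ∀ k, DifferentiableOn ℂ (ph k) (halfStrip ρ))
    (hqh : ∀ k, DifferentiableOn ℂ (qh k) (halfStrip ρ))
    (hp : ∀ h ∈ borelDisc θ d, DifferentiableOn ℂ (fun z => p z h) (halfStrip ρ))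
    (hp' : ∀ z ∈ halfStrip ρ, DifferentiableOn ℂ (p z) (borelDisc θ d))
    (hq : ∀ h ∈ borelDisc θ d, DifferentiableOn ℂ (fun z => q z h) (halfStrip ρ))
    (hq' : ∀ z ∈ halfStrip ρ, DifferentiableOn ℂ (q z) (borelDisc θ d))
    (hσ : DifferentiableOn ℂ σ (halfStrip ρ)) (hσ0 : ∀ z ∈ halfStrip ρ, σ z ≠ 0)
    (hσ2 : ∀ z ∈ halfStrip ρ, σ z ^ 2 = ph 0 z ^ 2 - 4 * qh 0 z)
    (hσB : ∀ z ∈ halfStrip ρ, ‖deriv σ z‖ ≤ B * ‖σ z‖)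
    (hpG : ∀ z ∈ halfStrip ρ, GevreyOn (borelDisc θ d) C M (fun h => p z h / σ z)
      fun k => ph k z / σ z)
    (hqG : ∀ z ∈ halfStrip ρ, GevreyOn (borelDisc θ d) C M (fun h => q z h / σ z ^ 2)
      fun k => qh k z / σ z ^ 2) :
    ∃ d' > 0, d' ≤ d ∧ ∃ K > 0, ∃ F : ℂ → ℂ → ℂ,
      (∀ h ∈ borelDisc θ d', DifferentiableOn ℂ (fun z => F z h) (halfStrip (ρ / 4))) ∧
      (∀ z ∈ halfStrip (ρ / 4), DifferentiableOn ℂ (F z) (borelDisc θ d')) ∧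
      (∀ z ∈ halfStrip (ρ / 4), ∀ h ∈ borelDisc θ d', ‖F z h‖ ≤ K) ∧
      ∀ z ∈ halfStrip (ρ / 4), ∀ h ∈ borelDisc θ d',
        h * deriv (fun w => (ph 0 w + ε * σ w) / 2 +
            h * (σ w * F w h / (ε * Complex.exp (θ * Complex.I)))) z *
            (σ z / (ε * Complex.exp (θ * Complex.I))) =
          ((ph 0 z + ε * σ z) / 2 + h * (σ z * F z h / (ε * Complex.exp (θ * Complex.I)))) ^ 2 -
            p z h * ((ph 0 z + ε * σ z) / 2 +
              h * (σ z * F z h / (ε * Complex.exp (θ * Complex.I)))) + q z h := by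
  set u := Complex.exp (θ * Complex.I) with hu
  have hu0 : u ≠ 0 := Complex.exp_ne_zero _
  have hun : ‖u‖ = 1 := Complex.norm_exp_ofReal_mul_I θ
  have hεn : ‖ε‖ = 1 := by rcases hε with rfl | rfl <;> simp
  have hrot : ∀ {e : ℝ} {η : ℂ}, η ∈ borelDisc 0 e → u * η ∈ borelDisc θ e := fun h =>
    borelDisc_rotate.2 h
  have hO : IsOpen (halfStrip ρ) := isOpen_halfStrip ρ
  have s2 : halfStrip (ρ / 2) ⊆ halfStrip ρ := halfStrip_mono (by linarith)
  have s42 : halfStrip (ρ / 4) ⊆ halfStrip (ρ / 2) := halfStrip_mono (by linarith)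
  have s4 : halfStrip (ρ / 4) ⊆ halfStrip ρ := s42.trans s2
  -- the coefficients
  set L : ℂ → ℂ := fun z => (ph 0 z + ε * σ z) / 2 with hL
  set l : ℂ → ℂ := fun z => L z / σ z with hl
  -- The function -a is the value of F dictated at order zero in ħ. Removing it eliminates the
  -- inhomogeneous term of order 1/η.
  set a : ℂ → ℂ := fun z => u * (qh 1 z / σ z ^ 2 - ph 1 z / σ z * l z) -
    ε * (deriv L z / σ z) with ha
  set P : ℂ → ℂ → ℂ := fun z η => (p z (u * η) - ph 0 z) / (u * η * σ z) with hP
  set P2 : ℂ → ℂ → ℂ := fun z η =>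
    (p z (u * η) - ph 0 z - ph 1 z * (u * η)) / ((u * η) ^ 2 * σ z) with hP2
  set Q2 : ℂ → ℂ → ℂ := fun z η =>
    (q z (u * η) - qh 0 z - qh 1 z * (u * η)) / ((u * η) ^ 2 * σ z ^ 2) with hQ2
  set b : ℂ → ℂ → ℂ := fun z η => -(ε * u) * P z η - deriv σ z / σ z with hb
  -- differentiability
  have hLd : DifferentiableOn ℂ L (halfStrip ρ) := ((hph 0).add (hσ.const_mul ε)).div_const 2
  have hld : DifferentiableOn ℂ l (halfStrip ρ) := hLd.div hσ hσ0
  have had : DifferentiableOn ℂ a (halfStrip ρ) := by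
    refine DifferentiableOn.sub (DifferentiableOn.const_mul (DifferentiableOn.sub ?_ ?_) _)
      (DifferentiableOn.const_mul ((hLd.deriv hO).div hσ hσ0) _)
    · exact (hqh 1).div (hσ.pow 2) fun z hz => pow_ne_zero 2 (hσ0 z hz)
    · exact ((hph 1).div hσ hσ0).mul hld
  have hη0 : ∀ η ∈ borelDisc 0 d, u * η ≠ 0 := fun η hη =>
    mul_ne_zero hu0 (ne_zero_of_mem_borelDisc hd hη)
  have hmulη : ∀ {f : ℂ → ℂ}, DifferentiableOn ℂ f (borelDisc θ d) →
      DifferentiableOn ℂ (fun η => f (u * η)) (borelDisc 0 d) := fun hf =>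
    hf.comp (by fun_prop) fun η hη => hrot hη
  have hPd : ∀ η ∈ borelDisc 0 d, DifferentiableOn ℂ (fun z => P z η) (halfStrip ρ) :=
    fun η hη => ((hp _ (hrot hη)).sub (hph 0)).div (hσ.const_mul _)
      fun z hz => mul_ne_zero (hη0 η hη) (hσ0 z hz)
  have hPd' : ∀ z ∈ halfStrip ρ, DifferentiableOn ℂ (P z) (borelDisc 0 d) :=
    fun z hz => ((hmulη (hp' z hz)).sub_const _).div (by fun_prop)
      fun η hη => mul_ne_zero (hη0 η hη) (hσ0 z hz)
  have hP2d : ∀ η ∈ borelDisc 0 d, DifferentiableOn ℂ (fun z => P2 z η) (halfStrip ρ) :=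
    fun η hη => (((hp _ (hrot hη)).sub (hph 0)).sub ((hph 1).mul_const _)).div (hσ.const_mul _)
      fun z hz => mul_ne_zero (pow_ne_zero 2 (hη0 η hη)) (hσ0 z hz)
  have hP2d' : ∀ z ∈ halfStrip ρ, DifferentiableOn ℂ (P2 z) (borelDisc 0 d) :=
    fun z hz => (((hmulη (hp' z hz)).sub_const _).sub (by fun_prop)).div (by fun_prop)
      fun η hη => mul_ne_zero (pow_ne_zero 2 (hη0 η hη)) (hσ0 z hz)
  have hQ2d : ∀ η ∈ borelDisc 0 d, DifferentiableOn ℂ (fun z => Q2 z η) (halfStrip ρ) :=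
    fun η hη => (((hq _ (hrot hη)).sub (hqh 0)).sub ((hqh 1).mul_const _)).div
      ((hσ.pow 2).const_mul _)
      fun z hz => mul_ne_zero (pow_ne_zero 2 (hη0 η hη)) (pow_ne_zero 2 (hσ0 z hz))
  have hQ2d' : ∀ z ∈ halfStrip ρ, DifferentiableOn ℂ (Q2 z) (borelDisc 0 d) :=
    fun z hz => (((hmulη (hq' z hz)).sub_const _).sub (by fun_prop)).div (by fun_prop)
      fun η hη => mul_ne_zero (pow_ne_zero 2 (hη0 η hη)) (pow_ne_zero 2 (hσ0 z hz))
  have hκd : DifferentiableOn ℂ (fun z => deriv σ z / σ z) (halfStrip ρ) := (hσ.deriv hO).div hσ hσ0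
  have hbd : ∀ η ∈ borelDisc 0 d, DifferentiableOn ℂ (fun z => b z η) (halfStrip ρ) :=
    fun η hη => ((hPd η hη).const_mul _).sub hκd
  have hbd' : ∀ z ∈ halfStrip ρ, DifferentiableOn ℂ (b z) (borelDisc 0 d) :=
    fun z hz => ((hPd' z hz).const_mul _).sub_const _
  -- bounds
  set Kl : ℝ := (C + 1) / 2 with hKl
  have hKl0 : 0 < Kl := by positivity
  have hlK : ∀ z ∈ halfStrip ρ, ‖l z‖ ≤ Kl := by
    intro z hz
    have h1 : ‖ph 0 z / σ z‖ ≤ C := by simpa using (hpG z hz).norm_coeff_le hd 0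
    have h2 : l z = (ph 0 z / σ z + ε) / 2 := by
      simp only [hl, hL]
      have := hσ0 z hz
      field_simp
    rw [h2, norm_div, hKl, Complex.norm_ofNat]
    gcongr
    exact (norm_add_le _ _).trans (add_le_add h1 hεn.le)
  have hκK : ∀ z ∈ halfStrip ρ, ‖deriv σ z / σ z‖ ≤ B := by
    intro z hz
    rw [norm_div, div_le_iff₀ (norm_pos_iff.2 (hσ0 z hz))]
    exact hσB z hz
  -- L itself may be unbounded; only L/σ is controlled. Its derivative is bounded by Cauchy's
  -- estimate on the strip of half size, and that of σ by the condition on the logarithmic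
  -- derivative. The bound for a' costs another halving.
  set KL : ℝ := Kl / (ρ / 4) + Kl * B with hKL
  have hLK : ∀ z ∈ halfStrip (ρ / 2), ‖deriv L z / σ z‖ ≤ KL := by
    intro z hz
    have hz1 := s2 hz
    have h0 := hσ0 z hz1
    have h1 : deriv L z = deriv l z * σ z + l z * deriv σ z := by
      have h2 := (hld.differentiableAt (hO.mem_nhds hz1)).hasDerivAt.mul
        (hσ.differentiableAt (hO.mem_nhds hz1)).hasDerivAt
      refine (h2.congr_of_eventuallyEq ?_).deriv
      filter_upwards [hO.mem_nhds hz1] with w hw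
      exact (div_mul_cancel₀ _ (hσ0 w hw)).symm
    have h3 : deriv L z / σ z = deriv l z + l z * (deriv σ z / σ z) := by
      rw [h1]; field_simp
    rw [h3]
    refine (norm_add_le _ _).trans (add_le_add (norm_deriv_le_of_halfStrip hρ hld hlK hz) ?_)
    rw [norm_mul]
    exact mul_le_mul (hlK z hz1) (hκK z hz1) (norm_nonneg _) hKl0.le
  set Ka : ℝ := C * M + C * M * Kl + KL with hKa
  have haK : ∀ z ∈ halfStrip (ρ / 2), ‖a z‖ ≤ Ka := by
    intro z hz
    have hz1 := s2 hz
    have h1 : ‖ph 1 z / σ z‖ ≤ C * M := by simpa using (hpG z hz1).norm_coeff_le hd 1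
    have h2 : ‖qh 1 z / σ z ^ 2‖ ≤ C * M := by simpa using (hqG z hz1).norm_coeff_le hd 1
    refine (norm_sub_le _ _).trans (add_le_add ?_ ?_)
    · rw [norm_mul, hun, one_mul]
      refine (norm_sub_le _ _).trans (add_le_add h2 ?_)
      rw [norm_mul]
      exact mul_le_mul h1 (hlK z hz1) (norm_nonneg _) (by positivity)
    · rw [norm_mul, hεn, one_mul]
      exact hLK z hz
  have hKL0 : 0 < KL := by positivity
  have hKa0 : 0 < Ka := by positivity
  have haK' : ∀ z ∈ halfStrip (ρ / 4), ‖deriv a z‖ ≤ Ka / (ρ / 8) := by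
    intro z hz
    have := norm_deriv_le_of_halfStrip (by positivity : 0 < ρ / 2) (had.mono s2) haK (z := z)
      (by rwa [show ρ / 2 / 2 = ρ / 4 by ring])
    rwa [show ρ / 2 / 4 = ρ / 8 by ring] at this
  have hPK : ∀ z ∈ halfStrip ρ, ∀ η ∈ borelDisc 0 d, ‖P z η‖ ≤ C * M := by
    intro z hz η hη
    have h1 := hpG z hz 1 (u * η) (hrot hη)
    have h2 : P z η = (p z (u * η) / σ z - ph 0 z / σ z) / (u * η) := by
      simp only [hP]
      have := hσ0 z hz
      field_simp
    rw [h2, norm_div, div_le_iff₀ (norm_pos_iff.2 (hη0 η hη))]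
    simpa using h1
  have hP2K : ∀ z ∈ halfStrip ρ, ∀ η ∈ borelDisc 0 d, ‖P2 z η‖ ≤ C * M ^ 2 * 2 := by
    intro z hz η hη
    have h1 := hpG z hz 2 (u * η) (hrot hη)
    have h2 : P2 z η = (p z (u * η) / σ z - (ph 0 z / σ z + ph 1 z / σ z * (u * η))) /
        (u * η) ^ 2 := by
      simp only [hP2]
      have := hσ0 z hz
      field_simp
      ring
    rw [h2, norm_div, norm_pow, div_le_iff₀ (pow_pos (norm_pos_iff.2 (hη0 η hη)) 2)]
    simpa [Finset.sum_range_succ] using h1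
  have hQ2K : ∀ z ∈ halfStrip ρ, ∀ η ∈ borelDisc 0 d, ‖Q2 z η‖ ≤ C * M ^ 2 * 2 := by
    intro z hz η hη
    have h1 := hqG z hz 2 (u * η) (hrot hη)
    have h2 : Q2 z η = (q z (u * η) / σ z ^ 2 - (qh 0 z / σ z ^ 2 + qh 1 z / σ z ^ 2 * (u * η))) /
        (u * η) ^ 2 := by
      simp only [hQ2]
      have := hσ0 z hz
      field_simp
      ring
    rw [h2, norm_div, norm_pow, div_le_iff₀ (pow_pos (norm_pos_iff.2 (hη0 η hη)) 2)]
    simpa [Finset.sum_range_succ] using h1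
  set Kb : ℝ := C * M + B with hKb
  have hbK : ∀ z ∈ halfStrip ρ, ∀ η ∈ borelDisc 0 d, ‖b z η‖ ≤ Kb := by
    intro z hz η hη
    refine (norm_sub_le _ _).trans (add_le_add ?_ (hκK z hz))
    rw [norm_mul, norm_neg, norm_mul, hεn, hun, one_mul, one_mul]
    exact hPK z hz η hη
  have hKb0 : 0 < Kb := by positivity
  -- the fixed point
  set n₀ : ℂ → ℂ → ℂ := fun z η => deriv a z + u ^ 2 * (Q2 z η - P2 z η * l z) + a z ^ 2 -
    b z η * a z with hn₀
  set n₁ : ℂ → ℂ → ℂ := fun z η => b z η - 2 * a z with hn₁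
  set K : ℝ := Ka / (ρ / 8) + (C * M ^ 2 * 2 + C * M ^ 2 * 2 * Kl) + Ka ^ 2 + Kb * Ka + Kb + 2 * Ka
    with hK
  have hK0 : 0 < K := by positivity
  obtain ⟨d', hd', hd'd, G, hGz, hGη, hG1, hG⟩ := exists_strip_solution (isOpen_halfStrip (ρ / 4))
    (fun z hz t ht => add_mem_halfStrip hz t ht) hd hK0 (n₀ := n₀) (n₁ := n₁)
    (fun η hη => (((((had.deriv hO).add (((hQ2d η hη).sub ((hP2d η hη).mul hld)).const_mul _)).add
      (had.pow 2)).sub ((hbd η hη).mul had))).mono s4)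
    (fun z hz => ((((hQ2d' z (s4 hz)).sub ((hP2d' z (s4 hz)).mul_const _)).const_mul _).const_add _
      |>.add_const _).sub ((hbd' z (s4 hz)).mul_const _))
    (fun η hη => ((hbd η hη).sub (had.const_mul 2)).mono s4)
    (fun z hz => (hbd' z (s4 hz)).sub_const _)
    (by
      intro z hz η hη
      have hz1 := s4 hz
      have e1 := haK' z hz
      have e2 : ‖u ^ 2 * (Q2 z η - P2 z η * l z)‖ ≤ C * M ^ 2 * 2 + C * M ^ 2 * 2 * Kl := by
        rw [norm_mul, norm_pow, hun, one_pow, one_mul]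
        refine (norm_sub_le _ _).trans (add_le_add (hQ2K z hz1 η hη) ?_)
        rw [norm_mul]
        exact mul_le_mul (hP2K z hz1 η hη) (hlK z hz1) (norm_nonneg _) (by positivity)
      have e3 : ‖a z ^ 2‖ ≤ Ka ^ 2 := by
        rw [norm_pow]
        exact pow_le_pow_left₀ (norm_nonneg _) (haK z (s42 hz)) 2
      have e4 : ‖b z η * a z‖ ≤ Kb * Ka := by
        rw [norm_mul]
        exact mul_le_mul (hbK z hz1 η hη) (haK z (s42 hz)) (norm_nonneg _) hKb0.le
      refine ((norm_sub_le _ _).trans (add_le_add (norm_add₃_le.trans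
        (add_le_add (add_le_add e1 e2) e3)) e4)).trans ?_
      rw [hK]
      linarith)
    (by
      intro z hz η hη
      refine ((norm_sub_le _ _).trans (add_le_add (hbK z (s4 hz) η hη) ?_ : _ ≤ Kb + 2 * Ka)).trans ?_
      · rw [norm_mul, Complex.norm_ofNat]
        exact mul_le_mul_of_nonneg_left (haK z (s42 hz)) zero_le_two
      · rw [hK]
        have : 0 < Ka / (ρ / 8) + (C * M ^ 2 * 2 + C * M ^ 2 * 2 * Kl) + Ka ^ 2 + Kb * Ka := by
          positivity
        linarith)
  have hrot' : ∀ {h : ℂ}, h ∈ borelDisc θ d' → h / u ∈ borelDisc 0 d' := fun {h} hh => by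
    rw [← borelDisc_rotate (θ := θ), ← hu, mul_div_cancel₀ _ hu0]
    exact hh
  refine ⟨d', hd', hd'd, 1 + Ka, by positivity, fun z h => G z (h / u) - a z, fun h hh => ?_,
    fun z hz => ?_, fun z hz h hh => ?_, fun z hz h hh => ?_⟩
  · exact (hGz _ (hrot' hh)).sub (had.mono s4)
  · refine DifferentiableOn.sub_const ?_ _
    exact (hGη z hz).comp (by fun_prop) fun h hh => hrot' hh
  · exact (norm_sub_le _ _).trans (add_le_add (hG1 z hz _ (hrot' hh)) (haK z (s42 hz)))
  · set η := h / u with hη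
    have hηm : η ∈ borelDisc 0 d' := hrot' hh
    have hhη : h = u * η := by rw [hη, mul_div_cancel₀ _ hu0]
    have hz1 := s4 hz
    have hσd := (hσ.differentiableAt (hO.mem_nhds hz1)).hasDerivAt
    have hLd' := (hLd.differentiableAt (hO.mem_nhds hz1)).hasDerivAt
    have had' := (had.differentiableAt (hO.mem_nhds hz1)).hasDerivAt
    have hY := hLd'.add (((hσd.mul ((hG z hz η hηm).sub had')).div_const (ε * u)).const_mul h)
    have hY' := hY.deriv
    simp only [Pi.mul_apply, Pi.sub_apply, Pi.add_def, Pi.sub_def] at hY'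
    rw [show (fun w => (ph 0 w + ε * σ w) / 2 + h * (σ w * (G w η - a w) / (ε * u))) =
      fun w => L w + h * (σ w * (G w η - a w) / (ε * u)) from rfl, hY']
    have hL2 : 2 * L z = ph 0 z + ε * σ z := by simp only [hL]; ring
    have hL1 : L z ^ 2 - ph 0 z * L z + qh 0 z = 0 := by
      have := hσ2 z hz1
      have hε2 : ε ^ 2 = 1 := by rcases hε with rfl | rfl <;> norm_num
      simp only [hL]
      linear_combination (1 / 4 : ℂ) * this + (1 / 4 : ℂ) * σ z ^ 2 * hε2
    have key := riccati_of_strip (η := η) (σ' := deriv σ z) (P := p z h) (Q := q z h)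
      (a' := deriv a z) (G := G z η) hε hu0 (ne_zero_of_mem_borelDisc hd' hηm) (hσ0 z hz1) hL1 hL2
      (show a z = u * (qh 1 z / σ z ^ 2 - ph 1 z / σ z * (L z / σ z)) - ε * (deriv L z / σ z)
        from rfl)
    rw [← hhη] at key
    change _ = (L z + h * (σ z * (G z η - a z) / (ε * u))) ^ 2 -
      p z h * (L z + h * (σ z * (G z η - a z) / (ε * u))) + q z h
    rw [← key]
    simp only [hn₀, hn₁, hb, hP, hP2, hQ2, hl, ← hhη]

end WKB

end

noncomputable section

namespace WKB

/-! ### Uniform Gevrey bounds -/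

theorem GevreyOn.mono_const {D : Set ℂ} {C C' M M' : ℝ} {f : ℂ → ℂ} {a : ℕ → ℂ}
    (h : GevreyOn D C M f a) (hC : 0 ≤ C) (hM : 0 ≤ M) (hCC : C ≤ C') (hMM : M ≤ M') :
    GevreyOn D C' M' f a := fun n z hz => (h n z hz).trans (by
    have := hC.trans hCC
    gcongr)

/-- Only the modulus of the divisor enters, so a bound stated with √|D₀| is also valid for any
branch of √D₀. -/
theorem GevreyOn.div_const_of_norm_eq {D : Set ℂ} {C M : ℝ} {f : ℂ → ℂ} {a : ℕ → ℂ} {w w' : ℂ}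
    (h : GevreyOn D C M (fun z => f z / w) fun k => a k / w) (hw : ‖w‖ = ‖w'‖) :
    GevreyOn D C M (fun z => f z / w') fun k => a k / w' := by
  intro n z hz
  have e : ∀ v : ℂ, f z / v - ∑ k ∈ Finset.range n, a k / v * z ^ k =
      (f z - ∑ k ∈ Finset.range n, a k * z ^ k) / v := by
    intro v
    rw [sub_div, Finset.sum_div]
    congr 1
    exact Finset.sum_congr rfl fun k _ => by ring
  have := h n z hz
  rw [e, norm_div] at this ⊢
  rwa [← hw]

theorem GevreyOn.div_const_of_le {D : Set ℂ} {C M B : ℝ} {f : ℂ → ℂ} {a : ℕ → ℂ}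
    {w : ℂ} (h : GevreyOn D C M f a) (hw : ‖w⁻¹‖ ≤ B) :
    GevreyOn D (C * B) M (fun z => f z / w) fun k => a k / w := by
  intro n z hz
  have e : f z / w - ∑ k ∈ Finset.range n, a k / w * z ^ k =
      (f z - ∑ k ∈ Finset.range n, a k * z ^ k) * w⁻¹ := by
    rw [sub_mul, Finset.sum_mul, div_eq_mul_inv]
    congr 1
    exact Finset.sum_congr rfl fun k _ => by ring
  rw [e, norm_mul]
  calc _ ≤ C * M ^ n * n.factorial * ‖z‖ ^ n * B := by
        have h1 := h n z hz
        exact mul_le_mul h1 hw (norm_nonneg _) ((norm_nonneg _).trans h1)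
    _ = _ := by ring

theorem LocUnifGevrey.exists_gevreyOn {X S K : Set ℂ} {a b θ : ℝ} {f : ℂ → ℂ → ℂ}
    {fh : ℕ → ℂ → ℂ} (h : LocUnifGevrey X S a b f fh) (ha : a ≤ θ - Real.pi / 2)
    (hb : θ + Real.pi / 2 ≤ b) (hK : IsCompact K) (hKX : K ⊆ X) :
    ∃ d > 0, ∃ C M : ℝ, 0 < C ∧ 0 < M ∧
      ∀ x ∈ K, GevreyOn (borelDisc θ d) C M (f x) fun k => fh k x := by
  refine hK.induction_on (p := fun K => ∃ d > 0, ∃ C M : ℝ, 0 < C ∧ 0 < M ∧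
      ∀ x ∈ K, GevreyOn (borelDisc θ d) C M (f x) fun k => fh k x) ?_ ?_ ?_ ?_
  · exact ⟨1, one_pos, 1, 1, one_pos, one_pos, fun x hx => absurd hx (notMem_empty x)⟩
  · rintro s t hst ⟨d, hd, C, M, hC, hM, H⟩
    exact ⟨d, hd, C, M, hC, hM, fun x hx => H x (hst hx)⟩
  · rintro s t ⟨d, hd, C, M, hC, hM, H⟩ ⟨d', hd', C', M', hC', hM', H'⟩
    have hm : 0 < min d d' := lt_min hd hd'
    refine ⟨min d d', hm, max C C', max M M', lt_max_of_lt_left hC, lt_max_of_lt_left hM, ?_⟩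
    rintro x (hx | hx)
    · exact ((H x hx).mono (borelDisc_mono hm (min_le_left _ _))).mono_const hC.le hM.le
        (le_max_left _ _) (le_max_left _ _)
    · exact ((H' x hx).mono (borelDisc_mono hm (min_le_right _ _))).mono_const hC'.le hM'.le
        (le_max_right _ _) (le_max_right _ _)
  · intro x hx
    obtain ⟨V, hV, -, hG⟩ := h x (hKX hx)
    obtain ⟨d, hd, -, C, M, hC, hM, H⟩ := hG.exists_gevreyOn ha hb
    exact ⟨V, mem_nhdsWithin_of_mem_nhds hV, d, hd, C, M, hC, hM, H⟩

/-! ### The local Riccati problem -/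

/-- The standing assumptions on a WKB equation near a family of complete rays. -/
structure IsSetting (X S : Set ℂ) (ϑm ϑp : ℝ) (p q : ℂ → ℂ → ℂ) (ph qh : ℕ → ℂ → ℂ) (θ δ : ℝ)
    (ε : ℂ) (U : Set ℂ) (r : ℂ → ℂ) (Φ : ℂ → ℂ) : Prop where
  isOpen_X : IsOpen X
  hp : DifferentiableOn ℂ (fun z : ℂ × ℂ => p z.1 z.2) (X ×ˢ S)
  hq : DifferentiableOn ℂ (fun z : ℂ × ℂ => q z.1 z.2) (X ×ˢ S)
  hph : ∀ k, DifferentiableOn ℂ (ph k) X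
  hqh : ∀ k, DifferentiableOn ℂ (qh k) X
  hpg : LocUnifGevrey X S ϑm ϑp p ph
  hqg : LocUnifGevrey X S ϑm ϑp q qh
  le_sub : ϑm ≤ θ - Real.pi / 2
  add_le : θ + Real.pi / 2 ≤ ϑp
  hδ : 0 < δ
  hδS : borelDisc θ δ ⊆ S
  hε : ε = 1 ∨ ε = -1
  isOpen_U : IsOpen U
  isSC : IsSimplyConnected U
  hUX : U ⊆ X
  hU : ∀ x ∈ U, disc ph qh x ≠ 0
  hr : DifferentiableOn ℂ r U
  hr2 : ∀ x ∈ U, r x ^ 2 = disc ph qh x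
  hΦ : ∀ x ∈ U, HasDerivAt Φ (r x) x
  hcomplete : ∀ x ∈ U, ∃ γ : ℝ → ℂ, IsCompleteRay X (disc ph qh) r θ ε x γ
  hends : ∀ x ∈ U, ∃ V ∈ 𝓝 x, V ⊆ U ∧ ∃ R : ℝ, 0 < R ∧
    (∃ C : ℝ, ∀ y ∈ rayEnd X (disc ph qh) r Φ θ ε V R, ‖deriv (disc ph qh) y‖ /
        (2 * Real.sqrt ‖disc ph qh y‖ ^ 3) ≤ C) ∧
      UnifGevrey (rayEnd X (disc ph qh) r Φ θ ε V R) (borelDisc θ δ)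
        (θ - Real.pi / 2) (θ + Real.pi / 2)
        (fun y h => p y h / (Real.sqrt ‖disc ph qh y‖ : ℂ))
        (fun k y => ph k y / (Real.sqrt ‖disc ph qh y‖ : ℂ)) ∧
      UnifGevrey (rayEnd X (disc ph qh) r Φ θ ε V R) (borelDisc θ δ)
        (θ - Real.pi / 2) (θ + Real.pi / 2)
        (fun y h => q y h / disc ph qh y)
        (fun k y => qh k y / disc ph qh y)

namespace IsSetting

variable {X S : Set ℂ} {ϑm ϑp : ℝ} {p q : ℂ → ℂ → ℂ} {ph qh : ℕ → ℂ → ℂ} {θ δ : ℝ}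
  {ε : ℂ} {U : Set ℂ} {r Φ : ℂ → ℂ}

theorem differentiableOn_disc (h : IsSetting X S ϑm ϑp p q ph qh θ δ ε U r Φ) :
    DifferentiableOn ℂ (disc ph qh) X := ((h.hph 0).pow 2).sub ((h.hqh 0).const_mul 4)

theorem r_ne_zero (h : IsSetting X S ϑm ϑp p q ph qh θ δ ε U r Φ) {x : ℂ} (hx : x ∈ U) :
    r x ≠ 0 := fun h0 => h.hU x hx (by rw [← h.hr2 x hx, h0]; simp)

theorem eps_mul_exp_ne_zero (h : IsSetting X S ϑm ϑp p q ph qh θ δ ε U r Φ) :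
    ε * Complex.exp (θ * Complex.I) ≠ 0 := by
  refine mul_ne_zero ?_ (Complex.exp_ne_zero _)
  rcases h.hε with rfl | rfl <;> simp

theorem norm_eps_mul_exp (h : IsSetting X S ϑm ϑp p q ph qh θ δ ε U r Φ) :
    ‖ε * Complex.exp (θ * Complex.I)‖ = 1 := by
  rw [norm_mul, Complex.norm_exp_ofReal_mul_I, mul_one]
  rcases h.hε with rfl | rfl <;> simp

/-- The half-strip is swept out by rays starting in the neighbourhood V from the assumption on the
ends. All points far to the right therefore lie in the region where that assumption gives bounds. -/
theorem exists_strip (h : IsSetting X S ϑm ϑp p q ph qh θ δ ε U r Φ) {x₁ : ℂ} (hx₁ : x₁ ∈ U) :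
    ∃ V ∈ 𝓝 x₁, V ⊆ U ∧ ∃ R : ℝ, 0 < R ∧
    (∃ C : ℝ, ∀ y ∈ rayEnd X (disc ph qh) r Φ θ ε V R, ‖deriv (disc ph qh) y‖ /
        (2 * Real.sqrt ‖disc ph qh y‖ ^ 3) ≤ C) ∧
      UnifGevrey (rayEnd X (disc ph qh) r Φ θ ε V R) (borelDisc θ δ)
        (θ - Real.pi / 2) (θ + Real.pi / 2)
        (fun y h => p y h / (Real.sqrt ‖disc ph qh y‖ : ℂ))
        (fun k y => ph k y / (Real.sqrt ‖disc ph qh y‖ : ℂ)) ∧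
      UnifGevrey (rayEnd X (disc ph qh) r Φ θ ε V R) (borelDisc θ δ)
        (θ - Real.pi / 2) (θ + Real.pi / 2)
        (fun y h => q y h / disc ph qh y)
        (fun k y => qh k y / disc ph qh y) ∧
    ∃ ρ > 0, ∃ g σ : ℂ → ℂ,
      IsFlowOn X (disc ph qh) (ε * Complex.exp (θ * Complex.I)) (halfStrip ρ) g σ ∧
      (∀ z ∈ Metric.ball (0 : ℂ) ρ, g z ∈ U ∧ σ z = r (g z) ∧
        Φ (g z) = Φ x₁ + ε * Complex.exp (θ * Complex.I) * z) ∧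
      (∀ e > 0, ∀ᶠ x in 𝓝 x₁, ∃ z ∈ Metric.ball (0 : ℂ) e, g z = x) ∧
      ∃ T : ℝ, ∀ z ∈ halfStrip ρ, T < z.re → g z ∈ rayEnd X (disc ph qh) r Φ θ ε V R := by
  set c := ε * Complex.exp (θ * Complex.I) with hc
  have hc0 : c ≠ 0 := h.eps_mul_exp_ne_zero
  have hrx : r x₁ ≠ 0 := h.r_ne_zero hx₁
  obtain ⟨V, hV, hVU, R, hR, hend1, hend2, hend3⟩ := h.hends x₁ hx₁
  refine ⟨V, hV, hVU, R, hR, hend1, hend2, hend3, ?_⟩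
  obtain ⟨η, hη, g₀, σ₀, hg0, hσ0, hflow, -⟩ := exists_local_flow h.isOpen_X h.differentiableOn_disc
    (c := c) (h.hUX hx₁) hrx (h.hr2 x₁ hx₁)
  have hgd : DifferentiableOn ℂ g₀ (Metric.ball 0 η) := fun z hz =>
    (hflow z hz).2.2.2.1.differentiableAt.differentiableWithinAt
  have hgc : ContinuousAt g₀ 0 :=
    (hflow 0 (Metric.mem_ball_self hη)).2.2.2.1.continuousAt
  have hσc : ContinuousAt σ₀ 0 :=
    (hflow 0 (Metric.mem_ball_self hη)).2.2.2.2.continuousAt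
  have hgV : ∀ᶠ z in 𝓝 (0 : ℂ), g₀ z ∈ V := hgc.eventually_mem (by rwa [hg0])
  have hσr : ∀ᶠ z in 𝓝 (0 : ℂ), σ₀ z = r (g₀ z) := by
    have hrc : Tendsto (fun z => r (g₀ z)) (𝓝 0) (𝓝 (r x₁)) := by
      have h1 := (h.hr.differentiableAt (h.isOpen_U.mem_nhds hx₁)).continuousAt
      rw [← hg0] at h1 ⊢
      exact h1.tendsto.comp hgc
    refine eventually_eq_of_sq_eq hrx (by rw [← hσ0]; exact hσc) hrc ?_
    filter_upwards [hgV, Metric.ball_mem_nhds (0 : ℂ) hη] with z h1 h2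
    rw [(hflow z h2).2.2.1, h.hr2 _ (hVU h1)]
  obtain ⟨e, he, hes⟩ := Metric.mem_nhds_iff.1 (hgV.and hσr)
  set ρ := min η e / 2 with hρdef
  have hρ : 0 < ρ := by have := lt_min hη he; positivity
  have hρη : 2 * ρ ≤ η := by rw [hρdef]; linarith [min_le_left η e]
  have hρe : 2 * ρ ≤ e := by rw [hρdef]; linarith [min_le_right η e]
  have hball : ∀ z ∈ Metric.ball (0 : ℂ) (2 * ρ), g₀ z ∈ V ∧ σ₀ z = r (g₀ z) := fun z hz =>
    hes (Metric.ball_subset_ball hρe hz)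
  have hflow2 := hflow.mono (Metric.ball_subset_ball hρη)
  have hΦg : ∀ z ∈ Metric.ball (0 : ℂ) (2 * ρ), Φ (g₀ z) = Φ x₁ + c * z := by
    intro z hz
    have hder : ∀ w ∈ Metric.ball (0 : ℂ) (2 * ρ), HasDerivWithinAt (fun w => Φ (g₀ w) - c * w) 0
        (Metric.ball 0 (2 * ρ)) w := by
      intro w hw
      obtain ⟨h1, h2⟩ := hball w hw
      have h3 := (h.hΦ _ (hVU h1)).comp w (hflow2 w hw).2.2.2.1
      have h4 := h3.sub ((hasDerivAt_id w).const_mul c)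
      refine (h4.congr_deriv ?_).hasDerivWithinAt
      have h5 : r (g₀ w) ≠ 0 := h.r_ne_zero (hVU h1)
      rw [h2]
      field_simp
      ring
    have := (convex_ball (0 : ℂ) (2 * ρ)).norm_image_sub_le_of_norm_hasDerivWithin_le hder
      (fun w _ => (norm_zero (E := ℂ)).le) (Metric.mem_ball_self (by positivity)) hz
    rw [zero_mul, norm_le_zero_iff, hg0] at this
    linear_combination this
  choose! γ hγ using h.hcomplete
  have hγ' : ∀ x ∈ U, ∃ P : ℝ → ℂ, IsRayOn X (disc ph qh) c (Ici 0) (γ x) P ∧ P 0 = r x := by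
    intro x hx
    obtain ⟨-, P, hP, hP0, H⟩ := hγ x hx
    exact ⟨P, ⟨hP, fun t ht => ⟨(H t ht).1, (H t ht).2.2.1, (H t ht).2.1, (H t ht).2.2.2⟩⟩, hP0⟩
  choose! P hP using hγ'
  obtain ⟨g, σ, hgσ, hgγ, hgg⟩ := exists_strip_flow h.isOpen_X h.differentiableOn_disc hc0 hρ hflow2
    (γ := fun z => γ (g₀ z)) (P := fun z => P (g₀ z)) fun z hz => by
      obtain ⟨h1, h2⟩ := hball z hz
      exact ⟨(hP _ (hVU h1)).1, (hγ _ (hVU h1)).1, by rw [(hP _ (hVU h1)).2, h2]⟩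
  have hsub : Metric.ball (0 : ℂ) ρ ⊆ Metric.ball 0 (2 * ρ) := Metric.ball_subset_ball (by linarith)
  -- With c = εe^{iθ}, the continued Liouville coordinate over z, divided by c, is Φ(x₁)/c + z; its
  -- real part exceeds R precisely beyond this threshold.
  refine ⟨ρ, hρ, g, σ, hgσ, fun z hz => ?_, fun e' he' => ?_, R - (Φ x₁ / c).re, fun z hz hzT => ?_⟩
  · obtain ⟨h1, h2⟩ := hball z (hsub hz)
    obtain ⟨h3, h4⟩ := hgg z hz
    rw [h3, h4]
    exact ⟨hVU h1, h2, hΦg z (hsub hz)⟩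
  · have hA : AnalyticAt ℂ g₀ 0 := hgd.analyticAt (Metric.ball_mem_nhds _ hη)
    have hd0 : deriv g₀ 0 ≠ 0 := by
      rw [(hflow 0 (Metric.mem_ball_self hη)).2.2.2.1.deriv, hσ0]
      exact div_ne_zero hc0 hrx
    have hmap := hA.hasStrictDerivAt.map_nhds_eq hd0
    rw [hg0] at hmap
    rw [← hmap, eventually_map]
    filter_upwards [Metric.ball_mem_nhds (0 : ℂ) hρ, Metric.ball_mem_nhds (0 : ℂ) he'] with z h1 h2
    exact ⟨z, h2, (hgg z h1).1⟩
  · have hzi := hz.2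
    have hst : (-ρ + z.im * Complex.I : ℂ) ∈ Metric.ball (0 : ℂ) (2 * ρ) := by
      rw [mem_ball_zero_iff]
      refine (norm_add_le _ _).trans_lt ?_
      rw [norm_neg, norm_mul, Complex.norm_I, Complex.norm_real, Complex.norm_real,
        Real.norm_of_nonneg hρ.le, Real.norm_eq_abs]
      linarith
    obtain ⟨h1, -⟩ := hball _ hst
    refine ⟨_, h1, _, hγ _ (hVU h1), z.re + ρ, by linarith [hz.1], (hgγ z hz).symm, ?_⟩
    rw [hΦg _ hst]
    have e1 : ε * Complex.exp (-(θ * Complex.I)) * c = 1 := by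
      rw [hc, mul_mul_mul_comm, ← Complex.exp_add, neg_add_cancel, Complex.exp_zero, mul_one]
      rcases h.hε with rfl | rfl <;> norm_num
    have e2 : ε * Complex.exp (-(θ * Complex.I)) = 1 / c := by
      rw [eq_div_iff hc0, e1]
    have e3 : ε * Complex.exp (-(θ * Complex.I)) * (Φ x₁ + c * (-ρ + z.im * Complex.I) +
        ε * Complex.exp (θ * Complex.I) * ((z.re + ρ : ℝ) : ℂ)) = Φ x₁ / c + z := by
      rw [← hc, e2]
      have : (z : ℂ) = z.re + z.im * Complex.I := (Complex.re_add_im z).symm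
      conv_rhs => rw [this]
      push_cast
      field_simp
      ring
    rw [e3, Complex.add_re]
    linarith

end IsSetting

end WKB

end

/-! ### ### Uniform bounds on the half-strip and local exact Riccati solutions -/

noncomputable section

namespace WKB

/-- Differentiating σ² = D(g) along the flow. For |c| = 1 the logarithmic derivative of σ has
modulus |D'|/(2|D|^{3/2}), the quantity bounded at the ends of the rays. -/
theorem IsFlowOn.hasDerivAt_branch {X : Set ℂ} (hX : IsOpen X) {D : ℂ → ℂ}
    (hD : DifferentiableOn ℂ D X) {c : ℂ} {N : Set ℂ} (hN : IsOpen N) {g σ : ℂ → ℂ}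
    (h : IsFlowOn X D c N g σ) {z : ℂ} (hz : z ∈ N) :
    HasDerivAt σ (deriv D (g z) * c / (2 * σ z ^ 2)) z := by
  obtain ⟨h1, h2, h3, h4, h5⟩ := h z hz
  have e1 := ((hD.differentiableAt (hX.mem_nhds h1)).hasDerivAt).comp z h4
  have e2 := hasDerivAt_of_sq_eq e1 h5.continuousAt
    (by filter_upwards [hN.mem_nhds hz] with w hw using (h w hw).2.2.1) h2
  refine e2.congr_deriv ?_
  field_simp

theorem isCompact_rectangle (a b c : ℝ) :
    IsCompact {z : ℂ | a ≤ z.re ∧ z.re ≤ b ∧ |z.im| ≤ c} := by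
  have h := (isCompact_Icc (a := a) (b := b)).reProdIm (isCompact_Icc (a := -c) (b := c))
  convert! h using 1
  ext z
  simp only [mem_ofPred_eq, Complex.mem_reProdIm, mem_Icc, abs_le]
  tauto

namespace IsSetting

variable {X S : Set ℂ} {ϑm ϑp : ℝ} {p q : ℂ → ℂ → ℂ} {ph qh : ℕ → ℂ → ℂ} {θ δ : ℝ}
  {ε : ℂ} {U : Set ℂ} {r Φ : ℂ → ℂ}

/-- A strip of half the width splits into a compact rectangle, where the locally uniform hypotheses
suffice, and a part inside the ray ends. The constants of the two parts are added and the smallest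
disc is kept. -/
theorem exists_strip_bounds (h : IsSetting X S ϑm ϑp p q ph qh θ δ ε U r Φ) {x₁ : ℂ}
    (hx₁ : x₁ ∈ U) :
    ∃ ρ > 0, ∃ g σ : ℂ → ℂ,
      IsFlowOn X (disc ph qh) (ε * Complex.exp (θ * Complex.I)) (halfStrip ρ) g σ ∧
      (∀ z ∈ Metric.ball (0 : ℂ) ρ, g z ∈ U ∧ σ z = r (g z) ∧
        Φ (g z) = Φ x₁ + ε * Complex.exp (θ * Complex.I) * z) ∧
      (∀ e > 0, ∀ᶠ x in 𝓝 x₁, ∃ z ∈ Metric.ball (0 : ℂ) e, g z = x) ∧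
      ∃ d > 0, d ≤ δ ∧ ∃ B C M : ℝ, 0 < B ∧ 0 < C ∧ 0 < M ∧
        (∀ z ∈ halfStrip ρ, ‖deriv σ z‖ ≤ B * ‖σ z‖) ∧
        (∀ z ∈ halfStrip ρ, GevreyOn (borelDisc θ d) C M (fun h => p (g z) h / σ z)
          fun k => ph k (g z) / σ z) ∧
        (∀ z ∈ halfStrip ρ, GevreyOn (borelDisc θ d) C M (fun h => q (g z) h / σ z ^ 2)
          fun k => qh k (g z) / σ z ^ 2) := by
  obtain ⟨V, hV, hVU, R, hR, ⟨B₀, hB₀⟩, hpE, hqE, ρ, hρ, g, σ, hflow, hball, himg, T, hT⟩ :=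
    h.exists_strip hx₁
  have hcn := h.norm_eps_mul_exp
  set c := ε * Complex.exp (θ * Complex.I) with hc
  obtain ⟨d₁, hd₁, -, C₁, M₁, hC₁, hM₁, G₁⟩ := hpE.exists_gevreyOn le_rfl le_rfl
  obtain ⟨d₂, hd₂, -, C₂, M₂, hC₂, hM₂, G₂⟩ := hqE.exists_gevreyOn le_rfl le_rfl
  -- the compact part
  set K₀ : Set ℂ := {z : ℂ | -(ρ / 2) ≤ z.re ∧ z.re ≤ T ∧ |z.im| ≤ ρ / 2} with hK₀
  have hK₀c : IsCompact K₀ := isCompact_rectangle _ _ _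
  have hK₀s : K₀ ⊆ halfStrip ρ := fun z hz => ⟨by linarith [hz.1], by linarith [hz.2.2]⟩
  have hgc : ContinuousOn g K₀ := fun z hz =>
    (hflow z (hK₀s hz)).2.2.2.1.continuousAt.continuousWithinAt
  have hgK : IsCompact (g '' K₀) := hK₀c.image_of_continuousOn hgc
  have hgX : g '' K₀ ⊆ X := by rintro _ ⟨z, hz, rfl⟩; exact (hflow z (hK₀s hz)).1
  obtain ⟨d₃, hd₃, C₃, M₃, hC₃, hM₃, G₃⟩ := h.hpg.exists_gevreyOn h.le_sub h.add_le hgK hgX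
  obtain ⟨d₄, hd₄, C₄, M₄, hC₄, hM₄, G₄⟩ := h.hqg.exists_gevreyOn h.le_sub h.add_le hgK hgX
  have hσd : DifferentiableOn ℂ σ (halfStrip ρ) := fun z hz =>
    (hflow z hz).2.2.2.2.differentiableWithinAt
  have hO := isOpen_halfStrip ρ
  have hσi : ContinuousOn (fun z => (σ z)⁻¹) K₀ :=
    (hσd.continuousOn.mono hK₀s).inv₀ fun z hz => (hflow z (hK₀s hz)).2.1
  have hσl : ContinuousOn (fun z => deriv σ z * (σ z)⁻¹) K₀ :=
    (((hσd.deriv hO).continuousOn).mono hK₀s).mul hσi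
  obtain ⟨b₁, hb₁⟩ := hK₀c.exists_bound_of_continuousOn hσi
  obtain ⟨b₂, hb₂⟩ := hK₀c.exists_bound_of_continuousOn hσl
  set b := |b₁| + 1 with hb
  have hb0 : 0 < b := by positivity
  have hbb : ∀ z ∈ K₀, ‖(σ z)⁻¹‖ ≤ b := fun z hz =>
    (hb₁ z hz).trans (by linarith [le_abs_self b₁])
  have hbb2 : ∀ z ∈ K₀, ‖(σ z ^ 2)⁻¹‖ ≤ b ^ 2 := fun z hz => by
    rw [← inv_pow, norm_pow]
    exact pow_le_pow_left₀ (norm_nonneg _) (hbb z hz) 2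
  set d := min (min δ d₁) (min d₂ (min d₃ d₄)) with hd
  have hd0 : 0 < d := lt_min (lt_min h.hδ hd₁) (lt_min hd₂ (lt_min hd₃ hd₄))
  have dd1 : d ≤ d₁ := (min_le_left _ _).trans (min_le_right _ _)
  have dd2 : d ≤ d₂ := (min_le_right _ _).trans (min_le_left _ _)
  have dd3 : d ≤ d₃ := (min_le_right _ _).trans ((min_le_right _ _).trans (min_le_left _ _))
  have dd4 : d ≤ d₄ := (min_le_right _ _).trans ((min_le_right _ _).trans (min_le_right _ _))
  have hss : halfStrip (ρ / 2) ⊆ halfStrip ρ := halfStrip_mono (by linarith)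
  have hcases : ∀ z ∈ halfStrip (ρ / 2), z ∈ K₀ ∨ T < z.re := by
    intro z hz
    rcases le_or_gt z.re T with h1 | h1
    · exact Or.inl ⟨hz.1.le, h1, hz.2.le⟩
    · exact Or.inr h1
  have hsqrt : ∀ z ∈ halfStrip ρ, Real.sqrt ‖disc ph qh (g z)‖ = ‖σ z‖ := fun z hz => by
    rw [← (hflow z hz).2.2.1, norm_pow, Real.sqrt_sq (norm_nonneg _)]
  refine ⟨ρ / 2, by positivity, g, σ, hflow.mono hss, fun z hz => hball z
    (Metric.ball_subset_ball (by linarith) hz), himg, d, hd0,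
    (min_le_left _ _).trans (min_le_left _ _), |B₀| + |b₂| + 1, C₁ + C₂ + C₃ * b + C₄ * b ^ 2,
    M₁ + M₂ + M₃ + M₄, by positivity, by positivity, by positivity, fun z hz => ?_,
    fun z hz => ?_, fun z hz => ?_⟩
  · have hz' := hss hz
    have hσ0 : 0 < ‖σ z‖ := norm_pos_iff.2 (hflow z hz').2.1
    rcases hcases z hz with hzK | hzT
    · have := hb₂ z hzK
      rw [norm_mul, norm_inv, ← div_eq_mul_inv, div_le_iff₀ hσ0] at this
      refine this.trans (mul_le_mul_of_nonneg_right ?_ hσ0.le)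
      linarith [le_abs_self b₂, abs_nonneg B₀]
    · have h1 := hB₀ _ (hT z hz' hzT)
      rw [hsqrt z hz', div_le_iff₀ (by positivity)] at h1
      rw [(hflow.hasDerivAt_branch h.isOpen_X h.differentiableOn_disc hO hz').deriv, norm_div,
        norm_mul, hcn, mul_one, norm_mul, norm_pow, Complex.norm_ofNat, div_le_iff₀ (by positivity)]
      refine h1.trans ?_
      have h2 : B₀ ≤ |B₀| + |b₂| + 1 := by linarith [le_abs_self B₀, abs_nonneg b₂]
      calc B₀ * (2 * ‖σ z‖ ^ 3) ≤ (|B₀| + |b₂| + 1) * (2 * ‖σ z‖ ^ 3) := by gcongr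
        _ = _ := by ring
  · have hz' := hss hz
    have p1 : 0 < C₃ * b := by positivity
    have p2 : 0 < C₄ * b ^ 2 := by positivity
    rcases hcases z hz with hzK | hzT
    · have h1 := (G₃ _ (mem_image_of_mem g hzK)).div_const_of_le (hbb z hzK)
      exact (h1.mono (borelDisc_mono hd0 dd3)).mono_const p1.le hM₃.le (by linarith) (by linarith)
    · have h1 := (G₁ _ (hT z hz' hzT)).div_const_of_norm_eq (w' := σ z) (by
        rw [Complex.norm_real, Real.norm_of_nonneg (Real.sqrt_nonneg _), hsqrt z hz'])
      exact (h1.mono (borelDisc_mono hd0 dd1)).mono_const hC₁.le hM₁.le (by linarith) (by linarith)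
  · have hz' := hss hz
    have p1 : 0 < C₃ * b := by positivity
    have p2 : 0 < C₄ * b ^ 2 := by positivity
    rcases hcases z hz with hzK | hzT
    · have h1 := (G₄ _ (mem_image_of_mem g hzK)).div_const_of_le (hbb2 z hzK)
      exact (h1.mono (borelDisc_mono hd0 dd4)).mono_const p2.le hM₄.le (by linarith) (by linarith)
    · have h1 := (G₂ _ (hT z hz' hzT)).div_const_of_norm_eq (w' := σ z ^ 2) (by
        rw [(hflow z hz').2.2.1])
      exact (h1.mono (borelDisc_mono hd0 dd2)).mono_const hC₂.le hM₂.le (by linarith) (by linarith)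

theorem differentiableOn_p_left (h : IsSetting X S ϑm ϑp p q ph qh θ δ ε U r Φ) {η : ℂ}
    (hη : η ∈ borelDisc θ δ) : DifferentiableOn ℂ (fun x => p x η) X :=
  h.hp.comp (f := fun x : ℂ => (x, η)) (by fun_prop) fun _ hx => ⟨hx, h.hδS hη⟩

theorem differentiableOn_q_left (h : IsSetting X S ϑm ϑp p q ph qh θ δ ε U r Φ) {η : ℂ}
    (hη : η ∈ borelDisc θ δ) : DifferentiableOn ℂ (fun x => q x η) X :=
  h.hq.comp (f := fun x : ℂ => (x, η)) (by fun_prop) fun _ hx => ⟨hx, h.hδS hη⟩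

theorem differentiableOn_p_right (h : IsSetting X S ϑm ϑp p q ph qh θ δ ε U r Φ) {x : ℂ}
    (hx : x ∈ X) : DifferentiableOn ℂ (p x) (borelDisc θ δ) :=
  h.hp.comp (f := fun η : ℂ => (x, η)) (by fun_prop) fun _ hη => ⟨hx, h.hδS hη⟩

theorem differentiableOn_q_right (h : IsSetting X S ϑm ϑp p q ph qh θ δ ε U r Φ) {x : ℂ}
    (hx : x ∈ X) : DifferentiableOn ℂ (q x) (borelDisc θ δ) :=
  h.hq.comp (f := fun η : ℂ => (x, η)) (by fun_prop) fun _ hη => ⟨hx, h.hδS hη⟩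

/-- Near each point of `U` the Riccati equation has a bounded solution with leading term the
characteristic root. -/
theorem exists_local_riccati (h : IsSetting X S ϑm ϑp p q ph qh θ δ ε U r Φ) {x₁ : ℂ}
    (hx₁ : x₁ ∈ U) :
    ∃ ρ > 0, Metric.ball x₁ ρ ⊆ U ∧ ∃ d > 0, d ≤ δ ∧ ∃ K > 0, ∃ Y : ℂ → ℂ → ℂ,
      (∀ η ∈ borelDisc θ d, DifferentiableOn ℂ (fun x => Y x η) (Metric.ball x₁ ρ)) ∧
      (∀ x ∈ Metric.ball x₁ ρ, DifferentiableOn ℂ (Y x) (borelDisc θ d)) ∧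
      (∀ x ∈ Metric.ball x₁ ρ, ∀ η ∈ borelDisc θ d, ‖Y x η‖ ≤ K) ∧
      ∀ x ∈ Metric.ball x₁ ρ, ∀ η ∈ borelDisc θ d,
        η * deriv (fun y => charRoot ph r ε y + η * Y y η) x =
          (charRoot ph r ε x + η * Y x η) ^ 2 - p x η * (charRoot ph r ε x + η * Y x η) + q x η := by
  obtain ⟨ρ, hρ, g, σ, hflow, hball, himg, d, hd, hdδ, B, C, M, hB, hC, hM, hσB, hpG, hqG⟩ :=
    h.exists_strip_bounds hx₁
  have hc0 := h.eps_mul_exp_ne_zero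
  have hcn := h.norm_eps_mul_exp
  have hsub : borelDisc θ d ⊆ borelDisc θ δ := borelDisc_mono hd hdδ
  have hgX : MapsTo g (halfStrip ρ) X := fun z hz => (hflow z hz).1
  have hgd : DifferentiableOn ℂ g (halfStrip ρ) := fun z hz =>
    (hflow z hz).2.2.2.1.differentiableAt.differentiableWithinAt
  have hσd : DifferentiableOn ℂ σ (halfStrip ρ) := fun z hz =>
    (hflow z hz).2.2.2.2.differentiableWithinAt
  obtain ⟨d', hd', hd'd, K, hK, F, hFz, hFh, hFK, hF⟩ := exists_riccati_strip (θ := θ)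
    (ph := fun k z => ph k (g z)) (qh := fun k z => qh k (g z)) (p := fun z η => p (g z) η)
    (q := fun z η => q (g z) η) hρ hd hB hC hM h.hε (fun k => (h.hph k).comp hgd hgX)
    (fun k => (h.hqh k).comp hgd hgX)
    (fun η hη => (h.differentiableOn_p_left (hsub hη)).comp hgd hgX)
    (fun z hz => (h.differentiableOn_p_right (hgX hz)).mono hsub)
    (fun η hη => (h.differentiableOn_q_left (hsub hη)).comp hgd hgX)
    (fun z hz => (h.differentiableOn_q_right (hgX hz)).mono hsub)
    hσd (fun z hz => (hflow z hz).2.1) (fun z hz => (hflow z hz).2.2.1) hσB hpG hqG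
  set c := ε * Complex.exp (θ * Complex.I) with hc
  -- the Liouville coordinate
  set ζ : ℂ → ℂ := fun x => (Φ x - Φ x₁) / c with hζ
  have hrc : ContinuousAt r x₁ := (h.hr.differentiableAt (h.isOpen_U.mem_nhds hx₁)).continuousAt
  have hbs : Metric.ball (0 : ℂ) (ρ / 4) ⊆ halfStrip (ρ / 4) := fun z hz => by
    rw [mem_ball_zero_iff] at hz
    exact ⟨(abs_lt.1 ((Complex.abs_re_le_norm z).trans_lt hz)).1,
      (Complex.abs_im_le_norm z).trans_lt hz⟩
  have hev : ∀ᶠ x in 𝓝 x₁, x ∈ U ∧ ‖r x‖ ≤ ‖r x₁‖ + 1 ∧ ζ x ∈ halfStrip (ρ / 4) ∧ g (ζ x) = x ∧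
      σ (ζ x) = r x := by
    filter_upwards [h.isOpen_U.mem_nhds hx₁, himg (ρ / 4) (by positivity),
      hrc.norm.tendsto.eventually_lt_const (lt_add_one ‖r x₁‖)] with x h1 ⟨z, hz, hzx⟩ h3
    obtain ⟨k1, k2, k3⟩ := hball z (Metric.ball_subset_ball (by linarith) hz)
    -- The Liouville coordinate increases along the flow exactly by cz, so ζ inverts g near x₁.
    have e : ζ x = z := by
      simp only [hζ]
      rw [← hzx, k3, add_sub_cancel_left, mul_div_cancel_left₀ _ hc0]
    rw [e]
    exact ⟨h1, h3.le, hbs hz, hzx, by rw [k2, hzx]⟩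
  obtain ⟨ρ₁, hρ₁, hρ₁s⟩ := Metric.mem_nhds_iff.1 hev
  have hU1 : Metric.ball x₁ ρ₁ ⊆ U := fun x hx => (hρ₁s hx).1
  have hζd : ∀ x ∈ Metric.ball x₁ ρ₁, HasDerivAt ζ (r x / c) x := fun x hx =>
    ((h.hΦ x (hU1 hx)).sub_const _).div_const c
  have hζm : MapsTo ζ (Metric.ball x₁ ρ₁) (halfStrip (ρ / 4)) := fun x hx => (hρ₁s hx).2.2.1
  have hζD : DifferentiableOn ℂ ζ (Metric.ball x₁ ρ₁) := fun x hx =>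
    (hζd x hx).differentiableAt.differentiableWithinAt
  have hsub' : borelDisc θ d' ⊆ borelDisc θ δ := borelDisc_mono hd' (hd'd.trans hdδ)
  refine ⟨ρ₁, hρ₁, hU1, d', hd', hd'd.trans hdδ, (‖r x₁‖ + 1) * K, by positivity,
    fun x η => r x * F (ζ x) η / c, fun η hη => ?_, fun x hx => ?_, fun x hx η hη => ?_,
    fun x hx η hη => ?_⟩
  · exact ((h.hr.mono hU1).mul ((hFz η hη).comp hζD hζm)).div_const c
  · exact ((hFh _ (hζm hx)).const_mul _).div_const c
  · rw [norm_div, hcn, div_one, norm_mul]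
    exact mul_le_mul (hρ₁s hx).2.1 (hFK _ (hζm hx) η hη) (norm_nonneg _) (by positivity)
  · have e := hF _ (hζm hx) η hη
    obtain ⟨-, -, -, hgx, hσx⟩ := hρ₁s hx
    have hmem := hζm hx
    have hmem' : ζ x ∈ halfStrip ρ := halfStrip_mono (by linarith) hmem
    have hdW : DifferentiableAt ℂ (fun w => (ph 0 (g w) + ε * σ w) / 2 + η * (σ w * F w η / c))
        (ζ x) := by
      have n1 := (isOpen_halfStrip ρ).mem_nhds hmem'
      have n2 := (isOpen_halfStrip (ρ / 4)).mem_nhds hmem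
      have d1 : DifferentiableAt ℂ (fun w => ph 0 (g w)) (ζ x) :=
        ((h.hph 0).comp hgd hgX).differentiableAt n1
      have d2 := hσd.differentiableAt n1
      have d3 := (hFz η hη).differentiableAt n2
      exact ((d1.add (d2.const_mul ε)).div_const 2).add (((d2.mul d3).div_const c).const_mul η)
    have hder : HasDerivAt (fun y => charRoot ph r ε y + η * (r y * F (ζ y) η / c))
        (deriv (fun w => (ph 0 (g w) + ε * σ w) / 2 + η * (σ w * F w η / c)) (ζ x) * (r x / c)) x := by
      refine (hdW.hasDerivAt.comp x (hζd x hx)).congr_of_eventuallyEq ?_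
      filter_upwards [Metric.isOpen_ball.mem_nhds hx] with y hy
      obtain ⟨-, -, -, hgy, hσy⟩ := hρ₁s hy
      simp only [Function.comp, hgy, hσy, charRoot]
    rw [hder.deriv]
    rw [hgx, hσx] at e
    simp only [charRoot]
    rw [← e, mul_assoc]

/-- Near each point of `U` the Riccati equation has an exact solution that is Gevrey-asymptotic to
the formal characteristic root. -/
theorem exists_local_gevrey (h : IsSetting X S ϑm ϑp p q ph qh θ δ ε U r Φ)
    {s : ℕ → ℂ → ℂ} (hs : IsFormalCharRoot U ph qh (charRoot ph r ε) s) {x₁ : ℂ} (hx₁ : x₁ ∈ U) :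
    ∃ ρ > 0, Metric.ball x₁ ρ ⊆ U ∧ ∃ d > 0, d ≤ δ ∧ ∃ C M : ℝ, 0 < C ∧ 0 < M ∧ ∃ Y : ℂ → ℂ → ℂ,
      (∀ η ∈ borelDisc θ d, DifferentiableOn ℂ (fun x => Y x η) (Metric.ball x₁ ρ)) ∧
      (∀ x ∈ Metric.ball x₁ ρ, DifferentiableOn ℂ (Y x) (borelDisc θ d)) ∧
      (∀ x ∈ Metric.ball x₁ ρ, GevreyOn (borelDisc θ d) C M (Y x) fun k => tailCoeff s k x) ∧
      ∀ x ∈ Metric.ball x₁ ρ, ∀ η ∈ borelDisc θ d,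
        η * deriv (fun y => charRoot ph r ε y + η * Y y η) x =
          (charRoot ph r ε x + η * Y x η) ^ 2 - p x η * (charRoot ph r ε x + η * Y x η) + q x η := by
  obtain ⟨ρ₁, hρ₁, hρ₁U, d₁, hd₁, hd₁δ, K, hK, Y, hYx, hYη, hYK, hY⟩ := h.exists_local_riccati hx₁
  obtain ⟨ρ₂, hρ₂, hcl⟩ : ∃ ρ₂ > 0, Metric.closedBall x₁ ρ₂ ⊆ U :=
    Metric.nhds_basis_closedBall.mem_iff.1 (h.isOpen_U.mem_nhds hx₁)
  have hcomp := isCompact_closedBall x₁ ρ₂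
  obtain ⟨d₃, hd₃, C₃, M₃, hC₃, hM₃, G₃⟩ :=
    h.hpg.exists_gevreyOn h.le_sub h.add_le hcomp (hcl.trans h.hUX)
  obtain ⟨d₄, hd₄, C₄, M₄, hC₄, hM₄, G₄⟩ :=
    h.hqg.exists_gevreyOn h.le_sub h.add_le hcomp (hcl.trans h.hUX)
  have hld : DifferentiableOn ℂ (charRoot ph r ε) U :=
    (((h.hph 0).mono h.hUX).add (h.hr.const_mul ε)).div_const 2
  obtain ⟨b₁, hb₁⟩ := hcomp.exists_bound_of_continuousOn (hld.continuousOn.mono hcl)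
  obtain ⟨b₂, hb₂⟩ : ∃ b₂ : ℝ, ∀ x ∈ Metric.closedBall x₁ ρ₂, ‖(r x)⁻¹‖ ≤ b₂ :=
    hcomp.exists_bound_of_continuousOn ((h.hr.continuousOn.mono hcl).inv₀ fun x hx => h.r_ne_zero (hcl hx))
  have hεn : ‖ε‖ = 1 := by rcases h.hε with rfl | rfl <;> simp
  set ρ := min (min ρ₁ ρ₂) 1 with hρ
  have hρ0 : 0 < ρ := lt_min (lt_min hρ₁ hρ₂) one_pos
  have s1 : Metric.ball x₁ ρ ⊆ Metric.ball x₁ ρ₁ :=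
    Metric.ball_subset_ball ((min_le_left _ _).trans (min_le_left _ _))
  have s2 : Metric.ball x₁ ρ ⊆ Metric.closedBall x₁ ρ₂ := Metric.ball_subset_closedBall.trans
    (Metric.closedBall_subset_closedBall ((min_le_left _ _).trans (min_le_right _ _)))
  have sU : Metric.ball x₁ ρ ⊆ U := s1.trans hρ₁U
  set d := min d₁ (min d₃ d₄) with hd
  have hd0 : 0 < d := lt_min hd₁ (lt_min hd₃ hd₄)
  have t1 : borelDisc θ d ⊆ borelDisc θ d₁ := borelDisc_mono hd0 (min_le_left _ _)
  have t3 : borelDisc θ d ⊆ borelDisc θ d₃ :=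
    borelDisc_mono hd0 ((min_le_right _ _).trans (min_le_left _ _))
  have t4 : borelDisc θ d ⊆ borelDisc θ d₄ :=
    borelDisc_mono hd0 ((min_le_right _ _).trans (min_le_right _ _))
  -- The factor 2λ - p₀ equals εr, and 1/|r| ≤ b₂ on the compact disc; the chosen c makes 2c a lower
  -- bound for |r|.
  obtain ⟨d', hd', hd'd, C, M, hC, hM, G⟩ := exists_gevreyOn_of_riccati (p := p) (q := q) (S := Y)
    (ph := ph) (qh := qh) (s := s) (lam := charRoot ph r ε) (c := 1 / (2 * (|b₂| + 1)))
    (K := K + |b₁|) (A := C₃ + C₄) (N := M₃ + M₄) hd0 hρ0 (min_le_right _ _) (by positivity)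
    (by positivity) (by positivity) (by positivity)
    ⟨fun k => (hs.1 k).mono sU, fun x hx => hs.2.1 (sU hx), fun x hx => hs.2.2 x (sU hx)⟩
    (fun η hη => (hYx η (t1 hη)).mono s1)
    (fun x hx => (hb₁ x (s2 hx)).trans (by linarith [le_abs_self b₁]))
    (fun x hx η hη => (hYK x (s1 hx) η (t1 hη)).trans (by linarith [abs_nonneg b₁]))
    (fun x hx => ((G₃ x (s2 hx)).mono t3).mono_const hC₃.le hM₃.le (by linarith) (by linarith))
    (fun x hx => ((G₄ x (s2 hx)).mono t4).mono_const hC₄.le hM₄.le (by linarith) (by linarith))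
    (by
      intro x hx
      have e : charRoot ph r ε x - ph 0 x + charRoot ph r ε x = ε * r x := by
        simp only [charRoot]; ring
      have h1 := hb₂ x (s2 hx)
      have hr0 : 0 < ‖r x‖ := norm_pos_iff.2 (h.r_ne_zero (sU hx))
      rw [norm_inv, inv_le_comm₀ hr0 (lt_of_lt_of_le (by positivity) h1)] at h1
      rw [e, norm_mul, hεn, one_mul]
      refine le_trans ?_ h1
      have hb0 : 0 < b₂ := by
        have h2 := hb₂ x (s2 hx)
        exact lt_of_lt_of_le (norm_pos_iff.2 (inv_ne_zero (h.r_ne_zero (sU hx)))) h2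
      rw [show 2 * (1 / (2 * (|b₂| + 1))) = (|b₂| + 1)⁻¹ by field_simp]
      exact inv_anti₀ hb0 (by linarith [le_abs_self b₂]))
    (fun x hx η hη => hY x (s1 hx) η (t1 hη))
  have s3 : Metric.ball x₁ (ρ / 2) ⊆ Metric.ball x₁ ρ := Metric.ball_subset_ball (by linarith)
  have t5 : borelDisc θ d' ⊆ borelDisc θ d := borelDisc_mono hd' hd'd
  exact ⟨ρ / 2, by positivity, s3.trans sU, d', hd', hd'd.trans ((min_le_left _ _).trans hd₁δ), C, M,
    hC, hM, Y, fun η hη => (hYx η (t1 (t5 hη))).mono (s3.trans s1),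
    fun x hx => (hYη x (s1 (s3 hx))).mono (t5.trans t1), G,
    fun x hx η hη => hY x (s1 (s3 hx)) η (t1 (t5 hη))⟩

end IsSetting

end WKB

end

noncomputable section

/-! ### Holomorphic dependence of linear differential equations on a parameter -/

/-- The primitive, vanishing at the origin, of `z ↦ F z h`, as an integral along the radius. -/
def radialPrimitive (F : ℂ → ℂ → ℂ) (z h : ℂ) : ℂ := ∫ t in (0 : ℝ)..1, z * F (t * z) h

theorem ofReal_mul_mem_ball {R t : ℝ} {z : ℂ} (hz : z ∈ Metric.ball (0 : ℂ) R)
    (ht : t ∈ Icc (0 : ℝ) 1) : (t : ℂ) * z ∈ Metric.ball (0 : ℂ) R := by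
  rw [mem_ball_zero_iff] at hz ⊢
  rw [norm_mul, Complex.norm_real, Real.norm_of_nonneg ht.1]
  nlinarith [ht.2, norm_nonneg z]

theorem hasDerivAt_radialPrimitive {R : ℝ} {F : ℂ → ℂ → ℂ} {h : ℂ}
    (hF : DifferentiableOn ℂ (fun z => F z h) (Metric.ball 0 R)) {z : ℂ}
    (hz : z ∈ Metric.ball (0 : ℂ) R) :
    HasDerivAt (fun z => radialPrimitive F z h) (F z h) z := by
  obtain ⟨G, hG⟩ := hF.isExactOn_ball
  have key : ∀ w ∈ Metric.ball (0 : ℂ) R, radialPrimitive F w h = G w - G 0 := by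
    intro w hw
    have hd : ∀ t ∈ uIcc (0 : ℝ) 1,
        HasDerivAt (fun t : ℝ => G (t * w)) (w * F (t * w) h) t := by
      intro t ht
      rw [uIcc_of_le zero_le_one] at ht
      have h1 : HasDerivAt (fun t : ℝ => (t : ℂ) * w) w t := by
        simpa using (Complex.ofRealCLM.hasDerivAt (x := t)).mul_const w
      exact (hG _ (ofReal_mul_mem_ball hw ht)).scomp t h1
    rw [radialPrimitive, intervalIntegral.integral_eq_sub_of_hasDerivAt hd]
    · simp
    · refine ContinuousOn.intervalIntegrable ?_
      rw [uIcc_of_le zero_le_one]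
      exact continuousOn_const.mul (hF.continuousOn.comp (by fun_prop)
        fun t ht => ofReal_mul_mem_ball hw ht)
  refine ((hG z hz).sub_const (G 0)).congr_of_eventuallyEq ?_
  filter_upwards [Metric.isOpen_ball.mem_nhds hz] with w hw using key w hw

theorem radialPrimitive_zero (F : ℂ → ℂ → ℂ) (h : ℂ) : radialPrimitive F 0 h = 0 := by
  simp [radialPrimitive]

/-- Each integration gains a factor 1/(n + 1); iterated, this builds the factorial that makes the
Picard series converge on any disc. -/
theorem norm_radialPrimitive_le {R c : ℝ} {n : ℕ} {F : ℂ → ℂ → ℂ} {h : ℂ}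
    (hb : ∀ z ∈ Metric.ball (0 : ℂ) R, ‖F z h‖ ≤ c * ‖z‖ ^ n) {z : ℂ}
    (hz : z ∈ Metric.ball (0 : ℂ) R) :
    ‖radialPrimitive F z h‖ ≤ c * ‖z‖ ^ (n + 1) / (n + 1) := by
  have h1 : ∀ t ∈ Ioc (0 : ℝ) 1, ‖z * F (t * z) h‖ ≤ c * ‖z‖ ^ (n + 1) * t ^ n := by
    intro t ht
    have h2 := hb _ (ofReal_mul_mem_ball hz ⟨ht.1.le, ht.2⟩)
    rw [norm_mul (t : ℂ), Complex.norm_real, Real.norm_of_nonneg ht.1.le] at h2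
    rw [norm_mul]
    calc ‖z‖ * ‖F (t * z) h‖ ≤ ‖z‖ * (c * (t * ‖z‖) ^ n) := by gcongr
      _ = _ := by ring
  refine (intervalIntegral.norm_integral_le_of_norm_le zero_le_one
    (ae_of_all _ h1) (Continuous.intervalIntegrable (by fun_prop) _ _)).trans (le_of_eq ?_)
  rw [intervalIntegral.integral_const_mul, integral_pow]
  simp
  ring

/-- Holomorphy in z is that of a primitive, holomorphy in the parameter is that of a dominated
integral, and a local bound joins them by Osgood's lemma. -/
theorem differentiableOn_radialPrimitive {B D : Set ℂ} (hD : IsOpen D) (hBo : IsOpen B)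
    (hB : ∀ z ∈ B, ∃ R, z ∈ Metric.ball 0 R ∧ Metric.closedBall 0 R ⊆ B) {F : ℂ → ℂ → ℂ}
    (hF : DifferentiableOn ℂ (fun z : ℂ × ℂ => F z.1 z.2) (B ×ˢ D)) :
    DifferentiableOn ℂ (fun z : ℂ × ℂ => radialPrimitive F z.1 z.2) (B ×ˢ D) := by
  have hloc : ∀ R, Metric.closedBall (0 : ℂ) R ⊆ B → ∀ h ∈ D, ∃ N ∈ 𝓝 h, N ⊆ D ∧ ∃ M : ℝ,
      ∀ z ∈ Metric.closedBall (0 : ℂ) R, ∀ k ∈ N, ‖F z k‖ ≤ M := by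
    intro R hR h hh
    obtain ⟨s, hs, hsD⟩ := Metric.nhds_basis_closedBall.mem_iff.1 (hD.mem_nhds hh)
    obtain ⟨M, hM⟩ := ((isCompact_closedBall (0 : ℂ) R).prod
      (isCompact_closedBall h s)).exists_bound_of_continuousOn
      (hF.continuousOn.mono (prod_mono hR hsD))
    exact ⟨_, Metric.closedBall_mem_nhds h hs, hsD, M, fun z hz k hk => hM (z, k) ⟨hz, hk⟩⟩
  have hFz : ∀ h ∈ D, DifferentiableOn ℂ (fun z => F z h) B := fun h hh =>
    hF.comp (f := fun z : ℂ => (z, h)) (by fun_prop) fun z hz => ⟨hz, hh⟩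
  refine differentiableOn_prod_of_separately hBo hD (fun h hh z hz => ?_) (fun z hz => ?_)
    fun z hz h hh => ?_
  · obtain ⟨R, hzR, hRB⟩ := hB z hz
    exact (hasDerivAt_radialPrimitive ((hFz h hh).mono (Metric.ball_subset_closedBall.trans hRB))
      hzR).differentiableAt.differentiableWithinAt
  · obtain ⟨R, hzR, hRB⟩ := hB z hz
    have hmem : ∀ t ∈ Ioc (0 : ℝ) 1, (t : ℂ) * z ∈ Metric.closedBall (0 : ℂ) R := fun t ht =>
      Metric.ball_subset_closedBall (ofReal_mul_mem_ball hzR ⟨ht.1.le, ht.2⟩)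
    rw [show radialPrimitive F z = fun h => ∫ t in Ioc (0 : ℝ) 1, z * F (t * z) h from
      funext fun h => intervalIntegral.integral_of_le zero_le_one]
    refine differentiableOn_integral_of_bound hD (fun h hh => ?_) ?_ fun h hh => ?_
    · refine ContinuousOn.aestronglyMeasurable ?_ measurableSet_Ioc
      exact continuousOn_const.mul ((hFz h hh).continuousOn.comp (by fun_prop)
        fun t ht => hRB (hmem t ht))
    · refine (ae_restrict_iff' measurableSet_Ioc).2 (ae_of_all _ fun t ht => ?_)
      exact (hF.comp (f := fun h : ℂ => ((t : ℂ) * z, h)) (by fun_prop)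
        fun h hh => ⟨hRB (hmem t ht), hh⟩).const_mul z
    · obtain ⟨N, hN, -, M, hM⟩ := hloc R hRB h hh
      refine ⟨N, hN, fun _ => ‖z‖ * M, integrable_const _,
        (ae_restrict_iff' measurableSet_Ioc).2 (ae_of_all _ fun t ht k hk => ?_)⟩
      rw [norm_mul]
      exact mul_le_mul_of_nonneg_left (hM _ (hmem t ht) k hk) (norm_nonneg z)
  · obtain ⟨R, hzR, hRB⟩ := hB z hz
    obtain ⟨N, hN, -, M, hM⟩ := hloc R hRB h hh
    refine ⟨_, Metric.isOpen_ball.mem_nhds hzR, N, hN, |M| * R, fun u hu k hk => ?_⟩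
    have h1 := norm_radialPrimitive_le (n := 0) (c := |M|) (F := F) (h := k)
      (fun w hw => by
        rw [pow_zero, mul_one]
        exact (hM w (Metric.ball_subset_closedBall hw) k hk).trans (le_abs_self M)) hu
    refine h1.trans ?_
    rw [mem_ball_zero_iff] at hu
    simp only [zero_add, pow_one, Nat.cast_zero, div_one]
    gcongr

/-- The Picard iterates for the system `v' = a w`, `w' = b v + c w`. -/
def picardTerm (a b c : ℂ → ℂ → ℂ) (v₀ w₀ : ℂ → ℂ) : ℕ → (ℂ → ℂ → ℂ) × (ℂ → ℂ → ℂ)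
  | 0 => (fun _ h => v₀ h, fun _ h => w₀ h)
  | n + 1 =>
    (radialPrimitive fun z h => a z h * (picardTerm a b c v₀ w₀ n).2 z h,
      radialPrimitive fun z h => b z h * (picardTerm a b c v₀ w₀ n).1 z h +
        c z h * (picardTerm a b c v₀ w₀ n).2 z h)

section Picard

variable {B D : Set ℂ} {a b c : ℂ → ℂ → ℂ} {v₀ w₀ : ℂ → ℂ}

theorem differentiableOn_picardTerm (hD : IsOpen D) (hBo : IsOpen B)
    (hB : ∀ z ∈ B, ∃ R, z ∈ Metric.ball 0 R ∧ Metric.closedBall 0 R ⊆ B)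
    (ha : DifferentiableOn ℂ (fun z : ℂ × ℂ => a z.1 z.2) (B ×ˢ D))
    (hb : DifferentiableOn ℂ (fun z : ℂ × ℂ => b z.1 z.2) (B ×ˢ D))
    (hc : DifferentiableOn ℂ (fun z : ℂ × ℂ => c z.1 z.2) (B ×ˢ D))
    (hv : DifferentiableOn ℂ v₀ D) (hw : DifferentiableOn ℂ w₀ D) (n : ℕ) :
    DifferentiableOn ℂ (fun z : ℂ × ℂ => (picardTerm a b c v₀ w₀ n).1 z.1 z.2) (B ×ˢ D) ∧
    DifferentiableOn ℂ (fun z : ℂ × ℂ => (picardTerm a b c v₀ w₀ n).2 z.1 z.2) (B ×ˢ D) := by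
  induction n with
  | zero =>
    exact ⟨hv.comp differentiableOn_snd fun z hz => hz.2,
      hw.comp differentiableOn_snd fun z hz => hz.2⟩
  | succ n ih =>
    exact ⟨differentiableOn_radialPrimitive (F := fun z h => a z h * (picardTerm a b c v₀ w₀ n).2 z h)
        hD hBo hB (ha.mul ih.2),
      differentiableOn_radialPrimitive (F := fun z h => b z h * (picardTerm a b c v₀ w₀ n).1 z h +
        c z h * (picardTerm a b c v₀ w₀ n).2 z h) hD hBo hB ((hb.mul ih.1).add (hc.mul ih.2))⟩

theorem norm_picardTerm_le {R K C : ℝ} {h : ℂ}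
    (ha : ∀ z ∈ Metric.ball (0 : ℂ) R, ‖a z h‖ ≤ K)
    (hbc : ∀ z ∈ Metric.ball (0 : ℂ) R, ‖b z h‖ + ‖c z h‖ ≤ K) (hv : ‖v₀ h‖ ≤ C) (hw : ‖w₀ h‖ ≤ C)
    (n : ℕ) : ∀ z ∈ Metric.ball (0 : ℂ) R,
      ‖(picardTerm a b c v₀ w₀ n).1 z h‖ ≤ C * K ^ n / n.factorial * ‖z‖ ^ n ∧
      ‖(picardTerm a b c v₀ w₀ n).2 z h‖ ≤ C * K ^ n / n.factorial * ‖z‖ ^ n := by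
  induction n with
  | zero => intro z hz; simpa [picardTerm] using ⟨hv, hw⟩
  | succ n ih =>
    intro z hz
    have e : C * K ^ (n + 1) / (n + 1).factorial * ‖z‖ ^ (n + 1) =
        K * (C * K ^ n / n.factorial) * ‖z‖ ^ (n + 1) / (n + 1) := by
      rw [Nat.factorial_succ]
      push_cast
      have : (n.factorial : ℝ) ≠ 0 := by exact_mod_cast n.factorial_ne_zero
      field_simp
      ring
    rw [e]
    refine ⟨norm_radialPrimitive_le (fun w hw => ?_) hz, norm_radialPrimitive_le (fun w hw => ?_) hz⟩
    · rw [norm_mul, mul_assoc]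
      exact mul_le_mul (ha w hw) (ih w hw).2 (norm_nonneg _) ((norm_nonneg _).trans (ha w hw))
    · have h0 : 0 ≤ C * K ^ n / n.factorial * ‖w‖ ^ n := (norm_nonneg _).trans (ih w hw).1
      calc _ ≤ ‖b w h‖ * ‖(picardTerm a b c v₀ w₀ n).1 w h‖ +
            ‖c w h‖ * ‖(picardTerm a b c v₀ w₀ n).2 w h‖ := by
              refine (norm_add_le _ _).trans ?_
              rw [norm_mul, norm_mul]
        _ ≤ ‖b w h‖ * (C * K ^ n / n.factorial * ‖w‖ ^ n) +
            ‖c w h‖ * (C * K ^ n / n.factorial * ‖w‖ ^ n) := by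
              gcongr
              exacts [(ih w hw).1, (ih w hw).2]
        _ = (‖b w h‖ + ‖c w h‖) * (C * K ^ n / n.factorial * ‖w‖ ^ n) := by ring
        _ ≤ K * (C * K ^ n / n.factorial * ‖w‖ ^ n) := by
              gcongr
              exact hbc w hw
        _ = _ := by ring

/-- Solutions of linear systems on discs and on the plane, with holomorphic dependence on a
parameter. -/
theorem exists_linear_solution (hD : IsOpen D) (hBo : IsOpen B)
    (hB : ∀ z ∈ B, ∃ R, z ∈ Metric.ball 0 R ∧ Metric.closedBall 0 R ⊆ B)
    (ha : DifferentiableOn ℂ (fun z : ℂ × ℂ => a z.1 z.2) (B ×ˢ D))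
    (hb : DifferentiableOn ℂ (fun z : ℂ × ℂ => b z.1 z.2) (B ×ˢ D))
    (hc : DifferentiableOn ℂ (fun z : ℂ × ℂ => c z.1 z.2) (B ×ˢ D))
    (hv : DifferentiableOn ℂ v₀ D) (hw : DifferentiableOn ℂ w₀ D) :
    ∃ v w : ℂ → ℂ → ℂ, DifferentiableOn ℂ (fun z : ℂ × ℂ => v z.1 z.2) (B ×ˢ D) ∧
      ∀ h ∈ D, v 0 h = v₀ h ∧ w 0 h = w₀ h ∧ ∀ z ∈ B,
        HasDerivAt (fun z => v z h) (a z h * w z h) z ∧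
        HasDerivAt (fun z => w z h) (b z h * v z h + c z h * w z h) z := by
  set P := picardTerm a b c v₀ w₀ with hP
  have hPd : ∀ n, DifferentiableOn ℂ (fun z : ℂ × ℂ => (P n).1 z.1 z.2) (B ×ˢ D) ∧
      DifferentiableOn ℂ (fun z : ℂ × ℂ => (P n).2 z.1 z.2) (B ×ˢ D) :=
    differentiableOn_picardTerm hD hBo hB ha hb hc hv hw
  have hsec : ∀ {F : ℂ → ℂ → ℂ}, DifferentiableOn ℂ (fun z : ℂ × ℂ => F z.1 z.2) (B ×ˢ D) →
      ∀ h ∈ D, DifferentiableOn ℂ (fun z => F z h) B := fun hF h hh =>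
    hF.comp (f := fun z : ℂ => (z, h)) (by fun_prop) fun z hz => ⟨hz, hh⟩
  -- A majorant of exponential type, uniform over a disc in z and a neighbourhood of the parameter.
  -- Linearity makes the series converge on the whole domain rather than just near the origin.
  have hloc : ∀ R, Metric.closedBall (0 : ℂ) R ⊆ B → ∀ h ∈ D, ∃ N ∈ 𝓝 h, IsOpen N ∧ N ⊆ D ∧
      ∃ (K : ℝ) (u : ℕ → ℝ), Summable u ∧ ∀ k ∈ N, ∀ z ∈ Metric.ball (0 : ℂ) R,
        ‖a z k‖ ≤ K ∧ ‖b z k‖ + ‖c z k‖ ≤ K ∧ ∀ n, ‖(P n).1 z k‖ ≤ u n ∧ ‖(P n).2 z k‖ ≤ u n := by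
    intro R hR h hh
    obtain ⟨s, hs, hsD⟩ := Metric.nhds_basis_closedBall.mem_iff.1 (hD.mem_nhds hh)
    have hc1 := (isCompact_closedBall (0 : ℂ) R).prod (isCompact_closedBall h s)
    have hsub := prod_mono hR hsD
    obtain ⟨K₁, h₁⟩ := hc1.exists_bound_of_continuousOn (ha.continuousOn.mono hsub)
    obtain ⟨K₂, h₂⟩ := hc1.exists_bound_of_continuousOn (hb.continuousOn.mono hsub)
    obtain ⟨K₃, h₃⟩ := hc1.exists_bound_of_continuousOn (hc.continuousOn.mono hsub)
    obtain ⟨C₁, h₄⟩ := (isCompact_closedBall h s).exists_bound_of_continuousOn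
      (hv.continuousOn.mono hsD)
    obtain ⟨C₂, h₅⟩ := (isCompact_closedBall h s).exists_bound_of_continuousOn
      (hw.continuousOn.mono hsD)
    set K := |K₁| + |K₂| + |K₃|
    set C := |C₁| + |C₂|
    have e₁ := le_abs_self K₁
    have e₂ := le_abs_self K₂
    have e₃ := le_abs_self K₃
    have e₄ := le_abs_self C₁
    have e₅ := le_abs_self C₂
    have p₁ := abs_nonneg K₁
    have p₂ := abs_nonneg K₂
    have p₃ := abs_nonneg K₃
    have p₄ := abs_nonneg C₁
    have p₅ := abs_nonneg C₂
    refine ⟨Metric.ball h s, Metric.ball_mem_nhds h hs, Metric.isOpen_ball,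
      Metric.ball_subset_closedBall.trans hsD, K, fun n => C * ((K * |R|) ^ n / n.factorial),
      (Real.summable_pow_div_factorial _).mul_left C, fun k hk z hz => ?_⟩
    have hk' := Metric.ball_subset_closedBall hk
    have ka : ∀ z ∈ Metric.ball (0 : ℂ) R, ‖a z k‖ ≤ K := fun z hz =>
      (h₁ (z, k) ⟨Metric.ball_subset_closedBall hz, hk'⟩).trans (by simp only [K]; linarith)
    have kbc : ∀ z ∈ Metric.ball (0 : ℂ) R, ‖b z k‖ + ‖c z k‖ ≤ K := fun z hz => by
      have i₂ := h₂ (z, k) ⟨Metric.ball_subset_closedBall hz, hk'⟩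
      have i₃ := h₃ (z, k) ⟨Metric.ball_subset_closedBall hz, hk'⟩
      simp only [K]
      dsimp only at i₂ i₃
      linarith
    refine ⟨ka z hz, kbc z hz, fun n => ?_⟩
    have hn := norm_picardTerm_le (C := C) ka kbc
      ((h₄ k hk').trans (by simp only [C]; linarith)) ((h₅ k hk').trans (by simp only [C]; linarith))
      n z hz
    have hzR : ‖z‖ ≤ |R| := (mem_ball_zero_iff.1 hz).le.trans (le_abs_self R)
    have e : C * K ^ n / n.factorial * ‖z‖ ^ n ≤ C * ((K * |R|) ^ n / n.factorial) := by
      rw [mul_pow]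
      calc C * K ^ n / n.factorial * ‖z‖ ^ n ≤ C * K ^ n / n.factorial * |R| ^ n := by gcongr
        _ = _ := by ring
    exact ⟨hn.1.trans e, hn.2.trans e⟩
  have hderiv : ∀ h ∈ D, ∀ z ∈ B, ∀ n,
      HasDerivAt (fun z => (P (n + 1)).1 z h) (a z h * (P n).2 z h) z ∧
      HasDerivAt (fun z => (P (n + 1)).2 z h) (b z h * (P n).1 z h + c z h * (P n).2 z h) z := by
    intro h hh z hz n
    obtain ⟨R, hzR, hRB⟩ := hB z hz
    have hs := Metric.ball_subset_closedBall.trans hRB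
    exact ⟨hasDerivAt_radialPrimitive (F := fun z h => a z h * (P n).2 z h)
        ((hsec (F := fun z h => a z h * (P n).2 z h) (ha.mul (hPd n).2) h hh).mono hs) hzR,
      hasDerivAt_radialPrimitive (F := fun z h => b z h * (P n).1 z h + c z h * (P n).2 z h)
        ((hsec (F := fun z h => b z h * (P n).1 z h + c z h * (P n).2 z h)
          ((hb.mul (hPd n).1).add (hc.mul (hPd n).2)) h hh).mono hs) hzR⟩
  have hzero : ∀ h, (∀ n, (P (n + 1)).1 0 h = 0) ∧ ∀ n, (P (n + 1)).2 0 h = 0 := fun h =>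
    by
    simp only [hP, picardTerm, radialPrimitive_zero, implies_true, and_self]
  have hP1 : ∀ z h, (P 0).1 z h = v₀ h := fun _ _ => rfl
  have hP2 : ∀ z h, (P 0).2 z h = w₀ h := fun _ _ => rfl
  clear_value P
  have hmain : ∀ h ∈ D, ∀ z ∈ B,
      HasDerivAt (fun z => ∑' n, (P n).1 z h) (a z h * ∑' n, (P n).2 z h) z ∧
      HasDerivAt (fun z => ∑' n, (P n).2 z h)
        (b z h * ∑' n, (P n).1 z h + c z h * ∑' n, (P n).2 z h) z := by
    intro h hh z hz
    obtain ⟨R, hzR, hRB⟩ := hB z hz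
    obtain ⟨N, hN, -, -, K, u, hu, hb'⟩ := hloc R hRB h hh
    have hhN := mem_of_mem_nhds hN
    have hsB := Metric.ball_subset_closedBall.trans hRB
    have s1 : ∀ y ∈ Metric.ball (0 : ℂ) R, Summable fun n => (P n).1 y h := fun y hy =>
      .of_norm_bounded hu fun n => ((hb' h hhN y hy).2.2 n).1
    have s2 : ∀ y ∈ Metric.ball (0 : ℂ) R, Summable fun n => (P n).2 y h := fun y hy =>
      .of_norm_bounded hu fun n => ((hb' h hhN y hy).2.2 n).2
    have g1 := hasDerivAt_tsum_of_isPreconnected (g := fun n y => (P (n + 1)).1 y h)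
      (g' := fun n y => a y h * (P n).2 y h) (hu.mul_left K) Metric.isOpen_ball
      (convex_ball (0 : ℂ) R).isPreconnected (fun n y hy => (hderiv h hh y (hsB hy) n).1)
      (fun n y hy => by
        obtain ⟨i₁, -, i₃⟩ := hb' h hhN y hy
        rw [norm_mul]
        exact mul_le_mul i₁ (i₃ n).2 (norm_nonneg _) ((norm_nonneg _).trans i₁)) hzR
      ((summable_nat_add_iff 1).2 (s1 z hzR)) hzR
    have g2 := hasDerivAt_tsum_of_isPreconnected (g := fun n y => (P (n + 1)).2 y h)
      (g' := fun n y => b y h * (P n).1 y h + c y h * (P n).2 y h) (hu.mul_left K) Metric.isOpen_ball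
      (convex_ball (0 : ℂ) R).isPreconnected (fun n y hy => (hderiv h hh y (hsB hy) n).2)
      (fun n y hy => by
        obtain ⟨-, i₂, i₃⟩ := hb' h hhN y hy
        refine (norm_add_le _ _).trans ?_
        rw [norm_mul, norm_mul]
        have hu0 : 0 ≤ u n := (norm_nonneg _).trans (i₃ n).1
        calc _ ≤ ‖b y h‖ * u n + ‖c y h‖ * u n := by
              gcongr
              exacts [(i₃ n).1, (i₃ n).2]
          _ = (‖b y h‖ + ‖c y h‖) * u n := by ring
          _ ≤ K * u n := by gcongr) hzR
      ((summable_nat_add_iff 1).2 (s2 z hzR)) hzR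
    rw [tsum_mul_left] at g1
    rw [((s1 z hzR).mul_left _).tsum_add ((s2 z hzR).mul_left _), tsum_mul_left,
      tsum_mul_left] at g2
    refine ⟨(g1.const_add (v₀ h)).congr_of_eventuallyEq ?_,
      (g2.const_add (w₀ h)).congr_of_eventuallyEq ?_⟩
    · filter_upwards [Metric.isOpen_ball.mem_nhds hzR] with y hy using by
        rw [(s1 y hy).tsum_eq_zero_add, hP1]
    · filter_upwards [Metric.isOpen_ball.mem_nhds hzR] with y hy using by
        rw [(s2 y hy).tsum_eq_zero_add, hP2]
  refine ⟨fun z h => ∑' n, (P n).1 z h, fun z h => ∑' n, (P n).2 z h, ?_, fun h hh =>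
    ⟨?_, ?_, fun z hz => hmain h hh z hz⟩⟩
  · refine differentiableOn_prod_of_separately hBo hD
      (fun h hh z hz => (hmain h hh z hz).1.differentiableAt.differentiableWithinAt)
      (fun z hz h hh => ?_) fun z hz h hh => ?_
    · obtain ⟨R, hzR, hRB⟩ := hB z hz
      obtain ⟨N, hN, hNo, hND, K, u, hu, hb'⟩ := hloc R hRB h hh
      refine ((Complex.differentiableOn_tsum_of_summable_norm (F := fun n k => (P n).1 z k) hu (fun n => ?_)
        hNo fun n k hk => ((hb' k hk z hzR).2.2 n).1).differentiableAt hN).differentiableWithinAt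
      exact (hPd n).1.comp (f := fun k : ℂ => (z, k)) (by fun_prop) fun k hk => ⟨hz, hND hk⟩
    · obtain ⟨R, hzR, hRB⟩ := hB z hz
      obtain ⟨N, hN, -, -, K, u, hu, hb'⟩ := hloc R hRB h hh
      exact ⟨_, Metric.isOpen_ball.mem_nhds hzR, N, hN, ∑' n, u n, fun y hy k hk =>
        tsum_of_norm_bounded hu.hasSum fun n => ((hb' k hk y hy).2.2 n).1⟩
  · dsimp only
    rw [tsum_eq_single 0 fun n hn => ?_]
    · exact hP1 0 h
    · obtain ⟨m, rfl⟩ := Nat.exists_eq_succ_of_ne_zero hn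
      exact (hzero h).1 m
  · dsimp only
    rw [tsum_eq_single 0 fun n hn => ?_]
    · exact hP2 0 h
    · obtain ⟨m, rfl⟩ := Nat.exists_eq_succ_of_ne_zero hn
      exact (hzero h).2 m

end Picard

end

/-! ### ### The Cauchy problem on a simply connected domain, and primitives with parameters -/

noncomputable section

theorem IsChart.exists_closedBall_subset {U B : Set ℂ} {x₀ : ℂ} {φ f : ℂ → ℂ}
    (h : IsChart U x₀ B φ f) {z : ℂ} (hz : z ∈ B) :
    ∃ R, z ∈ Metric.ball 0 R ∧ Metric.closedBall 0 R ⊆ B := by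
  obtain ⟨R, -, hRB, hzR⟩ := h.exists_radius isCompact_singleton (singleton_subset_iff.2 hz)
  exact ⟨R, hzR rfl, hRB⟩

theorem IsChart.zero_mem {U B : Set ℂ} {x₀ : ℂ} {φ f : ℂ → ℂ} (h : IsChart U x₀ B φ f) :
    (0 : ℂ) ∈ B := by
  rcases h.domain with rfl | rfl
  · exact Metric.mem_ball_self one_pos
  · trivial

theorem IsChart.inv_base {U B : Set ℂ} {x₀ : ℂ} {φ f : ℂ → ℂ} (h : IsChart U x₀ B φ f) :
    f x₀ = 0 := by
  rw [← h.zero, h.left_inv 0 h.zero_mem]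

theorem iteratedDeriv_two_eq {ψ χ : ℂ → ℂ} {x χ' : ℂ}
    (h1 : ∀ᶠ y in 𝓝 x, HasDerivAt ψ (χ y) y) (h2 : HasDerivAt χ χ' x) :
    iteratedDeriv 2 ψ x = χ' := by
  rw [show (2 : ℕ) = 1 + 1 from rfl, iteratedDeriv_succ, iteratedDeriv_one]
  refine (h2.congr_of_eventuallyEq ?_).deriv
  filter_upwards [h1] with y hy using hy.deriv

namespace WKB

/-- The Cauchy problem for the equation `ħ² ψ'' + p ħ ψ' + q ψ = 0` on a simply connected domain. -/
theorem exists_isHolSolution {U D : Set ℂ} (hU : IsOpen U) (hUs : IsSimplyConnected U) {x₀ : ℂ}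
    (hx₀ : x₀ ∈ U) (hD : IsOpen D) (hD0 : ∀ h ∈ D, h ≠ 0) {p q : ℂ → ℂ → ℂ} {w₀ : ℂ → ℂ}
    (hp : DifferentiableOn ℂ (fun z : ℂ × ℂ => p z.1 z.2) (U ×ˢ D))
    (hq : DifferentiableOn ℂ (fun z : ℂ × ℂ => q z.1 z.2) (U ×ˢ D))
    (hw : DifferentiableOn ℂ w₀ D) :
    ∃ ψ, IsHolSolution p q U D ψ ∧
      ∀ h ∈ D, ψ x₀ h = 1 ∧ deriv (fun y => ψ y h) x₀ = w₀ h := by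
  obtain ⟨B, φ, f, hc⟩ := exists_isChart hU hUs hx₀
  have hmaps : MapsTo (fun z : ℂ × ℂ => (φ z.1, z.2)) (B ×ˢ D) (U ×ˢ D) := fun z hz =>
    ⟨hc.maps hz.1, hz.2⟩
  have hφ : DifferentiableOn ℂ (fun z : ℂ × ℂ => (φ z.1, z.2)) (B ×ˢ D) :=
    (hc.diff.comp differentiableOn_fst fun z hz => hz.1).prodMk differentiableOn_snd
  have hφ' : DifferentiableOn ℂ (fun z : ℂ × ℂ => deriv φ z.1) (B ×ˢ D) :=
    (hc.diff.deriv hc.isOpen_domain).comp differentiableOn_fst fun z hz => hz.1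
  have hi : DifferentiableOn ℂ (fun z : ℂ × ℂ => z.2⁻¹) (B ×ˢ D) :=
    (differentiableOn_inv.mono hD0).comp differentiableOn_snd fun z hz => hz.2
  -- In the chart, v is ψ and w is ψ', both pulled back by φ; the factors φ' come from the chain
  -- rule.
  obtain ⟨v, w, hvd, hvw⟩ := exists_linear_solution (B := B) (D := D)
    (a := fun z _ => deriv φ z) (b := fun z h => -(deriv φ z * q (φ z) h * h⁻¹ ^ 2))
    (c := fun z h => -(deriv φ z * p (φ z) h * h⁻¹)) (v₀ := fun _ => 1) (w₀ := w₀)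
    hD hc.isOpen_domain (fun z hz => hc.exists_closedBall_subset hz) hφ'
    ((hφ'.mul (hq.comp hφ hmaps)).mul (hi.pow 2)).neg
    ((hφ'.mul (hp.comp hφ hmaps)).mul hi).neg
    (differentiableOn_const _) hw
  have hf : ∀ x ∈ U, HasDerivAt f (deriv f x) x := fun x hx =>
    (hc.diff_inv.differentiableAt (hU.mem_nhds hx)).hasDerivAt
  have h1 : ∀ h ∈ D, ∀ x ∈ U, HasDerivAt (fun y => v (f y) h) (w (f x) h) x := by
    intro h hh x hx
    refine (((hvw h hh).2.2 _ (hc.maps_inv hx)).1.comp x (hf x hx)).congr_deriv ?_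
    linear_combination (w (f x) h) * hc.deriv_mul_deriv hU hx
  have h2 : ∀ h ∈ D, ∀ x ∈ U, HasDerivAt (fun y => w (f y) h)
      (-(q x h / h ^ 2 * v (f x) h) - p x h / h * w (f x) h) x := by
    intro h hh x hx
    refine (((hvw h hh).2.2 _ (hc.maps_inv hx)).2.comp x (hf x hx)).congr_deriv ?_
    rw [hc.right_inv x hx]
    linear_combination (-(q x h / h ^ 2 * v (f x) h) - p x h / h * w (f x) h) *
      hc.deriv_mul_deriv hU hx
  refine ⟨fun x h => v (f x) h, ⟨?_, fun x hx h hh => ?_⟩, fun h hh => ⟨?_, ?_⟩⟩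
  · exact hvd.comp (f := fun z : ℂ × ℂ => (f z.1, z.2))
      ((hc.diff_inv.comp differentiableOn_fst fun z hz => hz.1).prodMk differentiableOn_snd)
      fun z hz => ⟨hc.maps_inv hz.1, hz.2⟩
  · rw [iteratedDeriv_two_eq (by
      filter_upwards [hU.mem_nhds hx] with y hy using h1 h hh y hy) (h2 h hh x hx), (h1 h hh x hx).deriv]
    have := hD0 h hh
    field_simp
    ring
  · dsimp only
    rw [hc.inv_base]
    exact (hvw h hh).1
  · rw [(h1 h hh x₀ hx₀).deriv, hc.inv_base]
    exact (hvw h hh).2.1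

theorem eq_mul_exp_of_hasDerivAt {W : Set ℂ} (hW : IsOpen W) (hWc : IsPreconnected W) {x₀ : ℂ}
    (hx₀ : x₀ ∈ W) {g G y : ℂ → ℂ} (hG : IsPrimitive W x₀ g G)
    (hy : ∀ x ∈ W, HasDerivAt y (g x * y x) x) {x : ℂ} (hx : x ∈ W) :
    y x = y x₀ * Complex.exp (G x) := by
  have hd : ∀ x ∈ W, HasDerivAt (fun x => y x * Complex.exp (-G x)) 0 x := fun x hx => by
    refine ((hy x hx).mul (hG.2 x hx).neg.cexp).congr_deriv ?_
    ring
  have := hW.eqOn_of_deriv_eq hWc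
    (fun x hx => (hd x hx).differentiableAt.differentiableWithinAt)
    (differentiableOn_const (y x₀)) (fun x hx => by simp [(hd x hx).deriv]) hx₀
    (by simp [hG.1]) hx
  dsimp only at this
  rw [← this, mul_assoc, ← Complex.exp_add, neg_add_cancel, Complex.exp_zero, mul_one]

/-- A solution of the second order equation whose logarithmic derivative at `x₀` is that given by a
solution `σ` of the Riccati equation is the exponential of `-(1/ħ) ∫ σ`. -/
theorem eq_exp_of_riccati {W : Set ℂ} (hW : IsOpen W) (hWs : IsSimplyConnected W) {x₀ h : ℂ}
    (hx₀ : x₀ ∈ W) (hh : h ≠ 0) {p q σ G ψ : ℂ → ℂ} (hp : DifferentiableOn ℂ p W)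
    (hσ : DifferentiableOn ℂ σ W) (hψ : DifferentiableOn ℂ ψ W)
    (hric : ∀ x ∈ W, h * deriv σ x = σ x ^ 2 - p x * σ x + q x)
    (hode : ∀ x ∈ W, h ^ 2 * iteratedDeriv 2 ψ x + p x * h * deriv ψ x + q x * ψ x = 0)
    (h0 : ψ x₀ = 1) (h1 : h * deriv ψ x₀ = -σ x₀) (hG : IsPrimitive W x₀ σ G) {x : ℂ}
    (hx : x ∈ W) : ψ x = Complex.exp (-(G x) / h) := by
  have hWc := hWs.isPathConnected.isConnected.isPreconnected
  have hψ1 : ∀ x ∈ W, HasDerivAt ψ (deriv ψ x) x := fun x hx =>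
    (hψ.differentiableAt (hW.mem_nhds hx)).hasDerivAt
  have hψ2 : ∀ x ∈ W, HasDerivAt (deriv ψ) (iteratedDeriv 2 ψ x) x := fun x hx => by
    have := ((hψ.deriv hW).differentiableAt (hW.mem_nhds hx)).hasDerivAt
    rwa [show (2 : ℕ) = 1 + 1 from rfl, iteratedDeriv_succ, iteratedDeriv_one]
  have hσ1 : ∀ x ∈ W, HasDerivAt σ (deriv σ x) x := fun x hx =>
    (hσ.differentiableAt (hW.mem_nhds hx)).hasDerivAt
  -- By the two equations hψ' + σψ solves a homogeneous first order equation with rate (σ - p)/h. It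
  -- vanishes at x₀, hence everywhere.
  have hu : ∀ x ∈ W, h * deriv ψ x + σ x * ψ x = 0 := by
    intro x hx
    rw [eq_mul_exp_of_hasDerivAt (g := fun x => (σ x - p x) / h)
      (y := fun x => h * deriv ψ x + σ x * ψ x) hW hWc hx₀
      (isPrimitive_primitive hW hWs x₀ ((hσ.sub hp).div_const h)) (fun x hx => ?_) hx]
    · rw [h0, h1]
      ring
    · refine (((hψ2 x hx).const_mul h).add ((hσ1 x hx).mul (hψ1 x hx))).congr_deriv ?_
      field_simp
      linear_combination (ψ x) * hric x hx + hode x hx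
  have hy := eq_mul_exp_of_hasDerivAt (g := fun x => -σ x / h) (G := fun x => -(G x) / h) (y := ψ)
    hW hWc hx₀ ⟨by simp [hG.1], fun x hx => ((hG.2 x hx).neg.div_const h)⟩ (fun x hx => by
      refine (hψ1 x hx).congr_deriv ?_
      field_simp
      linear_combination hu x hx) hx
  rw [hy, h0, one_mul]

/-- Integration from the base point is bounded for the supremum norm on compactly contained discs
of a chart. -/
theorem exists_norm_primitive_le {U B : Set ℂ} {x₀ : ℂ} {φ f : ℂ → ℂ} (hc : IsChart U x₀ B φ f)
    {ρ : ℝ} (hρ : 0 < ρ) (hρB : Metric.closedBall 0 ρ ⊆ B) :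
    ∃ K > 0, ∀ (g G : ℂ → ℂ) (c : ℝ), IsPrimitive (φ '' Metric.ball 0 ρ) x₀ g G →
      (∀ x ∈ φ '' Metric.ball 0 ρ, ‖g x‖ ≤ c) → ∀ x ∈ φ '' Metric.ball 0 ρ, ‖G x‖ ≤ c * K := by
  obtain ⟨K, hK⟩ := (isCompact_closedBall (0 : ℂ) ρ).exists_bound_of_continuousOn
    ((hc.diff.deriv hc.isOpen_domain).continuousOn.mono hρB)
  refine ⟨(|K| + 1) * ρ, by positivity, ?_⟩
  rintro g G c hG hg _ ⟨w, hw, rfl⟩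
  have hd : ∀ z ∈ Metric.ball (0 : ℂ) ρ,
      HasDerivWithinAt (fun z => G (φ z)) (g (φ z) * deriv φ z) (Metric.ball 0 ρ) z := fun z hz =>
    ((hG.2 _ (mem_image_of_mem φ hz)).comp z
      (hc.hasDerivAt (hρB (Metric.ball_subset_closedBall hz)))).hasDerivWithinAt
  have hb : ∀ z ∈ Metric.ball (0 : ℂ) ρ, ‖g (φ z) * deriv φ z‖ ≤ c * (|K| + 1) := fun z hz => by
    rw [norm_mul]
    have h1 := hg _ (mem_image_of_mem φ hz)
    exact mul_le_mul h1 ((hK z (Metric.ball_subset_closedBall hz)).trans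
      (by linarith [le_abs_self K])) (norm_nonneg _) ((norm_nonneg _).trans h1)
  have := (convex_ball (0 : ℂ) ρ).norm_image_sub_le_of_norm_hasDerivWithin_le hd hb
    (Metric.mem_ball_self hρ) hw
  rw [hc.zero, hG.1, sub_zero, sub_zero] at this
  have hw' : ‖w‖ ≤ ρ := (mem_ball_zero_iff.1 hw).le
  have h0 : 0 ≤ c * (|K| + 1) := (norm_nonneg _).trans (hb w hw)
  calc _ ≤ c * (|K| + 1) * ‖w‖ := this
    _ ≤ c * (|K| + 1) * ρ := by gcongr
    _ = _ := by ring

/-- Primitives depend holomorphically on a parameter. -/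
theorem differentiableOn_primitive_param {U B D : Set ℂ} (hU : IsOpen U) {x₀ : ℂ} {φ f : ℂ → ℂ}
    (hc : IsChart U x₀ B φ f) (hD : IsOpen D) {ρ : ℝ} (hρ : 0 < ρ)
    (hρB : Metric.closedBall 0 ρ ⊆ B) {F : ℂ → ℂ → ℂ} {C : ℝ}
    (hFx : ∀ h ∈ D, DifferentiableOn ℂ (fun x => F x h) (φ '' Metric.ball 0 ρ))
    (hFh : ∀ x ∈ φ '' Metric.ball 0 ρ, DifferentiableOn ℂ (F x) D)
    (hFC : ∀ x ∈ φ '' Metric.ball 0 ρ, ∀ h ∈ D, ‖F x h‖ ≤ C) {x : ℂ}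
    (hx : x ∈ φ '' Metric.ball 0 ρ) :
    DifferentiableOn ℂ (fun h => primitive (φ '' Metric.ball 0 ρ) x₀ (fun t => F t h) x) D := by
  set W := φ '' Metric.ball 0 ρ with hWd
  have hbB := Metric.ball_subset_closedBall.trans hρB
  have hWo : IsOpen W := hc.isOpen_image_ball hU hbB
  have hWs : IsSimplyConnected W := hc.isSimplyConnected_image_ball hρ hbB
  have hWU : W ⊆ U := by
    rintro _ ⟨w, hw, rfl⟩
    exact hc.maps (hbB hw)
  have hx₀ : x₀ ∈ W := ⟨0, Metric.mem_ball_self hρ, hc.zero⟩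
  have hmW : MapsTo φ (Metric.ball 0 ρ) W := mapsTo_image φ _
  have hfW : ∀ x ∈ W, f x ∈ Metric.ball (0 : ℂ) ρ := by
    rintro _ ⟨w, hw, rfl⟩
    rwa [hc.left_inv w (hbB hw)]
  have hdφ := hc.diff.deriv hc.isOpen_domain
  have hF : DifferentiableOn ℂ (fun z : ℂ × ℂ => F (φ z.1) z.2) (Metric.ball 0 ρ ×ˢ D) :=
    differentiableOn_prod_of_separately (f := fun z h => F (φ z) h) Metric.isOpen_ball hD
      (fun h hh => (hFx h hh).comp (hc.diff.mono hbB) hmW) (fun z hz => hFh _ (hmW hz))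
      fun z hz h hh => ⟨_, Metric.isOpen_ball.mem_nhds hz, _, hD.mem_nhds hh, C, fun u hu v hv =>
        hFC _ (hmW hu) v hv⟩
  have hF' : DifferentiableOn ℂ (fun z : ℂ × ℂ => F (φ z.1) z.2 * deriv φ z.1)
      (Metric.ball 0 ρ ×ˢ D) :=
    hF.mul ((hdφ.mono hbB).comp differentiableOn_fst fun z hz => hz.1)
  have hT := differentiableOn_radialPrimitive (F := fun z h => F (φ z) h * deriv φ z) hD
    Metric.isOpen_ball (fun z hz => by
      obtain ⟨R, hR1, hR2⟩ := exists_between (mem_ball_zero_iff.1 hz)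
      exact ⟨R, mem_ball_zero_iff.2 hR1, Metric.closedBall_subset_ball hR2⟩) hF'
  -- The primitive chosen separately for each h is identified with one explicit integral along the
  -- radius in the chart, for which holomorphy in h is known.
  have key : ∀ h ∈ D, primitive W x₀ (fun t => F t h) x =
      radialPrimitive (fun z h => F (φ z) h * deriv φ z) (f x) h := by
    intro h hh
    refine (isPrimitive_primitive hWo hWs x₀ (hFx h hh)).eqOn hWo
      hWs.isPathConnected.isConnected.isPreconnected subset_rfl hx₀
      (G₂ := fun x => radialPrimitive (fun z h => F (φ z) h * deriv φ z) (f x) h) ⟨?_, ?_⟩ hx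
    · dsimp only
      rw [hc.inv_base, radialPrimitive_zero]
    · intro y hy
      have h1 := hasDerivAt_radialPrimitive (F := fun z h => F (φ z) h * deriv φ z) (h := h)
        (hF'.comp (f := fun z : ℂ => (z, h)) (by fun_prop) fun z hz => ⟨hz, hh⟩) (hfW y hy)
      refine (h1.comp y (hc.diff_inv.differentiableAt (hU.mem_nhds (hWU hy))).hasDerivAt).congr_deriv
        ?_
      rw [hc.right_inv y (hWU hy), mul_assoc, hc.deriv_mul_deriv hU (hWU hy), mul_one]
  refine (hT.comp (f := fun h : ℂ => (f x, h)) (by fun_prop)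
    fun h hh => ⟨hfW x hx, hh⟩).congr fun h hh => key h hh

/-- The coefficients of a uniform Gevrey expansion of a holomorphic function are holomorphic. -/
theorem differentiableOn_coeff_of_gevreyOn {V : Set ℂ} (hV : IsOpen V) {θ δ C M : ℝ} (hδ : 0 < δ)
    {f : ℂ → ℂ → ℂ} {a : ℕ → ℂ → ℂ}
    (hfx : ∀ h ∈ borelDisc θ δ, DifferentiableOn ℂ (fun x => f x h) V)
    (hG : ∀ x ∈ V, GevreyOn (borelDisc θ δ) C M (f x) fun k => a k x) (n : ℕ) :
    DifferentiableOn ℂ (a n) V := by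
  induction n using Nat.strong_induction_on with
  | _ n ih =>
  set u := Complex.exp (θ * Complex.I) with hu
  have hu1 : ‖u‖ = 1 := Complex.norm_exp_ofReal_mul_I θ
  have hev : ∀ᶠ t : ℝ in 𝓝[>] 0, 0 < t ∧ t < δ :=
    (eventually_mem_nhdsWithin).and (eventually_nhdsWithin_of_eventually_nhds
      (eventually_lt_nhds hδ))
  set c := C * M ^ (n + 1) * (n + 1).factorial with hcdef
  -- Along the ray of direction θ, the n-th coefficient is a limit of normalised remainders, uniform
  -- on V by the Gevrey bound of order n + 1. Holomorphy is inherited inductively.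
  have hlim : TendstoUniformlyOn
      (fun (t : ℝ) x => (f x (u * t) - ∑ k ∈ Finset.range n, a k x * (u * t) ^ k) / (u * t) ^ n)
      (a n) (𝓝[>] 0) V := by
    rw [Metric.tendstoUniformlyOn_iff]
    intro e he
    have h2 : ∀ᶠ t : ℝ in 𝓝[>] 0, |c| * t < e := by
      refine eventually_nhdsWithin_of_eventually_nhds ?_
      have : Tendsto (fun t : ℝ => |c| * t) (𝓝 0) (𝓝 (|c| * 0)) :=
        tendsto_id.const_mul _
      rw [mul_zero] at this
      exact this.eventually (eventually_lt_nhds he)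
    filter_upwards [hev, h2] with t ht hte x hx
    have hmem : u * t ∈ borelDisc θ δ := mem_borelDisc_ofReal ht.1 ht.2
    have hne : u * t ≠ 0 := ne_zero_of_mem_borelDisc hδ hmem
    have hn : ‖u * (t : ℂ)‖ = t := by
      rw [norm_mul, hu1, one_mul, Complex.norm_real, Real.norm_of_nonneg ht.1.le]
    have hg := hG x hx (n + 1) _ hmem
    rw [Finset.sum_range_succ, hn] at hg
    rw [dist_comm, dist_eq_norm]
    have e1 : (f x (u * t) - ∑ k ∈ Finset.range n, a k x * (u * t) ^ k) / (u * t) ^ n - a n x =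
        (f x (u * t) - (∑ k ∈ Finset.range n, a k x * (u * t) ^ k + a n x * (u * t) ^ n)) /
          (u * t) ^ n := by
      field_simp
      ring
    rw [e1, norm_div, norm_pow, hn, div_lt_iff₀ (pow_pos ht.1 n)]
    calc _ ≤ c * t ^ (n + 1) := hg
      _ ≤ |c| * t ^ (n + 1) := by exact mul_le_mul_of_nonneg_right (le_abs_self c) (pow_pos ht.1 _).le
      _ = |c| * t * t ^ n := by ring
      _ < e * t ^ n := by exact mul_lt_mul_of_pos_right hte (pow_pos ht.1 n)
  refine hlim.tendstoLocallyUniformlyOn.differentiableOn ?_ hV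
  filter_upwards [hev] with t ht
  have hmem : u * t ∈ borelDisc θ δ := mem_borelDisc_ofReal ht.1 ht.2
  exact ((hfx _ hmem).sub (DifferentiableOn.fun_sum fun k hk =>
    (ih k (Finset.mem_range.1 hk)).mul_const _)).div_const _

end WKB

end

/-! ### ### Patching the local Riccati solutions through their Borel sums -/

noncomputable section

namespace WKB

/-- On `W`, and for `ħ` in the Borel disc of diameter `d`, the Borel sum of the formal solution
of the Riccati equation is a holomorphic solution, uniformly Gevrey-asymptotic to it. -/
structure IsRiccatiRegion (p q : ℂ → ℂ → ℂ) (lam : ℂ → ℂ) (s : ℕ → ℂ → ℂ) (θ : ℝ) (W : Set ℂ)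
    (d C M : ℝ) : Prop where
  diff_left : ∀ x ∈ W, ∀ η ∈ borelDisc θ d,
    DifferentiableAt ℂ (fun t => borelSum θ (fun k => tailCoeff s k t) η) x
  diff_right : ∀ x ∈ W, DifferentiableOn ℂ (borelSum θ fun k => tailCoeff s k x) (borelDisc θ d)
  gevrey : ∀ x ∈ W, GevreyOn (borelDisc θ d) C M (borelSum θ fun k => tailCoeff s k x)
    fun k => tailCoeff s k x
  riccati : ∀ x ∈ W, ∀ η ∈ borelDisc θ d,
    η * deriv (fun y => lam y + η * borelSum θ (fun k => tailCoeff s k y) η) x =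
      (lam x + η * borelSum θ (fun k => tailCoeff s k x) η) ^ 2
        - p x η * (lam x + η * borelSum θ (fun k => tailCoeff s k x) η) + q x η

variable {X S : Set ℂ} {ϑm ϑp : ℝ} {p q : ℂ → ℂ → ℂ} {ph qh : ℕ → ℂ → ℂ} {θ δ : ℝ} {ε : ℂ}
  {U : Set ℂ} {r Φ : ℂ → ℂ} {s : ℕ → ℂ → ℂ} {lam : ℂ → ℂ}

theorem IsRiccatiRegion.mono {W W' : Set ℂ} {d C M d' C' M' : ℝ}
    (h : IsRiccatiRegion p q lam s θ W d C M) (hW : W' ⊆ W) (hd' : 0 < d') (hd : d' ≤ d)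
    (hC : 0 ≤ C) (hM : 0 ≤ M) (hCC : C ≤ C') (hMM : M ≤ M') :
    IsRiccatiRegion p q lam s θ W' d' C' M' where
  diff_left x hx η hη := h.diff_left x (hW hx) η (borelDisc_mono hd' hd hη)
  diff_right x hx := (h.diff_right x (hW hx)).mono (borelDisc_mono hd' hd)
  gevrey x hx := ((h.gevrey x (hW hx)).mono (borelDisc_mono hd' hd)).mono_const hC hM hCC hMM
  riccati x hx η hη := h.riccati x (hW hx) η (borelDisc_mono hd' hd hη)

/-- The local exact solution equals the Borel sum of its expansion, so it may be replaced by
`borelSum`, which no longer depends on the local construction. -/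
theorem IsSetting.exists_local_region (h : IsSetting X S ϑm ϑp p q ph qh θ δ ε U r Φ)
    (hs : IsFormalCharRoot U ph qh (charRoot ph r ε) s) {x₁ : ℂ} (hx₁ : x₁ ∈ U) :
    ∃ N ∈ 𝓝 x₁, ∃ d C M : ℝ, 0 < d ∧ d ≤ δ ∧ 0 < C ∧ 0 < M ∧
      IsRiccatiRegion p q (charRoot ph r ε) s θ N d C M := by
  obtain ⟨ρ, hρ, hρU, d, hd, hdδ, C, M, hC, hM, Y, hYx, hYh, hYG, hY⟩ := h.exists_local_gevrey hs hx₁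
  obtain ⟨A, L, -, hL, hA⟩ := exists_borelSum_eq Metric.isOpen_ball hd hC hM hYh hYx
    (fun k => (hs.1 (k + 1)).mono hρU) hYG
  set d' := min d (1 / L)
  have hd' : 0 < d' := lt_min hd (by positivity)
  have hsub : borelDisc θ d' ⊆ borelDisc θ d := borelDisc_mono hd' (min_le_left _ _)
  have heq : ∀ x ∈ Metric.ball x₁ ρ, ∀ η ∈ borelDisc θ d',
      borelSum θ (fun k => tailCoeff s k x) η = Y x η := fun x hx η hη =>
    ((hA x hx).1 η (borelDisc_mono hd' (min_le_right _ _) hη)).symm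
  have hev : ∀ x ∈ Metric.ball x₁ ρ, ∀ η ∈ borelDisc θ d',
      (fun t => borelSum θ (fun k => tailCoeff s k t) η) =ᶠ[𝓝 x] fun t => Y t η := by
    intro x hx η hη
    filter_upwards [Metric.isOpen_ball.mem_nhds hx] with y hy using heq y hy η hη
  refine ⟨_, Metric.ball_mem_nhds x₁ hρ, d', C, M, hd', (min_le_left _ _).trans hdδ, hC, hM,
    fun x hx η hη => ?_, fun x hx => ?_, fun x hx n η hη => ?_, fun x hx η hη => ?_⟩
  · exact ((hYx η (hsub hη)).differentiableAt (Metric.isOpen_ball.mem_nhds hx)).congr_of_eventuallyEq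
      (hev x hx η hη)
  · exact ((hYh x hx).mono hsub).congr fun η hη => heq x hx η hη
  · rw [heq x hx η hη]
    exact hYG x hx n η (hsub hη)
  · rw [heq x hx η hη, ← hY x hx η (hsub hη)]
    congr 1
    refine EventuallyEq.deriv_eq ?_
    filter_upwards [hev x hx η hη] with y hy
    rw [hy]

/-- All the properties concern one globally defined function, so regions can be united without any
compatibility check; only the disc shrinks and the constants grow. -/
theorem IsSetting.exists_compact_region (h : IsSetting X S ϑm ϑp p q ph qh θ δ ε U r Φ)
    (hs : IsFormalCharRoot U ph qh (charRoot ph r ε) s) {K : Set ℂ} (hK : IsCompact K)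
    (hKU : K ⊆ U) : ∃ d C M : ℝ, 0 < d ∧ d ≤ δ ∧ 0 < C ∧ 0 < M ∧
      IsRiccatiRegion p q (charRoot ph r ε) s θ K d C M := by
  refine hK.induction_on (p := fun K => ∃ d C M : ℝ, 0 < d ∧ d ≤ δ ∧ 0 < C ∧ 0 < M ∧
    IsRiccatiRegion p q (charRoot ph r ε) s θ K d C M) ?_ ?_ ?_ fun x hx => ?_
  · exact ⟨δ, 1, 1, h.hδ, le_rfl, one_pos, one_pos, by simp, by simp, by simp, by simp⟩
  · rintro K₁ K₂ hsub ⟨d, C, M, hd, hdδ, hC, hM, hR⟩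
    exact ⟨d, C, M, hd, hdδ, hC, hM, hR.mono hsub hd le_rfl hC.le hM.le le_rfl le_rfl⟩
  · rintro K₁ K₂ ⟨d₁, C₁, M₁, hd₁, hdδ₁, hC₁, hM₁, h₁⟩ ⟨d₂, C₂, M₂, hd₂, hdδ₂, hC₂, hM₂, h₂⟩
    have hd : 0 < min d₁ d₂ := lt_min hd₁ hd₂
    have r₁ := h₁.mono (C' := max C₁ C₂) (M' := max M₁ M₂) subset_rfl hd (min_le_left _ _) hC₁.le
      hM₁.le (le_max_left _ _) (le_max_left _ _)
    have r₂ := h₂.mono (C' := max C₁ C₂) (M' := max M₁ M₂) subset_rfl hd (min_le_right _ _) hC₂.le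
      hM₂.le (le_max_right _ _) (le_max_right _ _)
    refine ⟨_, _, _, hd, (min_le_left _ _).trans hdδ₁, lt_max_of_lt_left hC₁, lt_max_of_lt_left hM₁,
      fun x hx => hx.elim (r₁.diff_left x) (r₂.diff_left x),
      fun x hx => hx.elim (r₁.diff_right x) (r₂.diff_right x),
      fun x hx => hx.elim (r₁.gevrey x) (r₂.gevrey x),
      fun x hx => hx.elim (r₁.riccati x) (r₂.riccati x)⟩
  · obtain ⟨N, hN, d, C, M, hR⟩ := h.exists_local_region hs (hKU hx)
    exact ⟨N, mem_nhdsWithin_of_mem_nhds hN, d, C, M, hR⟩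

/-- The integral from the base point of the Borel sum of the formal solution of the Riccati
equation. -/
def sumPrimitive (W : Set ℂ) (x₀ : ℂ) (θ : ℝ) (s : ℕ → ℂ → ℂ) (x η : ℂ) : ℂ :=
  primitive W x₀ (fun t => borelSum θ (fun k => tailCoeff s k t) η) x

/-- Every compact subset of `U` lies in a simply connected domain on which the Borel sum of the
formal WKB solution has uniform Gevrey estimates. -/
theorem IsSetting.exists_region (h : IsSetting X S ϑm ϑp p q ph qh θ δ ε U r Φ)
    (hs : IsFormalCharRoot U ph qh (charRoot ph r ε) s) {x₀ : ℂ} (hx₀ : x₀ ∈ U) {V : Set ℂ}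
    (hV : IsCompact V) (hVU : V ⊆ U) :
    ∃ W, IsOpen W ∧ IsSimplyConnected W ∧ x₀ ∈ W ∧ V ⊆ W ∧ W ⊆ U ∧ ∃ d C M : ℝ, 0 < d ∧ d ≤ δ ∧
      0 < C ∧ 0 < M ∧ IsRiccatiRegion p q (charRoot ph r ε) s θ W d C M ∧
      (∀ η ∈ borelDisc θ d, IsPrimitive W x₀ (fun t => borelSum θ (fun k => tailCoeff s k t) η)
        fun x => sumPrimitive W x₀ θ s x η) ∧
      (∀ x ∈ W, DifferentiableOn ℂ (sumPrimitive W x₀ θ s x) (borelDisc θ d)) ∧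
      ∀ x ∈ W, GevreyOn (borelDisc θ d) C M (fun η => Complex.exp (-sumPrimitive W x₀ θ s x η))
        fun k => ampCoeff U x₀ s k x := by
  have hU := h.isOpen_U
  obtain ⟨B, φ, f, hc⟩ := exists_isChart hU h.isSC hx₀
  obtain ⟨ρ, hρ, hρB, hVρ⟩ := hc.exists_radius (hV.image_of_continuousOn
    (hc.diff_inv.continuousOn.mono hVU)) (image_subset_iff.2 fun x hx => hc.maps_inv (hVU hx))
  have hbB := Metric.ball_subset_closedBall.trans hρB
  obtain ⟨d, C, M, hd, hdδ, hC, hM, hR⟩ := h.exists_compact_region hs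
    ((isCompact_closedBall (0 : ℂ) ρ).image_of_continuousOn (hc.diff.continuousOn.mono hρB))
    (image_subset_iff.2 fun w hw => hc.maps (hρB hw))
  obtain ⟨K, hK, hKb⟩ := exists_norm_primitive_le hc hρ hρB
  set W := φ '' Metric.ball 0 ρ with hW
  have hWo : IsOpen W := hc.isOpen_image_ball hU hbB
  have hWs : IsSimplyConnected W := hc.isSimplyConnected_image_ball hρ hbB
  have hWc : IsPreconnected W := hWs.isPathConnected.isConnected.isPreconnected
  have hWU : W ⊆ U := image_subset_iff.2 fun w hw => hc.maps (hbB hw)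
  have hxW : x₀ ∈ W := ⟨0, Metric.mem_ball_self hρ, hc.zero⟩
  have hVW : V ⊆ W := fun x hx =>
    ⟨f x, hVρ (mem_image_of_mem f hx), hc.right_inv x (hVU hx)⟩
  replace hR := hR.mono (image_mono Metric.ball_subset_closedBall) hd le_rfl hC.le hM.le le_rfl le_rfl
  have hYx : ∀ η ∈ borelDisc θ d,
      DifferentiableOn ℂ (fun t => borelSum θ (fun k => tailCoeff s k t) η) W := fun η hη x hx =>
    (hR.diff_left x hx η hη).differentiableWithinAt
  have hprim : ∀ η ∈ borelDisc θ d, IsPrimitive W x₀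
      (fun t => borelSum θ (fun k => tailCoeff s k t) η) fun x => sumPrimitive W x₀ θ s x η :=
    fun η hη => isPrimitive_primitive hWo hWs x₀ (hYx η hη)
  have hcoef : ∀ k, IsPrimitive W x₀ (tailCoeff s k) (primitive U x₀ (tailCoeff s k)) := fun k =>
    have := isPrimitive_primitive hU h.isSC x₀ (hs.1 (k + 1))
    ⟨this.1, fun x hx => this.2 x (hWU hx)⟩
  -- The remainder of the integral is the integral of the remainder, so each Gevrey bound is
  -- multiplied by the norm K of integration from x₀ and M is unchanged.
  have hIG : ∀ x ∈ W, GevreyOn (borelDisc θ d) (C * K) M (fun η => -sumPrimitive W x₀ θ s x η)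
      fun k => PowerSeries.coeff k
        (seriesAt (fun j y => -primitive U x₀ (tailCoeff s j) y) x) := by
    intro x hx n η hη
    have h1 := hKb (fun x => borelSum θ (fun k => tailCoeff s k x) η -
        ∑ k ∈ Finset.range n, tailCoeff s k x * η ^ k)
      (fun x => sumPrimitive W x₀ θ s x η -
        ∑ k ∈ Finset.range n, primitive U x₀ (tailCoeff s k) x * η ^ k)
      (C * M ^ n * n.factorial * ‖η‖ ^ n)
      ⟨by simp [(hprim η hη).1, (hcoef _).1], fun x hx => ((hprim η hη).2 x hx).sub
        (HasDerivAt.fun_sum fun k _ => ((hcoef k).2 x hx).mul_const _)⟩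
      (fun x hx => hR.gevrey x hx n η hη) x hx
    simp only [seriesAt, PowerSeries.coeff_mk, neg_mul, Finset.sum_neg_distrib]
    rw [neg_sub_neg, norm_sub_rev]
    refine h1.trans (le_of_eq ?_)
    ring
  have hIh : ∀ x ∈ W, DifferentiableOn ℂ (sumPrimitive W x₀ θ s x) (borelDisc θ d) := fun x hx =>
    differentiableOn_primitive_param (C := C) hU hc (isOpen_borelDisc hd) hρ hρB hYx hR.diff_right
      (fun y hy η hη => by simpa using hR.gevrey y hy 0 η hη) hx
  refine ⟨W, hWo, hWs, hxW, hVW, hWU, d, max C (Real.exp (7 * (C * K))), M, hd, hdδ,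
    lt_max_of_lt_left hC, hM, hR.mono subset_rfl hd le_rfl hC.le hM.le (le_max_left _ _) le_rfl,
    hprim, hIh, fun x hx => ?_⟩
  exact ((hIG x hx).formalExp hd (by positivity) hM.le).mono_const (Real.exp_pos _).le hM.le
    (le_max_right _ _) le_rfl

end WKB

end

/-! ### ### Borel summability, existence and uniqueness of exact WKB solutions -/

noncomputable section

namespace WKB

/-- Any holomorphic function with the given series as uniform Gevrey expansion serves as a witness
for Nevanlinna's theorem. Holomorphy of the coefficients is not assumed but deduced. -/
theorem locUnifBorelSummable_of_gevreyOn {U : Set ℂ} {θ : ℝ} {a : ℕ → ℂ → ℂ}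
    (h : ∀ x ∈ U, ∃ W, IsOpen W ∧ x ∈ W ∧ W ⊆ U ∧ ∃ d C M : ℝ, 0 < d ∧ 0 < C ∧ 0 < M ∧
      ∃ f : ℂ → ℂ → ℂ, (∀ x ∈ W, DifferentiableOn ℂ (f x) (borelDisc θ d)) ∧
        (∀ η ∈ borelDisc θ d, DifferentiableOn ℂ (fun x => f x η) W) ∧
        ∀ x ∈ W, GevreyOn (borelDisc θ d) C M (f x) fun k => a k x) :
    LocUnifBorelSummable U θ a := by
  intro x₁ hx₁
  obtain ⟨W, hW, hxW, hWU, d, C, M, hd, hC, hM, f, hf, hfx, hG⟩ := h x₁ hx₁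
  obtain ⟨η, hη, φ, hφ, hφb, A, L, -, -, hb, -⟩ := nevanlinna hW hd hC hM hf hfx
    (differentiableOn_coeff_of_gevreyOn hW hd hfx hG) hG
  exact ⟨W, hW, hxW, hWU, ⟨C, M, fun k x hx => (hG x hx).norm_coeff_le hd k⟩, η, hη, φ, hφ, hφb,
    A, L, hb⟩

variable {X S : Set ℂ} {ϑm ϑp : ℝ} {p q : ℂ → ℂ → ℂ} {ph qh : ℕ → ℂ → ℂ} {θ δ : ℝ} {ε : ℂ}
  {U : Set ℂ} {r Φ : ℂ → ℂ} {s : ℕ → ℂ → ℂ} {x₀ : ℂ}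

/-- The functions s 0 and lam agree only on U, so the chosen primitives need not be the same
function; this compares them where it matters. -/
theorem IsFormalCharRoot.primitive_eq {lam : ℂ → ℂ} (hs : IsFormalCharRoot U ph qh lam s)
    (hU : IsOpen U) (hUs : IsSimplyConnected U) (hx₀ : x₀ ∈ U) :
    IsPrimitive U x₀ lam (primitive U x₀ lam) ∧
      EqOn (primitive U x₀ (s 0)) (primitive U x₀ lam) U := by
  have h1 := isPrimitive_primitive hU hUs x₀ (hs.1 0)
  have h2 := isPrimitive_primitive hU hUs x₀ ((hs.1 0).congr fun x hx => (hs.2.1 hx).symm)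
  refine ⟨h2, h1.eqOn hU hUs.isPathConnected.isConnected.isPreconnected subset_rfl hx₀
    ⟨h2.1, fun x hx => ?_⟩⟩
  rw [hs.2.1 hx]
  exact h2.2 x hx

theorem IsExactWKB.exists_gevreyOn {δ' : ℝ} (hδ' : 0 < δ') {ψ : ℂ → ℂ → ℂ}
    (h : IsExactWKB p q U x₀ s θ δ' ψ) {x : ℂ} (hx : x ∈ U) :
    DifferentiableOn ℂ (fun η => Complex.exp (primitive U x₀ (s 0) x / η) * ψ x η) (borelDisc θ δ') ∧
    ∀ d' > 0, ∃ d > 0, d ≤ d' ∧ ∃ C M : ℝ, 0 < C ∧ 0 < M ∧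
      GevreyOn (borelDisc θ d) C M (fun η => Complex.exp (primitive U x₀ (s 0) x / η) * ψ x η)
        fun k => ampCoeff U x₀ s k x := by
  refine ⟨?_, fun d' hd' => ?_⟩
  · refine DifferentiableOn.mul (DifferentiableOn.cexp ?_) ?_
    · exact (differentiableOn_const _).div differentiableOn_id
        fun η hη => ne_zero_of_mem_borelDisc hδ' hη
    · exact h.1.1.comp (f := fun η : ℂ => (x, η)) (by fun_prop) fun η hη => ⟨hx, hη⟩
  · obtain ⟨V, hV, -, hG⟩ := h.2.2 x hx
    obtain ⟨d, hd, -, C, M, hC, hM, hG⟩ := hG.exists_gevreyOn le_rfl le_rfl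
    have hm : 0 < min d d' := lt_min hd hd'
    exact ⟨_, hm, min_le_right _ _, C, M, hC, hM,
      (hG x (mem_of_mem_nhds hV)).mono (borelDisc_mono hm (min_le_left _ _))⟩

/-- The amplitude of an exact solution and f share one Gevrey expansion at x, so uniqueness for
Gevrey functions identifies them pointwise in x. -/
theorem IsExactWKB.eq_of_gevreyOn {δ' d C M : ℝ} (hδ' : 0 < δ') (hd : 0 < d) (hdδ : d ≤ δ')
    (hC : 0 < C) (hM : 0 < M) {ψ : ℂ → ℂ → ℂ} (h : IsExactWKB p q U x₀ s θ δ' ψ) {x : ℂ} (hx : x ∈ U)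
    {f : ℂ → ℂ} (hf : DifferentiableOn ℂ f (borelDisc θ d))
    (hG : GevreyOn (borelDisc θ d) C M f fun k => ampCoeff U x₀ s k x) {η : ℂ}
    (hη : η ∈ borelDisc θ d) : ψ x η = Complex.exp (-primitive U x₀ (s 0) x / η) * f η := by
  obtain ⟨h1, h2⟩ := h.exists_gevreyOn hδ' hx
  obtain ⟨d₁, hd₁, hd₁d, C₁, M₁, hC₁, hM₁, hG₁⟩ := h2 d hd
  have := eqOn_of_gevreyOn hd₁ hd hd₁d le_rfl hC₁ hM₁ hC hM (h1.mono (borelDisc_mono hd hdδ)) hf hG₁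
    hG hη
  dsimp only at this
  rw [← this, ← mul_assoc, ← Complex.exp_add, neg_div, neg_add_cancel, Complex.exp_zero, one_mul]

/-- Uniqueness comes from the asymptotics alone, at each x separately; the differential equation
plays no role beyond holomorphy in ħ. -/
theorem IsExactWKB.unique {δ' : ℝ} (hδ' : 0 < δ') {ψ ψ' : ℂ → ℂ → ℂ}
    (h : IsExactWKB p q U x₀ s θ δ' ψ) (h' : IsExactWKB p q U x₀ s θ δ' ψ') {x : ℂ} (hx : x ∈ U)
    {η : ℂ} (hη : η ∈ borelDisc θ δ') : ψ' x η = ψ x η := by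
  obtain ⟨h1, h2⟩ := h.exists_gevreyOn hδ' hx
  obtain ⟨h1', h2'⟩ := h'.exists_gevreyOn hδ' hx
  obtain ⟨d₁, hd₁, hd₁d, C₁, M₁, hC₁, hM₁, hG₁⟩ := h2 δ' hδ'
  obtain ⟨d₂, hd₂, hd₂d, C₂, M₂, hC₂, hM₂, hG₂⟩ := h2' δ' hδ'
  have := eqOn_of_gevreyOn hd₂ hd₁ hd₂d hd₁d hC₂ hM₂ hC₁ hM₁ h1' h1 hG₂ hG₁ hη
  exact mul_left_cancel₀ (Complex.exp_ne_zero _) this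

/-- A Riccati solution at the single point x₀ fixes δ', and the linear equation is then solved on
all of U over that disc. Near any other point the solution is an exponential of the Borel sum's
primitive, on a smaller disc, and this suffices for the asymptotics. -/
theorem IsSetting.exists_isExactWKB (h : IsSetting X S ϑm ϑp p q ph qh θ δ ε U r Φ)
    (hs : IsFormalCharRoot U ph qh (charRoot ph r ε) s) (hx₀ : x₀ ∈ U) :
    ∃ δ' : ℝ, 0 < δ' ∧ δ' ≤ δ ∧ ∃ ψ, IsExactWKB p q U x₀ s θ δ' ψ := by
  obtain ⟨δ', _, _, hδ', hδ'δ, -, -, hR⟩ := h.exists_compact_region hs isCompact_singleton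
    (singleton_subset_iff.2 hx₀)
  have hU := h.isOpen_U
  have hsub : borelDisc θ δ' ⊆ S := (borelDisc_mono hδ' hδ'δ).trans h.hδS
  have hne : ∀ η ∈ borelDisc θ δ', η ≠ 0 := fun η hη => ne_zero_of_mem_borelDisc hδ' hη
  have hlam : DifferentiableOn ℂ (charRoot ph r ε) U := (hs.1 0).congr fun x hx => (hs.2.1 hx).symm
  -- The initial slope is -s(x₀, ħ)/ħ, the logarithmic derivative prescribed by the resummed Riccati
  -- solution.
  obtain ⟨ψ, hψ, hψ₀⟩ := exists_isHolSolution (w₀ := fun η => -(charRoot ph r ε x₀ +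
      η * borelSum θ (fun k => tailCoeff s k x₀) η) / η) hU h.isSC hx₀ (isOpen_borelDisc hδ') hne
    (h.hp.mono (prod_mono h.hUX hsub)) (h.hq.mono (prod_mono h.hUX hsub))
    (((differentiableOn_id.mul (hR.diff_right x₀ rfl)).const_add _).neg.div differentiableOn_id hne)
  refine ⟨δ', hδ', hδ'δ, ψ, hψ, fun η hη => (hψ₀ η hη).1, fun x hx => ?_⟩
  obtain ⟨W, hW, hWs, hxW, hVW, hWU, d, C, M, hd, -, hC, hM, hR', hprim, -, hG⟩ :=
    h.exists_region hs hx₀ isCompact_singleton (singleton_subset_iff.2 hx)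
  obtain ⟨hP, hPe⟩ := hs.primitive_eq hU h.isSC hx₀
  have hm : 0 < min d δ' := lt_min hd hδ'
  have hm1 : borelDisc θ (min d δ') ⊆ borelDisc θ d := borelDisc_mono hm (min_le_left _ _)
  have hm2 : borelDisc θ (min d δ') ⊆ borelDisc θ δ' := borelDisc_mono hm (min_le_right _ _)
  refine ⟨W, hW.mem_nhds (hVW rfl), hWU, unifGevrey_of_gevreyOn hm hm2 hC hM fun y hy n η hη => ?_⟩
  have hYx : DifferentiableOn ℂ (fun t => borelSum θ (fun k => tailCoeff s k t) η) W := fun y hy =>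
    (hR'.diff_left y hy η (hm1 hη)).differentiableWithinAt
  have key := eq_exp_of_riccati (h := η) (p := fun x => p x η) (q := fun x => q x η)
    (σ := fun x => charRoot ph r ε x + η * borelSum θ (fun k => tailCoeff s k x) η)
    (G := fun x => primitive U x₀ (charRoot ph r ε) x + η * sumPrimitive W x₀ θ s x η)
    (ψ := fun x => ψ x η) hW hWs hxW (hne η (hm2 hη))
    (h.hp.comp (f := fun x : ℂ => (x, η)) (by fun_prop)
      fun x hx => ⟨h.hUX (hWU hx), hsub (hm2 hη)⟩)
    ((hlam.mono hWU).add (hYx.const_mul η))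
    (hψ.1.comp (f := fun x : ℂ => (x, η)) (by fun_prop) fun x hx => ⟨hWU hx, hm2 hη⟩)
    (fun x hx => hR'.riccati x hx η (hm1 hη)) (fun x hx => hψ.2 x (hWU hx) η (hm2 hη))
    (hψ₀ η (hm2 hη)).1
    (by
      rw [(hψ₀ η (hm2 hη)).2]
      have := hne η (hm2 hη)
      field_simp)
    ⟨by simp [hP.1, (hprim η (hm1 hη)).1], fun x hx =>
      (hP.2 x (hWU hx)).add (((hprim η (hm1 hη)).2 x hx).const_mul η)⟩ hy
  have e : Complex.exp (primitive U x₀ (s 0) y / η) * ψ y η =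
      Complex.exp (-sumPrimitive W x₀ θ s y η) := by
    rw [key, hPe (hWU hy), ← Complex.exp_add]
    congr 1
    have := hne η (hm2 hη)
    field_simp
    ring
  rw [e]
  exact hG y hy n η (hm1 hη)

end WKB

end

/-! ### ### Resummation of the formal WKB solution -/

noncomputable section

namespace WKB

variable {X S : Set ℂ} {ϑm ϑp : ℝ} {p q : ℂ → ℂ → ℂ} {ph qh : ℕ → ℂ → ℂ} {θ δ : ℝ} {ε : ℂ}
  {U : Set ℂ} {r Φ : ℂ → ℂ} {s : ℕ → ℂ → ℂ} {x₀ : ℂ}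

theorem IsSetting.locUnifBorelSummable_tailCoeff
    (h : IsSetting X S ϑm ϑp p q ph qh θ δ ε U r Φ)
    (hs : IsFormalCharRoot U ph qh (charRoot ph r ε) s) (hx₀ : x₀ ∈ U) :
    LocUnifBorelSummable U θ (tailCoeff s) := by
  refine locUnifBorelSummable_of_gevreyOn fun x hx => ?_
  obtain ⟨W, hW, -, -, hVW, hWU, d, C, M, hd, -, hC, hM, hR, -⟩ :=
    h.exists_region hs hx₀ isCompact_singleton (singleton_subset_iff.2 hx)
  exact ⟨W, hW, hVW rfl, hWU, d, C, M, hd, hC, hM, fun x => borelSum θ fun k => tailCoeff s k x,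
    hR.diff_right, fun η hη y hy => (hR.diff_left y hy η hη).differentiableWithinAt, hR.gevrey⟩

/-- The witness is the exponential of minus the integrated Borel sum, so no existence theorem for
the linear equation is needed here. -/
theorem IsSetting.locUnifBorelSummable_ampCoeff
    (h : IsSetting X S ϑm ϑp p q ph qh θ δ ε U r Φ)
    (hs : IsFormalCharRoot U ph qh (charRoot ph r ε) s) (hx₀ : x₀ ∈ U) :
    LocUnifBorelSummable U θ (ampCoeff U x₀ s) := by
  refine locUnifBorelSummable_of_gevreyOn fun x hx => ?_
  obtain ⟨W, hW, -, -, hVW, hWU, d, C, M, hd, -, hC, hM, -, hprim, hIh, hG⟩ :=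
    h.exists_region hs hx₀ isCompact_singleton (singleton_subset_iff.2 hx)
  exact ⟨W, hW, hVW rfl, hWU, d, C, M, hd, hC, hM,
    fun x η => Complex.exp (-sumPrimitive W x₀ θ s x η), fun x hx => (hIh x hx).neg.cexp,
    fun η hη y hy => ((hprim η hη).2 y hy).neg.cexp.differentiableAt.differentiableWithinAt, hG⟩

/-- Exact WKB solutions are the locally uniform Borel resummations of formal WKB solutions. -/
theorem IsSetting.exists_resummation (h : IsSetting X S ϑm ϑp p q ph qh θ δ ε U r Φ)
    (hs : IsFormalCharRoot U ph qh (charRoot ph r ε) s) (hx₀ : x₀ ∈ U) {δ' : ℝ} (hδ' : 0 < δ')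
    {ψ : ℂ → ℂ → ℂ} (hψ : IsExactWKB p q U x₀ s θ δ' ψ) {V : Set ℂ} (hV : IsCompact V)
    (hVU : V ⊆ U) :
    ∃ W : Set ℂ, IsOpen W ∧ IsSimplyConnected W ∧ x₀ ∈ W ∧ V ⊆ W ∧ W ⊆ U ∧
      ∃ δ'' : ℝ, 0 < δ'' ∧ δ'' ≤ δ' ∧
        UnifResummable W (borelDisc θ δ'') θ (tailCoeff s) ∧
        UnifResummable W (borelDisc θ δ'') θ (ampCoeff U x₀ s) ∧
        ∀ h ∈ borelDisc θ δ'',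
          DifferentiableOn ℂ (fun t => borelSum θ (fun k => tailCoeff s k t) h) W ∧
          ∀ x ∈ W,
            ψ x h = Complex.exp (-(primitive U x₀ (charRoot ph r ε) x) / h) *
              borelSum θ (fun k => ampCoeff U x₀ s k x) h ∧
            ψ x h = Complex.exp (-(primitive U x₀ (charRoot ph r ε) x) / h) *
              Complex.exp (-(primitive W x₀
                (fun t => borelSum θ (fun k => tailCoeff s k t) h) x)) := by
  obtain ⟨W, hW, hWs, hxW, hVW, hWU, d, C, M, hd, -, hC, hM, hR, hprim, hIh, hG⟩ :=
    h.exists_region hs hx₀ hV hVU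
  have hYx : ∀ η ∈ borelDisc θ d,
      DifferentiableOn ℂ (fun t => borelSum θ (fun k => tailCoeff s k t) η) W := fun η hη y hy =>
    (hR.diff_left y hy η hη).differentiableWithinAt
  have hEx : ∀ η ∈ borelDisc θ d,
      DifferentiableOn ℂ (fun x => Complex.exp (-sumPrimitive W x₀ θ s x η)) W := fun η hη y hy =>
    ((hprim η hη).2 y hy).neg.cexp.differentiableAt.differentiableWithinAt
  have hEh : ∀ x ∈ W, DifferentiableOn ℂ (fun η => Complex.exp (-sumPrimitive W x₀ θ s x η))
      (borelDisc θ d) := fun x hx => (hIh x hx).neg.cexp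
  obtain ⟨A₁, L₁, hA₁, hL₁, e₁⟩ := exists_borelSum_eq hW hd hC hM hR.diff_right hYx
    (fun k => (hs.1 (k + 1)).mono hWU) hR.gevrey
  obtain ⟨A₂, L₂, hA₂, hL₂, e₂⟩ := exists_borelSum_eq
    (f := fun x η => Complex.exp (-sumPrimitive W x₀ θ s x η)) hW hd hC hM hEh hEx
    (differentiableOn_coeff_of_gevreyOn hW hd hEx hG) hG
  -- The bounds 1/(L + 1) rather than 1/L leave the spare decay that makes both Laplace integrals
  -- converge uniformly.
  obtain ⟨δ'', h0, hδ'', hd'', hL₁'', hL₂''⟩ : ∃ δ'' : ℝ, 0 < δ'' ∧ δ'' ≤ δ' ∧ δ'' ≤ d ∧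
      δ'' ≤ 1 / (L₁ + 1) ∧ δ'' ≤ 1 / (L₂ + 1) := by
    refine ⟨min (min δ' d) (min (1 / (L₁ + 1)) (1 / (L₂ + 1))), by positivity, ?_, ?_, ?_, ?_⟩ <;>
    simp
  have hsub : borelDisc θ δ'' ⊆ borelDisc θ d := borelDisc_mono h0 hd''
  refine ⟨W, hW, hWs, hxW, hVW, hWU, δ'', h0, hδ'',
    unifResummable hA₁ ((le_one_div (by positivity) h0).2 hL₁'') (fun x hx => (e₁ x hx).2.1)
      fun x hx => (e₁ x hx).2.2,
    unifResummable hA₂ ((le_one_div (by positivity) h0).2 hL₂'') (fun x hx => (e₂ x hx).2.1)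
      fun x hx => (e₂ x hx).2.2,
    fun η hη => ⟨hYx η (hsub hη), fun x hx => ?_⟩⟩
  have key : ψ x η = Complex.exp (-(primitive U x₀ (charRoot ph r ε) x) / η) *
      Complex.exp (-sumPrimitive W x₀ θ s x η) := by
    rw [← (hs.primitive_eq h.isOpen_U h.isSC hx₀).2 (hWU hx)]
    exact hψ.eq_of_gevreyOn hδ' h0 hδ'' hC hM (hWU hx) ((hEh x hx).mono hsub)
      ((hG x hx).mono hsub) hη
  refine ⟨?_, key⟩
  rw [key, (e₂ x hx).1 η (borelDisc_mono h0 (hL₂''.trans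
    (one_div_le_one_div_of_le hL₂ (by linarith))) hη)]

end WKB

end

theorem theorem210221112347
    -- the domain `X`, the sectorial domain `S` with opening `(ϑm, ϑp)`, and the coefficients
    (X S : Set ℂ) (hXo : IsOpen X) (hXc : IsConnected X)
    (ϑm ϑp : ℝ) (hA₁ : Real.pi ≤ ϑp - ϑm) (hA₂ : ϑp - ϑm ≤ 2 * Real.pi)
    (hS : WKB.IsSectorialDomain S ϑm ϑp)
    (p q : ℂ → ℂ → ℂ) (ph qh : ℕ → ℂ → ℂ)
    (hp : DifferentiableOn ℂ (fun z : ℂ × ℂ => p z.1 z.2) (X ×ˢ S))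
    (hq : DifferentiableOn ℂ (fun z : ℂ × ℂ => q z.1 z.2) (X ×ˢ S))
    (hph : ∀ k, DifferentiableOn ℂ (ph k) X) (hqh : ∀ k, DifferentiableOn ℂ (qh k) X)
    (hpg : WKB.LocUnifGevrey X S ϑm ϑp p ph) (hqg : WKB.LocUnifGevrey X S ϑm ϑp q qh)
    -- the copolar direction `θ`, a Borel disc in `S`, and the sign
    (θ : ℝ) (hθ : θ ∈ Set.Icc (ϑm + Real.pi / 2) (ϑp - Real.pi / 2))
    (δ : ℝ) (hδ : 0 < δ) (hδS : WKB.borelDisc θ δ ⊆ S)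
    (ε : ℂ) (hε : ε = 1 ∨ ε = -1)
    -- the simply connected domain `U ∋ x₀` free of turning points, and the branch `r` of `√D₀`
    (U : Set ℂ) (hUo : IsOpen U) (hUs : IsSimplyConnected U) (hUX : U ⊆ X)
    (x₀ : ℂ) (hx₀ : x₀ ∈ U) (hU : ∀ x ∈ U, WKB.disc ph qh x ≠ 0)
    (r : ℂ → ℂ) (hr : DifferentiableOn ℂ r U) (hr2 : ∀ x ∈ U, r x ^ 2 = WKB.disc ph qh x)
    -- every WKB `(θ, ε)`-ray emanating from `U` is complete
    (hcomplete : ∀ x ∈ U, ∃ γ : ℝ → ℂ, WKB.IsCompleteRay X (WKB.disc ph qh) r θ ε x γ)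
    -- the two conditions at the ends of the rays; they only involve absolute values, so the branch
    -- of `√D₀` there is immaterial
    (hends : ∀ x ∈ U, ∃ V ∈ 𝓝 x, V ⊆ U ∧ ∃ R : ℝ, 0 < R ∧
      let E := WKB.rayEnd X (WKB.disc ph qh) r (WKB.primitive U x₀ r) θ ε V R
      (∃ C : ℝ, ∀ y ∈ E, ‖deriv (WKB.disc ph qh) y‖ /
        (2 * Real.sqrt ‖WKB.disc ph qh y‖ ^ 3) ≤ C) ∧
      WKB.UnifGevrey E (WKB.borelDisc θ δ) (θ - Real.pi / 2) (θ + Real.pi / 2)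
        (fun y h => p y h / (Real.sqrt ‖WKB.disc ph qh y‖ : ℂ))
        (fun k y => ph k y / (Real.sqrt ‖WKB.disc ph qh y‖ : ℂ)) ∧
      WKB.UnifGevrey E (WKB.borelDisc θ δ) (θ - Real.pi / 2) (θ + Real.pi / 2)
        (fun y h => q y h / WKB.disc ph qh y)
        (fun k y => qh k y / WKB.disc ph qh y)) :
    -- the formal characteristic root `s` with leading term `λ`
    ∃ s : ℕ → ℂ → ℂ, WKB.IsFormalCharRoot U ph qh (WKB.charRoot ph r ε) s ∧
      (∀ s' : ℕ → ℂ → ℂ, WKB.IsFormalCharRoot U ph qh (WKB.charRoot ph r ε) s' →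
        ∀ k, Set.EqOn (s' k) (s k) U) ∧
      -- Borel summability of the formal WKB solution
      WKB.LocUnifBorelSummable U θ (WKB.tailCoeff s) ∧
      WKB.LocUnifBorelSummable U θ (WKB.ampCoeff U x₀ s) ∧
      -- the exact WKB solution exists on some Borel disc
      (∃ δ' : ℝ, 0 < δ' ∧ δ' ≤ δ ∧ ∃ ψ : ℂ → ℂ → ℂ, WKB.IsExactWKB p q U x₀ s θ δ' ψ) ∧
      -- wherever it exists it is unique and it is the locally uniform Borel resummation
      ∀ δ' : ℝ, 0 < δ' → δ' ≤ δ → ∀ ψ : ℂ → ℂ → ℂ, WKB.IsExactWKB p q U x₀ s θ δ' ψ →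
        (∀ ψ' : ℂ → ℂ → ℂ, WKB.IsExactWKB p q U x₀ s θ δ' ψ' →
          ∀ x ∈ U, ∀ h ∈ WKB.borelDisc θ δ', ψ' x h = ψ x h) ∧
        ∀ V : Set ℂ, IsCompact V → V ⊆ U →
          ∃ W : Set ℂ, IsOpen W ∧ IsSimplyConnected W ∧ x₀ ∈ W ∧ V ⊆ W ∧ W ⊆ U ∧
          ∃ δ'' : ℝ, 0 < δ'' ∧ δ'' ≤ δ' ∧
            WKB.UnifResummable W (WKB.borelDisc θ δ'') θ (WKB.tailCoeff s) ∧
            WKB.UnifResummable W (WKB.borelDisc θ δ'') θ (WKB.ampCoeff U x₀ s) ∧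
            ∀ h ∈ WKB.borelDisc θ δ'',
              DifferentiableOn ℂ
                (fun t => WKB.borelSum θ (fun k => WKB.tailCoeff s k t) h) W ∧
              ∀ x ∈ W,
                ψ x h = Complex.exp (-(WKB.primitive U x₀ (WKB.charRoot ph r ε) x) / h) *
                  WKB.borelSum θ (fun k => WKB.ampCoeff U x₀ s k x) h ∧
                ψ x h = Complex.exp (-(WKB.primitive U x₀ (WKB.charRoot ph r ε) x) / h) *
                  Complex.exp (-(WKB.primitive W x₀
                    (fun t => WKB.borelSum θ (fun k => WKB.tailCoeff s k t) h) x)) := by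
  have hr0 : ∀ x ∈ U, r x ≠ 0 := fun x hx h0 => hU x hx (by rw [← hr2 x hx, h0]; ring)
  have hset : WKB.IsSetting X S ϑm ϑp p q ph qh θ δ ε U r (WKB.primitive U x₀ r) :=
    { isOpen_X := hXo, hp := hp, hq := hq, hph := hph, hqh := hqh, hpg := hpg, hqg := hqg
      le_sub := by linarith [hθ.1], add_le := by linarith [hθ.2], hδ := hδ, hδS := hδS, hε := hε
      isOpen_U := hUo, isSC := hUs, hUX := hUX, hU := hU, hr := hr, hr2 := hr2
      hΦ := (isPrimitive_primitive hUo hUs x₀ hr).2, hcomplete := hcomplete, hends := hends }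
  have hε2 : ε ^ 2 = 1 := by rcases hε with rfl | rfl <;> norm_num
  have hε0 : ε ≠ 0 := by rcases hε with rfl | rfl <;> norm_num
  -- The divisor in the formal recursion is ε√D₀, which vanishes exactly at turning points.
  have hne : ∀ x ∈ U, WKB.charRoot ph r ε x - ph 0 x + WKB.charRoot ph r ε x ≠ 0 := fun x hx => by
    rw [show WKB.charRoot ph r ε x - ph 0 x + WKB.charRoot ph r ε x = ε * r x by
      simp only [WKB.charRoot]; ring]
    exact mul_ne_zero hε0 (hr0 x hx)
  have hs := WKB.isFormalCharRoot_formalRoot hUo (fun k => (hph k).mono hUX)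
    (fun k => (hqh k).mono hUX) (lam := WKB.charRoot ph r ε)
    ((((hph 0).mono hUX).add (hr.const_mul ε)).div_const 2) (fun x hx => by
      have := hr2 x hx
      simp only [WKB.disc] at this
      simp only [WKB.charRoot]
      linear_combination r x ^ 2 / 4 * hε2 + this / 4) hne
  refine ⟨_, hs, fun s' hs' => hs.eqOn hUo hne hs', ?_, ?_, hset.exists_isExactWKB hs hx₀,
    fun δ' hδ' _ ψ hψ => ⟨fun ψ' hψ' x hx η hη => hψ.unique hδ' hψ' hx hη, fun V hV hVU =>
      hset.exists_resummation hs hx₀ hδ' hψ hV hVU⟩⟩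
  · exact hset.locUnifBorelSummable_tailCoeff hs hx₀
  · exact hset.locUnifBorelSummable_ampCoeff hs hx₀
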